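/- **Theorem (warped Carleman estimate).** Let $m,n\ge 1$ be integers. On $\mathbb R^{m+n}=\mathbb R^m_t\times\mathbb R^n_x$ let $g=-|dt|^2+|dx|^2$, $\tau=|t|$, $r=|x|$, $u=\tfrac12(\tau-r)$, $v=\tfrac12(\tau+r)$, $f=-uv=\tfrac14(r^2-\tau^2)$ and $\mathfrak D=\{f>0\}$. For $\varepsilon>0$ let $\bar\rho=r+2\varepsilon f$ and let $$\bar g=-4\,du\,dv+\bar\rho^2\,\mathring\gamma_{\mathbb S^{n-1}}-\tau^2\,\mathring\gamma_{\mathbb S^{m-1}}$$ on $\{r\ne0\}$ (extended smoothly across $\tau=0$), where $\mathring\gamma$ denotes the unit round metrics, and let $\bar\Phi$ be the map given in the null coordinates $(u,v,\omega_x,\omega_t)$, where $\omega_x=x/r$ and $\omega_t=t/\tau$, by $$\bar\Phi(u,v,\omega_x,\omega_t)=\Big(\frac{u}{1+\varepsilon u},\frac{v}{1-\varepsilon v},\omega_x,\omega_t\Big).$$ For $a,b>0$ let $\zeta_{a,b}=f^{2a}e^{4abf^{1/2}}$. There is an absolute constant $c_0>0$ and, for all $m,n$, a constant $c=c(m,n)>0$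 such that the following holds. Let $\mathfrak U\subset\mathbb R^{m+n}$ be open with smooth boundary ($\mathfrak U$ lying locally on one side of $\partial\mathfrak U$) that is timelike, i.e. its nonzero $g$-normals $X$ satisfy $g(X,X)>0$. Let $R>0$ with $\bar{\mathfrak U}\cap\mathfrak D\subseteq\{r<R\}$, and let $\varepsilon,a,b>0$ satisfy $$a\ge(m+n)^2,\qquad \varepsilon\le c\,b,\qquad b\le c_0R^{-1}.$$ Let $z\in C^2(\bar\Phi(\mathfrak U\cap\mathfrak D))\cap C^1(\bar\Phi(\bar{\mathfrak U}\cap\mathfrak D))$ be such that $z$ and its first derivatives are bounded on $\bar\Phi(\mathfrak U\cap\mathfrak D)$ and $z=0$ on $\bar\Phi(\partial\mathfrak U\cap\mathfrak D)$. Then $$\begin{aligned}&\frac{\varepsilon}{8}\int_{\bar\Phi(\mathfrak U\cap\mathfrak D)}\zeta_{a,b}\,\bar\rho^{-1}\Big(|u\,\partial_uz|^2+|v\,\partial_vz|^2+f\,\bar g^{ij}\partial_iz\,\partial_jz-f\,\bar g^{CD}\partial_Cz\,\partial_Dz\Big)+\frac{ba^2}{4}\int_{\bar\Phi(\mathfrak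 U\cap\mathfrak D)}\zeta_{a,b}\,f^{-1/2}z^2\\&\qquad\le\frac1{2a}\int_{\bar\Phi(\mathfrak U\cap\mathfrak D)}\zeta_{a,b}\,f\,|\bar\Box z|^2+\int_{\bar\Phi(\partial\mathfrak U\cap\mathfrak D)}\zeta_{a,b}\,\bar{\mathcal N}f\,|\bar{\mathcal N}z|^2 .\end{aligned}$$ Here $i,j$ run over the angular coordinates on $\mathbb S^{n-1}$ and $C,D$ over those on $\mathbb S^{m-1}$ (so that $\bar g^{CD}\partial_Cz\,\partial_Dz\le0$), $\bar\Box$ is the wave operator of $\bar g$ (the $\bar g$-trace of the Hessian with respect to the Levi-Civita connection), $\bar{\mathcal N}$ is the outer-pointing $\bar g$-unit normal of $\bar\Phi(\mathfrak U\cap\mathfrak D)$, and the integrals are with respect to the volume forms induced by $\bar g$. The two integrals on the left and the boundary integral converge absolutely; the integral with $\bar\Box z$ is an element of $[0,\infty]$. -/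

import Mathlib

open MeasureTheory
open scoped ContDiff RealInnerProductSpace

noncomputable section

namespace WarpedCarleman

/-! ### Coordinates on `ℝ^{m+n}` -/

/-- `ℝ^{m+n}`, with points `p = (t, x)`; the indices `Sum.inl i` are the temporal Cartesian
coordinates `t_i` and the indices `Sum.inr j` the spatial ones `x_j`. -/
abbrev Spacetime (m n : ℕ) : Type := EuclideanSpace ℝ (Fin m ⊕ Fin n)

variable {m n : ℕ}

/-- The temporal part `t` of `p = (t, x)`. -/
def timePart (p : Spacetime m n) : EuclideanSpace ℝ (Fin m) := WithLp.toLp 2 fun i => p (Sum.inl i)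

/-- The spatial part `x` of `p = (t, x)`. -/
def spacePart (p : Spacetime m n) : EuclideanSpace ℝ (Fin n) := WithLp.toLp 2 fun j => p (Sum.inr j)

/-- The point `(t, x)`. -/
def mkPoint (t : EuclideanSpace ℝ (Fin m)) (x : EuclideanSpace ℝ (Fin n)) : Spacetime m n :=
  WithLp.toLp 2 (Sum.elim (fun i => t i) (fun j => x j))

/-- `τ = |t|`. -/
def tau (p : Spacetime m n) : ℝ := ‖timePart p‖

/-- `r = |x|`. -/
def rad (p : Spacetime m n) : ℝ := ‖spacePart p‖

/-- The null coordinate `u = (τ - r) / 2`. -/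
def nullU (p : Spacetime m n) : ℝ := (tau p - rad p) / 2

/-- The null coordinate `v = (τ + r) / 2`. -/
def nullV (p : Spacetime m n) : ℝ := (tau p + rad p) / 2

/-- `f = -u v`. -/
def fFun (p : Spacetime m n) : ℝ := -(nullU p * nullV p)

/-- The exterior `𝔇 = {f > 0}` of the null cone. -/
def exteriorCone (m n : ℕ) : Set (Spacetime m n) := {p | 0 < fFun p}

/-- The warped radius `ρ̄ = r + 2 ε f`. -/
def warpedRadius (ε : ℝ) (p : Spacetime m n) : ℝ := rad p + 2 * ε * fFun p

/-! ### The flat and the warped metric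

A metric is a map `G` sending a point `p` and two tangent vectors `X`, `Y` at `p` to `G p X Y`. -/

/-- The flat metric `-dt₁² - ⋯ - dt_m² + dx₁² + ⋯ + dx_n²`. -/
def flatMetric (_p X Y : Spacetime m n) : ℝ :=
  -⟪timePart X, timePart Y⟫ + ⟪spacePart X, spacePart Y⟫

/-- The one-form `dτ`; it is given the value `0` at `τ = 0`. -/
def dTau (p X : Spacetime m n) : ℝ := ⟪timePart p, timePart X⟫ / tau p

/-- The one-form `dr`. -/
def dRad (p X : Spacetime m n) : ℝ := ⟪spacePart p, spacePart X⟫ / rad p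

/-- The one-form `du = (dτ - dr) / 2`. -/
def dU (p X : Spacetime m n) : ℝ := (dTau p X - dRad p X) / 2

/-- The one-form `dv = (dτ + dr) / 2`. -/
def dV (p X : Spacetime m n) : ℝ := (dTau p X + dRad p X) / 2

/-- The tensor `r² γ_{S^{n-1}}`, that is `|dx|² - dr²`. -/
def spatialAngular (p X Y : Spacetime m n) : ℝ :=
  ⟪spacePart X, spacePart Y⟫ - dRad p X * dRad p Y

/-- The tensor `τ² γ_{S^{m-1}}`, that is `|dt|² - dτ²`. With the convention for `dτ` at `τ = 0`,
the metric `warpedMetric` below is its smooth extension across `τ = 0`. -/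
def temporalAngular (p X Y : Spacetime m n) : ℝ :=
  ⟪timePart X, timePart Y⟫ - dTau p X * dTau p Y

/-- The warped metric `ḡ = -4 du dv + ρ̄² γ_{S^{n-1}} - τ² γ_{S^{m-1}}`, where
`du dv` is the symmetric product `(du ⊗ dv + dv ⊗ du) / 2`. -/
def warpedMetric (ε : ℝ) (p X Y : Spacetime m n) : ℝ :=
  -4 * ((dU p X * dV p Y + dV p X * dU p Y) / 2)
    + (warpedRadius ε p) ^ 2 * (spatialAngular p X Y / (rad p) ^ 2)
    - temporalAngular p X Y

/-! ### Pseudo-Riemannian notions for a metric `G` in Cartesian coordinates -/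

/-- The Cartesian coordinate vector field `∂_i`. -/
def coordVec (i : Fin m ⊕ Fin n) : Spacetime m n := EuclideanSpace.single i 1

/-- The partial derivative `∂_i h`. -/
def partialD (i : Fin m ⊕ Fin n) (h : Spacetime m n → ℝ) (p : Spacetime m n) : ℝ :=
  fderiv ℝ h p (coordVec i)

/-- The components `G_{ij}`. -/
def metricMatrix (G : Spacetime m n → Spacetime m n → Spacetime m n → ℝ) (p : Spacetime m n) :
    Matrix (Fin m ⊕ Fin n) (Fin m ⊕ Fin n) ℝ :=
  Matrix.of fun i j => G p (coordVec i) (coordVec j)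

/-- The Christoffel symbols `Γ^k_{ij}` of the Levi-Civita connection of `G`. -/
def christoffel (G : Spacetime m n → Spacetime m n → Spacetime m n → ℝ)
    (k i j : Fin m ⊕ Fin n) (p : Spacetime m n) : ℝ :=
  (1 / 2) * ∑ l, (metricMatrix G p)⁻¹ k l *
    (partialD i (fun q => metricMatrix G q j l) p + partialD j (fun q => metricMatrix G q i l) p
      - partialD l (fun q => metricMatrix G q i j) p)

/-- The components `∇_{ij} z` of the Hessian of `z` with respect to `G`. -/
def hessian (G : Spacetime m n → Spacetime m n → Spacetime m n → ℝ)
    (i j : Fin m ⊕ Fin n) (z : Spacetime m n → ℝ) (p : Spacetime m n) : ℝ :=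
  partialD i (partialD j z) p - ∑ k, christoffel G k i j p * partialD k z p

/-- The wave operator `□ z = G^{ij} ∇_{ij} z`. -/
def box (G : Spacetime m n → Spacetime m n → Spacetime m n → ℝ)
    (z : Spacetime m n → ℝ) (p : Spacetime m n) : ℝ :=
  ∑ i, ∑ j, (metricMatrix G p)⁻¹ i j * hessian G i j z p

/-- The measure of the volume form of `G`, namely `√|det G_{ij}|` times Lebesgue measure. -/
def volumeMeasure (G : Spacetime m n → Spacetime m n → Spacetime m n → ℝ) :
    Measure (Spacetime m n) :=
  volume.withDensity fun p => ENNReal.ofReal (Real.sqrt |(metricMatrix G p).det|)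

/-! ### Boundaries -/

/-- On the open set `W` the set `V` is the sublevel set `{φ < 0}` of a `C^k` function `φ` without
critical points; so the boundary of `V` in `W` is the hypersurface `{φ = 0}`, and `V` lies on one
side of it. -/
structure IsLocalDefiningFunction (k : WithTop ℕ∞) (V W : Set (Spacetime m n))
    (φ : Spacetime m n → ℝ) : Prop where
  isOpen : IsOpen W
  contDiffOn : ContDiffOn ℝ k φ W
  fderiv_ne_zero : ∀ q ∈ W, fderiv ℝ φ q ≠ 0
  inter_eq : V ∩ W = {q ∈ W | φ q < 0}

/-- The boundary of `V` is smooth. -/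
def HasSmoothBoundary (V : Set (Spacetime m n)) : Prop :=
  ∀ q ∈ frontier V, ∃ W φ, q ∈ W ∧ IsLocalDefiningFunction ∞ V W φ

/-- `X` is normal, with respect to `G`, to the hypersurface `{φ = φ q}` at `q`: the one-form
`G(X, ·)` is a multiple of `dφ`. -/
def IsNormalTo (G : Spacetime m n → Spacetime m n → Spacetime m n → ℝ)
    (φ : Spacetime m n → ℝ) (q X : Spacetime m n) : Prop :=
  ∃ c : ℝ, ∀ Y, G q X Y = c * fderiv ℝ φ q Y

/-- The boundary of `V` is timelike for `G`: its normals are spacelike. -/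
def HasTimelikeBoundary (G : Spacetime m n → Spacetime m n → Spacetime m n → ℝ)
    (V : Set (Spacetime m n)) : Prop :=
  ∀ q ∈ frontier V, ∀ W φ, q ∈ W → IsLocalDefiningFunction 1 V W φ →
    ∀ X, X ≠ 0 → IsNormalTo G φ q X → 0 < G q X X

/-- `X` is the outer-pointing unit normal of `V` at the boundary point `q`, with respect to `G`. -/
def IsOuterUnitNormal (G : Spacetime m n → Spacetime m n → Spacetime m n → ℝ)
    (V : Set (Spacetime m n)) (q X : Spacetime m n) : Prop :=
  ∃ W φ, q ∈ W ∧ φ q = 0 ∧ IsLocalDefiningFunction 1 V W φ ∧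
    IsNormalTo G φ q X ∧ |G q X X| = 1 ∧ 0 < fderiv ℝ φ q X

open Classical in
/-- The outer-pointing unit normal field of `V` with respect to `G` (and `0` where there is
none). -/
def outerUnitNormal (G : Spacetime m n → Spacetime m n → Spacetime m n → ℝ)
    (V : Set (Spacetime m n)) (q : Spacetime m n) : Spacetime m n :=
  if h : ∃ X, IsOuterUnitNormal G V q X then h.choose else 0

/-- The tangent space at `q` of the hypersurface that bounds `V`, that is the set of all `Y` with
`G(N, Y) = 0`, where `N` is the unit normal. It is written as the Euclidean orthogonal complement
of the vector with the components `G(N, ∂_i)`. -/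
def boundaryTangent (G : Spacetime m n → Spacetime m n → Spacetime m n → ℝ)
    (V : Set (Spacetime m n)) (q : Spacetime m n) : Submodule ℝ (Spacetime m n) :=
  (Submodule.span ℝ
    {(WithLp.toLp 2 fun i => G q (outerUnitNormal G V q) (coordVec i) : Spacetime m n)})ᗮ

/-- The density of the volume form of the induced metric with respect to Euclidean surface
measure: `√|det G(e_i, e_j)|`, where `e` is a Euclidean orthonormal basis of the tangent space. -/
def boundaryDensity (G : Spacetime m n → Spacetime m n → Spacetime m n → ℝ)
    (V : Set (Spacetime m n)) (q : Spacetime m n) : ℝ :=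
  Real.sqrt |(Matrix.of fun i j =>
    G q (stdOrthonormalBasis ℝ (boundaryTangent G V q) i : Spacetime m n)
      (stdOrthonormalBasis ℝ (boundaryTangent G V q) j : Spacetime m n)).det|

/-- The measure of the volume form that `G` induces on the part `B` of the boundary of `V`. Here
`μHE[d]` is the `d`-dimensional Hausdorff measure that agrees with Lebesgue measure on `ℝ^d`. -/
def boundaryMeasure (G : Spacetime m n → Spacetime m n → Spacetime m n → ℝ)
    (V B : Set (Spacetime m n)) : Measure (Spacetime m n) :=
  ((Measure.euclideanHausdorffMeasure (m + n - 1) : Measure (Spacetime m n)).restrict B).withDensity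
    fun q => ENNReal.ofReal (boundaryDensity G V q)

/-! ### The conformal map, the weight and the derivatives in the estimate -/

/-- The map `Φ̄ : (u, v, ω_x, ω_t) ↦ (u / (1 + ε u), v / (1 - ε v), ω_x, ω_t)`. A point with null
coordinates `(u', v')` has `τ' = u' + v'` and `r' = v' - u'`; moreover `ω_t = t / τ` and
`ω_x = x / r`. Points with `τ = 0` have `t = 0` and `u' + v' = 0`. -/
def warpMap (ε : ℝ) (p : Spacetime m n) : Spacetime m n :=
  let u' := nullU p / (1 + ε * nullU p)
  let v' := nullV p / (1 - ε * nullV p)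
  mkPoint ((u' + v') • ((tau p)⁻¹ • timePart p)) ((v' - u') • ((rad p)⁻¹ • spacePart p))

/-- The weight `ζ_{a,b} = f^{2a} exp(4 a b f^{1/2})`. -/
def weight (a b : ℝ) (p : Spacetime m n) : ℝ :=
  fFun p ^ (2 * a) * Real.exp (4 * a * b * fFun p ^ (1 / 2 : ℝ))

/-- `∂_τ z`, in polar coordinates `(τ, r, ω_x, ω_t)`. -/
def derivTau (z : Spacetime m n → ℝ) (p : Spacetime m n) : ℝ :=
  fderiv ℝ z p (mkPoint ((tau p)⁻¹ • timePart p) 0)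

/-- `∂_r z`, in polar coordinates `(τ, r, ω_x, ω_t)`. -/
def derivRad (z : Spacetime m n → ℝ) (p : Spacetime m n) : ℝ :=
  fderiv ℝ z p (mkPoint 0 ((rad p)⁻¹ • spacePart p))

/-- `∂_u z` in null coordinates, where `τ = u + v` and `r = v - u`. -/
def derivU (z : Spacetime m n → ℝ) (p : Spacetime m n) : ℝ := derivTau z p - derivRad z p

/-- `∂_v z` in null coordinates, where `τ = u + v` and `r = v - u`. -/
def derivV (z : Spacetime m n → ℝ) (p : Spacetime m n) : ℝ := derivTau z p + derivRad z p

/-- `ḡ^{ab} ∂_a z ∂_b z`, summed over the spatial angular components. Here `ḡ^{ab} = ρ̄^{-2} γ^{ab}`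
and `γ^{ab} ∂_a z ∂_b z = r² (|∇_x z|² - (∂_r z)²)`. -/
def spatialAngularSq (ε : ℝ) (z : Spacetime m n → ℝ) (p : Spacetime m n) : ℝ :=
  ((warpedRadius ε p) ^ 2)⁻¹ *
    ((rad p) ^ 2 * (∑ j : Fin n, (partialD (Sum.inr j) z p) ^ 2 - (derivRad z p) ^ 2))

/-- `ḡ^{CD} ∂_C z ∂_D z`, summed over the temporal angular components. Here
`ḡ^{CD} = -τ^{-2} γ^{CD}` and `γ^{CD} ∂_C z ∂_D z = τ² (|∇_t z|² - (∂_τ z)²)`; it is `≤ 0`. -/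
def temporalAngularSq (z : Spacetime m n → ℝ) (p : Spacetime m n) : ℝ :=
  -(∑ i : Fin m, (partialD (Sum.inl i) z p) ^ 2 - (derivTau z p) ^ 2)

/-- The first-order integrand
`ζ ρ̄⁻¹ (|u ∂_u z|² + |v ∂_v z|² + f ḡ^{ab} ∂_a z ∂_b z - f ḡ^{CD} ∂_C z ∂_D z)`. -/
def firstOrderTerm (ε a b : ℝ) (z : Spacetime m n → ℝ) (p : Spacetime m n) : ℝ :=
  weight a b p * (warpedRadius ε p)⁻¹ *
    ((nullU p * derivU z p) ^ 2 + (nullV p * derivV z p) ^ 2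
      + fFun p * spatialAngularSq ε z p - fFun p * temporalAngularSq z p)

/-- The zeroth-order integrand `ζ f^{-1/2} z²`. -/
def zerothOrderTerm (a b : ℝ) (z : Spacetime m n → ℝ) (p : Spacetime m n) : ℝ :=
  weight a b p * fFun p ^ (-(1 / 2) : ℝ) * z p ^ 2

/-- The integrand `ζ f |□̄ z|²`. -/
def waveTerm (ε a b : ℝ) (z : Spacetime m n → ℝ) (p : Spacetime m n) : ℝ :=
  weight a b p * fFun p * (box (warpedMetric ε) z p) ^ 2

/-- The boundary integrand `ζ (N̄ f) |N̄ z|²`, where `N̄` is the outer-pointing `ḡ`-unit normal of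
`V`, and the derivative of `z` at the boundary is taken within `S`, the set `V` with its
boundary. -/
def boundaryTerm (ε a b : ℝ) (V S : Set (Spacetime m n)) (z : Spacetime m n → ℝ)
    (q : Spacetime m n) : ℝ :=
  weight a b q * fderiv ℝ fFun q (outerUnitNormal (warpedMetric ε) V q)
    * (fderivWithin ℝ z S q (outerUnitNormal (warpedMetric ε) V q)) ^ 2

end WarpedCarleman

end

open WarpedCarleman

/-!
The estimate is the integral of a pointwise inequality over `V = Φ̄(𝔘 ∩ 𝔇)`. Everything takes place
in Cartesian coordinates on `V`, an open subset of the exterior of the null cone: there `ḡ` is smooth,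
including at `τ = 0`, and the inverse of `Φ̄` is the same map with `-ε` in place of `ε`. This inverse
pulls the flat metric back to a multiple of `ḡ` (`flatMetric_fderiv_warpMap_neg`), and hence `∂V` is
timelike for `ḡ`.

*The pointwise inequality.* With `σ = (ρ̄/r)^(n-1)` the volume density of `ḡ`, the wave operator is
`σ⁻¹ ∂_i (σ ḡ^{ik} ∂_k z)` (`box_eq_divergence`, `box_warpedMetric`), so no connection has to be
computed. Let `ψ = ζ^{1/2} z`. The `ḡ`-gradient of `f` is half the Euler field `p ↦ p`, and
`□̄ψ` is multiplied by `Sψ = dψ(p) + 2 w ψ`, with `w` (`multW`) chosen so that the coefficient of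
`|∇̄ψ|²` in the divergence of the current is `-ε f / ρ̄`. The divergence is computed along rays,
where `f`, `r` and `ρ̄/r` are explicit functions of the scale (`divergence_current`). The weight
produces the positive terms `(a/f + a b/√f) (Sψ)²` and about `a² b f^{-1/2} ψ²`; the first absorbs the
wave operator and all cross terms, the second the errors of size `ε` since `ε ≤ b/100`, and the
term in `|∇̄ψ|²` gives the derivatives on the left-hand side. This is the algebra of
`carleman_algebra`, which yields `pointwise_carleman`.

*The boundary.* As `z` vanishes on `∂V`, its differential there is a multiple of the conormal, and
the flux of the current is exactly the boundary integrand (`flux_carlemanCurrent`).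

*The null cone.* The boundary of `V` has no regularity where it meets the null cone. But the weight
vanishes there at least like `f⁴`, whence the current is `O(f²)` (`exists_norm_carlemanCurrent_le`),
and a cutoff at `f ∼ δ`, whose derivative is `O(1/δ)`, contributes `O(δ)` to the integrated inequality
(`AdmissibleFunction.setIntegral_le_boundaryFlux`). The area of `∂V` is finite since `Φ̄` is Lipschitz
up to the null cone (`exists_lipschitzOnWith_warpMap`).

*The divergence theorem.* `z` is `C²` only inside `V` and `C¹` up to the boundary, so the divergence of
the current is not known to be integrable; it is bounded below by an integrable function. The
divergence theorem is therefore proved as an inequality (`setIntegral_le_flux`), for the Hausdorff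
measure on the boundary. Locally, a hypersurface is a graph in each transversal direction `e`, the
projection along `e` onto the tangent plane is nearly isometric near each point, which gives the area
formula (`IsGraphCylinder.map_graphMap`), and Fubini's theorem with the fundamental theorem of
calculus on the lines parallel to `e` gives the component of the divergence theorem along `e`
(`IsGraphCylinder.setIntegral_fderiv`). The transversal directions span, a translation of the field
into the domain removes the question of regularity at the boundary, and a partition of unity
concludes.
-/

open MeasureTheory
open scoped ContDiff RealInnerProductSpace

noncomputable section

namespace WarpedCarleman

/-! ### Lines in a fixed direction -/

section LineChart

variable {E : Type*} [NormedAddCommGroup E] [InnerProductSpace ℝ E] [FiniteDimensional ℝ E]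
  [MeasurableSpace E] [BorelSpace E]

/-- The chart `(k, s) ↦ k + s e` of `E`, where `k` is orthogonal to `e`. -/
def lineChart (e : E) (x : (ℝ ∙ e)ᗮ × ℝ) : E := (x.1 : E) + x.2 • e

lemma continuous_lineChart (e : E) : Continuous (lineChart e) := by
  unfold lineChart; fun_prop

lemma measurePreserving_lineChart {e : E} (he : ‖e‖ = 1) :
    MeasurePreserving (lineChart e) volume volume := by
  have h1 : MeasurePreserving (Prod.swap : (ℝ ∙ e)ᗮ × ℝ → ℝ × (ℝ ∙ e)ᗮ) volume volume :=
    Measure.measurePreserving_swap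
  have h2 : MeasurePreserving
      (Prod.map (LinearIsometryEquiv.toSpanUnitSingleton (𝕜 := ℝ) e he) (id : (ℝ ∙ e)ᗮ → _))
      volume volume :=
    ((LinearIsometryEquiv.toSpanUnitSingleton (𝕜 := ℝ) e he).measurePreserving).prod
      (MeasurePreserving.id _)
  have h3 := WithLp.volume_preserving_toLp (ℝ ∙ e) (ℝ ∙ e)ᗮ
  have h4 := (ℝ ∙ e).orthogonalDecomposition.symm.measurePreserving
  have h5 := h4.comp (h3.comp (h2.comp h1))
  refine MeasurePreserving.congr h5 (continuous_lineChart e).measurable ?_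
  exact Filter.Eventually.of_forall fun x => by simp [lineChart, add_comm]

lemma inner_lineChart {e : E} (he : ‖e‖ = 1) (x : (ℝ ∙ e)ᗮ × ℝ) : ⟪e, lineChart e x⟫ = x.2 := by
  have : ⟪e, (x.1 : E)⟫ = 0 := Submodule.mem_orthogonal_singleton_iff_inner_right.1 x.1.2
  simp [lineChart, inner_add_right, this, inner_smul_right, he]

lemma lineChart_injective {e : E} (he : ‖e‖ = 1) : Function.Injective (lineChart e) := by
  intro x y h
  have h2 : x.2 = y.2 := by rw [← inner_lineChart he x, h, inner_lineChart he y]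
  have h1 : (x.1 : E) = y.1 := by
    unfold lineChart at h
    rw [h2] at h
    exact add_right_cancel h
  exact Prod.ext (Subtype.ext h1) h2

lemma measurableEmbedding_lineChart {e : E} (he : ‖e‖ = 1) : MeasurableEmbedding (lineChart e) :=
  (continuous_lineChart e).measurableEmbedding (lineChart_injective he)

/-- Two measures are comparable if they are comparable, with constants arbitrarily close to `1`,
near each point of a set that carries both. -/
lemma measure_le_of_locally_le {X : Type*} [TopologicalSpace X] [SecondCountableTopology X]
    [MeasurableSpace X] [OpensMeasurableSpace X] {μ ν : Measure X} {Z : Set X}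
    (hm : MeasurableSet Z) (hμ : μ Zᶜ = 0)
    (h : ∀ t : NNReal, 1 < t → ∀ q ∈ Z, ∃ N : Set X, IsOpen N ∧ q ∈ N ∧
      ∀ A, MeasurableSet A → A ⊆ Z ∩ N → μ A ≤ t * ν A) : μ ≤ ν := by
  have key : ∀ t : NNReal, 1 < t → ∀ A, MeasurableSet A → μ A ≤ t * ν A := by
    intro t ht A hA
    choose! N hN using h t ht
    -- countably many neighbourhoods cover `Z`; sum over their disjoint differences
    obtain ⟨T, hTs, hTc, hcov⟩ := TopologicalSpace.countable_cover_nhdsWithin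
      (fun q (hq : q ∈ Z) => mem_nhdsWithin_of_mem_nhds ((hN q hq).1.mem_nhds (hN q hq).2.1))
    rcases T.eq_empty_or_nonempty with rfl | hne
    · have hS : Z = ∅ := by simpa using hcov
      have : μ A = 0 := measure_mono_null (by simp [hS]) hμ
      simp [this]
    obtain ⟨f, rfl⟩ := hTc.exists_eq_range hne
    set P : ℕ → Set X := fun i => A ∩ Z ∩ disjointed (fun j => N (f j)) i with hP
    have hPm : ∀ i, MeasurableSet (P i) := fun i =>
      (hA.inter hm).inter (MeasurableSet.disjointed
        (fun j => (hN _ (hTs ⟨j, rfl⟩)).1.measurableSet) i)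
    have hPd : Pairwise (Function.onFun Disjoint P) := fun i j hij =>
      ((disjoint_disjointed _) hij).mono Set.inter_subset_right Set.inter_subset_right
    have hU : ⋃ i, P i = A ∩ Z := by
      rw [hP, ← Set.inter_iUnion, iUnion_disjointed]
      refine Set.inter_eq_left.2 (Set.inter_subset_right.trans ?_)
      simpa using hcov
    calc μ A ≤ μ (A ∩ Z) + μ Zᶜ := by
          refine (measure_mono ?_).trans (measure_union_le _ _)
          intro x hx
          by_cases hxs : x ∈ Z
          · exact Or.inl ⟨hx, hxs⟩
          · exact Or.inr hxs
      _ = ∑' i, μ (P i) := by rw [hμ, add_zero, ← hU, measure_iUnion hPd hPm]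
      _ ≤ ∑' i, t * ν (P i) := by
          refine ENNReal.tsum_le_tsum fun i => (hN _ (hTs ⟨i, rfl⟩)).2.2 _ (hPm i) ?_
          exact fun x hx => ⟨hx.1.2, disjointed_subset (fun j => N (f j)) i hx.2⟩
      _ = t * ν (A ∩ Z) := by rw [ENNReal.tsum_mul_left, ← measure_iUnion hPd hPm, hU]
      _ ≤ t * ν A := by gcongr; exact Set.inter_subset_left
  -- let `t` decrease to `1`
  refine Measure.le_intro fun A hA _ => ?_
  have hlim : Filter.Tendsto (fun n : ℕ => (((1 + 1 / ((n : NNReal) + 1) : NNReal)) : ENNReal) * ν A)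
      Filter.atTop (nhds ((1 : NNReal) * ν A)) := by
    refine ENNReal.Tendsto.mul_const ?_ (Or.inl (by simp))
    refine ENNReal.tendsto_coe.2 ?_
    have := (tendsto_one_div_add_atTop_nhds_zero_nat (𝕜 := NNReal)).const_add 1
    simpa using this
  have := ge_of_tendsto' hlim (fun n => key _ (by
    have : (0 : NNReal) < 1 / ((n : NNReal) + 1) := by positivity
    exact lt_add_of_pos_right 1 this) A hA)
  simpa using this

end LineChart

/-! ### Hypersurfaces as graphs -/

section GraphCylinder

variable {E : Type*} [NormedAddCommGroup E] [InnerProductSpace ℝ E] [FiniteDimensional ℝ E]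
  [MeasurableSpace E] [BorelSpace E]

lemma lineChart_surjective {e : E} (he : ‖e‖ = 1) (y : E) :
    ∃ x, lineChart e x = y := by
  refine ⟨(⟨y - ⟪e, y⟫ • e, ?_⟩, ⟪e, y⟫), ?_⟩
  · rw [Submodule.mem_orthogonal_singleton_iff_inner_right]
    simp [inner_sub_right, inner_smul_right, he]
  · simp [lineChart]

lemma isOpenMap_lineChart {e : E} (he : ‖e‖ = 1) : IsOpenMap (lineChart e) := by
  let l : ((ℝ ∙ e)ᗮ × ℝ) →ₗ[ℝ] E :=
    { toFun := lineChart e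
      map_add' := fun x y => by simp [lineChart, add_smul]; abel
      map_smul' := fun c x => by simp [lineChart, mul_smul] }
  exact LinearMap.isOpenMap_of_finiteDimensional l (lineChart_surjective he)

lemma norm_sq_lineChart {e : E} (he : ‖e‖ = 1) (x : (ℝ ∙ e)ᗮ × ℝ) :
    ‖lineChart e x‖ ^ 2 = ‖x.1‖ ^ 2 + x.2 ^ 2 := by
  have : ⟪(x.1 : E), e⟫ = 0 := Submodule.mem_orthogonal_singleton_iff_inner_left.1 x.1.2
  unfold lineChart
  rw [norm_add_sq_real, inner_smul_right, this, norm_smul, he]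
  simp

/-- In a cylinder in the direction `e` over the open base `T`, the set `{φ = 0}` is the graph of `h`
and `{φ < 0}` is its subgraph. -/
structure IsGraphCylinder (φ : E → ℝ) (e : E) (T : Set (ℝ ∙ e)ᗮ) (a b : ℝ)
    (h : (ℝ ∙ e)ᗮ → ℝ) : Prop where
  isOpen : IsOpen T
  volume_lt_top : volume T < ⊤
  continuousOn : ContinuousOn h T
  mem_Ioo : ∀ k ∈ T, h k ∈ Set.Ioo a b
  neg_iff : ∀ k ∈ T, ∀ s ∈ Set.Ioo a b, φ (lineChart e (k, s)) < 0 ↔ s < h k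
  zero_iff : ∀ k ∈ T, ∀ s ∈ Set.Ioo a b, φ (lineChart e (k, s)) = 0 ↔ s = h k
  contDiffAt : ∀ k ∈ T, ∀ s ∈ Set.Ioo a b, ContDiffAt ℝ 1 φ (lineChart e (k, s))
  fderiv_pos : ∀ k ∈ T, ∀ s ∈ Set.Ioo a b, 0 < fderiv ℝ φ (lineChart e (k, s)) e

lemma hasDerivAt_lineChart (e : E) (k : (ℝ ∙ e)ᗮ) (s : ℝ) :
    HasDerivAt (fun s => lineChart e (k, s)) e s := by
  unfold lineChart
  simpa using ((hasDerivAt_id s).smul_const e).const_add (k : E)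

/-- A hypersurface that is transversal to `e` at `q` is a graph in the direction `e` near `q`. The
function `φ` increases strictly along the lines in the direction `e`, so that the height `h` exists by
the intermediate value theorem and the signs of `φ` tell the two sides of the graph apart. -/
lemma exists_isGraphCylinder {W : Set E} {φ : E → ℝ} {q e : E} (hW : IsOpen W)
    (hφ : ContDiffOn ℝ 1 φ W) (hq : q ∈ W) (h0 : φ q = 0) (he : ‖e‖ = 1)
    (hd : 0 < fderiv ℝ φ q e) :
    ∃ (T : Set (ℝ ∙ e)ᗮ) (a b : ℝ) (h : (ℝ ∙ e)ᗮ → ℝ), IsGraphCylinder φ e T a b h ∧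
      q ∈ lineChart e '' (T ×ˢ Set.Ioo a b) ∧ lineChart e '' (T ×ˢ Set.Ioo a b) ⊆ W := by
  obtain ⟨⟨k₀, s₀⟩, hks⟩ := lineChart_surjective he q
  have hdc : ContinuousOn (fun y => fderiv ℝ φ y e) W :=
    (hφ.continuousOn_fderiv_of_isOpen hW le_rfl).clm_apply continuousOn_const
  have hGo : IsOpen (W ∩ (fun y => fderiv ℝ φ y e) ⁻¹' Set.Ioi 0) :=
    hdc.isOpen_inter_preimage hW isOpen_Ioi
  have hGo' := hGo.preimage (continuous_lineChart e)
  obtain ⟨δ, hδ, hsub⟩ := Metric.isOpen_iff.1 hGo' (k₀, s₀) (by simp [hks, hq, hd])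
  have hin : ∀ k ∈ Metric.ball k₀ δ, ∀ s ∈ Set.Ioo (s₀ - δ) (s₀ + δ),
      lineChart e (k, s) ∈ W ∧ 0 < fderiv ℝ φ (lineChart e (k, s)) e := by
    intro k hk s hs
    have := @hsub (k, s) (by
      rw [← ball_prod_same]
      exact ⟨hk, by rwa [Real.ball_eq_Ioo]⟩)
    exact this
  have hder : ∀ k ∈ Metric.ball k₀ δ, ∀ s ∈ Set.Ioo (s₀ - δ) (s₀ + δ),
      HasDerivAt (fun s => φ (lineChart e (k, s))) (fderiv ℝ φ (lineChart e (k, s)) e) s := by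
    intro k hk s hs
    have h1 := ((hφ.differentiableOn one_ne_zero).differentiableAt
      (hW.mem_nhds (hin k hk s hs).1)).hasFDerivAt
    exact h1.comp_hasDerivAt s (hasDerivAt_lineChart e k s)
  have hmono : ∀ k ∈ Metric.ball k₀ δ,
      StrictMonoOn (fun s => φ (lineChart e (k, s))) (Set.Ioo (s₀ - δ) (s₀ + δ)) := by
    intro k hk
    refine strictMonoOn_of_deriv_pos (convex_Ioo _ _)
      (fun s hs => (hder k hk s hs).continuousAt.continuousWithinAt) fun s hs => ?_
    rw [interior_Ioo] at hs
    rw [(hder k hk s hs).deriv]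
    exact (hin k hk s hs).2
  have hk₀ : k₀ ∈ Metric.ball k₀ δ := Metric.mem_ball_self hδ
  have hφc : ∀ k ∈ Metric.ball k₀ δ, ∀ s ∈ Set.Ioo (s₀ - δ) (s₀ + δ),
      ContinuousAt (fun k => φ (lineChart e (k, s))) k := by
    intro k hk s hs
    have h1 : ContinuousAt φ (lineChart e (k, s)) :=
      hφ.continuousOn.continuousAt (hW.mem_nhds (hin k hk s hs).1)
    have h2 : ContinuousAt (fun k => lineChart e (k, s)) k :=
      ((continuous_lineChart e).comp (by fun_prop)).continuousAt
    exact ContinuousAt.comp (f := fun k => lineChart e (k, s)) h1 h2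
  have hz : φ (lineChart e (k₀, s₀)) = 0 := by rw [hks, h0]
  have hm : s₀ - δ / 2 ∈ Set.Ioo (s₀ - δ) (s₀ + δ) := ⟨by linarith, by linarith⟩
  have hp : s₀ + δ / 2 ∈ Set.Ioo (s₀ - δ) (s₀ + δ) := ⟨by linarith, by linarith⟩
  have h00 : s₀ ∈ Set.Ioo (s₀ - δ) (s₀ + δ) := ⟨by linarith, by linarith⟩
  have e1 : ∀ᶠ k in nhds k₀, φ (lineChart e (k, s₀ - δ / 2)) < 0 :=
    (hφc k₀ hk₀ _ hm).eventually_lt_const (by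
      rw [← hz]; exact hmono k₀ hk₀ hm h00 (by linarith))
  have e2 : ∀ᶠ k in nhds k₀, 0 < φ (lineChart e (k, s₀ + δ / 2)) :=
    (hφc k₀ hk₀ _ hp).eventually_const_lt (by
      rw [← hz]; exact hmono k₀ hk₀ h00 hp (by linarith))
  obtain ⟨δ', hδ', hsub'⟩ := Metric.eventually_nhds_iff_ball.1
    (e1.and (e2.and (Metric.ball_mem_nhds k₀ hδ)))
  have hex : ∀ k ∈ Metric.ball k₀ δ', ∃ s ∈ Set.Ioo (s₀ - δ) (s₀ + δ),
      φ (lineChart e (k, s)) = 0 := by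
    intro k hk
    obtain ⟨a1, a2, a3⟩ := hsub' k hk
    have hc : ContinuousOn (fun s => φ (lineChart e (k, s))) (Set.Icc (s₀ - δ / 2) (s₀ + δ / 2)) :=
      fun s hs => (hder k a3 s ⟨by linarith [hs.1], by linarith [hs.2]⟩).continuousAt.continuousWithinAt
    obtain ⟨s, hs, hs0⟩ := intermediate_value_Icc (by linarith) hc (show (0 : ℝ) ∈ _ from ⟨a1.le, a2.le⟩)
    exact ⟨s, ⟨by linarith [hs.1], by linarith [hs.2]⟩, hs0⟩
  choose! h hh1 hh2 using hex
  have hb : ∀ k ∈ Metric.ball k₀ δ', k ∈ Metric.ball k₀ δ := fun k hk => (hsub' k hk).2.2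
  have hneg : ∀ k ∈ Metric.ball k₀ δ', ∀ s ∈ Set.Ioo (s₀ - δ) (s₀ + δ),
      (φ (lineChart e (k, s)) < 0 ↔ s < h k) := by
    intro k hk s hs
    rw [← hh2 k hk]
    exact (hmono k (hb k hk)).lt_iff_lt hs (hh1 k hk)
  have hpos : ∀ k ∈ Metric.ball k₀ δ', ∀ s ∈ Set.Ioo (s₀ - δ) (s₀ + δ),
      (0 < φ (lineChart e (k, s)) ↔ h k < s) := by
    intro k hk s hs
    rw [← hh2 k hk]
    exact (hmono k (hb k hk)).lt_iff_lt (hh1 k hk) hs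
  refine ⟨Metric.ball k₀ δ', s₀ - δ, s₀ + δ, h, ⟨Metric.isOpen_ball, measure_ball_lt_top, ?_,
    hh1, hneg, ?_, ?_, fun k hk s hs => (hin k (hb k hk) s hs).2⟩, ?_, ?_⟩
  -- `h` is continuous since the conditions `s < h k` and `h k < s` on `k` are given by signs of `φ`
  · intro k hk
    refine ContinuousAt.continuousWithinAt (tendsto_order.2 ⟨fun s hs => ?_, fun s hs => ?_⟩)
    · have hnb : ∀ᶠ k' in nhds k, k' ∈ Metric.ball k₀ δ' := Metric.isOpen_ball.mem_nhds hk
      rcases le_or_gt s (s₀ - δ) with h1 | h1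
      · filter_upwards [hnb] with k' hk'
        exact h1.trans_lt (hh1 k' hk').1
      · have hsI : s ∈ Set.Ioo (s₀ - δ) (s₀ + δ) := ⟨h1, hs.trans (hh1 k hk).2⟩
        filter_upwards [hnb, (hφc k (hb k hk) s hsI).eventually_lt_const
          ((hneg k hk s hsI).2 hs)] with k' hk' hk''
        exact (hneg k' hk' s hsI).1 hk''
    · have hnb : ∀ᶠ k' in nhds k, k' ∈ Metric.ball k₀ δ' := Metric.isOpen_ball.mem_nhds hk
      rcases le_or_gt (s₀ + δ) s with h1 | h1
      · filter_upwards [hnb] with k' hk'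
        exact (hh1 k' hk').2.trans_le h1
      · have hsI : s ∈ Set.Ioo (s₀ - δ) (s₀ + δ) := ⟨(hh1 k hk).1.trans hs, h1⟩
        filter_upwards [hnb, (hφc k (hb k hk) s hsI).eventually_const_lt
          ((hpos k hk s hsI).2 hs)] with k' hk' hk''
        exact (hpos k' hk' s hsI).1 hk''
  · intro k hk s hs
    have h1 := hneg k hk s hs
    have h2 := hpos k hk s hs
    constructor
    · intro h3
      rw [h3] at h1 h2
      exact le_antisymm (not_lt.1 fun h => lt_irrefl _ (h2.2 h))
        (not_lt.1 fun h => lt_irrefl _ (h1.2 h))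
    · rintro rfl
      exact hh2 k hk
  · intro k hk s hs
    exact hφ.contDiffAt (hW.mem_nhds (hin k (hb k hk) s hs).1)
  · exact ⟨(k₀, s₀), ⟨Metric.mem_ball_self hδ', h00⟩, hks⟩
  · rintro _ ⟨⟨k, s⟩, ⟨hk, hs⟩, rfl⟩
    exact (hin k (hb k hk) s hs).1

/-- The linear graph map `k ↦ k - (L k / L e) e` over the hyperplane orthogonal to `e`; its range
is the kernel of `L`. -/
def kernelGraph (L : E →L[ℝ] ℝ) (e : E) : (ℝ ∙ e)ᗮ →ₗ[ℝ] E :=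
  ((ContinuousLinearMap.id ℝ E - (L.smulRight ((L e)⁻¹ • e))).comp (ℝ ∙ e)ᗮ.subtypeL).toLinearMap

lemma kernelGraph_apply (L : E →L[ℝ] ℝ) (e : E) (k : (ℝ ∙ e)ᗮ) :
    kernelGraph L e k = (k : E) - (L k / L e) • e := by
  simp [kernelGraph, div_eq_mul_inv, mul_smul]

/-- The Gram matrix of the graph map over an orthonormal basis is the identity plus a matrix of
rank one. -/
lemma normDet_kernelGraph (L : E →L[ℝ] ℝ) {e : E} (he : ‖e‖ = 1) (hL : 0 < L e) :
    (kernelGraph L e).normDet = ‖L‖ / L e := by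
  set b := stdOrthonormalBasis ℝ (ℝ ∙ e)ᗮ with hb
  have h1 := (kernelGraph L e).normDet_sq_eq_det_gram b
  have hbe : ∀ i, ⟪(b i : E), e⟫ = 0 := fun i =>
    Submodule.mem_orthogonal_singleton_iff_inner_left.1 (b i).2
  have hbe' : ∀ i, ⟪e, (b i : E)⟫ = 0 := fun i =>
    Submodule.mem_orthogonal_singleton_iff_inner_right.1 (b i).2
  set v : _ → ℝ := fun i => L (b i) / L e with hv
  -- the Gram matrix of the images of an orthonormal basis is `1 + v vᵀ`
  have h2 : (Matrix.gram ℝ (kernelGraph L e <| b ·)) =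
      1 + Matrix.replicateCol Unit v * Matrix.replicateRow Unit v := by
    ext i j
    have h3 : ⟪(b i : E), (b j : E)⟫ = if i = j then 1 else 0 :=
      orthonormal_iff_ite.1 b.orthonormal i j
    simp only [Matrix.gram_apply, kernelGraph_apply, inner_sub_left, inner_sub_right,
      inner_smul_left, inner_smul_right, hbe, hbe', h3, real_inner_self_eq_norm_sq, he,
      Matrix.add_apply, Matrix.one_apply, Matrix.mul_apply, Matrix.replicateCol_apply,
      Matrix.replicateRow_apply, hv]
    simp [mul_comm]
  rw [h2, Matrix.det_one_add_replicateCol_mul_replicateRow] at h1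
  obtain ⟨⟨k, s⟩, hks⟩ := lineChart_surjective he ((InnerProductSpace.toDual ℝ E).symm L)
  have hLy : ∀ y, L y = ⟪lineChart e (k, s), y⟫ := fun y => by
    rw [hks, InnerProductSpace.toDual_symm_apply]
  have hLe : L e = s := by rw [hLy, real_inner_comm, inner_lineChart he]
  have hLb : ∀ i, L (b i) = ⟪k, b i⟫ := fun i => by
    rw [hLy]
    simp [lineChart, inner_add_left, inner_smul_left, hbe']
  have hLn : ‖L‖ ^ 2 = ‖k‖ ^ 2 + s ^ 2 := by
    rw [← norm_sq_lineChart he (k, s), hks, LinearIsometryEquiv.norm_map]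
  have hk : ∑ i, L (b i) ^ 2 = ‖k‖ ^ 2 := by
    rw [← b.sum_sq_norm_inner_left k]
    simp [hLb]
  have h4 : (kernelGraph L e).normDet ^ 2 = (‖L‖ / L e) ^ 2 := by
    have h5 : (kernelGraph L e).normDet ^ 2 = 1 + v ⬝ᵥ v := by simpa using h1
    rw [h5, div_pow, hLn, ← hk, ← hLe]
    have : v ⬝ᵥ v = (∑ i, L (b i) ^ 2) / L e ^ 2 := by
      simp only [dotProduct, hv, Finset.sum_div]
      refine Finset.sum_congr rfl fun i _ => by field_simp
    rw [this]
    field_simp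
    ring
  exact (pow_left_inj₀ (LinearMap.normDet_nonneg _) (by positivity) two_ne_zero).1 h4

end GraphCylinder

/-! ### The area formula for a graph -/

section AreaFormula

variable {E : Type*} [NormedAddCommGroup E] [InnerProductSpace ℝ E] [FiniteDimensional ℝ E]
  [MeasurableSpace E] [BorelSpace E]

lemma finrank_orthogonal_of_norm_one {e : E} (he : ‖e‖ = 1) :
    Module.finrank ℝ (ℝ ∙ e)ᗮ = Module.finrank ℝ E - 1 := by
  have h0 : e ≠ 0 := by rintro rfl; simp at he
  have h1 := (ℝ ∙ e).finrank_add_finrank_orthogonal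
  rw [finrank_span_singleton h0] at h1
  omega

/-- The Lipschitz estimate for the Hausdorff measure in its Euclidean normalization. -/
lemma _root_.LipschitzOnWith.euclideanHausdorffMeasure_image_le {X Y : Type*} [EMetricSpace X]
    [MeasurableSpace X] [BorelSpace X] [EMetricSpace Y] [MeasurableSpace Y] [BorelSpace Y]
    {K : NNReal} {f : X → Y} {s : Set X} (h : LipschitzOnWith K f s) (d : ℕ) :
    (Measure.euclideanHausdorffMeasure d : Measure Y) (f '' s)
      ≤ (K : ENNReal) ^ d * (Measure.euclideanHausdorffMeasure d : Measure X) s := by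
  simp_rw [Measure.euclideanHausdorffMeasure_def, Measure.smul_apply]
  have h1 := h.hausdorffMeasure_image_le (d := (d : ℝ)) (by positivity)
  rw [ENNReal.rpow_natCast] at h1
  simp only [ENNReal.smul_def, smul_eq_mul]
  rw [mul_left_comm]
  gcongr

/-- The graph parametrized by the base of a cylinder. -/
def graphMap (e : E) (h : (ℝ ∙ e)ᗮ → ℝ) (k : (ℝ ∙ e)ᗮ) : E := lineChart e (k, h k)

lemma graphMap_injective {e : E} (he : ‖e‖ = 1) (h : (ℝ ∙ e)ᗮ → ℝ) :
    Function.Injective (graphMap e h) := fun _ _ hxy =>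
  congrArg Prod.fst (lineChart_injective he hxy)

variable {φ : E → ℝ} {e : E} {T : Set (ℝ ∙ e)ᗮ} {a b : ℝ} {h : (ℝ ∙ e)ᗮ → ℝ}

lemma IsGraphCylinder.continuousOn_graphMap (hg : IsGraphCylinder φ e T a b h) :
    ContinuousOn (graphMap e h) T :=
  (continuous_lineChart e).comp_continuousOn (continuousOn_id.prodMk hg.continuousOn)

lemma IsGraphCylinder.measurableSet_graph (hg : IsGraphCylinder φ e T a b h) (he : ‖e‖ = 1) :
    MeasurableSet (graphMap e h '' T) :=
  hg.isOpen.measurableSet.image_of_continuousOn_injOn hg.continuousOn_graphMap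
    (graphMap_injective he h).injOn

lemma IsGraphCylinder.aemeasurable_graphMap (hg : IsGraphCylinder φ e T a b h) :
    AEMeasurable (graphMap e h) (volume.restrict T) :=
  hg.continuousOn_graphMap.aemeasurable hg.isOpen.measurableSet

/-- The component along `e` of the unit conormal of the level sets of `φ`. -/
def normalDot (φ : E → ℝ) (e : E) (y : E) : ℝ := fderiv ℝ φ y e / ‖fderiv ℝ φ y‖

lemma kernelGraph_proj (L : E →L[ℝ] ℝ) {e : E} (hL : L e ≠ 0) (x : (ℝ ∙ e)ᗮ × ℝ) :
    kernelGraph L e x.1 = lineChart e x - (L (lineChart e x) / L e) • e := by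
  rw [kernelGraph_apply]
  simp only [lineChart, map_add, map_smul, smul_eq_mul, add_div, add_smul]
  rw [mul_div_cancel_right₀ _ hL]
  abel

/-- Near a point of a hypersurface, the projection along a transversal direction onto the tangent
plane is nearly isometric: the areas of a piece of the graph and of its projection, which is the
image of the base under `kernelGraph`, differ by factors close to `1`. -/
lemma IsGraphCylinder.measure_image_near (hg : IsGraphCylinder φ e T a b h) (he : ‖e‖ = 1)
    {κ : NNReal} (hκ : 1 < κ) {q : E} (hq : q ∈ graphMap e h '' T) :
    ∃ N : Set E, IsOpen N ∧ q ∈ N ∧ ∀ B ⊆ T, graphMap e h '' B ⊆ N →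
      (Measure.euclideanHausdorffMeasure (Module.finrank ℝ E - 1) : Measure E) (graphMap e h '' B)
        ≤ (κ : ENNReal) ^ (Module.finrank ℝ E - 1) *
          (ENNReal.ofReal (‖fderiv ℝ φ q‖ / fderiv ℝ φ q e) * volume B) ∧
      ENNReal.ofReal (‖fderiv ℝ φ q‖ / fderiv ℝ φ q e) * volume B ≤
        (κ : ENNReal) ^ (Module.finrank ℝ E - 1) *
        (Measure.euclideanHausdorffMeasure (Module.finrank ℝ E - 1) : Measure E)
          (graphMap e h '' B) := by
  obtain ⟨k₀, hk₀, rfl⟩ := hq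
  have hC := hg.contDiffAt k₀ hk₀ _ (hg.mem_Ioo k₀ hk₀)
  have hLpos := hg.fderiv_pos k₀ hk₀ _ (hg.mem_Ioo k₀ hk₀)
  change ContDiffAt ℝ 1 φ (graphMap e h k₀) at hC
  change 0 < fderiv ℝ φ (graphMap e h k₀) e at hLpos
  set L := fderiv ℝ φ (graphMap e h k₀) with hLdef
  have hκ' : (1 : ℝ) < κ := by exact_mod_cast hκ
  -- with this `δ` the Lipschitz constants `1 + δ` and `1 / (1 - δ)` are at most `κ`
  set δ : ℝ := 1 - 1 / κ with hδ
  have hδ0 : 0 < δ := by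
    have : 1 / (κ : ℝ) < 1 := by rw [div_lt_one (by linarith)]; exact hκ'
    linarith
  have hs : HasStrictFDerivAt φ L (graphMap e h k₀) := hC.hasStrictFDerivAt one_ne_zero
  have hev := hs.isLittleO.def (show 0 < δ * L e by positivity)
  rw [nhds_prod_eq] at hev
  -- strict differentiability makes chords of the hypersurface nearly tangent
  obtain ⟨N, hN, hN2'⟩ := Filter.mem_prod_self_iff.1 hev
  have hN2 : ∀ x ∈ N, ∀ y ∈ N, ‖φ x - φ y - L (x - y)‖ ≤ δ * L e * ‖x - y‖ :=
    fun x hx y hy => hN2' (Set.mk_mem_prod hx hy)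
  obtain ⟨N', hN', hN'o, hqN⟩ := mem_nhds_iff.1 hN
  refine ⟨N', hN'o, hqN, fun B hB hBN => ?_⟩
  have hφ0 : ∀ k ∈ T, φ (graphMap e h k) = 0 := fun k hk =>
    (hg.zero_iff k hk _ (hg.mem_Ioo k hk)).2 rfl
  have hest : ∀ k ∈ B, ∀ k' ∈ B,
      |L (graphMap e h k - graphMap e h k')| ≤ δ * L e * ‖graphMap e h k - graphMap e h k'‖ := by
    intro k hk k' hk'
    have := hN2 _ (hN' (hBN ⟨k, hk, rfl⟩)) _ (hN' (hBN ⟨k', hk', rfl⟩))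
    rwa [hφ0 k (hB hk), hφ0 k' (hB hk'), sub_zero, zero_sub, norm_neg] at this
  have hdiff : ∀ k k', kernelGraph L e k - kernelGraph L e k' =
      (graphMap e h k - graphMap e h k') - (L (graphMap e h k - graphMap e h k') / L e) • e := by
    intro k k'
    rw [show kernelGraph L e k = _ from kernelGraph_proj L hLpos.ne' (k, h k),
      show kernelGraph L e k' = _ from kernelGraph_proj L hLpos.ne' (k', h k')]
    simp only [graphMap, map_sub, sub_div, sub_smul]
    abel
  have hest2 : ∀ k ∈ B, ∀ k' ∈ B, ‖(L (graphMap e h k - graphMap e h k') / L e) • e‖ ≤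
      δ * ‖graphMap e h k - graphMap e h k'‖ := by
    intro k hk k' hk'
    rw [norm_smul, he, mul_one, Real.norm_eq_abs, abs_div, abs_of_pos hLpos, div_le_iff₀ hLpos]
    linarith [hest k hk k' hk']
  have hvol : (Measure.euclideanHausdorffMeasure (Module.finrank ℝ E - 1) : Measure E)
      (kernelGraph L e '' B) = ENNReal.ofReal (‖L‖ / L e) * volume B := by
    rw [← finrank_orthogonal_of_norm_one he,
      LinearMap.euclideanHausdorffMeasure_image_eq_normDet_mul_volume, normDet_kernelGraph L he hLpos]
  rw [← hvol]
  constructor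
  -- the graph is the image of its projection under a `κ`-Lipschitz map
  · have hinj : Set.InjOn (kernelGraph L e) B := by
      intro k hk k' hk' hkk
      have h1 := hdiff k k'
      rw [hkk, sub_self] at h1
      have h2 := hest2 k hk k' hk'
      rw [← sub_eq_zero.1 h1.symm] at h2
      have h3 : ‖graphMap e h k - graphMap e h k'‖ ≤ 0 := by
        have : 1 - δ = 1 / κ := by rw [hδ]; ring
        have h4 : (1 - δ) * ‖graphMap e h k - graphMap e h k'‖ ≤ 0 := by linarith
        rw [this] at h4
        by_contra hcon
        have : 0 < 1 / (κ : ℝ) * ‖graphMap e h k - graphMap e h k'‖ := by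
          have := not_le.1 hcon
          positivity
        linarith
      exact graphMap_injective he h (sub_eq_zero.1 (norm_le_zero_iff.1 h3))
    have hlip : LipschitzOnWith κ (graphMap e h ∘ Function.invFunOn (kernelGraph L e) B)
        (kernelGraph L e '' B) := by
      refine LipschitzOnWith.of_dist_le_mul ?_
      rintro _ ⟨k, hk, rfl⟩ _ ⟨k', hk', rfl⟩
      simp only [Function.comp_apply]
      rw [hinj.leftInvOn_invFunOn hk, hinj.leftInvOn_invFunOn hk', dist_eq_norm, dist_eq_norm,
        hdiff]
      have h1 := norm_sub_norm_le (graphMap e h k - graphMap e h k')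
        ((L (graphMap e h k - graphMap e h k') / L e) • e)
      have h2 := hest2 k hk k' hk'
      have h3 : 1 / (κ : ℝ) * ‖graphMap e h k - graphMap e h k'‖ ≤
          ‖graphMap e h k - graphMap e h k' - (L (graphMap e h k - graphMap e h k') / L e) • e‖ := by
        have : 1 / (κ : ℝ) = 1 - δ := by rw [hδ]; ring
        rw [this]; linarith
      rwa [one_div, inv_mul_le_iff₀ (by linarith)] at h3
    have himg : (graphMap e h ∘ Function.invFunOn (kernelGraph L e) B) '' (kernelGraph L e '' B) =
        graphMap e h '' B := by
      rw [Set.image_image]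
      refine Set.image_congr fun k hk => ?_
      simp [hinj.leftInvOn_invFunOn hk]
    rw [← himg]
    exact hlip.euclideanHausdorffMeasure_image_le _
  -- the projection is `κ`-Lipschitz on the graph
  · have hlip : LipschitzOnWith κ
        (fun y => y - (L y / L e) • e) (graphMap e h '' B) := by
      refine LipschitzOnWith.of_dist_le_mul ?_
      rintro _ ⟨k, hk, rfl⟩ _ ⟨k', hk', rfl⟩
      rw [dist_eq_norm, dist_eq_norm]
      have h0 : graphMap e h k - (L (graphMap e h k) / L e) • e -
          (graphMap e h k' - (L (graphMap e h k') / L e) • e) = (graphMap e h k - graphMap e h k')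
            - (L (graphMap e h k - graphMap e h k') / L e) • e := by
        simp only [map_sub, sub_div, sub_smul]
        abel
      rw [h0]
      have h1 := norm_sub_le (graphMap e h k - graphMap e h k')
        ((L (graphMap e h k - graphMap e h k') / L e) • e)
      have h2 := hest2 k hk k' hk'
      have h3 : 1 + δ ≤ κ := by
        have h4 : (0 : ℝ) < κ := by linarith
        rw [hδ, ← sub_nonneg]
        have : (κ : ℝ) - (1 + (1 - 1 / κ)) = (κ - 1) ^ 2 / κ := by field_simp; ring
        rw [this]; positivity
      calc _ ≤ (1 + δ) * ‖graphMap e h k - graphMap e h k'‖ := by linarith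
        _ ≤ κ * ‖graphMap e h k - graphMap e h k'‖ := by gcongr
    have himg : (fun y => y - (L y / L e) • e) '' (graphMap e h '' B) = kernelGraph L e '' B := by
      rw [Set.image_image]
      refine Set.image_congr fun k hk => ?_
      exact (kernelGraph_proj L hLpos.ne' (k, h k)).symm
    rw [← himg]
    exact hlip.euclideanHausdorffMeasure_image_le _

/-- The area formula for a hypersurface given as a graph. Both sides are compared near each point:
there the graph is nearly isometric to its projection onto the tangent plane, and the density is
nearly constant. -/
theorem IsGraphCylinder.map_graphMap (hg : IsGraphCylinder φ e T a b h) (he : ‖e‖ = 1) :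
    Measure.map (graphMap e h) (volume.restrict T) =
      ((Measure.euclideanHausdorffMeasure (Module.finrank ℝ E - 1) : Measure E).restrict
        (graphMap e h '' T)).withDensity fun y => ENNReal.ofReal (normalDot φ e y) := by
  set d := Module.finrank ℝ E - 1 with hd
  set H : Measure E := Measure.euclideanHausdorffMeasure d with hH
  set Z := graphMap e h '' T with hZ
  have hZm : MeasurableSet Z := hg.measurableSet_graph he
  have hZ0 : ∀ q ∈ Z, 0 < fderiv ℝ φ q e := by
    rintro _ ⟨k, hk, rfl⟩
    exact hg.fderiv_pos k hk _ (hg.mem_Ioo k hk)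
  have hn0 : ∀ q ∈ Z, 0 < ‖fderiv ℝ φ q‖ := by
    intro q hq
    rw [norm_pos_iff]
    intro h0
    have := hZ0 q hq
    simp [h0] at this
  have hg0 : ∀ q ∈ Z, 0 < normalDot φ e q := fun q hq => div_pos (hZ0 q hq) (hn0 q hq)
  have hcont : ∀ q ∈ Z, ContinuousAt (normalDot φ e) q := by
    rintro q hq
    obtain ⟨k, hk, rfl⟩ := id hq
    have h1 : ContinuousAt (fderiv ℝ φ) (graphMap e h k) :=
      (hg.contDiffAt k hk _ (hg.mem_Ioo k hk)).continuousAt_fderiv one_ne_zero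
    exact (h1.clm_apply continuousAt_const).div h1.norm (hn0 _ hq).ne'
  have hmap : ∀ A, MeasurableSet A → A ⊆ Z →
      Measure.map (graphMap e h) (volume.restrict T) A = volume (graphMap e h ⁻¹' A ∩ T) ∧
      graphMap e h '' (graphMap e h ⁻¹' A ∩ T) = A := by
    intro A hA hAZ
    constructor
    · rw [Measure.map_apply_of_aemeasurable hg.aemeasurable_graphMap hA,
        Measure.restrict_apply₀' hg.isOpen.measurableSet.nullMeasurableSet]
    · rw [Set.image_preimage_inter, Set.inter_eq_left.2 hAZ]
  have hwd : ∀ A, MeasurableSet A → A ⊆ Z → ((H.restrict Z).withDensity fun y =>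
      ENNReal.ofReal (normalDot φ e y)) A = ∫⁻ y in A, ENNReal.ofReal (normalDot φ e y) ∂H := by
    intro A hA hAZ
    rw [withDensity_apply _ hA, Measure.restrict_restrict hA, Set.inter_eq_left.2 hAZ]
  -- the comparison loses `κ` for the density and `κ ^ d` for the area
  have hchoice : ∀ t : NNReal, 1 < t → ∃ κ : NNReal, 1 < κ ∧ κ * κ ^ d ≤ t := by
    intro t ht
    have hc : Filter.Tendsto (fun κ : NNReal => κ * κ ^ d) (nhds 1) (nhds 1) := by
      have : Continuous fun κ : NNReal => κ * κ ^ d := by fun_prop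
      simpa using this.tendsto 1
    have h1 : ∀ᶠ κ in nhdsWithin (1 : NNReal) (Set.Ioi 1), κ * κ ^ d < t :=
      (hc.mono_left nhdsWithin_le_nhds).eventually_lt_const ht
    obtain ⟨κ, h2, h3⟩ := (h1.and self_mem_nhdsWithin).exists
    exact ⟨κ, h3, h2.le⟩
  have hnear : ∀ κ : NNReal, 1 < κ → ∀ q ∈ Z, ∃ N : Set E, IsOpen N ∧ q ∈ N ∧ ∀ y ∈ N,
      ENNReal.ofReal (normalDot φ e y) ≤ κ * ENNReal.ofReal (normalDot φ e q) ∧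
      ENNReal.ofReal (normalDot φ e q) ≤ κ * ENNReal.ofReal (normalDot φ e y) := by
    intro κ hκ q hq
    have hκ' : (1 : ℝ) < κ := by exact_mod_cast hκ
    have h1 : ∀ᶠ y in nhds q, normalDot φ e y < κ * normalDot φ e q :=
      (hcont q hq).eventually_lt_const (by nlinarith [hg0 q hq])
    have h2 : ∀ᶠ y in nhds q, normalDot φ e q < κ * normalDot φ e y :=
      (continuousAt_const.mul (hcont q hq)).eventually_const_lt (by
        change normalDot φ e q < κ * normalDot φ e q
        nlinarith [hg0 q hq])
    obtain ⟨N, hN, hNo, hqN⟩ := eventually_nhds_iff.1 (h1.and h2)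
    refine ⟨N, hNo, hqN, fun y hy => ?_⟩
    have hco : (κ : ENNReal) = ENNReal.ofReal κ := by simp
    rw [hco, ← ENNReal.ofReal_mul (by linarith), ← ENNReal.ofReal_mul (by linarith)]
    exact ⟨ENNReal.ofReal_le_ofReal (hN y hy).1.le, ENNReal.ofReal_le_ofReal (hN y hy).2.le⟩
  have hone : ∀ q ∈ Z, ENNReal.ofReal (normalDot φ e q) *
      ENNReal.ofReal (‖fderiv ℝ φ q‖ / fderiv ℝ φ q e) = 1 := by
    intro q hq
    have h1 := hZ0 q hq
    have h2 := hn0 q hq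
    rw [← ENNReal.ofReal_mul (hg0 q hq).le, normalDot]
    rw [div_mul_div_cancel₀ h2.ne', div_self h1.ne', ENNReal.ofReal_one]
  apply le_antisymm
  · refine measure_le_of_locally_le hZm ?_ ?_
    · rw [Measure.map_apply_of_aemeasurable hg.aemeasurable_graphMap hZm.compl,
        Measure.restrict_apply₀' hg.isOpen.measurableSet.nullMeasurableSet]
      convert measure_empty (μ := volume)
      ext k
      simp only [Set.mem_inter_iff, Set.mem_preimage, Set.mem_compl_iff, Set.mem_empty_iff_false,
        iff_false, not_and]
      exact fun h1 h2 => h1 ⟨k, h2, rfl⟩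
    intro t ht q hq
    obtain ⟨κ, hκ, hκt⟩ := hchoice t ht
    obtain ⟨N1, hN1o, hqN1, hN1⟩ := hg.measure_image_near he hκ hq
    obtain ⟨N2, hN2o, hqN2, hN2⟩ := hnear κ hκ q hq
    refine ⟨N1 ∩ N2, hN1o.inter hN2o, ⟨hqN1, hqN2⟩, fun A hA hAs => ?_⟩
    have hAZ : A ⊆ Z := fun x hx => (hAs hx).1
    obtain ⟨e1, e2⟩ := hmap A hA hAZ
    rw [e1, hwd A hA hAZ]
    have h3 := (hN1 _ Set.inter_subset_right (by rw [e2]; exact fun x hx => (hAs hx).2.1)).2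
    rw [e2] at h3
    have h4 : ENNReal.ofReal (normalDot φ e q) * H A ≤
        κ * ∫⁻ y in A, ENNReal.ofReal (normalDot φ e y) ∂H := by
      rw [← lintegral_const_mul' _ _ ENNReal.coe_ne_top, ← setLIntegral_const]
      exact setLIntegral_mono' hA fun y hy => (hN2 y (hAs hy).2.2).2
    calc volume (graphMap e h ⁻¹' A ∩ T)
        = ENNReal.ofReal (normalDot φ e q) *
          (ENNReal.ofReal (‖fderiv ℝ φ q‖ / fderiv ℝ φ q e) *
            volume (graphMap e h ⁻¹' A ∩ T)) := by rw [← mul_assoc, hone q hq, one_mul]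
      _ ≤ ENNReal.ofReal (normalDot φ e q) * (κ ^ d * H A) := by gcongr
      _ = κ ^ d * (ENNReal.ofReal (normalDot φ e q) * H A) := mul_left_comm _ _ _
      _ ≤ κ ^ d * (κ * ∫⁻ y in A, ENNReal.ofReal (normalDot φ e y) ∂H) := by gcongr
      _ = ((κ * κ ^ d : NNReal) : ENNReal) * ∫⁻ y in A, ENNReal.ofReal (normalDot φ e y) ∂H := by
          push_cast; ring
      _ ≤ t * ∫⁻ y in A, ENNReal.ofReal (normalDot φ e y) ∂H := by gcongr
  · refine measure_le_of_locally_le hZm ?_ ?_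
    · exact withDensity_absolutelyContinuous _ _ (by simp [Measure.restrict_apply hZm.compl])
    intro t ht q hq
    obtain ⟨κ, hκ, hκt⟩ := hchoice t ht
    obtain ⟨N1, hN1o, hqN1, hN1⟩ := hg.measure_image_near he hκ hq
    obtain ⟨N2, hN2o, hqN2, hN2⟩ := hnear κ hκ q hq
    refine ⟨N1 ∩ N2, hN1o.inter hN2o, ⟨hqN1, hqN2⟩, fun A hA hAs => ?_⟩
    have hAZ : A ⊆ Z := fun x hx => (hAs hx).1
    obtain ⟨e1, e2⟩ := hmap A hA hAZ
    rw [e1, hwd A hA hAZ]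
    have h3 := (hN1 _ Set.inter_subset_right (by rw [e2]; exact fun x hx => (hAs hx).2.1)).1
    rw [e2] at h3
    have h4 : ∫⁻ y in A, ENNReal.ofReal (normalDot φ e y) ∂H ≤
        κ * ENNReal.ofReal (normalDot φ e q) * H A := by
      rw [← setLIntegral_const]
      exact setLIntegral_mono' hA fun y hy => (hN2 y (hAs hy).2.2).1
    calc _ ≤ κ * ENNReal.ofReal (normalDot φ e q) * H A := h4
      _ ≤ κ * ENNReal.ofReal (normalDot φ e q) * (κ ^ d *
          (ENNReal.ofReal (‖fderiv ℝ φ q‖ / fderiv ℝ φ q e) *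
            volume (graphMap e h ⁻¹' A ∩ T))) := by gcongr
      _ = κ * κ ^ d * (ENNReal.ofReal (normalDot φ e q) *
          ENNReal.ofReal (‖fderiv ℝ φ q‖ / fderiv ℝ φ q e)) *
            volume (graphMap e h ⁻¹' A ∩ T) := by ring
      _ = ((κ * κ ^ d : NNReal) : ENNReal) * volume (graphMap e h ⁻¹' A ∩ T) := by
          rw [hone q hq]; push_cast; ring
      _ ≤ t * volume (graphMap e h ⁻¹' A ∩ T) := by gcongr

end AreaFormula

/-! ### The divergence theorem under a graph, one direction at a time -/

section LocalDivergence

variable {E : Type*} [NormedAddCommGroup E] [InnerProductSpace ℝ E] [FiniteDimensional ℝ E]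
  [MeasurableSpace E] [BorelSpace E]
  {φ : E → ℝ} {e : E} {T : Set (ℝ ∙ e)ᗮ} {a b : ℝ} {h : (ℝ ∙ e)ᗮ → ℝ}

lemma measurable_normalDot (φ : E → ℝ) (e : E) : Measurable (normalDot φ e) :=
  (measurable_fderiv_apply_const ℝ φ e).div (measurable_fderiv ℝ φ).norm

lemma IsGraphCylinder.setIntegral_graphMap (hg : IsGraphCylinder φ e T a b h) (he : ‖e‖ = 1)
    {g : E → ℝ} (hgc : ContinuousOn g (graphMap e h '' T)) :
    ∫ k in T, g (graphMap e h k) = ∫ y in graphMap e h '' T, g y * normalDot φ e y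
      ∂(Measure.euclideanHausdorffMeasure (Module.finrank ℝ E - 1) : Measure E) := by
  have hZm := hg.measurableSet_graph he
  have hmeas : AEStronglyMeasurable g
      (Measure.map (graphMap e h) (volume.restrict T)) := by
    rw [hg.map_graphMap he]
    exact (hgc.aestronglyMeasurable hZm).mono_ac (withDensity_absolutelyContinuous _ _)
  rw [← integral_map hg.aemeasurable_graphMap hmeas, hg.map_graphMap he,
    integral_withDensity_eq_integral_toReal_smul₀
      (measurable_normalDot φ e).ennreal_ofReal.aemeasurable
      (Filter.Eventually.of_forall fun _ => ENNReal.ofReal_lt_top)]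
  refine setIntegral_congr_fun hZm ?_
  rintro _ ⟨k, hk, rfl⟩
  have h1 : 0 ≤ normalDot φ e (graphMap e h k) :=
    div_nonneg (hg.fderiv_pos k hk _ (hg.mem_Ioo k hk)).le (norm_nonneg _)
  simp [ENNReal.toReal_ofReal h1, mul_comm]

/-- Fubini's theorem along the lines in the direction `e`, and the fundamental theorem of calculus
on each of them. -/
lemma IsGraphCylinder.setIntegral_fderiv (hg : IsGraphCylinder φ e T a b h) (he : ‖e‖ = 1)
    {V F : Set E} (hV : IsOpen V)
    (hVφ : V ∩ lineChart e '' (T ×ˢ Set.Ioo a b) =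
      {y ∈ lineChart e '' (T ×ˢ Set.Ioo a b) | φ y < 0})
    (hF : IsClosed F) (hFC : F ⊆ lineChart e '' (T ×ˢ Set.Ioo a b))
    {g : E → ℝ} (hsupp : ∀ y ∉ F, g y = 0)
    (hdiff : ∀ y ∈ V ∩ lineChart e '' (T ×ˢ Set.Ioo a b), DifferentiableAt ℝ g y)
    (hcont : ContinuousOn g {y ∈ lineChart e '' (T ×ˢ Set.Ioo a b) | φ y ≤ 0})
    {M : ℝ} (hM : ∀ y ∈ V ∩ lineChart e '' (T ×ˢ Set.Ioo a b), ‖fderiv ℝ g y‖ ≤ M) :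
    ∫ y in V ∩ lineChart e '' (T ×ˢ Set.Ioo a b), fderiv ℝ g y e =
      ∫ y in graphMap e h '' T, g y * normalDot φ e y
        ∂(Measure.euclideanHausdorffMeasure (Module.finrank ℝ E - 1) : Measure E) := by
  set C := lineChart e '' (T ×ˢ Set.Ioo a b) with hC
  have hCo : IsOpen C := isOpenMap_lineChart he _ (hg.isOpen.prod isOpen_Ioo)
  have hmem : ∀ k s, lineChart e (k, s) ∈ C ↔ k ∈ T ∧ s ∈ Set.Ioo a b := by
    intro k s
    rw [hC, (lineChart_injective he).mem_set_image]
    rfl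
  have hle : ∀ k ∈ T, ∀ s ∈ Set.Ioc a (h k), lineChart e (k, s) ∈ {y ∈ C | φ y ≤ 0} := by
    intro k hk s hs
    have hs' : s ∈ Set.Ioo a b := ⟨hs.1, hs.2.trans_lt (hg.mem_Ioo k hk).2⟩
    refine ⟨(hmem k s).2 ⟨hk, hs'⟩, ?_⟩
    rcases hs.2.lt_or_eq with h1 | h1
    · exact ((hg.neg_iff k hk s hs').2 h1).le
    · exact ((hg.zero_iff k hk s hs').2 h1).le
  have hmemV : ∀ k ∈ T, ∀ s ∈ Set.Ioo a (h k), lineChart e (k, s) ∈ V ∩ C := by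
    intro k hk s hs
    have hs' : s ∈ Set.Ioo a b := ⟨hs.1, hs.2.trans (hg.mem_Ioo k hk).2⟩
    rw [hVφ]
    exact ⟨(hmem k s).2 ⟨hk, hs'⟩, (hg.neg_iff k hk s hs').2 hs.2⟩
  -- in the chart the domain is the region below the graph of `h`
  have hpre : lineChart e ⁻¹' (V ∩ C) = regionBetween (fun _ => a) h T := by
    rw [hVφ]
    ext ⟨k, s⟩
    simp only [Set.mem_preimage, Set.mem_ofPred_eq, hmem, regionBetween]
    constructor
    · rintro ⟨⟨h1, h2⟩, h3⟩
      exact ⟨h1, h2.1, (hg.neg_iff k h1 s h2).1 h3⟩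
    · rintro ⟨h1, h2⟩
      have h3 : s ∈ Set.Ioo a b := ⟨h2.1, h2.2.trans (hg.mem_Ioo k h1).2⟩
      exact ⟨⟨h1, h3⟩, (hg.neg_iff k h1 s h3).2 h2.2⟩
  have hVCm : MeasurableSet (V ∩ C) := (hV.inter hCo).measurableSet
  have hRm : MeasurableSet (regionBetween (fun _ => a) h T) := by
    rw [← hpre]; exact (continuous_lineChart e).measurable hVCm
  rw [← (measurePreserving_lineChart he).setIntegral_preimage_emb
    (measurableEmbedding_lineChart he), hpre]
  set G : (ℝ ∙ e)ᗮ × ℝ → ℝ := fun x => fderiv ℝ g (lineChart e x) e with hG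
  have hGm : Measurable G :=
    (measurable_fderiv_apply_const ℝ g e).comp (continuous_lineChart e).measurable
  have hGb : ∀ x ∈ regionBetween (fun _ => a) h T, ‖G x‖ ≤ M := by
    intro x hx
    rw [← hpre] at hx
    refine ((fderiv ℝ g (lineChart e x)).le_opNorm e).trans ?_
    rw [he, mul_one]
    exact hM _ hx
  have hvolR : volume (regionBetween (fun _ => a) h T) < ⊤ := by
    have h1 : regionBetween (fun _ => a) h T ⊆ T ×ˢ Set.Ioo a b := fun x hx =>
      ⟨hx.1, hx.2.1, hx.2.2.trans (hg.mem_Ioo _ hx.1).2⟩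
    refine (measure_mono h1).trans_lt ?_
    rw [Measure.volume_eq_prod, Measure.prod_prod]
    exact ENNReal.mul_lt_top hg.volume_lt_top (by simp)
  have hGint : IntegrableOn G (regionBetween (fun _ => a) h T) :=
    IntegrableOn.of_bound hvolR hGm.aestronglyMeasurable M
      ((ae_restrict_iff' hRm).2 (Filter.Eventually.of_forall hGb))
  rw [← integral_indicator hRm, Measure.volume_eq_prod, integral_prod _ (by
    rw [← Measure.volume_eq_prod]; exact hGint.integrable_indicator hRm)]
  have hline : ∀ k, ∫ s, (regionBetween (fun _ => a) h T).indicator G (k, s) =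
      T.indicator (fun k => g (graphMap e h k)) k := by
    intro k
    by_cases hk : k ∈ T
    · rw [Set.indicator_of_mem hk]
      have h1 : (fun s => (regionBetween (fun _ => a) h T).indicator G (k, s)) =
          (Set.Ioo a (h k)).indicator (fun s => G (k, s)) := by
        ext s
        by_cases hs : s ∈ Set.Ioo a (h k)
        · rw [Set.indicator_of_mem hs, Set.indicator_of_mem
              (show (k, s) ∈ regionBetween (fun _ => a) h T from ⟨hk, hs⟩)]
        · rw [Set.indicator_of_notMem hs, Set.indicator_of_notMem fun hc => hs hc.2]
      have hak := (hg.mem_Ioo k hk).1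
      rw [h1, integral_indicator measurableSet_Ioo, ← integral_Ioc_eq_integral_Ioo,
        ← intervalIntegral.integral_of_le hak.le]
      -- `g` vanishes near the lower end of the line, only the end on the graph contributes
      have haF : lineChart e (k, a) ∉ F := fun hc =>
        lt_irrefl a ((hmem k a).1 (hFC hc)).2.1
      have hline_c : Continuous fun s => lineChart e (k, s) :=
        (continuous_lineChart e).comp (by fun_prop)
      have h2 : ContinuousOn (fun s => g (lineChart e (k, s))) (Set.Icc a (h k)) := by
        intro s hs
        rcases hs.1.eq_or_lt with rfl | has
        · have h3 : ∀ᶠ s in nhds a, lineChart e (k, s) ∈ Fᶜ :=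
            hline_c.continuousAt.eventually (hF.isOpen_compl.mem_nhds haF)
          have h4 : (fun s => g (lineChart e (k, s))) =ᶠ[nhds a] fun _ => 0 :=
            h3.mono fun s hs => hsupp _ hs
          exact (continuousAt_const.congr h4.symm).continuousWithinAt
        · have h3 : s ∈ Set.Ioc a (h k) := ⟨has, hs.2⟩
          have h4 : ContinuousWithinAt (fun s => g (lineChart e (k, s))) (Set.Ioc a (h k)) s :=
            (hcont _ (hle k hk s h3)).comp (f := fun s => lineChart e (k, s))
              hline_c.continuousWithinAt (fun s hs => hle k hk s hs)
          refine h4.mono_of_mem_nhdsWithin ?_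
          have h5 : Set.Ioi a ∈ nhds s := Ioi_mem_nhds has
          filter_upwards [mem_nhdsWithin_of_mem_nhds h5, self_mem_nhdsWithin] with s' h6 h7
          exact ⟨h6, h7.2⟩
      have h3 : ∀ s ∈ Set.Ioo a (h k), HasDerivAt (fun s => g (lineChart e (k, s))) (G (k, s)) s :=
        fun s hs => ((hdiff _ (hmemV k hk s hs)).hasFDerivAt).comp_hasDerivAt s
          (hasDerivAt_lineChart e k s)
      have h4 : IntervalIntegrable (fun s => G (k, s)) volume a (h k) := by
        rw [intervalIntegrable_iff_integrableOn_Ioo_of_le hak.le]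
        refine IntegrableOn.of_bound (by simp)
          (hGm.comp (measurable_const.prodMk measurable_id)).aestronglyMeasurable M ?_
        exact (ae_restrict_iff' measurableSet_Ioo).2 (Filter.Eventually.of_forall
          fun s hs => hGb (k, s) ⟨hk, hs⟩)
      rw [intervalIntegral.integral_eq_sub_of_hasDerivAt_of_le hak.le h2 h3 h4, hsupp _ haF,
        sub_zero]
      rfl
    · rw [Set.indicator_of_notMem hk]
      have h1 : (fun s => (regionBetween (fun _ => a) h T).indicator G (k, s)) = fun _ => 0 := by
        ext s
        exact Set.indicator_of_notMem (fun hc => hk hc.1) _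
      rw [h1, integral_zero]
  refine (integral_congr_ae (Filter.Eventually.of_forall hline)).trans ?_
  rw [integral_indicator hg.isOpen.measurableSet]
  refine hg.setIntegral_graphMap he (hcont.mono ?_)
  rintro _ ⟨k, hk, rfl⟩
  exact hle k hk _ ⟨(hg.mem_Ioo k hk).1, le_rfl⟩

end LocalDivergence

/-! ### The divergence theorem near a boundary point -/

section LocalDivergenceTheorem

variable {E : Type*} [NormedAddCommGroup E] [InnerProductSpace ℝ E] [FiniteDimensional ℝ E]
  [MeasurableSpace E] [BorelSpace E]

/-- Finitely many unit vectors on which `L` is positive and which determine linear forms. -/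
lemma exists_finite_transversal {L : E →L[ℝ] ℝ} (hL : L ≠ 0) :
    ∃ v : Option (Fin (Module.finrank ℝ E)) → E, (∀ i, ‖v i‖ = 1 ∧ 0 < L (v i)) ∧
      ∀ A : E →L[ℝ] ℝ, (∀ i, A (v i) = 0) → A = 0 := by
  set n := (InnerProductSpace.toDual ℝ E).symm L with hn
  have hLn : ∀ y, L y = ⟪n, y⟫ := fun y => by rw [hn, InnerProductSpace.toDual_symm_apply]
  have hn0 : n ≠ 0 := by
    intro h0
    exact hL (by ext y; simp [hLn, h0])
  have hnn : 0 < ‖n‖ := norm_pos_iff.2 hn0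
  set b := stdOrthonormalBasis ℝ E
  -- the unit normal `n / ‖n‖`, and its perturbations by half of each vector of an orthonormal basis
  set u : Option (Fin (Module.finrank ℝ E)) → E := fun i =>
    i.elim (‖n‖⁻¹ • n) (fun i => ‖n‖⁻¹ • n + (1 / 2 : ℝ) • b i) with hu
  have hLu : ∀ i, 0 < L (u i) := by
    have h1 : L (‖n‖⁻¹ • n) = ‖n‖ := by
      rw [hLn, inner_smul_right, real_inner_self_eq_norm_sq]; field_simp
    rintro (_ | i)
    · simpa [hu, h1] using hnn
    · have h2 : |⟪n, b i⟫| ≤ ‖n‖ * 1 := by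
        simpa using abs_real_inner_le_norm n (b i)
      have h3 : L (u (some i)) = ‖n‖ + (1 / 2) * ⟪n, b i⟫ := by
        simp only [hu, Option.elim_some, map_add, h1, map_smul, smul_eq_mul, hLn (b i)]
      rw [h3]
      linarith [(abs_le.1 h2).1]
  have hu0 : ∀ i, 0 < ‖u i‖ := fun i => norm_pos_iff.2 fun h0 => by
    have := hLu i; rw [h0, map_zero] at this; exact lt_irrefl _ this
  refine ⟨fun i => ‖u i‖⁻¹ • u i, fun i => ⟨?_, ?_⟩, fun A hA => ?_⟩
  · rw [norm_smul, norm_inv, norm_norm, inv_mul_cancel₀ (hu0 i).ne']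
  · rw [map_smul, smul_eq_mul]
    exact mul_pos (inv_pos.2 (hu0 i)) (hLu i)
  · have hAu : ∀ i, A (u i) = 0 := fun i => by
      have := hA i
      rw [map_smul, smul_eq_mul] at this
      exact (mul_eq_zero.1 this).resolve_left (inv_pos.2 (hu0 i)).ne'
    have hAb : ∀ i, A (b i) = 0 := fun i => by
      have h1 := hAu none
      have h2 := hAu (some i)
      simp only [hu, Option.elim_none, Option.elim_some, map_add] at h1 h2
      rw [h1, map_smul, smul_eq_mul] at h2
      linarith
    exact ContinuousLinearMap.coe_injective (b.toBasis.ext fun i => by simpa using hAb i)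

/-- The divergence theorem for functions supported near a boundary point at which the domain is
`{φ < 0}`. It holds in finitely many transversal directions that span, hence in all directions `w`.
The lemma also records that the boundary has finite area near `q` and that translations in a
transversal direction map the closed domain into the domain. -/
theorem exists_local_divergence {V W : Set E} {φ : E → ℝ} {q : E} (hV : IsOpen V) (hW : IsOpen W)
    (hφ : ContDiffOn ℝ 1 φ W) (hq : q ∈ W) (h0 : φ q = 0) (hd : fderiv ℝ φ q ≠ 0)
    (hVφ : V ∩ W = {y ∈ W | φ y < 0}) :
    ∃ ρ > 0, Metric.ball q ρ ⊆ W ∧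
      (Measure.euclideanHausdorffMeasure (Module.finrank ℝ E - 1) : Measure E)
        {y ∈ Metric.ball q ρ | φ y = 0} < ⊤ ∧
      (∃ e : E, 0 < fderiv ℝ φ q e ∧ ∀ y ∈ Metric.ball q ρ, ∀ s : ℝ, 0 < s → φ y ≤ 0 →
        y - s • e ∈ Metric.ball q ρ → φ (y - s • e) < 0) ∧
      ∀ ρ₀ < ρ, ∀ g : E → ℝ, (∀ y, ρ₀ < dist y q → g y = 0) →
        (∀ y ∈ V ∩ Metric.ball q ρ, DifferentiableAt ℝ g y) →
        ContinuousOn g {y ∈ Metric.ball q ρ | φ y ≤ 0} →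
        (∃ M, ∀ y ∈ V ∩ Metric.ball q ρ, ‖fderiv ℝ g y‖ ≤ M) →
        ∀ w, IntegrableOn (fun y => fderiv ℝ g y w) V ∧
          IntegrableOn (fun y => g y * normalDot φ w y) {y ∈ Metric.ball q ρ | φ y = 0}
            (Measure.euclideanHausdorffMeasure (Module.finrank ℝ E - 1) : Measure E) ∧
          ∫ y in V, fderiv ℝ g y w = ∫ y in {y ∈ Metric.ball q ρ | φ y = 0},
          g y * normalDot φ w y
            ∂(Measure.euclideanHausdorffMeasure (Module.finrank ℝ E - 1) : Measure E) := by
  set H : Measure E := Measure.euclideanHausdorffMeasure (Module.finrank ℝ E - 1) with hH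
  obtain ⟨v, hv, hvA⟩ := exists_finite_transversal hd
  choose T a b h hg hqC hCW using fun i =>
    exists_isGraphCylinder hW hφ hq h0 (hv i).1 (hv i).2
  set C : Option (Fin (Module.finrank ℝ E)) → Set E :=
    fun i => lineChart (v i) '' (T i ×ˢ Set.Ioo (a i) (b i)) with hC
  have hCo : ∀ i, IsOpen (C i) := fun i =>
    isOpenMap_lineChart (hv i).1 _ ((hg i).isOpen.prod isOpen_Ioo)
  -- on a small ball, the conormal is bounded below in one of the directions
  have hnc : ContinuousAt (normalDot φ (v none)) q := by
    have h1 : ContinuousAt (fderiv ℝ φ) q :=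
      (hφ.contDiffAt (hW.mem_nhds hq)).continuousAt_fderiv one_ne_zero
    exact (h1.clm_apply continuousAt_const).div h1.norm (norm_ne_zero_iff.2 hd)
  set c := normalDot φ (v none) q / 2 with hc
  have hc0 : 0 < c := half_pos (div_pos (hv none).2 (norm_pos_iff.2 hd))
  have hnear : ∀ᶠ y in nhds q, y ∈ ⋂ i, C i ∧ c < normalDot φ (v none) y :=
    (Filter.Eventually.and ((isOpen_iInter_of_finite hCo).mem_nhds (Set.mem_iInter.2 hqC))
      (hnc.eventually_const_lt (half_lt_self (div_pos (hv none).2 (norm_pos_iff.2 hd)))))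
  obtain ⟨ρ, hρ, hball⟩ := Metric.eventually_nhds_iff_ball.1 hnear
  have hbC : ∀ i, Metric.ball q ρ ⊆ C i := fun i y hy => Set.mem_iInter.1 (hball y hy).1 i
  have hbW : Metric.ball q ρ ⊆ W := (hbC none).trans (hCW none)
  have hZsub : ∀ i, {y ∈ Metric.ball q ρ | φ y = 0} ⊆ graphMap (v i) (h i) '' T i := by
    rintro i y ⟨hy, hy0⟩
    obtain ⟨⟨k, s⟩, ⟨hk, hs⟩, rfl⟩ := hbC i hy
    refine ⟨k, hk, ?_⟩
    rw [((hg i).zero_iff k hk s hs).1 hy0]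
    rfl
  have hZm : MeasurableSet {y ∈ Metric.ball q ρ | φ y = 0} := by
    have : {y ∈ Metric.ball q ρ | φ y = 0} =
        Metric.ball q ρ ∩ graphMap (v none) (h none) '' T none := by
      refine subset_antisymm (fun y hy => ⟨hy.1, hZsub none hy⟩) ?_
      rintro _ ⟨hy, k, hk, rfl⟩
      exact ⟨hy, ((hg none).zero_iff k hk _ ((hg none).mem_Ioo k hk)).2 rfl⟩
    rw [this]
    exact Metric.isOpen_ball.measurableSet.inter ((hg none).measurableSet_graph (hv none).1)
  -- the area is at most `c⁻¹` times the measure of the base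
  have hfin : H {y ∈ Metric.ball q ρ | φ y = 0} < ⊤ := by
    set Z := {y ∈ Metric.ball q ρ | φ y = 0}
    have h1 : ENNReal.ofReal c * H Z ≤ ∫⁻ y in Z, ENNReal.ofReal (normalDot φ (v none) y) ∂H := by
      rw [← setLIntegral_const]
      exact setLIntegral_mono' hZm fun y hy => ENNReal.ofReal_le_ofReal (hball y hy.1).2.le
    have h2 : ∫⁻ y in Z, ENNReal.ofReal (normalDot φ (v none) y) ∂H ≤ volume (T none) := by
      have h3 := congrArg (fun μ => μ Z) ((hg none).map_graphMap (hv none).1)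
      rw [withDensity_apply _ hZm, Measure.restrict_restrict hZm,
        Set.inter_eq_left.2 (hZsub none)] at h3
      rw [← h3, Measure.map_apply_of_aemeasurable (hg none).aemeasurable_graphMap hZm]
      exact (measure_mono (Set.subset_univ _)).trans (by simp)
    have h4 := (h1.trans h2).trans_lt (hg none).volume_lt_top
    by_contra hcon
    rw [not_lt, top_le_iff] at hcon
    rw [hcon, ENNReal.mul_top (by simpa using hc0)] at h4
    exact lt_irrefl _ h4
  refine ⟨ρ, hρ, hbW, hfin, ⟨v none, (hv none).2, ?_⟩, ?_⟩
  · intro y hy s hs hφy hys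
    obtain ⟨⟨k, s₁⟩, ⟨hk, hs₁⟩, rfl⟩ := hbC none hy
    have h1 : lineChart (v none) (k, s₁) - s • v none = lineChart (v none) (k, s₁ - s) := by
      simp only [lineChart, sub_smul]; abel
    rw [h1] at hys ⊢
    have h2 : s₁ - s ∈ Set.Ioo (a none) (b none) := by
      have := hbC none hys
      rw [hC, (lineChart_injective (hv none).1).mem_set_image] at this
      exact this.2
    rw [(hg none).neg_iff k hk _ h2]
    have h3 : s₁ ≤ h none k := by
      rcases hφy.lt_or_eq with h4 | h4
      · exact (((hg none).neg_iff k hk s₁ hs₁).1 h4).le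
      · exact (((hg none).zero_iff k hk s₁ hs₁).1 h4).le
    linarith
  intro ρ₀ hρ₀ g hsupp hdiff hcont ⟨M, hM⟩
  have hloc0 : ∀ y, ρ₀ < dist y q → g =ᶠ[nhds y] fun _ => 0 := by
    intro y hy
    filter_upwards [(isOpen_lt continuous_const (continuous_id.dist continuous_const)).mem_nhds hy]
      with z hz using hsupp z hz
  have hfd0 : ∀ y, ρ₀ < dist y q → fderiv ℝ g y = 0 := by
    intro y hy
    rw [(hloc0 y hy).fderiv_eq]
    simp
  have hMi : ∀ y ∈ V, ‖fderiv ℝ g y‖ ≤ max M 0 := by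
    intro y hy
    by_cases hyb : y ∈ Metric.ball q ρ
    · exact (hM y ⟨hy, hyb⟩).trans (le_max_left _ _)
    · rw [hfd0 y (hρ₀.trans_le (not_lt.1 hyb))]
      simp
  have hcl : ∀ y, y ∉ Metric.closedBall q ρ₀ → ρ₀ < dist y q := fun y hy => not_le.1 hy
  have hcb : Metric.closedBall q ρ₀ ⊆ Metric.ball q ρ := Metric.closedBall_subset_ball hρ₀
  have hfi : IntegrableOn (fderiv ℝ g) V := by
    have h1 : IntegrableOn (fderiv ℝ g) (V ∩ Metric.closedBall q ρ₀) :=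
      IntegrableOn.of_bound ((measure_mono Set.inter_subset_right).trans_lt measure_closedBall_lt_top)
        (measurable_fderiv ℝ g).aestronglyMeasurable (max M 0)
        ((ae_restrict_iff' (hV.measurableSet.inter measurableSet_closedBall)).2
          (Filter.Eventually.of_forall fun y hy => hMi y hy.1))
    refine IntegrableOn.of_forall_sdiff_eq_zero (s := V ∩ Metric.closedBall q ρ₀)
      (f := fderiv ℝ g) (μ := volume) h1 hV.measurableSet fun y hy => ?_
    exact hfd0 y (hcl y fun hc => hy.2 ⟨hy.1, hc⟩)
  -- the surface integrand, as a function with values in the dual space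
  set K : E → (E →L[ℝ] ℝ) := fun y => (g y / ‖fderiv ℝ φ y‖) • fderiv ℝ φ y with hK
  set Z := {y ∈ Metric.ball q ρ | φ y = 0} with hZ
  have hgZ : ContinuousOn g Z := hcont.mono fun y hy => ⟨hy.1, hy.2.le⟩
  have hgb : ∃ M', ∀ y ∈ Z, ‖g y‖ ≤ M' := by
    have hcomp : IsCompact {y ∈ Metric.closedBall q ρ₀ | φ y ≤ 0} := by
      have h2 : IsClosed {y ∈ Metric.closedBall q ρ₀ | φ y ≤ 0} :=
        (hφ.continuousOn.mono (hcb.trans hbW)).preimage_isClosed_of_isClosed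
          Metric.isClosed_closedBall isClosed_Iic
      exact (isCompact_closedBall q ρ₀).of_isClosed_subset h2 fun y hy => hy.1
    obtain ⟨M', hM'⟩ := hcomp.exists_bound_of_continuousOn
      (hcont.mono fun y hy => ⟨hcb hy.1, hy.2⟩)
    refine ⟨max M' 0, fun y hy => ?_⟩
    by_cases hyb : y ∈ Metric.closedBall q ρ₀
    · exact (hM' y ⟨hyb, hy.2.le⟩).trans (le_max_left _ _)
    · rw [hsupp y (hcl y hyb)]; simp
  have hKi : IntegrableOn K Z H := by
    obtain ⟨M', hM'⟩ := hgb
    refine IntegrableOn.of_bound hfin ?_ M' ?_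
    · have h1 := (hgZ.aestronglyMeasurable (μ := H) hZm)
      have h2 : AEStronglyMeasurable (fun y => ‖fderiv ℝ φ y‖⁻¹) (H.restrict Z) :=
        (measurable_fderiv ℝ φ).norm.inv.aestronglyMeasurable
      have h3 : AEStronglyMeasurable (fderiv ℝ φ) (H.restrict Z) :=
        (measurable_fderiv ℝ φ).aestronglyMeasurable
      refine ((h1.mul h2).smul h3).congr (Filter.Eventually.of_forall fun y => ?_)
      simp [hK, div_eq_mul_inv]
    · refine (ae_restrict_iff' hZm).2 (Filter.Eventually.of_forall fun y hy => ?_)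
      rw [hK]
      simp only [norm_smul, norm_div, norm_norm]
      refine le_trans ?_ (hM' y hy)
      rcases eq_or_ne ‖fderiv ℝ φ y‖ 0 with h1 | h1
      · rw [h1]; simp
      · rw [div_mul_cancel₀ _ h1]
  have hKw : ∀ w y, K y w = g y * normalDot φ w y := by
    intro w y
    simp only [hK, normalDot, _root_.smul_apply, smul_eq_mul]
    ring
  -- the two sides, as linear forms in `w`, agree in the transversal directions
  have hmain : (∫ y in V, fderiv ℝ g y) - ∫ y in Z, K y ∂H = 0 := by
    refine hvA _ fun i => ?_
    rw [_root_.sub_apply, ContinuousLinearMap.integral_apply hfi,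
      ContinuousLinearMap.integral_apply hKi, sub_eq_zero]
    have h1 := (hg i).setIntegral_fderiv (hv i).1 (V := V) (F := Metric.closedBall q ρ₀) (g := g)
      (M := max M 0) hV (by
        ext y
        constructor
        · rintro ⟨h1, h2⟩
          have h3 : y ∈ V ∩ W := ⟨h1, hCW i h2⟩
          rw [hVφ] at h3
          exact ⟨h2, h3.2⟩
        · rintro ⟨h1, h2⟩
          have h3 : y ∈ {y ∈ W | φ y < 0} := ⟨hCW i h1, h2⟩
          rw [← hVφ] at h3
          exact ⟨h3.1, h1⟩) Metric.isClosed_closedBall (hcb.trans (hbC i))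
      (fun y hy => hsupp y (hcl y hy)) (fun y hy => ?_) (fun y hy => ?_)
      (fun y hy => hMi y hy.1)
    · calc ∫ y in V, fderiv ℝ g y (v i) = ∫ y in V ∩ C i, fderiv ℝ g y (v i) := by
            apply setIntegral_eq_of_subset_of_forall_sdiff_eq_zero hV.measurableSet
              Set.inter_subset_left
            intro y hy
            rw [hfd0 y (hcl y fun hc => hy.2 ⟨hy.1, hbC i (hcb hc)⟩)]
            rfl
        _ = _ := h1
        _ = ∫ y in Z, K y (v i) ∂H := by
            simp_rw [hKw]
            refine setIntegral_eq_of_subset_of_forall_sdiff_eq_zero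
              ((hg i).measurableSet_graph (hv i).1) (hZsub i) fun y hy => ?_
            rw [hsupp y (hcl y fun hc => hy.2 ⟨hcb hc, ?_⟩), zero_mul]
            obtain ⟨k, hk, rfl⟩ := hy.1
            exact ((hg i).zero_iff k hk _ ((hg i).mem_Ioo k hk)).2 rfl
    · by_cases hyb : y ∈ Metric.ball q ρ
      · exact hdiff y ⟨hy.1, hyb⟩
      · exact (hloc0 y (hρ₀.trans_le (not_lt.1 hyb))).differentiableAt_iff.2
          (differentiableAt_const _)
    · by_cases hyb : y ∈ Metric.ball q ρ
      · refine (hcont y ⟨hyb, hy.2⟩).mono_of_mem_nhdsWithin ?_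
        filter_upwards [mem_nhdsWithin_of_mem_nhds (Metric.isOpen_ball.mem_nhds hyb),
          self_mem_nhdsWithin] with z hz1 hz2
        exact ⟨hz1, hz2.2⟩
      · exact (continuousAt_const.congr
          (hloc0 y (hρ₀.trans_le (not_lt.1 hyb))).symm).continuousWithinAt
  intro w
  have h2 := congrArg (fun A => A w) (sub_eq_zero.1 hmain)
  rw [ContinuousLinearMap.integral_apply hfi, ContinuousLinearMap.integral_apply hKi] at h2
  refine ⟨hfi.apply_continuousLinearMap w, ?_, ?_⟩
  · exact (hKi.apply_continuousLinearMap w).congr (Filter.Eventually.of_forall fun y => hKw w y)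
  · rw [h2]
    exact integral_congr_ae (Filter.Eventually.of_forall fun y => hKw w y)

end LocalDivergenceTheorem

/-! ### Local defining functions and the outer conormal -/

section Conormal

variable {m n : ℕ} {V W W' : Set (Spacetime m n)} {φ φ' : Spacetime m n → ℝ} {q : Spacetime m n}

lemma finrank_spacetime : Module.finrank ℝ (Spacetime m n) = m + n := by
  simp [Spacetime]

lemma IsLocalDefiningFunction.differentiableAt {k : WithTop ℕ∞} (hk : 1 ≤ k)
    (h : IsLocalDefiningFunction k V W φ) (hq : q ∈ W) : DifferentiableAt ℝ φ q :=
  (h.contDiffOn.differentiableOn (by rintro rfl; simp at hk)).differentiableAt (h.isOpen.mem_nhds hq)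

lemma IsLocalDefiningFunction.of_le {k k' : WithTop ℕ∞} (hk : k' ≤ k)
    (h : IsLocalDefiningFunction k V W φ) : IsLocalDefiningFunction k' V W φ :=
  ⟨h.isOpen, h.contDiffOn.of_le hk, h.fderiv_ne_zero, h.inter_eq⟩

lemma IsLocalDefiningFunction.inter_isOpen {k : WithTop ℕ∞}
    (h : IsLocalDefiningFunction k V W φ) (hW' : IsOpen W') :
    IsLocalDefiningFunction k V (W ∩ W') φ := by
  refine ⟨h.isOpen.inter hW', h.contDiffOn.mono Set.inter_subset_left,
    fun q hq => h.fderiv_ne_zero q hq.1, ?_⟩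
  rw [← Set.inter_assoc, h.inter_eq]
  ext y
  constructor
  · rintro ⟨⟨h1, h2⟩, h3⟩; exact ⟨⟨h1, h3⟩, h2⟩
  · rintro ⟨⟨h1, h3⟩, h2⟩; exact ⟨⟨h1, h2⟩, h3⟩

lemma eventually_neg_of_fderiv_neg {q Y : Spacetime m n} (hd : DifferentiableAt ℝ φ q)
    (h0 : φ q ≤ 0) (hY : fderiv ℝ φ q Y < 0) :
    ∀ᶠ s in nhdsWithin (0 : ℝ) (Set.Ioi 0), φ (q + s • Y) < 0 := by
  have h1 : HasDerivAt (fun s : ℝ => φ (q + s • Y)) (fderiv ℝ φ q Y) 0 := by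
    have h2 : HasDerivAt (fun s : ℝ => q + s • Y) Y 0 := by
      simpa using ((hasDerivAt_id (0 : ℝ)).smul_const Y).const_add q
    have h3 : HasFDerivAt φ (fderiv ℝ φ q) (q + (0 : ℝ) • Y) := by simpa using hd.hasFDerivAt
    exact h3.comp_hasDerivAt (0 : ℝ) h2
  have h4 := (hasDerivAt_iff_tendsto_slope.1 h1).mono_left
    (nhdsWithin_mono 0 (fun s (hs : s ∈ Set.Ioi (0 : ℝ)) => (ne_of_gt hs : s ≠ 0)))
  filter_upwards [h4.eventually_lt_const hY, self_mem_nhdsWithin] with s hs hs0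
  rw [slope_def_field] at hs
  simp only [zero_smul, add_zero, sub_zero] at hs
  have hs0' : (0 : ℝ) < s := hs0
  rw [div_lt_iff₀ hs0', zero_mul] at hs
  linarith

lemma tendsto_add_smul_nhdsGT (q Y : Spacetime m n) :
    Filter.Tendsto (fun s : ℝ => q + s • Y) (nhdsWithin 0 (Set.Ioi 0)) (nhds q) := by
  have h1 : Continuous fun s : ℝ => q + s • Y := by fun_prop
  simpa using (h1.tendsto 0).mono_left (nhdsWithin_le_nhds (s := Set.Ioi (0 : ℝ)))

lemma exists_fderiv_neg {q : Spacetime m n} (h : fderiv ℝ φ q ≠ 0) :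
    ∃ Y, fderiv ℝ φ q Y < 0 := by
  by_contra! hcon
  refine h (ContinuousLinearMap.ext fun Y => le_antisymm ?_ (hcon Y))
  have := hcon (-Y)
  rw [map_neg] at this
  simpa using this

/-- The closure of a domain near a boundary point. -/
lemma IsLocalDefiningFunction.mem_closure (h : IsLocalDefiningFunction 1 V W φ) (hq : q ∈ W)
    (h0 : φ q ≤ 0) : q ∈ closure V := by
  obtain ⟨Y, hY⟩ := exists_fderiv_neg (h.fderiv_ne_zero q hq)
  refine mem_closure_of_tendsto (tendsto_add_smul_nhdsGT q Y) ?_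
  filter_upwards [eventually_neg_of_fderiv_neg (h.differentiableAt le_rfl hq) h0 hY,
    (tendsto_add_smul_nhdsGT q Y).eventually (h.isOpen.mem_nhds hq)] with s h1 h2
  have : q + s • Y ∈ V ∩ W := by rw [h.inter_eq]; exact ⟨h2, h1⟩
  exact this.1

lemma IsLocalDefiningFunction.nonpos_of_mem_closure {k : WithTop ℕ∞}
    (h : IsLocalDefiningFunction k V W φ) (hq : q ∈ W) (hc : q ∈ closure V) : φ q ≤ 0 := by
  by_contra hcon
  rw [not_le] at hcon
  have h1 : IsOpen (W ∩ φ ⁻¹' Set.Ioi 0) :=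
    h.contDiffOn.continuousOn.isOpen_inter_preimage h.isOpen isOpen_Ioi
  obtain ⟨y, ⟨hyW, hy⟩, hyV⟩ := mem_closure_iff.1 hc _ h1 ⟨hq, hcon⟩
  have : y ∈ V ∩ W := ⟨hyV, hyW⟩
  rw [h.inter_eq] at this
  exact lt_asymm hy this.2

lemma IsLocalDefiningFunction.mem_frontier_iff (h : IsLocalDefiningFunction 1 V W φ)
    (hV : IsOpen V) (hq : q ∈ W) : q ∈ frontier V ↔ φ q = 0 := by
  rw [hV.frontier_eq]
  constructor
  · rintro ⟨h1, h2⟩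
    refine le_antisymm (h.nonpos_of_mem_closure hq h1) (not_lt.1 fun h3 => h2 ?_)
    have : q ∈ V ∩ W := by rw [h.inter_eq]; exact ⟨hq, h3⟩
    exact this.1
  · intro h1
    refine ⟨h.mem_closure hq h1.le, fun h2 => ?_⟩
    have : q ∈ V ∩ W := ⟨h2, hq⟩
    rw [h.inter_eq] at this
    exact this.2.ne h1

/-- Two linear forms with nested negative half-spaces are proportional. -/
lemma eq_smul_of_neg_imp_nonpos {L L' : Spacetime m n →L[ℝ] ℝ} (hL : ∃ Y, L Y < 0) (hL' : L' ≠ 0)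
    (h : ∀ Y, L Y < 0 → L' Y ≤ 0) : ∃ c : ℝ, 0 < c ∧ L' = c • L := by
  obtain ⟨Y₀, hY₀⟩ := hL
  -- a linear form that is bounded above on a line in the half space is constant on it
  have hker : ∀ Y, L Y = 0 → L' Y = 0 := by
    intro Y hY
    have h1 : ∀ t : ℝ, L' Y₀ + t * L' Y ≤ 0 := fun t => by
      have := h (Y₀ + t • Y) (by simpa [hY] using hY₀)
      simpa using this
    by_contra hne
    have := h1 ((1 - L' Y₀) / L' Y)
    rw [div_mul_cancel₀ _ hne] at this
    linarith
  have heq : L' = (L' Y₀ / L Y₀) • L := by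
    ext Y
    have h1 := hker (Y - (L Y / L Y₀) • Y₀) (by
      simp only [map_sub, map_smul, smul_eq_mul]
      rw [div_mul_cancel₀ _ hY₀.ne, sub_self])
    simp only [map_sub, map_smul, smul_eq_mul] at h1
    simp only [_root_.smul_apply, smul_eq_mul]
    have h2 := hY₀.ne
    field_simp at h1 ⊢
    linarith
  refine ⟨L' Y₀ / L Y₀, ?_, heq⟩
  refine lt_of_le_of_ne (div_nonneg_of_nonpos (h Y₀ hY₀) hY₀.le) fun h0 => hL' ?_
  rw [heq, ← h0, zero_smul]

/-- The differentials of two local defining functions are positive multiples of each other. -/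
lemma IsLocalDefiningFunction.fderiv_eq_smul (h : IsLocalDefiningFunction 1 V W φ)
    (h' : IsLocalDefiningFunction 1 V W' φ') (hq : q ∈ W) (hq' : q ∈ W') (h0 : φ q = 0)
    (h0' : φ' q = 0) : ∃ c : ℝ, 0 < c ∧ fderiv ℝ φ' q = c • fderiv ℝ φ q := by
  refine eq_smul_of_neg_imp_nonpos (exists_fderiv_neg (h.fderiv_ne_zero q hq))
    (h'.fderiv_ne_zero q hq') fun Y hY => ?_
  by_contra hcon
  rw [not_le] at hcon
  have hY' : fderiv ℝ (fun y => -φ' y) q Y < 0 := by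
    rw [fderiv_fun_neg]; simpa using hcon
  have h1 := eventually_neg_of_fderiv_neg (h.differentiableAt le_rfl hq) h0.le hY
  have h2 := eventually_neg_of_fderiv_neg (φ := fun y => -φ' y)
    (h'.differentiableAt le_rfl hq').neg (by simp [h0']) hY'
  have h3 := (tendsto_add_smul_nhdsGT q Y).eventually
    ((h.isOpen.inter h'.isOpen).mem_nhds ⟨hq, hq'⟩)
  obtain ⟨s, h4, h5, h6⟩ := (h1.and (h2.and h3)).exists
  have h7 : q + s • Y ∈ V ∩ W := by rw [h.inter_eq]; exact ⟨h6.1, h4⟩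
  have h8 : q + s • Y ∈ V ∩ W' := ⟨h7.1, h6.2⟩
  rw [h'.inter_eq] at h8
  have := h8.2
  linarith

open Classical in
/-- The Euclidean outer unit conormal of `V` at `q`: the normalized differential of a local
defining function, and `0` where there is none. It does not depend on the defining function, by
`IsLocalDefiningFunction.fderiv_eq_smul`. -/
def outerConormal (V : Set (Spacetime m n)) (q : Spacetime m n) : Spacetime m n →L[ℝ] ℝ :=
  if h : ∃ L, ∃ W φ, q ∈ W ∧ φ q = 0 ∧ IsLocalDefiningFunction 1 V W φ ∧
    L = ‖fderiv ℝ φ q‖⁻¹ • fderiv ℝ φ q then h.choose else 0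

lemma IsLocalDefiningFunction.outerConormal_eq (h : IsLocalDefiningFunction 1 V W φ)
    (hq : q ∈ W) (h0 : φ q = 0) :
    outerConormal V q = ‖fderiv ℝ φ q‖⁻¹ • fderiv ℝ φ q := by
  have hex : ∃ L, ∃ W φ, q ∈ W ∧ φ q = 0 ∧ IsLocalDefiningFunction 1 V W φ ∧
    L = ‖fderiv ℝ φ q‖⁻¹ • fderiv ℝ φ q := ⟨_, W, φ, hq, h0, h, rfl⟩
  rw [outerConormal, dif_pos hex]
  obtain ⟨W', φ', hq', h0', h', heq⟩ := hex.choose_spec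
  rw [heq]
  obtain ⟨c, hc, h1⟩ := h.fderiv_eq_smul h' hq hq' h0 h0'
  rw [h1, norm_smul, Real.norm_of_nonneg hc.le, mul_inv, smul_smul]
  congr 1
  field_simp

lemma IsLocalDefiningFunction.outerConormal_apply (h : IsLocalDefiningFunction 1 V W φ)
    (hq : q ∈ W) (h0 : φ q = 0) (Y : Spacetime m n) :
    outerConormal V q Y = normalDot φ Y q := by
  rw [h.outerConormal_eq hq h0, normalDot, _root_.smul_apply, smul_eq_mul, div_eq_inv_mul]

end Conormal

/-! ### The divergence inequality near a boundary point -/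

section LocalDivergenceInequality

variable {m n : ℕ} {V W : Set (Spacetime m n)} {φ : Spacetime m n → ℝ} {q : Spacetime m n}

/-- The Euclidean divergence of a vector field. -/
def divergence (X : Spacetime m n → Spacetime m n) (p : Spacetime m n) : ℝ :=
  ∑ i, partialD i (fun y => X y i) p

/-- Euclidean surface measure on hypersurfaces of `ℝ^{m+n}`. -/
abbrev surfaceMeasure (m n : ℕ) : Measure (Spacetime m n) :=
  Measure.euclideanHausdorffMeasure (m + n - 1)

lemma sum_smul_coordVec (Y : Spacetime m n) : ∑ i, Y i • coordVec i = Y := by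
  ext j
  simp [coordVec, Pi.single_apply, -Fintype.sum_sum_type]

lemma apply_eq_sum_coordVec (L : Spacetime m n →L[ℝ] ℝ) (Y : Spacetime m n) :
    L Y = ∑ i, Y i * L (coordVec i) := by
  conv_lhs => rw [← sum_smul_coordVec Y]
  simp

lemma IsLocalDefiningFunction.mem_iff {k : WithTop ℕ∞} (h : IsLocalDefiningFunction k V W φ)
    (hq : q ∈ W) : q ∈ V ↔ φ q < 0 := by
  have h1 : q ∈ V ∩ W ↔ q ∈ {q ∈ W | φ q < 0} := by rw [h.inter_eq]
  exact ⟨fun h2 => (h1.1 ⟨h2, hq⟩).2, fun h2 => (h1.2 ⟨hq, h2⟩).1⟩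

lemma norm_outerConormal_le (V : Set (Spacetime m n)) (q : Spacetime m n) :
    ‖outerConormal V q‖ ≤ 1 := by
  classical
  unfold outerConormal
  split_ifs with h
  · obtain ⟨W', φ', -, -, -, heq⟩ := h.choose_spec
    rw [heq, norm_smul, norm_inv, norm_norm]
    exact inv_mul_le_one
  · simp

lemma le_dist_of_notMem_ball {y : Spacetime m n} {ρ : ℝ} (h : y ∉ Metric.ball q ρ) :
    ρ ≤ dist y q := by simpa using h

lemma lt_dist_of_notMem_closedBall {y : Spacetime m n} {ρ : ℝ} (h : y ∉ Metric.closedBall q ρ) :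
    ρ < dist y q := by simpa using h

lemma divergence_comp_sub (Y : Spacetime m n → Spacetime m n) (v y : Spacetime m n) :
    divergence (fun y => Y (y - v)) y = divergence Y (y - v) := by
  simp only [divergence, partialD]
  refine Finset.sum_congr rfl fun i _ => ?_
  rw [fderiv_comp_sub (f := fun y => Y y i)]

lemma divergence_eq_zero_of_eventuallyEq {Y : Spacetime m n → Spacetime m n} {y : Spacetime m n}
    (h : ∀ᶠ z in nhds y, Y z = 0) : divergence Y y = 0 := by
  simp only [divergence, partialD]
  refine Finset.sum_eq_zero fun i _ => ?_
  have : (fun y => Y y i) =ᶠ[nhds y] fun _ => 0 := h.mono fun z hz => by simp [hz]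
  rw [this.fderiv_eq]
  simp

/-- The divergence inequality for fields supported near a boundary point, with a lower bound `ℓ` of
the divergence. The field is translated into the domain, where it is differentiable up to the
boundary, before the translation is made to tend to zero. -/
lemma IsLocalDefiningFunction.exists_local_divergence_le (hV : IsOpen V)
    (h : IsLocalDefiningFunction 1 V W φ) (hq : q ∈ W) (h0 : φ q = 0) :
    ∃ ρ > 0, Metric.ball q ρ ⊆ W ∧ surfaceMeasure m n (frontier V ∩ Metric.ball q ρ) < ⊤ ∧
      ∀ Y : Spacetime m n → Spacetime m n, (∀ y, ρ / 2 < dist y q → Y y = 0) →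
        ContDiffOn ℝ 1 Y (V ∩ Metric.ball q ρ) → ContinuousOn Y (closure V ∩ Metric.ball q ρ) →
        ∀ ℓ : Spacetime m n → ℝ, IntegrableOn ℓ V →
          (∀ y ∈ V ∩ Metric.ball q ρ, ℓ y ≤ divergence Y y) →
          (∀ y ∈ V, y ∉ Metric.ball q ρ → ℓ y = 0) →
          IntegrableOn (fun y => outerConormal V y (Y y)) (frontier V ∩ Metric.ball q ρ)
            (surfaceMeasure m n) ∧
          ∫ y in V, ℓ y ≤ ∫ y in frontier V ∩ Metric.ball q ρ, outerConormal V y (Y y)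
            ∂(surfaceMeasure m n) := by
  obtain ⟨ρ, hρ, hbW, hfin, ⟨e, -, hshift⟩, hloc⟩ := exists_local_divergence hV h.isOpen
    h.contDiffOn hq h0 (h.fderiv_ne_zero q hq) h.inter_eq
  rw [finrank_spacetime] at hfin hloc
  have hZ : {y ∈ Metric.ball q ρ | φ y = 0} = frontier V ∩ Metric.ball q ρ := by
    ext y
    constructor
    · rintro ⟨h1, h2⟩; exact ⟨(h.mem_frontier_iff hV (hbW h1)).2 h2, h1⟩
    · rintro ⟨h2, h1⟩; exact ⟨h1, (h.mem_frontier_iff hV (hbW h1)).1 h2⟩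
  have hZc : {y ∈ Metric.ball q ρ | φ y ≤ 0} = closure V ∩ Metric.ball q ρ := by
    ext y
    constructor
    · rintro ⟨h1, h2⟩; exact ⟨h.mem_closure (hbW h1) h2, h1⟩
    · rintro ⟨h2, h1⟩; exact ⟨h1, h.nonpos_of_mem_closure (hbW h1) h2⟩
  rw [hZ] at hfin hloc
  rw [hZc] at hloc
  set Z := frontier V ∩ Metric.ball q ρ with hZdef
  have hZm : MeasurableSet Z := isClosed_frontier.measurableSet.inter measurableSet_ball
  have hZcl : Z ⊆ closure V ∩ Metric.ball q ρ := fun y hy => ⟨frontier_subset_closure hy.1, hy.2⟩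
  refine ⟨ρ, hρ, hbW, hfin, fun Y hY0 hY hYc ℓ hℓ hdiv hℓ0 => ?_⟩
  -- the boundary integrand for the translated field
  have hshiftV : ∀ y ∈ closure V ∩ Metric.ball q ρ, ∀ s : ℝ, 0 < s →
      y - s • e ∈ Metric.ball q ρ → y - s • e ∈ V ∩ Metric.ball q ρ := fun y hy s hs hys =>
    ⟨(h.mem_iff (hbW hys)).2 (hshift y hy.2 s hs
      (h.nonpos_of_mem_closure (hbW hy.2) hy.1) hys), hys⟩
  have hYnhds : ∀ y, ρ / 2 < dist y q → ∀ᶠ z in nhds y, Y z = 0 := fun y hy => by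
    filter_upwards [(isOpen_lt continuous_const (continuous_id.dist continuous_const)).mem_nhds hy]
      with z hz using hY0 z hz
  have hYd : ∀ y ∈ V ∩ Metric.ball q ρ, ContDiffAt ℝ 1 Y y := fun y hy =>
    hY.contDiffAt ((hV.inter Metric.isOpen_ball).mem_nhds hy)
  set δ₀ : ℝ := ρ / (4 * (‖e‖ + 1)) with hδ₀
  have hδ₀0 : 0 < δ₀ := by positivity
  have hsmall : ∀ s : ℝ, 0 < s → s ≤ δ₀ → ‖s • e‖ ≤ ρ / 4 := by
    intro s hs hsδ
    rw [norm_smul, Real.norm_of_nonneg hs.le]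
    calc s * ‖e‖ ≤ δ₀ * (‖e‖ + 1) := by gcongr; linarith
      _ = ρ / 4 := by rw [hδ₀]; field_simp
  have hdist : ∀ s : ℝ, 0 < s → s ≤ δ₀ → ∀ y, dist y q - ρ / 4 ≤ dist (y - s • e) q := by
    intro s hs hsδ y
    have h1 := dist_triangle y (y - s • e) q
    have h2 : dist y (y - s • e) = ‖s • e‖ := by rw [dist_eq_norm]; congr 1; abel
    linarith [hsmall s hs hsδ]
  -- the translated field is continuously differentiable up to the boundary
  have hYsd : ∀ s : ℝ, 0 < s → s ≤ δ₀ → ∀ y ∈ closure V ∩ Metric.ball q ρ,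
      ContDiffAt ℝ 1 (fun y => Y (y - s • e)) y := by
    intro s hs hsδ y hy
    have h1 : ContDiffAt ℝ 1 Y (y - s • e) := by
      by_cases hb : y - s • e ∈ Metric.ball q ρ
      · exact hYd _ (hshiftV y hy s hs hb)
      · have : ρ / 2 < dist (y - s • e) q := by
          have := le_dist_of_notMem_ball hb; linarith
        exact contDiffAt_const.congr_of_eventuallyEq (hYnhds _ this)
    exact h1.comp y (contDiffAt_id.sub contDiffAt_const)
  have hcompact : IsCompact (closure V ∩ Metric.closedBall q (3 * ρ / 4)) :=
    (isCompact_closedBall _ _).inter_left isClosed_closure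
  have hcb : closure V ∩ Metric.closedBall q (3 * ρ / 4) ⊆ closure V ∩ Metric.ball q ρ :=
    Set.inter_subset_inter_right _ (Metric.closedBall_subset_ball (by linarith))
  obtain ⟨M, hM⟩ := hcompact.exists_bound_of_continuousOn (hYc.mono hcb)
  have hMb : ∀ y ∈ closure V ∩ Metric.ball q ρ, ‖Y y‖ ≤ max M 0 := by
    intro y hy
    by_cases hyb : y ∈ Metric.closedBall q (3 * ρ / 4)
    · exact (hM y ⟨hy.1, hyb⟩).trans (le_max_left _ _)
    · rw [hY0 y (by have := lt_dist_of_notMem_closedBall hyb; linarith)]; simp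
  have hcon : ContinuousOn (fun y => outerConormal V y) Z := by
    have h1 : ContinuousOn (fun y => ‖fderiv ℝ φ y‖⁻¹ • fderiv ℝ φ y) W := by
      have h2 := h.contDiffOn.continuousOn_fderiv_of_isOpen h.isOpen le_rfl
      exact (h2.norm.inv₀ fun y hy => norm_ne_zero_iff.2 (h.fderiv_ne_zero y hy)).smul h2
    refine (h1.mono fun y hy => hbW hy.2).congr fun y hy => ?_
    exact h.outerConormal_eq (hbW hy.2) ((h.mem_frontier_iff hV (hbW hy.2)).1 hy.1)
  have hflux_le : ∀ y (v : Spacetime m n), ‖outerConormal V y v‖ ≤ ‖v‖ := fun y v =>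
    ((outerConormal V y).le_opNorm v).trans
      (mul_le_of_le_one_left (norm_nonneg _) (norm_outerConormal_le V y))
  have hfluxm : ∀ X : Spacetime m n → Spacetime m n, ContinuousOn X Z →
      AEStronglyMeasurable (fun y => outerConormal V y (X y)) ((surfaceMeasure m n).restrict Z) :=
    fun X hX => (hcon.clm_apply hX).aestronglyMeasurable hZm
  refine ⟨IntegrableOn.of_bound hfin (hfluxm Y (hYc.mono hZcl)) (max M 0)
    ((ae_restrict_iff' hZm).2 (Filter.Eventually.of_forall fun y hy =>
      (hflux_le y _).trans (hMb y (hZcl hy)))), ?_⟩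
  set ℓ' : Spacetime m n → ℝ := (V ∩ Metric.ball q ρ).indicator ℓ with hℓ'
  have hVbm : MeasurableSet (V ∩ Metric.ball q ρ) := hV.measurableSet.inter measurableSet_ball
  have hℓ'i : Integrable ℓ' := (hℓ.mono_set Set.inter_subset_left).integrable_indicator hVbm
  -- the divergence theorem for the translated field, applied to its components
  have hstep : ∀ s : ℝ, 0 < s → s ≤ δ₀ → ∫ y in V, ℓ' (y - s • e) ≤
      ∫ y in Z, outerConormal V y (Y (y - s • e)) ∂(surfaceMeasure m n) := by
    intro s hs hsδ
    have hfar : ∀ y, 3 * ρ / 4 < dist y q → ∀ᶠ z in nhds (y - s • e), Y z = 0 := fun y hy =>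
      hYnhds _ (by linarith [hdist s hs hsδ y])
    have hi := fun i => hloc (3 * ρ / 4) (by linarith) (fun y => Y (y - s • e) i)
      (fun y hy => by
        have := (hfar y hy).self_of_nhds
        simp [this])
      (fun y hy => by
        have h1 := (hYsd s hs hsδ y ⟨subset_closure hy.1, hy.2⟩).differentiableAt one_ne_zero
        exact (differentiableAt_euclidean.1 h1) i)
      (fun y hy => by
        have h1 := (hYsd s hs hsδ y hy).continuousAt.continuousWithinAt
          (s := closure V ∩ Metric.ball q ρ)
        exact ((EuclideanSpace.proj i).continuous.continuousAt.comp_continuousWithinAt h1))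
      (by
        have h1 : ContinuousOn (fun y => fderiv ℝ (fun y => Y (y - s • e) i) y)
            (closure V ∩ Metric.closedBall q (3 * ρ / 4)) := by
          intro y hy
          have h2 : ContDiffAt ℝ 1 (fun y => Y (y - s • e) i) y :=
            (contDiffAt_euclidean.1 (hYsd s hs hsδ y (hcb hy))) i
          exact (h2.continuousAt_fderiv one_ne_zero).continuousWithinAt
        obtain ⟨M', hM'⟩ := hcompact.exists_bound_of_continuousOn h1
        refine ⟨max M' 0, fun y hy => ?_⟩
        by_cases hyb : y ∈ Metric.closedBall q (3 * ρ / 4)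
        · exact (hM' y ⟨subset_closure hy.1, hyb⟩).trans (le_max_left _ _)
        · have h2 : (fun y => Y (y - s • e) i) =ᶠ[nhds y] fun _ => 0 := by
            have h3 : Filter.Tendsto (fun y => y - s • e) (nhds y) (nhds (y - s • e)) :=
              (continuous_id.sub continuous_const).tendsto y
            filter_upwards [h3.eventually (hfar y (lt_dist_of_notMem_closedBall hyb))] with z hz
            simp [hz]
          rw [h2.fderiv_eq]
          simp)
      (coordVec i)
    have hsum : ∫ y in V, divergence (fun y => Y (y - s • e)) y =
        ∫ y in Z, outerConormal V y (Y (y - s • e)) ∂(surfaceMeasure m n) := by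
      simp only [divergence, partialD]
      rw [integral_finsetSum _ fun i _ => (hi i).1]
      rw [Finset.sum_congr rfl fun i _ => (hi i).2.2]
      rw [← integral_finsetSum _ fun i _ => (hi i).2.1]
      refine setIntegral_congr_fun hZm fun y hy => ?_
      rw [apply_eq_sum_coordVec (outerConormal V y)]
      refine Finset.sum_congr rfl fun i _ => ?_
      rw [h.outerConormal_apply (hbW hy.2) ((h.mem_frontier_iff hV (hbW hy.2)).1 hy.1)]
    rw [← hsum]
    refine setIntegral_mono_on (hℓ'i.comp_sub_right (s • e)).integrableOn ?_ hV.measurableSet ?_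
    · exact integrable_finsetSum _ fun i _ => (hi i).1
    · intro y hy
      rw [divergence_comp_sub]
      by_cases hyV : y - s • e ∈ V ∩ Metric.ball q ρ
      · rw [hℓ', Set.indicator_of_mem hyV]
        exact hdiv _ hyV
      · rw [hℓ', Set.indicator_of_notMem hyV, divergence_eq_zero_of_eventuallyEq]
        by_cases hyb : y ∈ Metric.ball q ρ
        · have h1 : y - s • e ∉ Metric.ball q ρ := fun hc =>
            hyV (hshiftV y ⟨subset_closure hy, hyb⟩ s hs hc)
          have h2 := le_dist_of_notMem_ball h1
          exact hYnhds _ (by linarith)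
        · have h2 := le_dist_of_notMem_ball hyb
          exact hfar y (by linarith)
  set δ : ℕ → ℝ := fun k => δ₀ * (1 / ((k : ℝ) + 1)) with hδ
  have hδpos : ∀ k, 0 < δ k := fun k => by positivity
  have hδle : ∀ k, δ k ≤ δ₀ := fun k => by
    have : 1 / ((k : ℝ) + 1) ≤ 1 := by
      rw [div_le_one (by positivity)]; linarith [(Nat.cast_nonneg k : (0 : ℝ) ≤ k)]
    exact mul_le_of_le_one_right hδ₀0.le this
  have hδlim : Filter.Tendsto δ Filter.atTop (nhds 0) := by
    have h1 := (tendsto_one_div_add_atTop_nhds_zero_nat (𝕜 := ℝ)).const_mul δ₀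
    rwa [mul_zero] at h1
  -- translations are continuous in the mean, here by moving the translation to the indicator of `V`
  have hlim1 : Filter.Tendsto (fun k => ∫ y in V, ℓ' (y - δ k • e)) Filter.atTop
      (nhds (∫ y in V, ℓ y)) := by
    have h1 : ∀ k, ∫ y in V, ℓ' (y - δ k • e) = ∫ y, V.indicator (fun _ => ℓ' y) (y + δ k • e) := by
      intro k
      rw [← integral_indicator hV.measurableSet, ← integral_add_right_eq_self _ (δ k • e)]
      refine integral_congr_ae (Filter.Eventually.of_forall fun y => ?_)
      by_cases hy : y + δ k • e ∈ V
      · simp [Set.indicator_of_mem hy]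
      · simp [Set.indicator_of_notMem hy]
    have h2 : ∫ y in V, ℓ y = ∫ y, ℓ' y := by
      rw [hℓ', integral_indicator hVbm]
      apply setIntegral_eq_of_subset_of_forall_sdiff_eq_zero hV.measurableSet Set.inter_subset_left
      intro y hy
      exact hℓ0 y hy.1 fun hc => hy.2 ⟨hy.1, hc⟩
    simp_rw [h1]
    rw [h2]
    refine tendsto_integral_of_dominated_convergence (fun y => ‖ℓ' y‖) (fun k => ?_) hℓ'i.norm
      (fun k => Filter.Eventually.of_forall fun y => ?_) (Filter.Eventually.of_forall fun y => ?_)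
    · have : (fun y => V.indicator (fun _ => ℓ' y) (y + δ k • e)) =
          ((fun y => y + δ k • e) ⁻¹' V).indicator ℓ' := by
        ext y
        by_cases hy : y + δ k • e ∈ V
        · rw [Set.indicator_of_mem hy, Set.indicator_of_mem (by exact hy)]
        · rw [Set.indicator_of_notMem hy, Set.indicator_of_notMem (by exact hy)]
      rw [this]
      exact hℓ'i.aestronglyMeasurable.indicator
        ((hV.preimage (continuous_id.add continuous_const)).measurableSet)
    · by_cases hy : y + δ k • e ∈ V
      · rw [Set.indicator_of_mem hy]
      · rw [Set.indicator_of_notMem hy]; simp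
    · by_cases hy : y ∈ V ∩ Metric.ball q ρ
      · have h3 : Filter.Tendsto (fun k => y + δ k • e) Filter.atTop (nhds y) := by
          simpa using (hδlim.smul_const e).const_add y
        refine tendsto_const_nhds.congr' ?_
        filter_upwards [h3.eventually (hV.mem_nhds hy.1)] with k hk
        rw [Set.indicator_of_mem hk]
      · have : ℓ' y = 0 := Set.indicator_of_notMem hy _
        simp only [this]
        refine tendsto_const_nhds.congr fun k => ?_
        by_cases hy : y + δ k • e ∈ V
        · rw [Set.indicator_of_mem hy]
        · rw [Set.indicator_of_notMem hy]
  have hlim2 : Filter.Tendsto (fun k => ∫ y in Z, outerConormal V y (Y (y - δ k • e))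
      ∂(surfaceMeasure m n)) Filter.atTop
      (nhds (∫ y in Z, outerConormal V y (Y y) ∂(surfaceMeasure m n))) := by
    have hbound : ∀ k, ∀ y ∈ Z, ‖outerConormal V y (Y (y - δ k • e))‖ ≤ max M 0 := by
      intro k y hy
      refine (hflux_le y _).trans ?_
      by_cases hb : y - δ k • e ∈ Metric.ball q ρ
      · have h1 := hshiftV y (hZcl hy) (δ k) (hδpos k) hb
        exact hMb _ ⟨subset_closure h1.1, h1.2⟩
      · rw [hY0 _ (by have := le_dist_of_notMem_ball hb; linarith)]; simp
    refine tendsto_integral_of_dominated_convergence (fun _ => max M 0) (fun k => ?_)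
      (integrableOn_const hfin.ne) (fun k => (ae_restrict_iff' hZm).2
        (Filter.Eventually.of_forall (hbound k)))
      ((ae_restrict_iff' hZm).2 (Filter.Eventually.of_forall fun y hy => ?_))
    · refine hfluxm _ fun y hy => ?_
      exact (hYsd (δ k) (hδpos k) (hδle k) y (hZcl hy)).continuousAt.continuousWithinAt
    · have h3 : Filter.Tendsto (fun k => y - δ k • e) Filter.atTop (nhds y) := by
        simpa using (hδlim.smul_const e).const_sub y
      have h4 : Filter.Tendsto (fun k => y - δ k • e) Filter.atTop
          (nhdsWithin y (closure V ∩ Metric.ball q ρ)) := by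
        refine tendsto_nhdsWithin_of_tendsto_nhds_of_eventually_within _ h3 ?_
        filter_upwards [h3.eventually (Metric.isOpen_ball.mem_nhds hy.2)] with k hk
        have h1 := hshiftV y (hZcl hy) (δ k) (hδpos k) hk
        exact ⟨subset_closure h1.1, h1.2⟩
      exact ((outerConormal V y).continuous.tendsto _).comp
        ((hYc y (hZcl hy)).tendsto.comp h4)
  exact le_of_tendsto_of_tendsto' hlim1 hlim2 fun k => hstep (δ k) (hδpos k) (hδle k)

end LocalDivergenceInequality

/-! ### The divergence theorem, globally -/

section GlobalDivergenceTheorem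

variable {m n : ℕ} {V O K : Set (Spacetime m n)} {X : Spacetime m n → Spacetime m n}
  {ℓ : Spacetime m n → ℝ}

lemma divergence_smul {χ : Spacetime m n → ℝ} {y : Spacetime m n} (hχ : DifferentiableAt ℝ χ y)
    (hX : DifferentiableAt ℝ X y) :
    divergence (fun y => χ y • X y) y = χ y * divergence X y + fderiv ℝ χ y (X y) := by
  have h1 : ∀ i, DifferentiableAt ℝ (fun y => X y i) y := differentiableAt_euclidean.1 hX
  rw [apply_eq_sum_coordVec (fderiv ℝ χ y), divergence, divergence, Finset.mul_sum,
    ← Finset.sum_add_distrib]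
  refine Finset.sum_congr rfl fun i _ => ?_
  have h2 := (hχ.hasFDerivAt.mul (h1 i).hasFDerivAt).fderiv
  simp only [partialD]
  have h3 : (fun y => (χ y • X y) i) = χ * fun y => X y i := rfl
  rw [h3, h2]
  simp

lemma integral_divergence_eq_zero {Y : Spacetime m n → Spacetime m n} (hY : ContDiff ℝ 1 Y)
    (hc : HasCompactSupport Y) :
    Integrable (divergence Y) ∧ ∫ y, divergence Y y = 0 := by
  have h1 : ∀ i, ContDiff ℝ 1 (fun y => Y y i) := contDiff_euclidean.1 hY
  have h2 : ∀ i, HasCompactSupport (fun y => Y y i) := fun i =>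
    hc.comp_left (g := fun v : Spacetime m n => v i) rfl
  have h3 : ∀ i, Integrable (fun y => partialD i (fun y => Y y i) y) := fun i =>
    (((h1 i).continuous_fderiv one_ne_zero).clm_apply continuous_const).integrable_of_hasCompactSupport
      ((h2 i).fderiv_apply (𝕜 := ℝ) (coordVec i))
  have h4 : ∀ i, ∫ y, partialD i (fun y => Y y i) y = 0 := fun i => by
    have := integral_smul_fderiv_eq_neg_fderiv_smul_of_integrable (𝕜 := ℝ) (μ := volume)
      (f := fun _ : Spacetime m n => (1 : ℝ)) (g := fun y => Y y i) (v := coordVec i)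
      (by simp) (by simpa [partialD] using h3 i)
      (by simpa using (h1 i).continuous.integrable_of_hasCompactSupport (h2 i))
      (fun x _ => differentiableAt_const _) (fun x _ => ((h1 i).differentiable one_ne_zero) x)
    simpa [partialD] using this
  refine ⟨integrable_finsetSum _ fun i _ => h3 i, ?_⟩
  simp only [divergence]
  rw [integral_finsetSum _ fun i _ => h3 i]
  exact Finset.sum_eq_zero fun i _ => h4 i

/-- The localized form of the divergence inequality near an arbitrary point of `O`: in the interior
of `V` the flux vanishes, at a boundary point the local inequality applies, and in the exterior
both sides vanish. -/
lemma exists_nhds_divergence_le (hV : IsOpen V) (hO : IsOpen O)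
    (hloc : ∀ q ∈ frontier V ∩ O, ∃ W φ, q ∈ W ∧ IsLocalDefiningFunction 1 V W φ)
    (hX : ContDiffOn ℝ 1 X V) (hXc : ContinuousOn X (closure V ∩ O))
    (hdiv : ∀ y ∈ V, ℓ y ≤ divergence X y) {q : Spacetime m n}
    (hq : q ∈ O) :
    ∃ N, IsOpen N ∧ q ∈ N ∧ ∀ χ : Spacetime m n → ℝ, ContDiff ℝ ∞ χ → (∀ y, 0 ≤ χ y) →
      tsupport χ ⊆ N → IntegrableOn (fun y => χ y * ℓ y + fderiv ℝ χ y (X y)) V →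
      IntegrableOn (fun y => χ y * outerConormal V y (X y)) (frontier V ∩ O)
        (surfaceMeasure m n) ∧
      ∫ y in V, (χ y * ℓ y + fderiv ℝ χ y (X y)) ≤
        ∫ y in frontier V ∩ O, χ y * outerConormal V y (X y) ∂(surfaceMeasure m n) := by
  have hzero : ∀ χ : Spacetime m n → ℝ, ∀ y ∉ tsupport χ, χ y = 0 ∧ fderiv ℝ χ y = 0 := by
    intro χ y hy
    refine ⟨image_eq_zero_of_notMem_tsupport hy, ?_⟩
    exact image_eq_zero_of_notMem_tsupport (f := fderiv ℝ χ) fun hc => hy (tsupport_fderiv_subset ℝ hc)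
  have hdiv' : ∀ χ : Spacetime m n → ℝ, ContDiff ℝ ∞ χ → (∀ y, 0 ≤ χ y) → ∀ y ∈ V,
      χ y * ℓ y + fderiv ℝ χ y (X y) ≤ divergence (fun y => χ y • X y) y := by
    intro χ hχ hχ0 y hy
    rw [divergence_smul ((hχ.differentiable (by simp)) y)
      ((hX.differentiableOn one_ne_zero).differentiableAt (hV.mem_nhds hy))]
    gcongr
    · exact hχ0 y
    · exact hdiv y hy
  have hFm : MeasurableSet (frontier V ∩ O) := isClosed_frontier.measurableSet.inter hO.measurableSet
  by_cases hqV : q ∈ V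
  · obtain ⟨r, hr, hrV⟩ := Metric.isOpen_iff.1 hV q hqV
    refine ⟨Metric.ball q r, Metric.isOpen_ball, Metric.mem_ball_self hr,
      fun χ hχ hχ0 hχs hint => ?_⟩
    have hF0 : ∀ y ∈ frontier V ∩ O, χ y * outerConormal V y (X y) = 0 := by
      intro y hy
      rw [(hzero χ y fun hc => ?_).1, zero_mul]
      rw [hV.frontier_eq] at hy
      exact hy.1.2 (hrV (hχs hc))
    refine ⟨IntegrableOn.congr_fun integrableOn_zero (fun y hy => (hF0 y hy).symm) hFm, ?_⟩
    rw [setIntegral_congr_fun hFm hF0, integral_zero]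
    have hYs : tsupport (fun y => χ y • X y) ⊆ tsupport χ := tsupport_smul_subset_left χ X
    have hYc : HasCompactSupport (fun y => χ y • X y) :=
      (isCompact_closedBall q r).of_isClosed_subset (isClosed_tsupport _)
        ((hYs.trans hχs).trans Metric.ball_subset_closedBall)
    have hYd : ContDiff ℝ 1 (fun y => χ y • X y) := by
      rw [contDiff_iff_contDiffAt]
      intro y
      by_cases hy : y ∈ tsupport (fun y => χ y • X y)
      · have h1 : y ∈ V := hrV (hχs (hYs hy))
        exact (hχ.contDiffAt.of_le (by exact_mod_cast le_top)).smul
          (hX.contDiffAt (hV.mem_nhds h1))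
      · exact contDiffAt_const.congr_of_eventuallyEq (notMem_tsupport_iff_eventuallyEq.1 hy)
    obtain ⟨h1, h2⟩ := integral_divergence_eq_zero hYd hYc
    calc ∫ y in V, (χ y * ℓ y + fderiv ℝ χ y (X y))
        ≤ ∫ y in V, divergence (fun y => χ y • X y) y :=
          setIntegral_mono_on hint h1.integrableOn hV.measurableSet (hdiv' χ hχ hχ0)
      _ = ∫ y, divergence (fun y => χ y • X y) y := by
          refine setIntegral_eq_integral_of_forall_compl_eq_zero fun y hy => ?_
          refine divergence_eq_zero_of_eventuallyEq ?_
          exact notMem_tsupport_iff_eventuallyEq.1 fun hc => hy (hrV (hχs (hYs hc)))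
      _ = 0 := h2
      _ ≤ 0 := le_rfl
  by_cases hqc : q ∈ closure V
  · have hqF : q ∈ frontier V := by rw [hV.frontier_eq]; exact ⟨hqc, hqV⟩
    obtain ⟨W, φ, hqW, h⟩ := hloc q ⟨hqF, hq⟩
    have hφ0 := (h.mem_frontier_iff hV hqW).1 hqF
    obtain ⟨ρ, hρ, hbW, hfin, hmain⟩ :=
      (h.inter_isOpen hO).exists_local_divergence_le hV ⟨hqW, hq⟩ hφ0
    have hbO : Metric.ball q ρ ⊆ O := hbW.trans Set.inter_subset_right
    refine ⟨Metric.ball q (ρ / 2), Metric.isOpen_ball, Metric.mem_ball_self (by linarith),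
      fun χ hχ hχ0 hχs hint => ?_⟩
    have hout : ∀ y, ρ / 2 ≤ dist y q → χ y = 0 ∧ fderiv ℝ χ y = 0 := fun y hy =>
      hzero χ y fun hc => absurd (Metric.mem_ball.1 (hχs hc)) (not_lt.2 hy)
    obtain ⟨h1, h2⟩ := hmain (fun y => χ y • X y)
      (fun y hy => by rw [(hout y hy.le).1, zero_smul])
      ((hχ.contDiffOn.of_le (by exact_mod_cast le_top)).smul (hX.mono Set.inter_subset_left))
      ((hχ.continuous.continuousOn).smul (hXc.mono (Set.inter_subset_inter_right _ hbO)))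
      (fun y => χ y * ℓ y + fderiv ℝ χ y (X y)) hint
      (fun y hy => hdiv' χ hχ hχ0 y hy.1)
      (fun y _ hy => by
        obtain ⟨h3, h4⟩ := hout y (by linarith [le_dist_of_notMem_ball hy])
        rw [h3, h4]; simp)
    simp only [map_smul, smul_eq_mul] at h1 h2
    have hd0 : ∀ y ∈ (frontier V ∩ O) \ (frontier V ∩ Metric.ball q ρ),
        χ y * outerConormal V y (X y) = 0 := by
      intro y hy
      have : y ∉ Metric.ball q ρ := fun hc => hy.2 ⟨hy.1.1, hc⟩
      rw [(hout y (by linarith [le_dist_of_notMem_ball this])).1, zero_mul]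
    refine ⟨h1.of_forall_sdiff_eq_zero hFm hd0, h2.trans_eq ?_⟩
    exact (setIntegral_eq_of_subset_of_forall_sdiff_eq_zero hFm
      (Set.inter_subset_inter_right _ hbO) hd0).symm
  · refine ⟨(closure V)ᶜ, isClosed_closure.isOpen_compl, hqc, fun χ hχ hχ0 hχs hint => ?_⟩
    have h0 : ∀ y ∈ closure V, χ y = 0 ∧ fderiv ℝ χ y = 0 := fun y hy =>
      hzero χ y fun hc => hχs hc hy
    have hF0 : ∀ y ∈ frontier V ∩ O, χ y * outerConormal V y (X y) = 0 := by
      intro y hy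
      rw [(h0 y (frontier_subset_closure hy.1)).1, zero_mul]
    refine ⟨IntegrableOn.congr_fun integrableOn_zero (fun y hy => (hF0 y hy).symm) hFm, ?_⟩
    rw [setIntegral_congr_fun hFm hF0, integral_zero]
    refine (setIntegral_congr_fun (g := fun _ => (0 : ℝ)) hV.measurableSet fun y hy => ?_).trans_le
      (by simp)
    simp [h0 y (subset_closure hy)]

/-- The divergence theorem for a field with compact support in the open set `O`, in which the
boundary of `V` is of class `C¹`. The divergence only has to be bounded below by an integrable
function, so that nothing is required of the second derivatives of a solution. -/
theorem setIntegral_le_flux (hV : IsOpen V) (hO : IsOpen O) (hVO : V ⊆ O)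
    (hloc : ∀ q ∈ frontier V ∩ O, ∃ W φ, q ∈ W ∧ IsLocalDefiningFunction 1 V W φ)
    (hK : IsCompact K) (hKO : K ⊆ O)
    (hX : ContDiffOn ℝ 1 X V) (hXc : ContinuousOn X (closure V ∩ O))
    (hX0 : ∀ y ∈ closure V ∩ O, y ∉ K → X y = 0)
    (hℓ : IntegrableOn ℓ V) (hdiv : ∀ y ∈ V, ℓ y ≤ divergence X y) :
    ∫ y in V, ℓ y ≤ ∫ y in frontier V ∩ O, outerConormal V y (X y) ∂(surfaceMeasure m n) := by
  choose! N hNo hqN hN using fun q (hq : q ∈ O) =>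
    exists_nhds_divergence_le hV hO hloc hX hXc hdiv hq
  obtain ⟨T, hTK, hcov⟩ := hK.elim_nhds_subcover N
    fun q hq => (hNo q (hKO hq)).mem_nhds (hqN q (hKO hq))
  obtain ⟨f, hf⟩ := SmoothPartitionOfUnity.exists_isSubordinate
    (modelWithCornersSelf ℝ (Spacetime m n)) hK.isClosed (fun q : T => N q)
    (fun q => hNo q (hKO (hTK q q.2))) (fun y hy => by
      obtain ⟨q, hqT, hq⟩ := Set.mem_iUnion₂.1 (hcov hy)
      exact Set.mem_iUnion.2 ⟨⟨q, hqT⟩, hq⟩)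
  have hfs : ∀ i, ContDiff ℝ ∞ (f i) := fun i => (f i).contMDiff.contDiff
  have hsum1 : ∀ y ∈ K, ∑ i, f i y = 1 := fun y hy => by
    rw [← finsum_eq_sum_of_fintype]; exact f.sum_eq_one hy
  have hsumle : ∀ y, ∑ i, f i y ≤ 1 := fun y => by
    rw [← finsum_eq_sum_of_fintype]; exact f.sum_le_one y
  have hXb : ∃ M, ∀ y ∈ V, ‖X y‖ ≤ M := by
    have h1 : IsCompact (closure V ∩ K) := hK.inter_left isClosed_closure
    obtain ⟨M, hM⟩ := h1.exists_bound_of_continuousOn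
      (hXc.mono (Set.inter_subset_inter_right _ hKO))
    refine ⟨max M 0, fun y hy => ?_⟩
    by_cases hyK : y ∈ K
    · exact (hM y ⟨subset_closure hy, hyK⟩).trans (le_max_left _ _)
    · rw [hX0 y ⟨subset_closure hy, hVO hy⟩ hyK]; simp
  obtain ⟨M, hM⟩ := hXb
  have hint : ∀ i, IntegrableOn (fun y => f i y * ℓ y + fderiv ℝ (f i) y (X y)) V := by
    intro i
    refine Integrable.add ?_ ?_
    · refine Integrable.bdd_mul (c := 1) hℓ (hfs i).continuous.aestronglyMeasurable
        (Filter.Eventually.of_forall fun y => ?_)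
      rw [Real.norm_of_nonneg (f.nonneg i y)]
      exact f.le_one i y
    · have hcf : Continuous (fderiv ℝ (f i)) := (hfs i).continuous_fderiv (by simp)
      obtain ⟨M', hM'⟩ := hK.exists_bound_of_continuousOn hcf.continuousOn
      have h1 : IntegrableOn (fun y => fderiv ℝ (f i) y (X y)) (V ∩ K) := by
        refine IntegrableOn.of_bound ((measure_mono Set.inter_subset_right).trans_lt
          hK.measure_lt_top) ?_ (M' * M) ((ae_restrict_iff' (hV.measurableSet.inter
            hK.measurableSet)).2 (Filter.Eventually.of_forall fun y hy => ?_))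
        · exact (hcf.continuousOn.clm_apply (hX.continuousOn.mono
            Set.inter_subset_left)).aestronglyMeasurable (hV.measurableSet.inter hK.measurableSet)
        · refine ((fderiv ℝ (f i) y).le_opNorm _).trans ?_
          have := hM' y hy.2
          have := hM y hy.1
          have := norm_nonneg (fderiv ℝ (f i) y)
          gcongr
          · linarith
      refine h1.of_forall_sdiff_eq_zero hV.measurableSet fun y hy => ?_
      rw [hX0 y ⟨subset_closure hy.1, hVO hy.1⟩ fun hc => hy.2 ⟨hy.1, hc⟩, map_zero]
  have hres := fun i : T => hN i (hKO (hTK i i.2)) (f i) (hfs i) (f.nonneg i) (hf i) (hint i)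
  have hkey : ∀ y ∈ V, ℓ y ≤ ∑ i, (f i y * ℓ y + fderiv ℝ (f i) y (X y)) := by
    intro y hy
    have hyO : y ∈ closure V ∩ O := ⟨subset_closure hy, hVO hy⟩
    rw [Finset.sum_add_distrib, ← Finset.sum_mul]
    -- where `X ≠ 0` the point is interior to `K`, and there the derivatives of the partition sum to `0`
    have hder : ∑ i, fderiv ℝ (f i) y (X y) = 0 := by
      by_cases hXy : X y = 0
      · simp [hXy]
      have h1 : ∀ᶠ z in nhds y, z ∈ V ∧ X z ≠ 0 :=
        Filter.Eventually.and (hV.mem_nhds hy) ((hX.continuousOn.continuousAt (hV.mem_nhds hy)).eventually_ne hXy)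
      have h2 : (fun z => ∑ i, f i z) =ᶠ[nhds y] fun _ => 1 := by
        filter_upwards [h1] with z hz
        refine hsum1 z ?_
        by_contra hc
        exact hz.2 (hX0 z ⟨subset_closure hz.1, hVO hz.1⟩ hc)
      have h3 := h2.fderiv_eq (𝕜 := ℝ)
      rw [fderiv_fun_sum fun i _ => (hfs i).differentiable (by simp) y] at h3
      have h4 := congrArg (fun L => L (X y)) h3
      simpa using h4
    rw [hder, add_zero]
    by_cases hyK : y ∈ K
    · rw [hsum1 y hyK, one_mul]
    · have h1 : ∀ᶠ z in nhds y, X z = 0 := by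
        filter_upwards [hV.mem_nhds hy, hK.isClosed.isOpen_compl.mem_nhds hyK] with z hz1 hz2
        exact hX0 z ⟨subset_closure hz1, hVO hz1⟩ hz2
      have h2 := hdiv y hy
      rw [divergence_eq_zero_of_eventuallyEq h1] at h2
      nlinarith [hsumle y]
  calc ∫ y in V, ℓ y ≤ ∫ y in V, ∑ i, (f i y * ℓ y + fderiv ℝ (f i) y (X y)) :=
        setIntegral_mono_on hℓ (integrable_finsetSum _ fun i _ => hint i) hV.measurableSet hkey
    _ = ∑ i, ∫ y in V, (f i y * ℓ y + fderiv ℝ (f i) y (X y)) :=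
        integral_finsetSum _ fun i _ => hint i
    _ ≤ ∑ i, ∫ y in frontier V ∩ O, f i y * outerConormal V y (X y) ∂(surfaceMeasure m n) :=
        Finset.sum_le_sum fun i _ => (hres i).2
    _ = ∫ y in frontier V ∩ O, ∑ i, f i y * outerConormal V y (X y) ∂(surfaceMeasure m n) :=
        (integral_finsetSum _ fun i _ => (hres i).1).symm
    _ = ∫ y in frontier V ∩ O, outerConormal V y (X y) ∂(surfaceMeasure m n) := by
        refine setIntegral_congr_fun (isClosed_frontier.measurableSet.inter hO.measurableSet)
          fun y hy => ?_
        rw [← Finset.sum_mul]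
        by_cases hyK : y ∈ K
        · rw [hsum1 y hyK, one_mul]
        · rw [hX0 y ⟨frontier_subset_closure hy.1, hy.2⟩ hyK]; simp

end GlobalDivergenceTheorem

/-! ### Cartesian formulas for the coordinates -/

section Coordinates

variable {m n : ℕ}

/-- `timePart` as a continuous linear map. -/
def timeCLM (m n : ℕ) : Spacetime m n →L[ℝ] EuclideanSpace ℝ (Fin m) :=
  LinearMap.toContinuousLinearMap
    { toFun := timePart
      map_add' := fun _ _ => rfl
      map_smul' := fun _ _ => rfl }

/-- `spacePart` as a continuous linear map. -/
def spaceCLM (m n : ℕ) : Spacetime m n →L[ℝ] EuclideanSpace ℝ (Fin n) :=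
  LinearMap.toContinuousLinearMap
    { toFun := spacePart
      map_add' := fun _ _ => rfl
      map_smul' := fun _ _ => rfl }

@[simp] lemma timeCLM_apply (p : Spacetime m n) : timeCLM m n p = timePart p := rfl
@[simp] lemma spaceCLM_apply (p : Spacetime m n) : spaceCLM m n p = spacePart p := rfl
@[simp] lemma timePart_mkPoint (t : EuclideanSpace ℝ (Fin m)) (x : EuclideanSpace ℝ (Fin n)) :
    timePart (mkPoint t x) = t := rfl
@[simp] lemma spacePart_mkPoint (t : EuclideanSpace ℝ (Fin m)) (x : EuclideanSpace ℝ (Fin n)) :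
    spacePart (mkPoint t x) = x := rfl
lemma timePart_add (p q : Spacetime m n) : timePart (p + q) = timePart p + timePart q := rfl
lemma spacePart_add (p q : Spacetime m n) : spacePart (p + q) = spacePart p + spacePart q := rfl
lemma timePart_sub (p q : Spacetime m n) : timePart (p - q) = timePart p - timePart q := rfl
lemma spacePart_sub (p q : Spacetime m n) : spacePart (p - q) = spacePart p - spacePart q := rfl
lemma timePart_smul (c : ℝ) (p : Spacetime m n) : timePart (c • p) = c • timePart p := rfl
lemma spacePart_smul (c : ℝ) (p : Spacetime m n) : spacePart (c • p) = c • spacePart p := rfl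

lemma mkPoint_parts (p : Spacetime m n) : mkPoint (timePart p) (spacePart p) = p := by
  ext i
  rcases i with i | i <;> rfl

lemma eq_of_parts {p q : Spacetime m n} (h1 : timePart p = timePart q)
    (h2 : spacePart p = spacePart q) : p = q := by
  rw [← mkPoint_parts p, ← mkPoint_parts q, h1, h2]

/-- `mkPoint` as a continuous linear map. -/
def mkPointCLM (m n : ℕ) :
    (EuclideanSpace ℝ (Fin m) × EuclideanSpace ℝ (Fin n)) →L[ℝ] Spacetime m n :=
  LinearMap.toContinuousLinearMap
    { toFun := fun z => mkPoint z.1 z.2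
      map_add' := fun _ _ => eq_of_parts rfl rfl
      map_smul' := fun _ _ => eq_of_parts rfl rfl }

@[simp] lemma mkPointCLM_apply (z : EuclideanSpace ℝ (Fin m) × EuclideanSpace ℝ (Fin n)) :
    mkPointCLM m n z = mkPoint z.1 z.2 := rfl

lemma inner_eq_parts (p q : Spacetime m n) :
    ⟪p, q⟫ = ⟪timePart p, timePart q⟫ + ⟪spacePart p, spacePart q⟫ := by
  simp only [PiLp.inner_apply, Fintype.sum_sum_type]
  rfl

lemma norm_sq_eq_parts (p : Spacetime m n) :
    ‖p‖ ^ 2 = ‖timePart p‖ ^ 2 + ‖spacePart p‖ ^ 2 := by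
  simp only [← real_inner_self_eq_norm_sq, inner_eq_parts]

lemma norm_timePart_le (p : Spacetime m n) : ‖timePart p‖ ≤ ‖p‖ := by
  refine le_of_sq_le_sq ?_ (norm_nonneg _)
  rw [norm_sq_eq_parts]; nlinarith [sq_nonneg ‖spacePart p‖]

lemma norm_spacePart_le (p : Spacetime m n) : ‖spacePart p‖ ≤ ‖p‖ := by
  refine le_of_sq_le_sq ?_ (norm_nonneg _)
  rw [norm_sq_eq_parts]; nlinarith [sq_nonneg ‖timePart p‖]

lemma norm_le_parts (p : Spacetime m n) : ‖p‖ ≤ ‖timePart p‖ + ‖spacePart p‖ := by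
  refine le_of_sq_le_sq ?_ (by positivity)
  rw [norm_sq_eq_parts]
  nlinarith [mul_nonneg (norm_nonneg (timePart p)) (norm_nonneg (spacePart p))]

lemma tau_nonneg (p : Spacetime m n) : 0 ≤ tau p := norm_nonneg _
lemma rad_nonneg (p : Spacetime m n) : 0 ≤ rad p := norm_nonneg _

lemma fFun_eq (p : Spacetime m n) : fFun p = (rad p ^ 2 - tau p ^ 2) / 4 := by
  simp only [fFun, nullU, nullV]; ring

lemma fFun_eq_inner (p : Spacetime m n) :
    fFun p = (⟪spacePart p, spacePart p⟫ - ⟪timePart p, timePart p⟫) / 4 := by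
  rw [fFun_eq, real_inner_self_eq_norm_sq, real_inner_self_eq_norm_sq]; rfl

lemma contDiff_fFun : ContDiff ℝ ∞ (fFun : Spacetime m n → ℝ) := by
  have : (fFun : Spacetime m n → ℝ) = fun p =>
      (⟪spaceCLM m n p, spaceCLM m n p⟫ - ⟪timeCLM m n p, timeCLM m n p⟫) / 4 :=
    funext fFun_eq_inner
  rw [this]
  exact (((spaceCLM m n).contDiff.inner ℝ (spaceCLM m n).contDiff).sub
    ((timeCLM m n).contDiff.inner ℝ (timeCLM m n).contDiff)).div_const 4

lemma hasFDerivAt_fFun (p : Spacetime m n) : HasFDerivAt fFun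
    ((1 / 2 : ℝ) • ((innerSL ℝ (spacePart p)).comp (spaceCLM m n)
      - (innerSL ℝ (timePart p)).comp (timeCLM m n))) p := by
  have hs := (spaceCLM m n).hasFDerivAt (x := p)
  have ht := (timeCLM m n).hasFDerivAt (x := p)
  have h1 := ((hs.inner ℝ hs).sub (ht.inner ℝ ht)).mul_const (1 / 4 : ℝ)
  have h2 : (fFun : Spacetime m n → ℝ) = fun p =>
      (⟪spaceCLM m n p, spaceCLM m n p⟫ - ⟪timeCLM m n p, timeCLM m n p⟫) * (1 / 4) := by
    ext p; rw [fFun_eq_inner]; simp only [spaceCLM_apply, timeCLM_apply]; ring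
  rw [h2]
  refine h1.congr_fderiv ?_
  ext X
  simp [fderivInnerCLM_apply, real_inner_comm]
  ring

lemma fderiv_fFun (p X : Spacetime m n) : fderiv ℝ fFun p X =
    (⟪spacePart p, spacePart X⟫ - ⟪timePart p, timePart X⟫) / 2 := by
  rw [(hasFDerivAt_fFun p).fderiv]
  simp
  ring

lemma isOpen_exteriorCone : IsOpen (exteriorCone m n) :=
  isOpen_lt continuous_const contDiff_fFun.continuous

lemma tau_lt_rad {p : Spacetime m n} (hp : p ∈ exteriorCone m n) : tau p < rad p := by
  have h1 : 0 < fFun p := hp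
  rw [fFun_eq] at h1
  nlinarith [tau_nonneg p, rad_nonneg p]

lemma rad_pos {p : Spacetime m n} (hp : p ∈ exteriorCone m n) : 0 < rad p :=
  (tau_nonneg p).trans_lt (tau_lt_rad hp)

lemma nullU_neg {p : Spacetime m n} (hp : p ∈ exteriorCone m n) : nullU p < 0 := by
  have := tau_lt_rad hp; unfold nullU; linarith

lemma nullV_pos {p : Spacetime m n} (hp : p ∈ exteriorCone m n) : 0 < nullV p := by
  have := rad_pos hp; have := tau_nonneg p; unfold nullV; linarith

lemma hasFDerivAt_rad {p : Spacetime m n} (hp : 0 < rad p) : HasFDerivAt rad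
    ((rad p)⁻¹ • (innerSL ℝ (spacePart p)).comp (spaceCLM m n)) p := by
  have hs := (spaceCLM m n).hasFDerivAt (x := p)
  have h1 := hs.norm_sq.sqrt (x := p) (by
    have : (0 : ℝ) < ‖spacePart p‖ := hp
    simpa using this.ne')
  have h2 : (rad : Spacetime m n → ℝ) = fun p => √(‖spaceCLM m n p‖ ^ 2) := by
    ext p; rw [Real.sqrt_sq (norm_nonneg _)]; rfl
  rw [h2]
  refine h1.congr_fderiv ?_
  ext X
  simp [Real.sqrt_sq]
  ring

lemma fderiv_rad {p : Spacetime m n} (hp : 0 < rad p) (X : Spacetime m n) :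
    fderiv ℝ rad p X = dRad p X := by
  rw [(hasFDerivAt_rad hp).fderiv]
  simp [dRad, div_eq_inv_mul]

lemma contDiffAt_rad {p : Spacetime m n} (hp : 0 < rad p) {k : WithTop ℕ∞} :
    ContDiffAt ℝ k (rad : Spacetime m n → ℝ) p := by
  have h1 : ContDiffAt ℝ k (fun p => spaceCLM m n p) p := (spaceCLM m n).contDiff.contDiffAt
  exact h1.norm ℝ (by
    have : (0 : ℝ) < ‖spacePart p‖ := hp
    exact norm_pos_iff.1 this)

lemma continuous_rad : Continuous (rad : Spacetime m n → ℝ) :=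
  (spaceCLM m n).continuous.norm

lemma continuous_tau : Continuous (tau : Spacetime m n → ℝ) :=
  (timeCLM m n).continuous.norm

end Coordinates

/-! ### The conformal map -/

section WarpMap

variable {m n : ℕ} {ε : ℝ} {p : Spacetime m n}

/-- The part of the exterior of the null cone on which `warpMap ε` is a diffeomorphism. -/
def warpDomain (ε : ℝ) (m n : ℕ) : Set (Spacetime m n) :=
  {p | p ∈ exteriorCone m n ∧ 0 < 1 + ε * nullU p ∧ 0 < 1 - ε * nullV p}

/-- The conformal factor `(1 + ε u) (1 - ε v) = 1 - ε r + ε² f`. -/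
def warpFactor (ε : ℝ) (p : Spacetime m n) : ℝ := 1 - ε * rad p + ε ^ 2 * fFun p

lemma warpFactor_eq (ε : ℝ) (p : Spacetime m n) :
    warpFactor ε p = (1 + ε * nullU p) * (1 - ε * nullV p) := by
  simp only [warpFactor, fFun, nullU, nullV]; ring

lemma warpFactor_pos (hp : p ∈ warpDomain ε m n) : 0 < warpFactor ε p := by
  rw [warpFactor_eq]; exact mul_pos hp.2.1 hp.2.2

/-- The value of `τ` at the image under the conformal map, in terms of the null coordinates. -/
lemma null_add_identity {ε u v : ℝ} (hA : 1 + ε * u ≠ 0) (hB : 1 - ε * v ≠ 0) :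
    u / (1 + ε * u) + v / (1 - ε * v) = ((1 + ε * u) * (1 - ε * v))⁻¹ * (u + v) := by
  obtain ⟨A, hA'⟩ : ∃ A, A = 1 + ε * u := ⟨_, rfl⟩
  obtain ⟨B, hB'⟩ : ∃ B, B = 1 - ε * v := ⟨_, rfl⟩
  rw [← hA'] at hA ⊢
  rw [← hB'] at hB ⊢
  field_simp
  rw [hA', hB']
  ring

/-- The value of `r` at the image under the conformal map, in terms of the null coordinates. -/
lemma null_sub_identity {ε u v : ℝ} (hA : 1 + ε * u ≠ 0) (hB : 1 - ε * v ≠ 0) :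
    v / (1 - ε * v) - u / (1 + ε * u) =
      ((1 + ε * u) * (1 - ε * v))⁻¹ * (v - u - 2 * ε * -(u * v)) := by
  obtain ⟨A, hA'⟩ : ∃ A, A = 1 + ε * u := ⟨_, rfl⟩
  obtain ⟨B, hB'⟩ : ∃ B, B = 1 - ε * v := ⟨_, rfl⟩
  rw [← hA'] at hA ⊢
  rw [← hB'] at hB ⊢
  field_simp
  rw [hA', hB']
  ring

lemma null_inverse_identity {ε u : ℝ} (hA : 1 + ε * u ≠ 0) :
    1 + -ε * (u / (1 + ε * u)) = 1 / (1 + ε * u) := by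
  obtain ⟨A, hA'⟩ : ∃ A, A = 1 + ε * u := ⟨_, rfl⟩
  rw [← hA'] at hA ⊢
  field_simp
  rw [hA']
  ring

lemma null_inverse_identity' {ε v : ℝ} (hB : 1 - ε * v ≠ 0) :
    1 - -ε * (v / (1 - ε * v)) = 1 / (1 - ε * v) := by
  have h := null_inverse_identity (ε := -ε) (u := v) (by rwa [neg_mul, ← sub_eq_add_neg])
  simpa [← sub_eq_add_neg] using h

/-- The conformal map in Cartesian terms: no quotient by `τ` appears, so it is smooth at `τ = 0`. -/
lemma warpMap_eq (hp : p ∈ warpDomain ε m n) : warpMap ε p =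
    mkPoint ((warpFactor ε p)⁻¹ • timePart p)
      (((warpFactor ε p)⁻¹ * ((rad p - 2 * ε * fFun p) / rad p)) • spacePart p) := by
  have hA := hp.2.1.ne'
  have hB := hp.2.2.ne'
  have hr := (rad_pos hp.1).ne'
  have hE := (warpFactor_pos hp).ne'
  have h1 : nullU p / (1 + ε * nullU p) + nullV p / (1 - ε * nullV p) =
      (warpFactor ε p)⁻¹ * tau p := by
    rw [warpFactor_eq, show tau p = nullU p + nullV p by simp only [nullU, nullV]; ring]
    exact null_add_identity hA hB
  have h2 : nullV p / (1 - ε * nullV p) - nullU p / (1 + ε * nullU p) =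
      (warpFactor ε p)⁻¹ * (rad p - 2 * ε * fFun p) := by
    rw [warpFactor_eq, fFun, show rad p = nullV p - nullU p by simp only [nullU, nullV]; ring]
    exact null_sub_identity hA hB
  unfold warpMap
  simp only
  rw [h1, h2]
  congr 1
  · rw [smul_smul]
    rcases eq_or_ne (tau p) 0 with h0 | h0
    · have : timePart p = 0 := norm_eq_zero.1 h0
      rw [this]; simp
    · rw [mul_assoc, mul_inv_cancel₀ h0, mul_one]
  · rw [smul_smul, mul_assoc]
    rfl

lemma rad_sub_pos (hp : p ∈ warpDomain ε m n) : 0 < rad p - 2 * ε * fFun p := by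
  have h1 : rad p - 2 * ε * fFun p =
      nullV p * (1 + ε * nullU p) - nullU p * (1 - ε * nullV p) := by
    simp only [fFun, nullU, nullV]; ring
  rw [h1]
  nlinarith [mul_pos (nullV_pos hp.1) hp.2.1, mul_pos (neg_pos.2 (nullU_neg hp.1)) hp.2.2]

lemma tau_warpMap (hp : p ∈ warpDomain ε m n) :
    tau (warpMap ε p) = (warpFactor ε p)⁻¹ * tau p := by
  rw [warpMap_eq hp, tau, timePart_mkPoint, norm_smul,
    Real.norm_of_nonneg (inv_nonneg.2 (warpFactor_pos hp).le)]
  rfl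

lemma rad_warpMap (hp : p ∈ warpDomain ε m n) :
    rad (warpMap ε p) = (warpFactor ε p)⁻¹ * (rad p - 2 * ε * fFun p) := by
  have hr := rad_pos hp.1
  have h1 := rad_sub_pos hp
  have h2 := warpFactor_pos hp
  rw [warpMap_eq hp, rad, spacePart_mkPoint, norm_smul, Real.norm_of_nonneg (by positivity)]
  change _ * rad p = _
  field_simp

lemma nullU_warpMap (hp : p ∈ warpDomain ε m n) :
    nullU (warpMap ε p) = nullU p / (1 + ε * nullU p) := by
  have hA := hp.2.1.ne'
  have hB := hp.2.2.ne'
  rw [nullU, tau_warpMap hp, rad_warpMap hp, warpFactor_eq, fFun,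
    show tau p = nullU p + nullV p by simp only [nullU, nullV]; ring,
    show rad p = nullV p - nullU p by simp only [nullU, nullV]; ring, 
    ← null_add_identity hA hB, ← null_sub_identity hA hB]
  ring

lemma nullV_warpMap (hp : p ∈ warpDomain ε m n) :
    nullV (warpMap ε p) = nullV p / (1 - ε * nullV p) := by
  have hA := hp.2.1.ne'
  have hB := hp.2.2.ne'
  rw [nullV, tau_warpMap hp, rad_warpMap hp, warpFactor_eq, fFun,
    show tau p = nullU p + nullV p by simp only [nullU, nullV]; ring,
    show rad p = nullV p - nullU p by simp only [nullU, nullV]; ring,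
    ← null_add_identity hA hB, ← null_sub_identity hA hB]
  ring

lemma warpMap_mem_warpDomain (hp : p ∈ warpDomain ε m n) :
    warpMap ε p ∈ warpDomain (-ε) m n := by
  have hA := hp.2.1
  have hB := hp.2.2
  have hA' := hA.ne'
  have hB' := hB.ne'
  refine ⟨?_, ?_, ?_⟩
  · change 0 < fFun _
    rw [fFun, nullU_warpMap hp, nullV_warpMap hp]
    have h1 := div_neg_of_neg_of_pos (nullU_neg hp.1) hA
    have h2 := div_pos (nullV_pos hp.1) hB
    nlinarith [mul_neg_of_neg_of_pos h1 h2]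
  · rw [nullU_warpMap hp]
    rw [null_inverse_identity hA']; positivity
  · rw [nullV_warpMap hp]
    rw [null_inverse_identity' hB']; positivity

/-- The inverse of the conformal map is obtained by changing the sign of `ε`. -/
lemma warpMap_neg_warpMap (hp : p ∈ warpDomain ε m n) : warpMap (-ε) (warpMap ε p) = p := by
  have hq := warpMap_mem_warpDomain hp
  have hA := hp.2.1.ne'
  have hB := hp.2.2.ne'
  have hE := (warpFactor_pos hp).ne'
  have hr := (rad_pos hp.1).ne'
  have hs := (rad_sub_pos hp).ne'
  have hu : nullU (warpMap ε p) / (1 + -ε * nullU (warpMap ε p)) = nullU p := by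
    rw [nullU_warpMap hp]
    rw [null_inverse_identity hA, div_div_div_cancel_right₀ hA, div_one]
  have hv : nullV (warpMap ε p) / (1 - -ε * nullV (warpMap ε p)) = nullV p := by
    rw [nullV_warpMap hp]
    rw [null_inverse_identity' hB, div_div_div_cancel_right₀ hB, div_one]
  have hdef : warpMap (-ε) (warpMap ε p) = mkPoint
      ((nullU p + nullV p) • ((tau (warpMap ε p))⁻¹ • timePart (warpMap ε p)))
      ((nullV p - nullU p) • ((rad (warpMap ε p))⁻¹ • spacePart (warpMap ε p))) := by
    have hgen : ∀ q : Spacetime m n, nullU q / (1 + -ε * nullU q) = nullU p →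
        nullV q / (1 - -ε * nullV q) = nullV p → warpMap (-ε) q =
        mkPoint ((nullU p + nullV p) • ((tau q)⁻¹ • timePart q))
          ((nullV p - nullU p) • ((rad q)⁻¹ • spacePart q)) := by
      intro q h1 h2
      simp only [warpMap, h1, h2]
    exact hgen _ hu hv
  rw [hdef, tau_warpMap hp, rad_warpMap hp,
    show nullU p + nullV p = tau p by simp only [nullU, nullV]; ring,
    show nullV p - nullU p = rad p by simp only [nullU, nullV]; ring, warpMap_eq hp]
  simp only [timePart_mkPoint, spacePart_mkPoint, smul_smul]
  refine eq_of_parts ?_ ?_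
  · rw [timePart_mkPoint]
    rcases eq_or_ne (tau p) 0 with h0 | h0
    · have : timePart p = 0 := norm_eq_zero.1 h0
      rw [this]; simp
    · have : tau p * (((warpFactor ε p)⁻¹ * tau p)⁻¹ * (warpFactor ε p)⁻¹) = 1 := by
        field_simp
      rw [this, one_smul]
  · rw [spacePart_mkPoint]
    have : rad p * (((warpFactor ε p)⁻¹ * (rad p - 2 * ε * fFun p))⁻¹ *
        ((warpFactor ε p)⁻¹ * ((rad p - 2 * ε * fFun p) / rad p))) = 1 := by
      field_simp
    rw [this, one_smul]

lemma exteriorCone_subset_warpDomain_neg (hε : 0 < ε) :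
    exteriorCone m n ⊆ warpDomain (-ε) m n := fun p hp => by
  refine ⟨hp, ?_, ?_⟩
  · nlinarith [mul_pos hε (neg_pos.2 (nullU_neg hp))]
  · nlinarith [mul_pos hε (nullV_pos hp)]

lemma warpMap_warpMap_neg (hε : 0 < ε) (hp : p ∈ exteriorCone m n) :
    warpMap ε (warpMap (-ε) p) = p := by
  have := warpMap_neg_warpMap (exteriorCone_subset_warpDomain_neg hε hp)
  rwa [neg_neg] at this

lemma warpMap_neg_mem (hε : 0 < ε) (hp : p ∈ exteriorCone m n) :
    warpMap (-ε) p ∈ warpDomain ε m n := by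
  have := warpMap_mem_warpDomain (exteriorCone_subset_warpDomain_neg hε hp)
  rwa [neg_neg] at this

/-- The smallness of `ε R` keeps the domain of the estimate inside the domain of the conformal map. -/
lemma mem_warpDomain_of_rad_lt {R : ℝ} (hε : 0 < ε) (hR : ε * R ≤ 1 / 2)
    (hp : p ∈ exteriorCone m n) (hr : rad p < R) :
    p ∈ warpDomain ε m n ∧ 1 / 2 < 1 + ε * nullU p ∧ 1 / 2 < 1 - ε * nullV p := by
  have h1 := tau_lt_rad hp
  have h2 := tau_nonneg p
  have h3 : ε * nullU p > -(1 / 2) := by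
    unfold nullU
    nlinarith
  have h4 : ε * nullV p < 1 / 2 := by
    unfold nullV
    nlinarith
  exact ⟨⟨hp, by linarith, by linarith⟩, by linarith, by linarith⟩

/-- The images under the conformal map are preimages under its inverse. -/
lemma warpMap_image_eq {R : ℝ} (hε : 0 < ε) (hR : ε * R ≤ 1 / 2) {A : Set (Spacetime m n)}
    (hA : A ∩ exteriorCone m n ⊆ {p | rad p < R}) :
    warpMap ε '' (A ∩ exteriorCone m n) = exteriorCone m n ∩ warpMap (-ε) ⁻¹' A := by
  ext p
  constructor
  · rintro ⟨q, hq, rfl⟩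
    have h1 := (mem_warpDomain_of_rad_lt hε hR hq.2 (hA hq)).1
    refine ⟨(warpMap_mem_warpDomain h1).1, ?_⟩
    rw [Set.mem_preimage, warpMap_neg_warpMap h1]
    exact hq.1
  · rintro ⟨hp, hpA⟩
    exact ⟨warpMap (-ε) p, ⟨hpA, (warpMap_neg_mem hε hp).1⟩, warpMap_warpMap_neg hε hp⟩

lemma isOpen_warpDomain (ε : ℝ) : IsOpen (warpDomain ε m n) := by
  have hu : Continuous (nullU : Spacetime m n → ℝ) := (continuous_tau.sub continuous_rad).div_const 2
  have hv : Continuous (nullV : Spacetime m n → ℝ) := (continuous_tau.add continuous_rad).div_const 2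
  exact isOpen_exteriorCone.inter ((isOpen_lt continuous_const (continuous_const.add (continuous_const.mul hu))).inter
    (isOpen_lt continuous_const (continuous_const.sub (continuous_const.mul hv))))

lemma contDiffAt_warpMap (hp : p ∈ warpDomain ε m n) : ContDiffAt ℝ ∞ (warpMap ε) p := by
  have hr := rad_pos hp.1
  have h0 : warpMap ε =ᶠ[nhds p] fun p => mkPointCLM m n
      ((warpFactor ε p)⁻¹ • timeCLM m n p,
        ((warpFactor ε p)⁻¹ * ((rad p - 2 * ε * fFun p) / rad p)) • spaceCLM m n p) := by
    filter_upwards [(isOpen_warpDomain ε).mem_nhds hp] with q hq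
    exact warpMap_eq hq
  refine ContDiffAt.congr_of_eventuallyEq ?_ h0
  have h1 : ContDiffAt ℝ ∞ (rad : Spacetime m n → ℝ) p := contDiffAt_rad hr
  have h2 : ContDiffAt ℝ ∞ (fFun : Spacetime m n → ℝ) p := contDiff_fFun.contDiffAt
  have h3 : ContDiffAt ℝ ∞ (fun p : Spacetime m n => warpFactor ε p) p :=
    (contDiffAt_const.sub (contDiffAt_const.mul h1)).add (contDiffAt_const.mul h2)
  have h4 := h3.inv (warpFactor_pos hp).ne'
  have h5 : ContDiffAt ℝ ∞ (timeCLM m n) p := (timeCLM m n).contDiff.contDiffAt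
  have h6 : ContDiffAt ℝ ∞ (spaceCLM m n) p := (spaceCLM m n).contDiff.contDiffAt
  exact (mkPointCLM m n).contDiff.contDiffAt.comp p ((h4.smul h5).prodMk
    ((h4.mul ((h1.sub (contDiffAt_const.mul h2)).div h1 hr.ne')).smul h6))

end WarpMap

/-! ### The wave operator in divergence form -/

section WaveOperator

variable {m n : ℕ} {p : Spacetime m n}

lemma partialD_mul {g h : Spacetime m n → ℝ} (hg : DifferentiableAt ℝ g p)
    (hh : DifferentiableAt ℝ h p) (l : Fin m ⊕ Fin n) :
    partialD l (fun q => g q * h q) p = partialD l g p * h p + g p * partialD l h p := by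
  simp only [partialD]
  rw [show (fun q => g q * h q) = g * h from rfl, (hg.hasFDerivAt.mul hh.hasFDerivAt).fderiv]
  simp
  ring

lemma partialD_sum {ι : Type*} {s : Finset ι} {g : ι → Spacetime m n → ℝ}
    (hg : ∀ i ∈ s, DifferentiableAt ℝ (g i) p) (l : Fin m ⊕ Fin n) :
    partialD l (fun q => ∑ i ∈ s, g i q) p = ∑ i ∈ s, partialD l (g i) p := by
  simp only [partialD]
  rw [(HasFDerivAt.fun_sum fun i hi => (hg i hi).hasFDerivAt).fderiv]
  simp

lemma partialD_congr {g h : Spacetime m n → ℝ} (H : g =ᶠ[nhds p] h) (l : Fin m ⊕ Fin n) :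
    partialD l g p = partialD l h p := by
  simp only [partialD, H.fderiv_eq]

lemma differentiableAt_partialD {z : Spacetime m n → ℝ} (hz : ContDiffAt ℝ 2 z p)
    (l : Fin m ⊕ Fin n) : DifferentiableAt ℝ (partialD l z) p := by
  have h1 : ContDiffAt ℝ 1 (fderiv ℝ z) p := hz.fderiv_right (by norm_num)
  exact (h1.differentiableAt (by norm_num)).clm_apply (differentiableAt_const _)

/-- If `H` is the inverse of the matrix of the metric and `σ` has the logarithmic derivative of
`√|det G|` (Jacobi's formula is the hypothesis `htr`), the wave operator is
`σ⁻¹ ∂_i (σ H^{ik} ∂_k z)`. -/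
lemma box_eq_divergence {G : Spacetime m n → Spacetime m n → Spacetime m n → ℝ}
    {H : Spacetime m n → Matrix (Fin m ⊕ Fin n) (Fin m ⊕ Fin n) ℝ} {σ z : Spacetime m n → ℝ}
    (hz : ContDiffAt ℝ 2 z p)
    (hG : ∀ i j, DifferentiableAt ℝ (fun q => metricMatrix G q i j) p)
    (hH : ∀ i j, DifferentiableAt ℝ (fun q => H q i j) p)
    (hHs : ∀ i j, H p i j = H p j i)
    (hinv : ∀ᶠ q in nhds p, H q * metricMatrix G q = 1)
    (hσ : DifferentiableAt ℝ σ p) (hσ0 : σ p ≠ 0)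
    (htr : ∀ l, ∑ i, ∑ j, H p i j * partialD l (fun q => metricMatrix G q i j) p
      = 2 * (partialD l σ p / σ p)) :
    box G z p = (σ p)⁻¹ * divergence (fun q => σ q •
      (WithLp.toLp 2 fun i => ∑ k, H q i k * partialD k z q : Spacetime m n)) p := by
  have hz1 := fun k => differentiableAt_partialD hz k
  have hinvp := hinv.self_of_nhds
  have hinv' : (metricMatrix G p)⁻¹ = H p := Matrix.inv_eq_left_inv hinvp
  have hinvp' : metricMatrix G p * H p = 1 := mul_eq_one_comm.1 hinvp
  -- the derivative of the inverse matrix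
  have hdH : ∀ l i k, partialD l (fun q => H q i k) p = -∑ j, ∑ e,
      H p i j * partialD l (fun q => metricMatrix G q j e) p * H p e k := by
    intro l i k
    have h1 : (Matrix.of fun i j => partialD l (fun q => H q i j) p) * metricMatrix G p
        = -(H p * Matrix.of fun i j => partialD l (fun q => metricMatrix G q i j) p) := by
      ext i k
      have h2 : (fun q => ∑ j, H q i j * metricMatrix G q j k) =ᶠ[nhds p]
          fun _ => (1 : Matrix (Fin m ⊕ Fin n) (Fin m ⊕ Fin n) ℝ) i k := by
        filter_upwards [hinv] with q hq
        rw [← hq, Matrix.mul_apply]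
      have h3 := partialD_congr h2 l
      rw [partialD_sum (fun j _ => (hH i j).fun_mul (hG j k))] at h3
      simp only [partialD_mul (hH _ _) (hG _ _), Finset.sum_add_distrib] at h3
      have h4 : partialD l (fun _ : Spacetime m n =>
          (1 : Matrix (Fin m ⊕ Fin n) (Fin m ⊕ Fin n) ℝ) i k) p = 0 := by simp [partialD]
      rw [h4] at h3
      simp only [Matrix.mul_apply, Matrix.neg_apply, Matrix.of_apply]
      linarith
    have h5 := congrArg (fun M => (M * H p) i k) h1
    simp only [Matrix.mul_assoc, hinvp', mul_one, Matrix.neg_mul, Matrix.neg_apply] at h5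
    rw [Matrix.of_apply] at h5
    rw [h5]
    simp only [Matrix.mul_apply, Matrix.of_apply, Finset.mul_sum, mul_assoc]
  have hX : ∀ i, partialD i (fun q => σ q * ∑ k, H q i k * partialD k z q) p =
      partialD i σ p * ∑ k, H p i k * partialD k z p + σ p * ∑ k,
        (partialD i (fun q => H q i k) p * partialD k z p
          + H p i k * partialD i (partialD k z) p) := by
    intro i
    rw [partialD_mul hσ (DifferentiableAt.fun_sum fun k _ => (hH i k).fun_mul (hz1 k)),
      partialD_sum (fun k _ => (hH i k).fun_mul (hz1 k))]
    simp only [partialD_mul (hH _ _) (hz1 _)]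
  have hdiv : divergence (fun q => σ q •
      (WithLp.toLp 2 fun i => ∑ k, H q i k * partialD k z q : Spacetime m n)) p =
      ∑ i, partialD i (fun q => σ q * ∑ k, H q i k * partialD k z q) p := rfl
  rw [hdiv]
  simp only [hX]
  -- the contracted Christoffel symbols
  have hΓ : ∀ k, ∑ i, ∑ j, H p i j * christoffel G k i j p =
      -∑ i, partialD i (fun q => H q i k) p - ∑ i, partialD i σ p / σ p * H p i k := by
    intro k
    simp only [christoffel, hinv', hdH]
    set dG := fun l i j => partialD l (fun q => metricMatrix G q i j) p with hdG
    have e1 : ∑ i, ∑ j, H p i j * (1 / 2 * ∑ l, H p k l * (dG i j l + dG j i l - dG l i j)) =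
        1 / 2 * (∑ i, ∑ j, ∑ l, H p i j * H p k l * dG i j l)
        + 1 / 2 * (∑ i, ∑ j, ∑ l, H p i j * H p k l * dG j i l)
        - 1 / 2 * (∑ i, ∑ j, ∑ l, H p i j * H p k l * dG l i j) := by
      simp only [Finset.mul_sum, ← Finset.sum_add_distrib, ← Finset.sum_sub_distrib]
      refine Finset.sum_congr rfl fun i _ => Finset.sum_congr rfl fun j _ =>
        Finset.sum_congr rfl fun l _ => ?_
      ring
    have e2 : ∑ i, ∑ j, ∑ l, H p i j * H p k l * dG j i l =
        ∑ i, ∑ j, ∑ l, H p i j * H p k l * dG i j l := by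
      rw [Finset.sum_comm]
      refine Finset.sum_congr rfl fun i _ => Finset.sum_congr rfl fun j _ =>
        Finset.sum_congr rfl fun l _ => ?_
      rw [hHs j i]
    have e3 : ∑ i, ∑ j, ∑ l, H p i j * H p k l * dG l i j =
        2 * ∑ i, partialD i σ p / σ p * H p i k := by
      have : ∀ l, ∑ i, ∑ j, H p i j * dG l i j = 2 * (partialD l σ p / σ p) := htr
      rw [Finset.mul_sum, Finset.sum_congr rfl fun i _ => Finset.sum_comm, Finset.sum_comm]
      refine Finset.sum_congr rfl fun l _ => ?_
      rw [← mul_assoc, ← this l, Finset.sum_mul]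
      refine Finset.sum_congr rfl fun i _ => ?_
      rw [Finset.sum_mul]
      refine Finset.sum_congr rfl fun j _ => ?_
      rw [hHs k l]; ring
    have e4 : ∑ i, -∑ j, ∑ e, H p i j * dG i j e * H p e k =
        -∑ i, ∑ j, ∑ l, H p i j * H p k l * dG i j l := by
      rw [Finset.sum_neg_distrib]
      congr 1
      refine Finset.sum_congr rfl fun i _ => Finset.sum_congr rfl fun j _ =>
        Finset.sum_congr rfl fun l _ => ?_
      rw [hHs k l]; ring
    change ∑ i, ∑ j, H p i j * (1 / 2 * ∑ l, H p k l * (dG i j l + dG j i l - dG l i j)) =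
      -(∑ i, -∑ j, ∑ e, H p i j * dG i j e * H p e k) - _
    rw [e1, e2, e3, e4]
    ring
  have hL : box G z p = (∑ i, ∑ j, H p i j * partialD i (partialD j z) p)
      - ∑ k, (∑ i, ∑ j, H p i j * christoffel G k i j p) * partialD k z p := by
    have f1 : ∑ k, (∑ i, ∑ j, H p i j * christoffel G k i j p) * partialD k z p =
        ∑ i, ∑ j, H p i j * ∑ k, christoffel G k i j p * partialD k z p := by
      simp only [Finset.sum_mul, Finset.mul_sum]
      rw [Finset.sum_comm]
      refine Finset.sum_congr rfl fun i _ => ?_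
      rw [Finset.sum_comm]
      refine Finset.sum_congr rfl fun j _ => Finset.sum_congr rfl fun k _ => by ring
    rw [f1, box, hinv']
    simp only [hessian, mul_sub, Finset.sum_sub_distrib]
  rw [hL]
  simp only [hΓ]
  have hR : ∀ i, (σ p)⁻¹ * (partialD i σ p * ∑ k, H p i k * partialD k z p + σ p * ∑ k,
        (partialD i (fun q => H q i k) p * partialD k z p
          + H p i k * partialD i (partialD k z) p)) =
      ∑ k, (H p i k * partialD i (partialD k z) p
        + (partialD i (fun q => H q i k) p + partialD i σ p / σ p * H p i k) * partialD k z p) := by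
    intro i
    rw [mul_add, ← mul_assoc, ← mul_assoc, inv_mul_cancel₀ hσ0, one_mul, Finset.mul_sum,
      ← Finset.sum_add_distrib]
    refine Finset.sum_congr rfl fun k _ => ?_
    ring
  rw [Finset.mul_sum, Finset.sum_congr rfl fun i _ => hR i]
  simp only [Finset.sum_add_distrib]
  have g1 : ∑ i, ∑ k, (partialD i (fun q => H q i k) p + partialD i σ p / σ p * H p i k)
        * partialD k z p =
      ∑ k, (∑ i, partialD i (fun q => H q i k) p + ∑ i, partialD i σ p / σ p * H p i k)
        * partialD k z p := by
    rw [Finset.sum_comm]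
    refine Finset.sum_congr rfl fun k _ => ?_
    rw [← Finset.sum_add_distrib, Finset.sum_mul]
  rw [g1, sub_eq_add_neg, ← Finset.sum_neg_distrib]
  congr 1
  refine Finset.sum_congr rfl fun k _ => by ring

end WaveOperator

/-! ### The warped metric in Cartesian coordinates -/

section WarpedMetric

variable {m n : ℕ} {ε : ℝ} {p : Spacetime m n}

/-- The ratio `s = ρ̄ / r` by which the warped metric stretches the spheres `r = const`. -/
def warpRatio (ε : ℝ) (p : Spacetime m n) : ℝ := warpedRadius ε p / rad p

/-- `√|det ḡ| = s^{n-1}` in Cartesian coordinates. -/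
def volDensity (ε : ℝ) (p : Spacetime m n) : ℝ := warpRatio ε p ^ (n - 1)

/-- The inverse of the warped metric, as the operator that turns the Euclidean gradient of a
function into its `ḡ`-gradient: it is `-1` on the temporal part, `1` on the radial direction and
`s⁻²` on the directions tangent to the spheres `r = const`. -/
def raise (ε : ℝ) (p W : Spacetime m n) : Spacetime m n :=
  mkPoint (-timePart W) ((warpRatio ε p ^ 2)⁻¹ • spacePart W
    + ((1 - (warpRatio ε p ^ 2)⁻¹) / rad p ^ 2 * ⟪spacePart p, spacePart W⟫) • spacePart p)

/-- The matrix of `raise`, that is the matrix `ḡ^{ij}`. -/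
def cometricMatrix (ε : ℝ) (p : Spacetime m n) : Matrix (Fin m ⊕ Fin n) (Fin m ⊕ Fin n) ℝ :=
  Matrix.fromBlocks (-1) 0 0 ((warpRatio ε p ^ 2)⁻¹ • 1
    + ((1 - (warpRatio ε p ^ 2)⁻¹) / rad p ^ 2) •
      Matrix.vecMulVec (fun j => p (Sum.inr j)) (fun j => p (Sum.inr j)))

lemma warpRatio_pos (hε : 0 < ε) (hp : p ∈ exteriorCone m n) : 0 < warpRatio ε p := by
  have h1 := rad_pos hp
  have h2 : 0 < fFun p := hp
  exact div_pos (by unfold warpedRadius; positivity) h1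

lemma warpRatio_eq (hr : 0 < rad p) : warpRatio ε p = 1 + 2 * ε * fFun p / rad p := by
  rw [warpRatio, warpedRadius]; field_simp

lemma contDiffAt_warpRatio {k : WithTop ℕ∞} (hk : k ≤ ∞) (hr : 0 < rad p) :
    ContDiffAt ℝ k (warpRatio ε : Spacetime m n → ℝ) p :=
  ((contDiffAt_rad hr).add (contDiffAt_const.mul (contDiff_fFun.of_le hk).contDiffAt)).div
    (contDiffAt_rad hr) hr.ne'

lemma volDensity_pos (hε : 0 < ε) (hp : p ∈ exteriorCone m n) : 0 < volDensity ε p :=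
  pow_pos (warpRatio_pos hε hp) _

lemma warpedMetric_eq (hr : 0 < rad p) (X Y : Spacetime m n) : warpedMetric ε p X Y =
    -⟪timePart X, timePart Y⟫ + warpRatio ε p ^ 2 * ⟪spacePart X, spacePart Y⟫
      + (1 - warpRatio ε p ^ 2) / rad p ^ 2
        * (⟪spacePart p, spacePart X⟫ * ⟪spacePart p, spacePart Y⟫) := by
  simp only [warpedMetric, dU, dV, spatialAngular, temporalAngular, warpRatio, dRad]
  field_simp
  ring

lemma inner_raise (W W' : Spacetime m n) : ⟪W, raise ε p W'⟫ =
    -⟪timePart W, timePart W'⟫ + (warpRatio ε p ^ 2)⁻¹ * ⟪spacePart W, spacePart W'⟫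
      + (1 - (warpRatio ε p ^ 2)⁻¹) / rad p ^ 2
        * (⟪spacePart p, spacePart W⟫ * ⟪spacePart p, spacePart W'⟫) := by
  rw [inner_eq_parts, raise, timePart_mkPoint, spacePart_mkPoint, inner_neg_right, inner_add_right,
    inner_smul_right, inner_smul_right, real_inner_comm (spacePart p) (spacePart W)]
  ring

lemma inner_raise_comm (W W' : Spacetime m n) : ⟪W, raise ε p W'⟫ = ⟪W', raise ε p W⟫ := by
  rw [inner_raise, inner_raise, real_inner_comm (timePart W') (timePart W),
    real_inner_comm (spacePart W') (spacePart W)]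
  ring

lemma raise_smul (c : ℝ) (W : Spacetime m n) : raise ε p (c • W) = c • raise ε p W := by
  refine ext_inner_left ℝ fun Y => ?_
  rw [inner_raise, inner_smul_right, inner_raise, timePart_smul, spacePart_smul]
  simp only [inner_smul_right]
  ring

lemma raise_add (W W' : Spacetime m n) :
    raise ε p (W + W') = raise ε p W + raise ε p W' := by
  refine ext_inner_left ℝ fun Y => ?_
  rw [inner_raise, inner_add_right, inner_raise, inner_raise, timePart_add, spacePart_add]
  simp only [inner_add_right]
  ring

/-- The metric turns the `ḡ`-gradient back into the differential. -/
lemma warpedMetric_raise (hr : 0 < rad p) (hs : warpRatio ε p ≠ 0) (W Y : Spacetime m n) :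
    warpedMetric ε p (raise ε p W) Y = ⟪W, Y⟫ := by
  rw [warpedMetric_eq hr, inner_eq_parts, raise, timePart_mkPoint, spacePart_mkPoint,
    inner_neg_left, inner_add_left, inner_add_right, inner_smul_left, inner_smul_left,
    inner_smul_right, inner_smul_right, real_inner_self_eq_norm_sq,
    show ‖spacePart p‖ = rad p from rfl]
  have hr' := hr.ne'
  simp only [conj_trivial]
  field_simp
  ring

lemma warpedMetric_comm (X Y : Spacetime m n) :
    warpedMetric ε p X Y = warpedMetric ε p Y X := by
  simp only [warpedMetric, spatialAngular, temporalAngular, real_inner_comm (spacePart X),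
    real_inner_comm (timePart X)]
  ring

lemma inner_spacePart_coordVec (x : EuclideanSpace ℝ (Fin n)) (j : Fin n) :
    ⟪x, spacePart (coordVec (Sum.inr j) : Spacetime m n)⟫ = x j := by
  have : spacePart (coordVec (Sum.inr j) : Spacetime m n) = EuclideanSpace.single j 1 := by
    ext k; simp [spacePart, coordVec]
  rw [this, EuclideanSpace.inner_single_right]; simp

lemma spacePart_coordVec_inl (i : Fin m) :
    spacePart (coordVec (Sum.inl i) : Spacetime m n) = 0 := by
  ext k; simp [spacePart, coordVec]

lemma timePart_coordVec_inr (j : Fin n) :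
    timePart (coordVec (Sum.inr j) : Spacetime m n) = 0 := by
  ext k; simp [timePart, coordVec]

lemma inner_timePart_coordVec (x : EuclideanSpace ℝ (Fin m)) (j : Fin m) :
    ⟪x, timePart (coordVec (Sum.inl j) : Spacetime m n)⟫ = x j := by
  have : timePart (coordVec (Sum.inl j) : Spacetime m n) = EuclideanSpace.single j 1 := by
    ext k; simp [timePart, coordVec]
  rw [this, EuclideanSpace.inner_single_right]; simp

lemma metricMatrix_warpedMetric (hr : 0 < rad p) : metricMatrix (warpedMetric ε) p =
    Matrix.fromBlocks (-1) 0 0 ((warpRatio ε p ^ 2) • 1 + ((1 - warpRatio ε p ^ 2) / rad p ^ 2) •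
      Matrix.vecMulVec (fun j => p (Sum.inr j)) (fun j => p (Sum.inr j))) := by
  ext i j
  rw [metricMatrix, Matrix.of_apply, warpedMetric_eq hr]
  rcases i with i | i <;> rcases j with j | j <;>
    simp only [spacePart_coordVec_inl, timePart_coordVec_inr, inner_zero_left, inner_zero_right,
      inner_spacePart_coordVec, inner_timePart_coordVec, Matrix.fromBlocks_apply₁₁,
      Matrix.fromBlocks_apply₁₂, Matrix.fromBlocks_apply₂₁, Matrix.fromBlocks_apply₂₂]
  · simp [timePart, coordVec, Matrix.one_apply, eq_comm]
  · simp
  · simp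
  · simp [spacePart, coordVec, Matrix.one_apply, Matrix.vecMulVec_apply, eq_comm]

lemma sum_spacePart_sq (p : Spacetime m n) :
    ∑ j, p (Sum.inr j) * p (Sum.inr j) = rad p ^ 2 := by
  rw [rad, EuclideanSpace.norm_sq_eq]
  simp [spacePart, sq]

lemma cometricMatrix_mul (hr : 0 < rad p) (hs : warpRatio ε p ≠ 0) :
    cometricMatrix ε p * metricMatrix (warpedMetric ε) p = 1 := by
  rw [metricMatrix_warpedMetric hr, cometricMatrix, Matrix.fromBlocks_multiply]
  simp only [Matrix.mul_zero, Matrix.zero_mul, add_zero, zero_add, Matrix.mul_neg, Matrix.mul_one,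
    neg_neg]
  rw [← Matrix.fromBlocks_one]
  congr 1
  · exact neg_zero
  simp only [add_mul, mul_add, Matrix.smul_mul, Matrix.mul_smul, one_mul, mul_one,
    Matrix.vecMulVec_mul_vecMulVec]
  ext i j
  have h1 : (fun j => p (Sum.inr j)) ⬝ᵥ (fun j => p (Sum.inr j)) = rad p ^ 2 :=
    sum_spacePart_sq p
  simp only [h1, Matrix.add_apply, Matrix.smul_apply, Matrix.vecMulVec_apply, Pi.smul_apply,
    smul_eq_mul]
  have hr' := hr.ne'
  field_simp
  ring

lemma cometricMatrix_comm (i j : Fin m ⊕ Fin n) :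
    cometricMatrix ε p i j = cometricMatrix ε p j i := by
  rcases i with i | i <;> rcases j with j | j <;>
    simp [cometricMatrix, Matrix.one_apply, Matrix.vecMulVec_apply, eq_comm, mul_comm]

lemma raise_apply (W : Spacetime m n) (i : Fin m ⊕ Fin n) :
    raise ε p W i = ∑ k, cometricMatrix ε p i k * W k := by
  rw [Fintype.sum_sum_type]
  rcases i with i | i
  · simp [raise, cometricMatrix, mkPoint, timePart, Matrix.one_apply, neg_ite]
  · simp only [raise, mkPoint, cometricMatrix, Matrix.fromBlocks_apply₂₁,
      Matrix.fromBlocks_apply₂₂, Matrix.zero_apply, zero_mul, Finset.sum_const_zero, zero_add,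
      Matrix.add_apply, Matrix.smul_apply, Matrix.one_apply, Matrix.vecMulVec_apply, smul_eq_mul,
      Sum.elim_inr, add_mul, Finset.sum_add_distrib]
    simp [spacePart, PiLp.inner_apply, Finset.mul_sum, Finset.sum_mul]
    refine Finset.sum_congr rfl fun _ _ => by ring

/-- The volume density of the warped metric is `(ρ̄/r)^(n-1)`: on the space directions its matrix is
`s² (1 + c x xᵀ)` with `s = ρ̄/r`, a multiple of a perturbation of the identity of rank one. -/
lemma sqrt_abs_det_metricMatrix (hn : 1 ≤ n) (hε : 0 < ε) (hp : p ∈ exteriorCone m n) :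
    Real.sqrt |(metricMatrix (warpedMetric ε) p).det| = volDensity ε p := by
  have hr := rad_pos hp
  have hs := warpRatio_pos hε hp
  rw [metricMatrix_warpedMetric hr, Matrix.det_fromBlocks_zero₁₂, abs_mul]
  have h1 : |(-1 : Matrix (Fin m) (Fin m) ℝ).det| = 1 := by
    rw [Matrix.det_neg, Matrix.det_one, mul_one, abs_pow]; simp
  have h2 : (warpRatio ε p ^ 2) • (1 : Matrix (Fin n) (Fin n) ℝ)
      + ((1 - warpRatio ε p ^ 2) / rad p ^ 2) •
      Matrix.vecMulVec (fun j => p (Sum.inr j)) (fun j => p (Sum.inr j)) =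
      (warpRatio ε p ^ 2) • (1 + Matrix.replicateCol Unit
        (fun j => (1 - warpRatio ε p ^ 2) / rad p ^ 2 / warpRatio ε p ^ 2 * p (Sum.inr j))
        * Matrix.replicateRow Unit fun j => p (Sum.inr j)) := by
    ext i j
    simp only [Matrix.add_apply, Matrix.smul_apply, Matrix.vecMulVec_apply, smul_eq_mul,
      Matrix.mul_apply, Matrix.replicateCol_apply, Matrix.replicateRow_apply, Finset.univ_unique,
      Finset.sum_const, Finset.card_singleton, one_smul]
    field_simp
  have h3 : (fun j => p (Sum.inr j)) ⬝ᵥ (fun j : Fin n =>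
      (1 - warpRatio ε p ^ 2) / rad p ^ 2 / warpRatio ε p ^ 2 * p (Sum.inr j)) =
      (1 - warpRatio ε p ^ 2) / warpRatio ε p ^ 2 := by
    have : (fun j => p (Sum.inr j)) ⬝ᵥ (fun j : Fin n =>
      (1 - warpRatio ε p ^ 2) / rad p ^ 2 / warpRatio ε p ^ 2 * p (Sum.inr j)) =
      (1 - warpRatio ε p ^ 2) / rad p ^ 2 / warpRatio ε p ^ 2 *
        ∑ j, p (Sum.inr j) * p (Sum.inr j) := by
      rw [Finset.mul_sum]
      exact Finset.sum_congr rfl fun _ _ => by ring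
    rw [this, sum_spacePart_sq]
    field_simp
  rw [h1, one_mul, h2, Matrix.det_smul, Matrix.det_one_add_replicateCol_mul_replicateRow, h3,
    Fintype.card_fin]
  obtain ⟨k, rfl⟩ : ∃ k, n = k + 1 := ⟨n - 1, by omega⟩
  have h4 : (warpRatio ε p ^ 2) ^ (k + 1) * (1 + (1 - warpRatio ε p ^ 2) / warpRatio ε p ^ 2) =
      (warpRatio ε p ^ k) ^ 2 := by
    rw [pow_succ]
    field_simp
    ring
  rw [h4, abs_of_nonneg (sq_nonneg _), Real.sqrt_sq (by positivity)]
  rfl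

lemma differentiableAt_coord (i : Fin m ⊕ Fin n) :
    DifferentiableAt ℝ (fun q : Spacetime m n => q i) p :=
  differentiableAt_euclidean.1 differentiableAt_id i

lemma contDiffAt_cometricMatrix {k : WithTop ℕ∞} (hk : k ≤ ∞) (hε : 0 < ε)
    (hp : p ∈ exteriorCone m n)
    (i j : Fin m ⊕ Fin n) : ContDiffAt ℝ k (fun q => cometricMatrix ε q i j) p := by
  have hr := rad_pos hp
  have h1 : ContDiffAt ℝ k (fun q : Spacetime m n => (warpRatio ε q ^ 2)⁻¹) p :=
    ((contDiffAt_warpRatio hk hr).pow 2).inv (pow_pos (warpRatio_pos hε hp) 2).ne'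
  have h2 : ContDiffAt ℝ k (fun q : Spacetime m n => rad q ^ 2) p := (contDiffAt_rad hr).pow 2
  have hc : ∀ i : Fin m ⊕ Fin n, ContDiffAt ℝ k (fun q : Spacetime m n => q i) p :=
    fun i => contDiffAt_euclidean.1 contDiffAt_id i
  rcases i with i | i <;> rcases j with j | j
  · exact contDiffAt_const
  · exact contDiffAt_const
  · exact contDiffAt_const
  · exact (h1.mul contDiffAt_const).add
      (((contDiffAt_const.sub h1).div h2 (pow_pos hr 2).ne').mul ((hc _).mul (hc _)))

/-- The derivative of the matrix of the warped metric, and Jacobi's formula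
`tr (ḡ⁻¹ ∂_l ḡ) = 2 (n - 1) ∂_l s / s`. -/
lemma trace_cometric_mul_deriv (hn : 1 ≤ n) (hε : 0 < ε) (hp : p ∈ exteriorCone m n) :
    (∀ i j, DifferentiableAt ℝ (fun q => metricMatrix (warpedMetric ε) q i j) p) ∧
    ∀ l, ∑ i, ∑ j, cometricMatrix ε p i j *
        partialD l (fun q => metricMatrix (warpedMetric ε) q i j) p
      = 2 * (partialD l (volDensity ε) p / volDensity ε p) := by
  have hr := rad_pos hp
  have hs := warpRatio_pos hε hp
  have hev : ∀ i j, (fun q => metricMatrix (warpedMetric ε) q i j) =ᶠ[nhds p] fun q =>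
      Matrix.fromBlocks (-1) 0 0 ((warpRatio ε q ^ 2) • 1 + ((1 - warpRatio ε q ^ 2) / rad q ^ 2) •
      Matrix.vecMulVec (fun j => q (Sum.inr j)) (fun j => q (Sum.inr j))) i j := by
    intro i j
    filter_upwards [continuous_rad.continuousAt.eventually (lt_mem_nhds hr)] with q hq
    rw [metricMatrix_warpedMetric hq]
  have hd1 : DifferentiableAt ℝ (warpRatio ε : Spacetime m n → ℝ) p :=
    (contDiffAt_warpRatio (k := 1) (by simp) hr).differentiableAt (by norm_num)
  have hd2 : DifferentiableAt ℝ (fun q : Spacetime m n => warpRatio ε q ^ 2) p := hd1.pow 2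
  have hd3 : DifferentiableAt ℝ (rad : Spacetime m n → ℝ) p :=
    (contDiffAt_rad (k := 1) hr).differentiableAt (by norm_num)
  have hd4 : DifferentiableAt ℝ (fun q : Spacetime m n =>
      (1 - warpRatio ε q ^ 2) / rad q ^ 2) p :=
    by
    simp only [div_eq_mul_inv]
    exact ((differentiableAt_const _).sub hd2).mul ((hd3.fun_pow 2).inv (pow_pos hr 2).ne')
  have hdd : ∀ i j : Fin n, DifferentiableAt ℝ (fun q : Spacetime m n =>
      q (Sum.inr i) * q (Sum.inr j)) p := fun i j =>
    (differentiableAt_coord _).fun_mul (differentiableAt_coord _)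
  refine ⟨fun i j => (DifferentiableAt.congr_of_eventuallyEq ?_ (hev i j)), fun l => ?_⟩
  · rcases i with i | i <;> rcases j with j | j
    · exact differentiableAt_const _
    · exact differentiableAt_const _
    · exact differentiableAt_const _
    · exact (hd2.mul (differentiableAt_const _)).add (hd4.mul (hdd i j))
  set e : Fin n → ℝ := fun j => partialD l (fun q : Spacetime m n => q (Sum.inr j)) p with he
  set A := partialD l (fun q : Spacetime m n => warpRatio ε q ^ 2) p with hA
  set B := partialD l (fun q : Spacetime m n => (1 - warpRatio ε q ^ 2) / rad q ^ 2) p with hB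
  have hc0 : ∀ c : ℝ, partialD l (fun _ : Spacetime m n => c) p = 0 := fun c => by simp [partialD]
  have hpart : ∀ i j : Fin n, partialD l
      (fun q => metricMatrix (warpedMetric ε) q (Sum.inr i) (Sum.inr j)) p =
      A * (1 : Matrix (Fin n) (Fin n) ℝ) i j + B * (p (Sum.inr i) * p (Sum.inr j))
      + (1 - warpRatio ε p ^ 2) / rad p ^ 2
        * (e i * p (Sum.inr j) + p (Sum.inr i) * e j) := by
    intro i j
    rw [partialD_congr (hev _ _) l]
    have h1 : (fun q : Spacetime m n => Matrix.fromBlocks (-1 : Matrix (Fin m) (Fin m) ℝ) 0 0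
      ((warpRatio ε q ^ 2) • 1 + ((1 - warpRatio ε q ^ 2) / rad q ^ 2) •
      Matrix.vecMulVec (fun j => q (Sum.inr j)) (fun j => q (Sum.inr j))) (Sum.inr i) (Sum.inr j))
      = fun q => ∑ b : Bool, if b then (warpRatio ε q ^ 2) * (1 : Matrix (Fin n) (Fin n) ℝ) i j
        else ((1 - warpRatio ε q ^ 2) / rad q ^ 2) * (q (Sum.inr i) * q (Sum.inr j)) := by
      ext q
      simp [Matrix.vecMulVec_apply]
    rw [h1, partialD_sum]
    · simp only [Fintype.sum_bool, if_true, Bool.false_eq_true, if_false]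
      rw [partialD_mul hd2 (differentiableAt_const _), partialD_mul hd4 (hdd i j),
        partialD_mul (differentiableAt_coord _) (differentiableAt_coord _), hc0]
      ring
    · rintro (_ | _) -
      · simpa using hd4.fun_mul (hdd i j)
      · simpa using hd2.fun_mul (differentiableAt_const _)
  have hzero : ∀ i j, (∀ i' j', ¬ (i = Sum.inr i' ∧ j = Sum.inr j')) → partialD l
      (fun q => metricMatrix (warpedMetric ε) q i j) p = 0 := by
    intro i j hij
    rw [partialD_congr (hev _ _) l]
    rcases i with i | i <;> rcases j with j | j
    · exact hc0 _
    · exact hc0 _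
    · exact hc0 _
    · exact absurd ⟨rfl, rfl⟩ (hij i j)
  -- differentiate `κ r² = 1 - s²`, where `κ` is the coefficient of `x ⊗ x` in the metric
  have hrel : B * rad p ^ 2 + (1 - warpRatio ε p ^ 2) / rad p ^ 2
      * (2 * ∑ j, e j * p (Sum.inr j)) = -A := by
    have h1 : (fun q : Spacetime m n => (1 - warpRatio ε q ^ 2) / rad q ^ 2 *
        ∑ j, q (Sum.inr j) * q (Sum.inr j)) =ᶠ[nhds p] fun q => 1 + (-1) * warpRatio ε q ^ 2 := by
      filter_upwards [continuous_rad.continuousAt.eventually (lt_mem_nhds hr)] with q hq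
      rw [sum_spacePart_sq]
      have : rad q ≠ 0 := hq.ne'
      field_simp
      ring
    have h2 := partialD_congr h1 l
    have h4 : partialD l (fun q : Spacetime m n => 1 + (-1) * warpRatio ε q ^ 2) p = -A := by
      simp only [partialD, hA]
      rw [((hd2.hasFDerivAt.const_mul (-1)).const_add 1).fderiv]
      simp
    rw [h4, partialD_mul hd4 (DifferentiableAt.fun_sum fun j _ => hdd j j), sum_spacePart_sq,
      partialD_sum (fun j _ => hdd j j)] at h2
    simp only [partialD_mul (differentiableAt_coord _) (differentiableAt_coord _)] at h2
    rw [← h2, Finset.mul_sum]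
    congr 2
    exact Finset.sum_congr rfl fun j _ => by simp only [he]; ring
  have hsum : ∑ i, ∑ j, cometricMatrix ε p i j *
        partialD l (fun q => metricMatrix (warpedMetric ε) q i j) p =
      ∑ i : Fin n, ∑ j : Fin n, ((warpRatio ε p ^ 2)⁻¹ * (1 : Matrix (Fin n) (Fin n) ℝ) i j
        + (1 - (warpRatio ε p ^ 2)⁻¹) / rad p ^ 2 * (p (Sum.inr i) * p (Sum.inr j))) *
      (A * (1 : Matrix (Fin n) (Fin n) ℝ) i j + B * (p (Sum.inr i) * p (Sum.inr j))
      + (1 - warpRatio ε p ^ 2) / rad p ^ 2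
        * (e i * p (Sum.inr j) + p (Sum.inr i) * e j)) := by
    rw [Fintype.sum_sum_type]
    simp only [Fintype.sum_sum_type]
    have z1 : ∀ (i : Fin m) (j : Fin m ⊕ Fin n), partialD l
      (fun q => metricMatrix (warpedMetric ε) q (Sum.inl i) j) p = 0 := fun i j =>
      hzero _ _ (by simp)
    have z2 : ∀ (i : Fin n) (j : Fin m), partialD l
      (fun q => metricMatrix (warpedMetric ε) q (Sum.inr i) (Sum.inl j)) p = 0 := fun i j =>
      hzero _ _ (by simp)
    simp only [z1, z2, hpart, mul_zero, Finset.sum_const_zero, zero_add]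
    rfl
  rw [hsum]
  have hexp : ∑ i : Fin n, ∑ j : Fin n, ((warpRatio ε p ^ 2)⁻¹ * (1 : Matrix (Fin n) (Fin n) ℝ) i j
        + (1 - (warpRatio ε p ^ 2)⁻¹) / rad p ^ 2 * (p (Sum.inr i) * p (Sum.inr j))) *
      (A * (1 : Matrix (Fin n) (Fin n) ℝ) i j + B * (p (Sum.inr i) * p (Sum.inr j))
      + (1 - warpRatio ε p ^ 2) / rad p ^ 2
        * (e i * p (Sum.inr j) + p (Sum.inr i) * e j)) =
      (warpRatio ε p ^ 2)⁻¹ * (n * A + B * rad p ^ 2 + (1 - warpRatio ε p ^ 2) / rad p ^ 2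
        * (2 * ∑ j, e j * p (Sum.inr j)))
      + (1 - (warpRatio ε p ^ 2)⁻¹) * (A + B * rad p ^ 2 + (1 - warpRatio ε p ^ 2) / rad p ^ 2
        * (2 * ∑ j, e j * p (Sum.inr j))) := by
    set h := (warpRatio ε p ^ 2)⁻¹
    set κ := (1 - warpRatio ε p ^ 2) / rad p ^ 2
    have hk' : (1 - h) = (1 - h) / rad p ^ 2 * ∑ j, p (Sum.inr j) * p (Sum.inr j) := by
      rw [sum_spacePart_sq]; field_simp
    set k' := (1 - h) / rad p ^ 2
    have hin : ∀ i : Fin n, ∑ j : Fin n, (h * (1 : Matrix (Fin n) (Fin n) ℝ) i j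
        + k' * (p (Sum.inr i) * p (Sum.inr j))) *
      (A * (1 : Matrix (Fin n) (Fin n) ℝ) i j + B * (p (Sum.inr i) * p (Sum.inr j))
      + κ * (e i * p (Sum.inr j) + p (Sum.inr i) * e j)) =
      h * (A + B * (p (Sum.inr i) * p (Sum.inr i)) + κ * (2 * (e i * p (Sum.inr i))))
      + k' * (p (Sum.inr i) * p (Sum.inr i) * A
        + B * (p (Sum.inr i) * p (Sum.inr i)) * (∑ j, p (Sum.inr j) * p (Sum.inr j))
        + κ * (e i * p (Sum.inr i) * (∑ j, p (Sum.inr j) * p (Sum.inr j))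
          + p (Sum.inr i) * p (Sum.inr i) * ∑ j, e j * p (Sum.inr j))) := by
      intro i
      have hs1 : ∀ j : Fin n, (h * (1 : Matrix (Fin n) (Fin n) ℝ) i j
        + k' * (p (Sum.inr i) * p (Sum.inr j))) *
      (A * (1 : Matrix (Fin n) (Fin n) ℝ) i j + B * (p (Sum.inr i) * p (Sum.inr j))
      + κ * (e i * p (Sum.inr j) + p (Sum.inr i) * e j)) =
        (if i = j then (h * (A + B * (p (Sum.inr i) * p (Sum.inr j))
          + κ * (e i * p (Sum.inr j) + p (Sum.inr i) * e j))
          + k' * (p (Sum.inr i) * p (Sum.inr j)) * A) else 0)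
        + (k' * B * (p (Sum.inr i) * p (Sum.inr i)) * (p (Sum.inr j) * p (Sum.inr j))
        + (k' * κ * (e i * p (Sum.inr i)) * (p (Sum.inr j) * p (Sum.inr j))
          + k' * κ * (p (Sum.inr i) * p (Sum.inr i)) * (e j * p (Sum.inr j)))) := by
        intro j
        rw [Matrix.one_apply]
        split_ifs <;> ring
      rw [Finset.sum_congr rfl fun j _ => hs1 j]
      simp only [Finset.sum_add_distrib, Finset.sum_ite_eq, Finset.mem_univ, if_true,
        ← Finset.mul_sum]
      ring
    rw [Finset.sum_congr rfl fun i _ => hin i, hk']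
    simp only [Finset.sum_add_distrib, ← Finset.mul_sum, ← Finset.sum_mul, Finset.sum_const,
      Finset.card_univ, Fintype.card_fin, nsmul_eq_mul]
    rw [sum_spacePart_sq]
    ring
  rw [hexp, add_assoc _ (B * _), add_assoc A (B * _), hrel]
  have hvol : partialD l (volDensity ε) p =
      ((n - 1 : ℕ) : ℝ) * warpRatio ε p ^ (n - 1 - 1) * partialD l (warpRatio ε) p := by
    simp only [partialD]
    rw [show (volDensity ε : Spacetime m n → ℝ) = fun q => warpRatio ε q ^ (n - 1) from rfl,
      (hd1.hasFDerivAt.pow (n - 1)).fderiv]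
    simp
  have hA' : A = 2 * warpRatio ε p * partialD l (warpRatio ε) p := by
    simp only [hA, partialD]
    rw [(hd1.hasFDerivAt.pow 2).fderiv]
    simp
  rw [hvol, hA', volDensity]
  obtain ⟨k, rfl⟩ : ∃ k, n = k + 1 := ⟨n - 1, by omega⟩
  simp only [Nat.add_sub_cancel]
  rcases k with _ | k
  · simp
  · simp only [Nat.add_sub_cancel]
    push_cast
    field_simp
    ring

end WarpedMetric

/-! ### The multiplier identity -/

section Multiplier

variable {m n : ℕ} {ε : ℝ} {p : Spacetime m n}

/-- The vector that represents the covector `L` in the Euclidean inner product. -/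
def sharp (L : Spacetime m n →L[ℝ] ℝ) : Spacetime m n :=
  (InnerProductSpace.toDual ℝ (Spacetime m n)).symm L

lemma inner_sharp (L : Spacetime m n →L[ℝ] ℝ) (Y : Spacetime m n) : ⟪sharp L, Y⟫ = L Y :=
  InnerProductSpace.toDual_symm_apply

lemma inner_sharp' (L : Spacetime m n →L[ℝ] ℝ) (Y : Spacetime m n) : ⟪Y, sharp L⟫ = L Y := by
  rw [real_inner_comm, inner_sharp]

lemma sharp_apply (L : Spacetime m n →L[ℝ] ℝ) (i : Fin m ⊕ Fin n) :
    sharp L i = L (coordVec i) := by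
  rw [← inner_sharp' L, coordVec, EuclideanSpace.inner_single_left]; simp

lemma sharp_add (L L' : Spacetime m n →L[ℝ] ℝ) : sharp (L + L') = sharp L + sharp L' :=
  map_add _ _ _

lemma sharp_smul (c : ℝ) (L : Spacetime m n →L[ℝ] ℝ) : sharp (c • L) = c • sharp L := by
  simp [sharp]

lemma norm_sharp (L : Spacetime m n →L[ℝ] ℝ) : ‖sharp L‖ = ‖L‖ :=
  LinearIsometryEquiv.norm_map _ _

/-- The `ḡ`-gradient of a function with differential `L`. -/
def raiseCov (ε : ℝ) (p : Spacetime m n) (L : Spacetime m n →L[ℝ] ℝ) : Spacetime m n :=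
  raise ε p (sharp L)

lemma raiseCov_add (L L' : Spacetime m n →L[ℝ] ℝ) :
    raiseCov ε p (L + L') = raiseCov ε p L + raiseCov ε p L' := by
  rw [raiseCov, sharp_add, raise_add]; rfl

lemma raiseCov_smul (c : ℝ) (L : Spacetime m n →L[ℝ] ℝ) :
    raiseCov ε p (c • L) = c • raiseCov ε p L := by
  rw [raiseCov, sharp_smul, raise_smul]; rfl

lemma raiseCov_comm (L L' : Spacetime m n →L[ℝ] ℝ) :
    L (raiseCov ε p L') = L' (raiseCov ε p L) := by
  rw [← inner_sharp L, ← inner_sharp L', raiseCov, raiseCov, inner_raise_comm]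

lemma raiseCov_apply (L : Spacetime m n →L[ℝ] ℝ) (i : Fin m ⊕ Fin n) :
    raiseCov ε p L i = ∑ k, cometricMatrix ε p i k * L (coordVec k) := by
  simp only [raiseCov, raise_apply, sharp_apply]

/-- The `ḡ`-gradient of `f` is half the Euler field. -/
lemma raiseCov_fderiv_fFun (hr : 0 < rad p) :
    raiseCov ε p (fderiv ℝ fFun p) = (1 / 2 : ℝ) • p := by
  have h1 : sharp (fderiv ℝ fFun p) =
      mkPoint (-(1 / 2 : ℝ) • timePart p) ((1 / 2 : ℝ) • spacePart p) := by
    refine ext_inner_right ℝ fun Y => ?_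
    rw [inner_sharp, fderiv_fFun, inner_eq_parts, timePart_mkPoint, spacePart_mkPoint,
      inner_smul_left, inner_smul_left]
    simp
    ring
  have hr' := hr.ne'
  rw [raiseCov, h1]
  refine eq_of_parts ?_ ?_
  · simp only [raise, timePart_mkPoint, timePart_smul]
    rw [neg_smul, neg_neg]
  · simp only [raise, spacePart_mkPoint, spacePart_smul]
    rw [inner_smul_right, real_inner_self_eq_norm_sq, show ‖spacePart p‖ = rad p from rfl,
      smul_smul, ← add_smul]
    congr 1
    field_simp
    ring

lemma differentiableAt_raiseCov (hε : 0 < ε) (hp : p ∈ exteriorCone m n)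
    {z : Spacetime m n → ℝ} (hz : ContDiffAt ℝ 2 z p) :
    DifferentiableAt ℝ (fun q => raiseCov ε q (fderiv ℝ z q)) p := by
  refine differentiableAt_euclidean.2 fun i => ?_
  simp only [raiseCov_apply]
  exact DifferentiableAt.fun_sum fun k _ =>
    ((contDiffAt_cometricMatrix (k := 1) (by simp) hε hp i k).differentiableAt
      (by norm_num)).fun_mul (differentiableAt_partialD hz k)

lemma differentiableAt_volDensity (hp : p ∈ exteriorCone m n) :
    DifferentiableAt ℝ (volDensity ε : Spacetime m n → ℝ) p :=
  ((contDiffAt_warpRatio (k := 1) (by simp) (rad_pos hp)).differentiableAt (by norm_num)).fun_pow _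

/-- The wave operator of the warped metric in divergence form. -/
lemma box_warpedMetric (hn : 1 ≤ n) (hε : 0 < ε) (hp : p ∈ exteriorCone m n)
    {z : Spacetime m n → ℝ} (hz : ContDiffAt ℝ 2 z p) :
    box (warpedMetric ε) z p = (volDensity ε p)⁻¹ *
      divergence (fun q => volDensity ε q • raiseCov ε q (fderiv ℝ z q)) p := by
  obtain ⟨h1, h2⟩ := trace_cometric_mul_deriv hn hε hp
  rw [box_eq_divergence hz h1
    (fun i j => (contDiffAt_cometricMatrix (k := 1) (by simp) hε hp i j).differentiableAt
      (by norm_num)) (fun i j => cometricMatrix_comm i j) ?_ (differentiableAt_volDensity hp)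
    (volDensity_pos hε hp).ne' h2]
  · congr 2
    ext q i
    simp only [PiLp.smul_apply, raiseCov_apply]
    rfl
  · filter_upwards [isOpen_exteriorCone.mem_nhds hp] with q hq
    exact cometricMatrix_mul (rad_pos hq) (warpRatio_pos hε hq).ne'

/-- The square of the angular part of the Euclidean gradient in the `x`-directions, rescaled to
the warped metric: `s⁻² (|L_x|² - (L ∂_r)²)`. -/
def angularSq (ε : ℝ) (p : Spacetime m n) (L : Spacetime m n →L[ℝ] ℝ) : ℝ :=
  (warpRatio ε p ^ 2)⁻¹ * (⟪spacePart (sharp L), spacePart (sharp L)⟫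
    - ⟪spacePart p, spacePart (sharp L)⟫ ^ 2 / rad p ^ 2)

lemma raiseCov_self (L : Spacetime m n →L[ℝ] ℝ) : L (raiseCov ε p L) =
    -⟪timePart (sharp L), timePart (sharp L)⟫
      + ⟪spacePart p, spacePart (sharp L)⟫ ^ 2 / rad p ^ 2 + angularSq ε p L := by
  rw [← inner_sharp L, raiseCov, inner_raise, angularSq]
  ring

/-- The derivative along the Euler field is the derivative along dilations. -/
lemma fderiv_self_of_homogeneous {g : Spacetime m n → ℝ} {g' : ℝ}
    (hg : DifferentiableAt ℝ g p) (h : HasDerivAt (fun l : ℝ => g ((1 + l) • p)) g' 0) :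
    fderiv ℝ g p p = g' := by
  have h0 : (1 + (0 : ℝ)) • p = p := by simp
  have h1 : HasDerivAt (fun l : ℝ => (1 + l) • p) p 0 := by
    simpa using ((hasDerivAt_id (0 : ℝ)).const_add 1).smul_const p
  have h2 : HasFDerivAt g (fderiv ℝ g p) ((1 + (0 : ℝ)) • p) := by
    rw [h0]; exact hg.hasFDerivAt
  exact (h2.comp_hasDerivAt 0 h1).unique h

lemma rad_smul {l : ℝ} (hl : 0 ≤ l) : rad (l • p) = l * rad p := by
  rw [rad, spacePart_smul, norm_smul, Real.norm_of_nonneg hl]; rfl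

lemma fFun_smul (l : ℝ) : fFun (l • p) = l ^ 2 * fFun p := by
  rw [fFun_eq_inner, fFun_eq_inner, timePart_smul, spacePart_smul]
  simp only [inner_smul_left, inner_smul_right, conj_trivial]
  ring

lemma eventually_one_add_pos : ∀ᶠ l : ℝ in nhds 0, 0 < 1 + l := by
  filter_upwards [lt_mem_nhds (show (-1 : ℝ) < 0 by norm_num)] with l hl
  linarith

lemma hasDerivAt_warpRatio_smul (hr : 0 < rad p) :
    HasDerivAt (fun l : ℝ => warpRatio ε ((1 + l) • p)) (2 * ε * fFun p / rad p) 0 := by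
  have h1 : HasDerivAt (fun l : ℝ => 1 + (1 + l) * (2 * ε * fFun p / rad p))
      (2 * ε * fFun p / rad p) 0 := by
    simpa using (((hasDerivAt_id (0 : ℝ)).const_add 1).mul_const
      (2 * ε * fFun p / rad p)).const_add 1
  refine h1.congr_of_eventuallyEq ?_
  filter_upwards [eventually_one_add_pos] with l hl
  rw [warpRatio_eq (by rw [rad_smul hl.le]; positivity), rad_smul hl.le, fFun_smul]
  field_simp

lemma fderiv_warpRatio_self (hr : 0 < rad p) :
    fderiv ℝ (warpRatio ε) p p = 2 * ε * fFun p / rad p :=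
  fderiv_self_of_homogeneous
    ((contDiffAt_warpRatio (k := 1) (by simp) hr).differentiableAt (by norm_num))
    (hasDerivAt_warpRatio_smul hr)

lemma fderiv_volDensity_self (hn : 1 ≤ n) (hε : 0 < ε) (hp : p ∈ exteriorCone m n) :
    fderiv ℝ (volDensity ε) p p =
      volDensity ε p * (2 * ((n : ℝ) - 1) * ε * (fFun p / warpedRadius ε p)) := by
  have hr := rad_pos hp
  have hd1 : DifferentiableAt ℝ (warpRatio ε : Spacetime m n → ℝ) p :=
    (contDiffAt_warpRatio (k := 1) (by simp) hr).differentiableAt (by norm_num)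
  rw [show (volDensity ε : Spacetime m n → ℝ) = fun q => warpRatio ε q ^ (n - 1) from rfl,
      (hd1.hasFDerivAt.pow (n - 1)).fderiv]
  simp only [_root_.smul_apply, fderiv_warpRatio_self hr]
  obtain ⟨k, rfl⟩ : ∃ k, n = k + 1 := ⟨n - 1, by omega⟩
  have hs := warpRatio_pos hε hp
  have hw : warpedRadius ε p = warpRatio ε p * rad p := by rw [warpRatio]; field_simp
  rw [hw]
  simp only [Nat.add_sub_cancel]
  rcases k with _ | k
  · simp
  · simp only [Nat.add_sub_cancel]
    push_cast
    simp
    field_simp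
    ring

/-- The derivative of `|∇ψ|²` along the Euler field: apart from the second derivatives of `ψ` only
the scale `s` contributes, since `x / r` is constant along rays. -/
lemma fderiv_raiseCov_self (hε : 0 < ε) (hp : p ∈ exteriorCone m n)
    {ψ : Spacetime m n → ℝ} (hψ : ContDiffAt ℝ 2 ψ p) :
    DifferentiableAt ℝ (fun q => fderiv ℝ ψ q (raiseCov ε q (fderiv ℝ ψ q))) p ∧
    fderiv ℝ (fun q => fderiv ℝ ψ q (raiseCov ε q (fderiv ℝ ψ q))) p p =
      2 * fderiv ℝ (fderiv ℝ ψ) p p (raiseCov ε p (fderiv ℝ ψ p))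
      - 4 * ε * (fFun p / warpedRadius ε p) * angularSq ε p (fderiv ℝ ψ p) := by
  have hr := rad_pos hp
  have hs := warpRatio_pos hε hp
  have h1 : ContDiffAt ℝ 1 (fderiv ℝ ψ) p := hψ.fderiv_right (by norm_num)
  have h2 : DifferentiableAt ℝ (fderiv ℝ ψ) p := h1.differentiableAt (by norm_num)
  have h3 : DifferentiableAt ℝ (fun q => fderiv ℝ ψ q (raiseCov ε q (fderiv ℝ ψ q))) p :=
    h2.clm_apply (differentiableAt_raiseCov hε hp hψ)
  refine ⟨h3, fderiv_self_of_homogeneous h3 ?_⟩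
  have h0 : (1 + (0 : ℝ)) • p = p := by simp
  set W : ℝ → Spacetime m n := fun l => sharp (fderiv ℝ ψ ((1 + l) • p)) with hW
  set W' : Spacetime m n := sharp (fderiv ℝ (fderiv ℝ ψ) p p) with hW'
  have hcur : HasDerivAt (fun l : ℝ => (1 + l) • p) p 0 := by
    simpa using ((hasDerivAt_id (0 : ℝ)).const_add 1).smul_const p
  have hWd : HasDerivAt W W' 0 := by
    have h4 : HasFDerivAt (fderiv ℝ ψ) (fderiv ℝ (fderiv ℝ ψ) p) ((1 + (0 : ℝ)) • p) := by
      rw [h0]; exact h2.hasFDerivAt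
    exact ((InnerProductSpace.toDual ℝ (Spacetime m n)).symm.toContinuousLinearEquiv.toContinuousLinearMap.hasFDerivAt).comp_hasDerivAt 0 (h4.comp_hasDerivAt 0 hcur)
  have hWt : HasDerivAt (fun l => timePart (W l)) (timePart W') 0 :=
    (timeCLM m n).hasFDerivAt.comp_hasDerivAt 0 hWd
  have hWx : HasDerivAt (fun l => spacePart (W l)) (spacePart W') 0 :=
    (spaceCLM m n).hasFDerivAt.comp_hasDerivAt 0 hWd
  have hin : HasDerivAt (fun l => ⟪spacePart p, spacePart (W l)⟫) ⟪spacePart p, spacePart W'⟫ 0 := by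
    simpa using (hasDerivAt_const (0 : ℝ) (spacePart p)).inner ℝ hWx
  have hsd := hasDerivAt_warpRatio_smul (ε := ε) hr
  have hs0 : warpRatio ε ((1 + (0 : ℝ)) • p) = warpRatio ε p := by rw [h0]
  have hW0 : W 0 = sharp (fderiv ℝ ψ p) := by simp only [hW, h0]
  have hsi := (hsd.fun_pow 2).fun_inv (by rw [hs0]; positivity)
  have hmain := ((hWt.inner ℝ hWt).fun_neg.fun_add (hsi.fun_mul (hWx.inner ℝ hWx))).fun_add
    (((hsi.const_sub 1).mul_const (1 / rad p ^ 2)).fun_mul (hin.fun_mul hin))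
  refine HasDerivAt.congr_of_eventuallyEq (hmain.congr_deriv ?_) ?_
  · rw [hs0, hW0]
    have e1 : fderiv ℝ (fderiv ℝ ψ) p p (raiseCov ε p (fderiv ℝ ψ p)) =
        ⟪W', raise ε p (sharp (fderiv ℝ ψ p))⟫ := (inner_sharp _ _).symm
    have hw : warpedRadius ε p = warpRatio ε p * rad p := by rw [warpRatio]; field_simp
    rw [e1, inner_raise, angularSq, hw, real_inner_comm (timePart W'),
      real_inner_comm (spacePart W')]
    field_simp
    push_cast
    ring
  · filter_upwards [eventually_one_add_pos] with l hl
    rw [← inner_sharp, raiseCov, inner_raise, spacePart_smul, rad_smul hl.le]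
    simp only [inner_smul_left, conj_trivial]
    have := hl.ne'
    field_simp
    simp only [hW]
    ring

/-- The divergence of the Euler field is the dimension. -/
lemma divergence_self (y : Spacetime m n) :
    divergence (fun q : Spacetime m n => q) y = (m : ℝ) + n := by
  have : ∀ i : Fin m ⊕ Fin n, partialD i (fun q : Spacetime m n => q i) y = 1 := by
    intro i
    have h1 : HasFDerivAt (fun q : Spacetime m n => q i)
        (EuclideanSpace.proj i : Spacetime m n →L[ℝ] ℝ) y :=
      (EuclideanSpace.proj i : Spacetime m n →L[ℝ] ℝ).hasFDerivAt
    rw [partialD, h1.fderiv]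
    simp [coordVec]
  simp only [divergence, this]
  simp

lemma divergence_add {X Y : Spacetime m n → Spacetime m n}
    (hX : DifferentiableAt ℝ X p) (hY : DifferentiableAt ℝ Y p) :
    divergence (fun q => X q + Y q) p = divergence X p + divergence Y p := by
  simp only [divergence, partialD, ← Finset.sum_add_distrib]
  refine Finset.sum_congr rfl fun i _ => ?_
  have h1 := differentiableAt_euclidean.1 hX i
  have h2 := differentiableAt_euclidean.1 hY i
  have h3 : (fun q => (X q + Y q) i) = fun q => X q i + Y q i := rfl
  rw [h3, (h1.hasFDerivAt.fun_add h2.hasFDerivAt).fderiv]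
  simp

lemma divergence_volDensity_smul_self (hn : 1 ≤ n) (hε : 0 < ε) (hp : p ∈ exteriorCone m n)
    {g : Spacetime m n → ℝ} (hg : DifferentiableAt ℝ g p) :
    divergence (fun q => g q • volDensity ε q • q) p = volDensity ε p *
      (g p * (m + n + 2 * ((n : ℝ) - 1) * ε * (fFun p / warpedRadius ε p))
        + fderiv ℝ g p p) := by
  have h1 := differentiableAt_volDensity (ε := ε) hp
  rw [divergence_smul hg (h1.fun_smul differentiableAt_fun_id),
    divergence_smul h1 differentiableAt_fun_id, divergence_self, fderiv_volDensity_self hn hε hp,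
    map_smul, smul_eq_mul]
  ring

/-- The current
`(dψ(p) + 2 w ψ) ∇ψ + ½ (A ψ² - |∇ψ|²) p` of the multiplier `dψ(p) + 2 w ψ`; here `y` is the value
and `L` the differential of `ψ` at `p`, and `∇` is the `ḡ`-gradient. -/
def current (ε w A : ℝ) (p : Spacetime m n) (y : ℝ) (L : Spacetime m n →L[ℝ] ℝ) :
    Spacetime m n :=
  (L p + 2 * w * y) • raiseCov ε p L + ((A * y ^ 2 - L (raiseCov ε p L)) / 2) • p

/-- The divergence of the current. The second derivatives of `ψ` enter only through `□̄ψ`: those in the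
derivative of `dψ(p)` along `∇ψ` cancel against those in the derivative of `|∇ψ|²` along the Euler
field. -/
lemma divergence_current (hn : 1 ≤ n) (hε : 0 < ε) (hp : p ∈ exteriorCone m n)
    {ψ w A : Spacetime m n → ℝ} (hψ : ContDiffAt ℝ 2 ψ p) (hw : DifferentiableAt ℝ w p)
    (hA : DifferentiableAt ℝ A p) :
    (volDensity ε p)⁻¹ * divergence (fun q => volDensity ε q •
      current ε (w q) (A q) q (ψ q) (fderiv ℝ ψ q)) p =
    (fderiv ℝ ψ p p + 2 * w p * ψ p) * box (warpedMetric ε) ψ p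
      + (1 + 2 * w p - (m + n + 2 * ((n : ℝ) - 1) * ε * (fFun p / warpedRadius ε p)) / 2)
        * fderiv ℝ ψ p (raiseCov ε p (fderiv ℝ ψ p))
      + 2 * ψ p * fderiv ℝ w p (raiseCov ε p (fderiv ℝ ψ p))
      + (A p * (m + n + 2 * ((n : ℝ) - 1) * ε * (fFun p / warpedRadius ε p))
          + fderiv ℝ A p p) / 2 * ψ p ^ 2
      + A p * ψ p * fderiv ℝ ψ p p
      + 2 * ε * (fFun p / warpedRadius ε p) * angularSq ε p (fderiv ℝ ψ p) := by
  have hσ := volDensity_pos hε hp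
  have hσd := differentiableAt_volDensity (ε := ε) hp
  have hψd : DifferentiableAt ℝ ψ p := hψ.differentiableAt (by norm_num)
  have h1 : ContDiffAt ℝ 1 (fderiv ℝ ψ) p := hψ.fderiv_right (by norm_num)
  have h2 : DifferentiableAt ℝ (fderiv ℝ ψ) p := h1.differentiableAt (by norm_num)
  have hr := differentiableAt_raiseCov hε hp hψ
  obtain ⟨hN, hN'⟩ := fderiv_raiseCov_self hε hp hψ
  have hSd : HasFDerivAt (fun q => fderiv ℝ ψ q q + 2 * w q * ψ q)
      ((fderiv ℝ ψ p + (fderiv ℝ (fderiv ℝ ψ) p).flip p)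
        + ((2 * w p) • fderiv ℝ ψ p + ψ p • ((2 : ℝ) • fderiv ℝ w p))) p := by
    refine HasFDerivAt.fun_add ?_ ((hw.hasFDerivAt.const_mul 2).fun_mul hψd.hasFDerivAt)
    refine (h2.hasFDerivAt.clm_apply (hasFDerivAt_id p)).congr_fderiv ?_
    ext Y; simp
  have hgd : HasFDerivAt (fun q => (A q * ψ q ^ 2 - fderiv ℝ ψ q (raiseCov ε q (fderiv ℝ ψ q))) / 2)
      ((1 / 2 : ℝ) • ((A p • ((2 * ψ p) • fderiv ℝ ψ p) + ψ p ^ 2 • fderiv ℝ A p)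
        - fderiv ℝ (fun q => fderiv ℝ ψ q (raiseCov ε q (fderiv ℝ ψ q))) p)) p := by
    have := (((hA.hasFDerivAt.fun_mul (hψd.hasFDerivAt.pow 2)).fun_sub hN.hasFDerivAt).mul_const
      (1 / 2 : ℝ))
    refine HasFDerivAt.congr_of_eventuallyEq (this.congr_fderiv ?_)
      (Filter.Eventually.of_forall fun q => by ring)
    ext Y; simp
  have hsplit : (fun q => volDensity ε q • current ε (w q) (A q) q (ψ q) (fderiv ℝ ψ q)) =
      fun q => (fderiv ℝ ψ q q + 2 * w q * ψ q) • (volDensity ε q • raiseCov ε q (fderiv ℝ ψ q))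
        + ((A q * ψ q ^ 2 - fderiv ℝ ψ q (raiseCov ε q (fderiv ℝ ψ q))) / 2)
          • volDensity ε q • q := by
    ext1 q
    rw [current, smul_add, smul_comm, smul_comm (volDensity ε q)]
  rw [hsplit, divergence_add (hSd.differentiableAt.fun_smul (hσd.fun_smul hr))
    (hgd.differentiableAt.fun_smul (hσd.fun_smul differentiableAt_fun_id)),
    divergence_smul hSd.differentiableAt (hσd.fun_smul hr),
    divergence_volDensity_smul_self hn hε hp hgd.differentiableAt, hSd.fderiv, hgd.fderiv,
    box_warpedMetric hn hε hp hψ]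
  -- symmetry of the second derivative, which makes the second order terms cancel
  have hsym := hψ.isSymmSndFDerivAt (by simp) p (raiseCov ε p (fderiv ℝ ψ p))
  simp only [_root_.add_apply, _root_.smul_apply, _root_.sub_apply, map_smul, smul_eq_mul,
    ContinuousLinearMap.flip_apply, hN', hsym]
  field_simp
  ring

end Multiplier

/-! ### The algebra of the pointwise estimate -/

section Pointwise

set_option maxHeartbeats 1000000 in
/-- The algebra of the pointwise estimate. In it `U = u ∂_u ψ`, `V = v ∂_v ψ`, `S` is the multiplier
`U + V + 2 w y`, `Ax` and `At` are the squares of the angular derivatives, `Φ = f φ`, and `D` is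
the term with the derivative of `w`. -/
lemma carleman_algebra {a b ε f s r ρ u v w d n U V y L Ax At N D : ℝ}
    (hf : 0 < f) (hs : 0 < s) (hsf : s ^ 2 = f) (hu : u < 0) (hv : 0 < v) (hfuv : f = -(u * v))
    (hr : r = v - u) (hρ : ρ = r + 2 * ε * f) (hε : 0 < ε) (hb : 0 < b) (hn : 1 ≤ n)
    (hnd : n + 1 ≤ d) (had : d ^ 2 ≤ a) (hεb : ε ≤ b / 100) (hbs : b * s ≤ 1 / 100)
    (hw : w = (d - 2) / 4 + (n - 2) / 2 * ε * (f / ρ))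
    (hN : f * N = U * V + f * (Ax - At)) (hAx : 0 ≤ Ax) (hAt : 0 ≤ At)
    (hD : D = (n - 2) * ε * (v * V - u * U) / (4 * ρ ^ 2)) :
    ε / 8 * (ρ⁻¹ * ((U - a * (1 + b * s) * y) ^ 2 + (V - a * (1 + b * s) * y) ^ 2
        + f * Ax + f * At)) + b * a ^ 2 / 4 * (y ^ 2 / s) ≤
      f * L ^ 2 / (2 * a) + ((U + V + 2 * w * y) * L
        + (a / f + a * b / s) * (U + V + 2 * w * y) ^ 2
        + ε * (f / ρ) * (a / f + a * b / s) * y * (U + V + 2 * w * y)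
        - ε * (f / ρ) * N + 2 * ε * (f / ρ) * Ax + 2 * y * D
        + ((a ^ 2 * b - a * b / 4) / s + a ^ 2 * b ^ 2
          + (a ^ 2 / f + (2 * a ^ 2 * b - a * b / 2) / s + a ^ 2 * b ^ 2) * ε * (f / ρ))
          * y ^ 2) := by
  have hd : 2 ≤ d := by linarith
  have ha : 4 ≤ a := by nlinarith
  have ha0 : 0 < a := by linarith
  have hr0 : 0 < r := by linarith
  have hrρ : r ≤ ρ := by rw [hρ]; nlinarith [mul_pos hε hf]
  have hρ0 : 0 < ρ := by linarith
  -- `r² = (u + v)² + 4 f`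
  have h2s : 2 * s ≤ ρ := by
    refine le_trans ?_ hrρ
    refine le_of_sq_le_sq ?_ hr0.le
    rw [hr]; nlinarith [sq_nonneg (v + u)]
  set κ := ε / ρ with hκ
  have hκ0 : 0 < κ := div_pos hε hρ0
  have hκs : κ * s ≤ ε / 2 := by
    rw [hκ, div_mul_eq_mul_div, div_le_iff₀ hρ0]
    linarith [mul_le_mul_of_nonneg_left h2s hε.le]
  have hεs : ε * s ≤ 1 / 10000 := by
    linarith [mul_le_mul_of_nonneg_right hεb hs.le]
  have hκf : κ * f ≤ 1 / 20000 := by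
    rw [← hsf, sq, ← mul_assoc]
    linarith [mul_le_mul_of_nonneg_right hκs hs.le]
  have hκf0 : 0 < κ * f := mul_pos hκ0 hf
  set S := U + V + 2 * w * y with hS
  have hεh : ε * (f / ρ) = κ * f := by rw [hκ]; field_simp
  -- the wave operator and the square of the multiplier
  have t1 : 0 ≤ f * L ^ 2 / (2 * a) + S * L + a / (2 * f) * S ^ 2 := by
    have : f * L ^ 2 / (2 * a) + S * L + a / (2 * f) * S ^ 2 =
        (f * L + a * S) ^ 2 / (2 * a * f) := by
      field_simp; ring
    rw [this]; positivity
  have t2 : a / f * S ^ 2 ≤ (a / f + a * b / s) * S ^ 2 :=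
    mul_le_mul_of_nonneg_right (by have := div_pos (mul_pos ha0 hb) hs; linarith) (sq_nonneg _)
  have hΦ : f * (a / f + a * b / s) = a * (1 + b * s) := by
    rw [← hsf]; field_simp
  set Φ := a * (1 + b * s) with hΦd
  have hΦ0 : 0 < Φ := by positivity
  have hΦa : Φ ≤ 101 / 100 * a := by
    rw [hΦd]; linarith [mul_le_mul_of_nonneg_left hbs ha0.le]
  -- the wave operator took half of `a / f * S ^ 2`, this cross term takes a quarter
  have t3 : -(a / (4 * f) * S ^ 2 + κ * f * κ * Φ ^ 2 / a * y ^ 2) ≤ κ * Φ * y * S := by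
    have : a / (4 * f) * S ^ 2 + κ * f * κ * Φ ^ 2 / a * y ^ 2 + κ * Φ * y * S =
        (a * S + 2 * f * κ * Φ * y) ^ 2 / (4 * a * f) := by
      field_simp; ring
    have h2 : 0 ≤ (a * S + 2 * f * κ * Φ * y) ^ 2 / (4 * a * f) := by positivity
    linarith
  have hΦ2 : Φ ^ 2 ≤ 2 * a ^ 2 := by
    have := pow_le_pow_left₀ hΦ0.le hΦa 2
    linarith [sq_nonneg a]
  have t3' : κ * f * κ * Φ ^ 2 / a * y ^ 2 ≤ κ * a * y ^ 2 := by
    refine mul_le_mul_of_nonneg_right ?_ (sq_nonneg y)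
    rw [div_le_iff₀ ha0]
    have h2 : κ * f * κ * Φ ^ 2 ≤ 1 / 20000 * κ * (2 * a ^ 2) :=
      mul_le_mul (mul_le_mul_of_nonneg_right hκf hκ0.le) hΦ2 (sq_nonneg _) (by positivity)
    have h3 : 0 < κ * (a * a) := mul_pos hκ0 (mul_pos ha0 ha0)
    linarith
  -- the gradient term
  have t4 : -(κ * f) * N = κ * ((U ^ 2 + V ^ 2) / 2 - (U + V) ^ 2 / 2 - f * Ax + f * At) := by
    have : -(κ * f) * N = -κ * (f * N) := by ring
    rw [this, hN]; ring
  have hw1 : |w| ≤ d / 2 := by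
    have h1 : ε * (f / ρ) ≤ 1 / 20000 := by rw [hεh]; exact hκf
    have h2 : 0 ≤ ε * (f / ρ) := by rw [hεh]; exact hκf0.le
    have h3 : 0 ≤ n * (ε * (f / ρ)) := mul_nonneg (by linarith) h2
    have h4 : n * (ε * (f / ρ)) ≤ d * (1 / 20000) :=
      mul_le_mul (by linarith) h1 h2 (by linarith)
    rw [hw, mul_assoc, abs_le]
    constructor <;> linarith
  have hw2 : 4 * w ^ 2 ≤ a := by
    have := sq_le_sq' (abs_le.1 hw1).1 (abs_le.1 hw1).2
    linarith
  have t5 : (U + V) ^ 2 / 2 ≤ S ^ 2 + a * y ^ 2 := by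
    have h1 : U + V = S - 2 * w * y := by rw [hS]; ring
    rw [h1]
    linarith [sq_nonneg (S + 2 * w * y), mul_le_mul_of_nonneg_right hw2 (sq_nonneg y)]
  have t5' : κ * S ^ 2 ≤ a / (4 * f) * S ^ 2 := by
    refine mul_le_mul_of_nonneg_right ?_ (sq_nonneg _)
    rw [le_div_iff₀ (by positivity)]
    linarith
  -- the derivative of the zeroth order part of the multiplier
  have t6 : -(κ * ((U ^ 2 + V ^ 2) / 4 + a / 2 * y ^ 2)) ≤ 2 * y * D := by
    have h1 : 2 * y * D = κ * ((n - 2) * y * ((v / ρ) * V + (-u / ρ) * U) / 2) := by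
      rw [hD, hκ]; field_simp; ring
    have hv1 : v / ρ ≤ 1 := (div_le_one hρ0).2 (by linarith)
    have hu1 : -u / ρ ≤ 1 := (div_le_one hρ0).2 (by linarith)
    have hv0 : 0 ≤ v / ρ := by positivity
    have hu0 : 0 ≤ -u / ρ := div_nonneg (by linarith) hρ0.le
    have hn2 : (n - 2) ^ 2 ≤ a := (sq_le_sq' (by linarith) (by linarith)).trans had
    have key : ∀ c X : ℝ, 0 ≤ c → c ≤ 1 →
        -(X ^ 2 / 4 + a / 4 * y ^ 2) ≤ (n - 2) * y * (c * X) / 2 := by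
      intro c X h0 h1
      have e1 : c ^ 2 ≤ 1 := pow_le_one₀ h0 h1
      have e2 : c ^ 2 * X ^ 2 ≤ X ^ 2 := mul_le_of_le_one_left (sq_nonneg X) e1
      linarith [sq_nonneg ((n - 2) * y + c * X), mul_le_mul_of_nonneg_right hn2 (sq_nonneg y)]
    have k1 := key _ V hv0 hv1
    have k2 := key _ U hu0 hu1
    rw [h1, ← mul_neg]
    refine mul_le_mul_of_nonneg_left ?_ hκ0.le
    linarith
  have t7 : κ / 8 * ((U - Φ * y) ^ 2 + (V - Φ * y) ^ 2) ≤
      κ * ((U ^ 2 + V ^ 2) / 4 + Φ ^ 2 / 2 * y ^ 2) := by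
    linarith [mul_nonneg hκ0.le (sq_nonneg (U + Φ * y)), mul_nonneg hκ0.le (sq_nonneg (V + Φ * y))]
  -- the terms with `y ^ 2`
  have t8 : 0 ≤ (a ^ 2 * b ^ 2
      + (a ^ 2 / f + (2 * a ^ 2 * b - a * b / 2) / s + a ^ 2 * b ^ 2) * ε * (f / ρ)) * y ^ 2 := by
    have h1 : 0 < a * b := mul_pos ha0 hb
    have h2 : 4 * (a * b) ≤ a * (a * b) := mul_le_mul_of_nonneg_right ha h1.le
    have : 0 ≤ 2 * a ^ 2 * b - a * b / 2 := by linarith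
    positivity
  have t9 : (b * a ^ 2 / 4) / s + κ * Φ ^ 2 / 2 + 3 * (κ * a) ≤ (a ^ 2 * b - a * b / 4) / s := by
    have h1 : κ ≤ b / 200 / s := by
      rw [le_div_iff₀ hs]; linarith
    have h3 : κ * Φ ^ 2 / 2 + 3 * (κ * a) ≤ b / 200 / s * (a ^ 2 + 3 * a) := by
      have : κ * Φ ^ 2 ≤ b / 200 / s * (2 * a ^ 2) :=
        mul_le_mul h1 hΦ2 (sq_nonneg _) (hκ0.le.trans h1)
      have h4 : κ * a ≤ b / 200 / s * a := mul_le_mul_of_nonneg_right h1 ha0.le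
      linarith
    have h5 : b / 200 / s * (a ^ 2 + 3 * a) = b / 200 * (a ^ 2 + 3 * a) / s := by field_simp
    rw [add_assoc]
    refine (add_le_add_right h3 _).trans ?_
    rw [h5, ← add_div]
    refine div_le_div_of_nonneg_right ?_ hs.le
    linarith [mul_pos ha0 hb, mul_le_mul_of_nonneg_right ha (mul_pos ha0 hb).le]
  have t9' := mul_le_mul_of_nonneg_right t9 (sq_nonneg y)
  have hΦ' : ε * (f / ρ) * (a / f + a * b / s) * y * S = κ * Φ * y * S := by
    rw [hεh, ← hΦ]; ring
  have hlhs : ε / 8 * (ρ⁻¹ * ((U - Φ * y) ^ 2 + (V - Φ * y) ^ 2 + f * Ax + f * At))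
      = κ / 8 * ((U - Φ * y) ^ 2 + (V - Φ * y) ^ 2) + κ / 8 * (f * Ax + f * At) := by
    rw [hκ]; ring
  have hpos : κ / 8 * (f * Ax + f * At) ≤ κ * (f * Ax + f * At) := by
    have : 0 ≤ f * Ax + f * At := by positivity
    linarith [mul_nonneg hκ0.le this]
  have t5'' := mul_le_mul_of_nonneg_left t5 hκ0.le
  have e2 : 2 * ε * (f / ρ) * Ax = 2 * κ * (f * Ax) := by
    rw [mul_assoc 2 ε, hεh]; ring
  have e3 : -(ε * (f / ρ) * N) = -(κ * f) * N := by rw [hεh]; ring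
  have e4 : a / f * S ^ 2 = a / (2 * f) * S ^ 2 + (a / (4 * f) * S ^ 2 + a / (4 * f) * S ^ 2) := by
    field_simp; ring
  rw [hlhs, hΦ', e2, sub_eq_add_neg _ (ε * (f / ρ) * N), e3, t4]
  have e5 : b * a ^ 2 / 4 * (y ^ 2 / s) = b * a ^ 2 / 4 / s * y ^ 2 := by ring
  rw [e5]
  have t10 : 0 ≤ κ * a * y ^ 2 := by positivity
  linarith

end Pointwise

/-! ### The conjugated function and its wave operator -/

section Conjugation

variable {m n : ℕ} {ε a b : ℝ} {p : Spacetime m n}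

/-- The square root `f^a e^{2 a b √f}` of the weight, as a function of `f > 0`. -/
def ampFun (a b x : ℝ) : ℝ := Real.exp (a * Real.log x + 2 * a * b * √x)

/-- The logarithmic derivative `a / f + a b / √f` of `ampFun`. -/
def ampLog (a b x : ℝ) : ℝ := a / x + a * b / √x

/-- The coefficient of `ψ²` in the current; with `θ = ampFun`, `φ = ampLog` and `f = x` it is
`f φ² - (f φ)'`. -/
def ampPot (a b x : ℝ) : ℝ := a ^ 2 / x + (2 * a ^ 2 * b - a * b / 2) / √x + a ^ 2 * b ^ 2

lemma ampFun_pos (x : ℝ) : 0 < ampFun a b x := Real.exp_pos _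

lemma ampFun_sq (hp : p ∈ exteriorCone m n) : ampFun a b (fFun p) ^ 2 = weight a b p := by
  have hf : 0 < fFun p := hp
  rw [weight, ampFun, ← Real.exp_nat_mul, Real.rpow_def_of_pos hf, ← Real.exp_add,
    ← Real.sqrt_eq_rpow]
  congr 1
  push_cast
  ring

lemma hasDerivAt_ampFun {x : ℝ} (hx : 0 < x) :
    HasDerivAt (ampFun a b) (ampFun a b x * ampLog a b x) x := by
  have h := (((Real.hasDerivAt_log hx.ne').const_mul a).add
    ((Real.hasDerivAt_sqrt hx.ne').const_mul (2 * a * b))).exp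
  refine h.congr_deriv ?_
  simp only [ampFun, ampLog, Pi.add_apply]
  have := (Real.sqrt_pos.2 hx).ne'
  field_simp

lemma hasDerivAt_inv_sqrt {x : ℝ} (hx : 0 < x) (c : ℝ) :
    HasDerivAt (fun x => c / √x) (-c / (2 * x * √x)) x := by
  have hs := (Real.sqrt_pos.2 hx).ne'
  have h := ((Real.hasDerivAt_sqrt hx.ne').fun_inv hs).const_mul c
  refine (h.congr_deriv ?_).congr_of_eventuallyEq
    (Filter.Eventually.of_forall fun y => by simp only [div_eq_mul_inv])
  rw [Real.sq_sqrt hx.le]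
  field_simp

lemma hasDerivAt_div_self {x : ℝ} (hx : 0 < x) (c : ℝ) :
    HasDerivAt (fun x => c / x) (-c / x ^ 2) x := by
  refine (((hasDerivAt_inv hx.ne').const_mul c).congr_deriv ?_).congr_of_eventuallyEq
    (Filter.Eventually.of_forall fun y => by simp only [div_eq_mul_inv])
  field_simp

lemma hasDerivAt_ampLog {x : ℝ} (hx : 0 < x) :
    HasDerivAt (ampLog a b) (-a / x ^ 2 - a * b / (2 * x * √x)) x :=
  ((hasDerivAt_div_self hx a).add (hasDerivAt_inv_sqrt hx (a * b))).congr_deriv (by ring)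

lemma hasDerivAt_ampPot {x : ℝ} (hx : 0 < x) : HasDerivAt (ampPot a b)
    (-a ^ 2 / x ^ 2 - (2 * a ^ 2 * b - a * b / 2) / (2 * x * √x)) x :=
  (((hasDerivAt_div_self hx (a ^ 2)).add
    (hasDerivAt_inv_sqrt hx (2 * a ^ 2 * b - a * b / 2))).add_const _).congr_deriv (by ring)

lemma contDiffAt_ampFun {k : WithTop ℕ∞} {x : ℝ} (hx : 0 < x) : ContDiffAt ℝ k (ampFun a b) x :=
  ((contDiffAt_const.mul (Real.contDiffAt_log.2 hx.ne')).add
    (contDiffAt_const.mul (Real.contDiffAt_sqrt hx.ne'))).exp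

lemma contDiffAt_ampLog {k : WithTop ℕ∞} {x : ℝ} (hx : 0 < x) : ContDiffAt ℝ k (ampLog a b) x :=
  (contDiffAt_const.div contDiffAt_id hx.ne').add
    (contDiffAt_const.div (Real.contDiffAt_sqrt hx.ne') (Real.sqrt_pos.2 hx).ne')

lemma contDiffAt_ampPot {k : WithTop ℕ∞} {x : ℝ} (hx : 0 < x) : ContDiffAt ℝ k (ampPot a b) x :=
  ((contDiffAt_const.div contDiffAt_id hx.ne').add
    (contDiffAt_const.div (Real.contDiffAt_sqrt hx.ne') (Real.sqrt_pos.2 hx).ne')).add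
      contDiffAt_const

/-- `ζ^{1/2} z`, the function to which the multiplier is applied. -/
def conj (a b : ℝ) (z : Spacetime m n → ℝ) (p : Spacetime m n) : ℝ :=
  ampFun a b (fFun p) * z p

/-- The differential of `ζ^{1/2} z`, for a function `z` with value `y` and differential `L`. -/
def conjCov (a b : ℝ) (p : Spacetime m n) (y : ℝ) (L : Spacetime m n →L[ℝ] ℝ) :
    Spacetime m n →L[ℝ] ℝ :=
  ampFun a b (fFun p) • L + (ampFun a b (fFun p) * ampLog a b (fFun p) * y) • fderiv ℝ fFun p

lemma differentiableAt_fFun (p : Spacetime m n) : DifferentiableAt ℝ fFun p :=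
  contDiff_fFun.differentiable (by simp) p

lemma hasFDerivAt_comp_fFun {g : ℝ → ℝ} {g' : ℝ} (hg : HasDerivAt g g' (fFun p)) :
    HasFDerivAt (fun q : Spacetime m n => g (fFun q)) (g' • fderiv ℝ fFun p) p :=
  hg.comp_hasFDerivAt p (differentiableAt_fFun p).hasFDerivAt

lemma hasFDerivAt_conj (hp : p ∈ exteriorCone m n) {z : Spacetime m n → ℝ}
    (hz : DifferentiableAt ℝ z p) :
    HasFDerivAt (conj a b z) (conjCov a b p (z p) (fderiv ℝ z p)) p := by
  have hf : 0 < fFun p := hp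
  refine ((hasFDerivAt_comp_fFun (hasDerivAt_ampFun hf)).mul hz.hasFDerivAt).congr_fderiv ?_
  ext Y
  simp [conjCov]
  ring

lemma contDiffAt_conj {k : WithTop ℕ∞} (hk : k ≤ ∞) (hp : p ∈ exteriorCone m n)
    {z : Spacetime m n → ℝ} (hz : ContDiffAt ℝ k z p) : ContDiffAt ℝ k (conj a b z) p :=
  ((contDiffAt_ampFun hp).comp p (contDiff_fFun.of_le hk).contDiffAt).mul hz

lemma fderiv_fFun_self (p : Spacetime m n) : fderiv ℝ fFun p p = 2 * fFun p := by
  rw [fderiv_fFun, fFun_eq_inner]; ring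

/-- The wave operator of `ζ^{1/2} z`. -/
lemma box_conj (hn : 1 ≤ n) (hε : 0 < ε) (hp : p ∈ exteriorCone m n) {z : Spacetime m n → ℝ}
    (hz : ContDiffAt ℝ 2 z p) :
    box (warpedMetric ε) (conj a b z) p = ampFun a b (fFun p) * (box (warpedMetric ε) z p
      + ampLog a b (fFun p) * fderiv ℝ z p p
      + z p * (ampLog a b (fFun p) *
          ((m + n + 2 * ((n : ℝ) - 1) * ε * (fFun p / warpedRadius ε p)) / 2)
        + fFun p * ampLog a b (fFun p) ^ 2
        + fFun p * (-a / fFun p ^ 2 - a * b / (2 * fFun p * √(fFun p))))) := by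
  have hf : 0 < fFun p := hp
  have hσ := volDensity_pos hε hp
  have hσd := differentiableAt_volDensity (ε := ε) hp
  have hzd : DifferentiableAt ℝ z p := hz.differentiableAt (by norm_num)
  have hr := differentiableAt_raiseCov hε hp hz
  rw [box_warpedMetric hn hε hp (contDiffAt_conj (by decide) hp hz), box_warpedMetric hn hε hp hz]
  have hev : (fun q => volDensity ε q • raiseCov ε q (fderiv ℝ (conj a b z) q)) =ᶠ[nhds p]
      fun q => ampFun a b (fFun q) • (volDensity ε q • raiseCov ε q (fderiv ℝ z q))
        + (ampFun a b (fFun q) * (ampLog a b (fFun q) * (z q / 2))) • volDensity ε q • q := by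
    filter_upwards [isOpen_exteriorCone.mem_nhds hp,
      (hz.eventually (by decide)).mono fun q hq => hq.differentiableAt (by norm_num)] with q hq hzq
    rw [(hasFDerivAt_conj hq hzq).fderiv, conjCov, raiseCov_add, raiseCov_smul, raiseCov_smul,
      raiseCov_fderiv_fFun (rad_pos hq)]
    simp only [smul_add, smul_smul]
    congr 1
    · ring_nf
    · congr 1; ring
  have hdiv : divergence (fun q => volDensity ε q • raiseCov ε q (fderiv ℝ (conj a b z) q)) p =
      divergence (fun q => ampFun a b (fFun q) • (volDensity ε q • raiseCov ε q (fderiv ℝ z q))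
        + (ampFun a b (fFun q) * (ampLog a b (fFun q) * (z q / 2))) • volDensity ε q • q) p := by
    refine Finset.sum_congr rfl fun i _ => partialD_congr ?_ i
    filter_upwards [hev] with q hq
    rw [hq]
  have hθ := hasFDerivAt_comp_fFun (m := m) (n := n) (p := p) (hasDerivAt_ampFun (a := a) (b := b) hf)
  have hφ := hasFDerivAt_comp_fFun (m := m) (n := n) (p := p) (hasDerivAt_ampLog (a := a) (b := b) hf)
  have hg := hθ.fun_mul (hφ.fun_mul (hzd.hasFDerivAt.mul_const (1 / 2 : ℝ)))
  have hg' : HasFDerivAt (fun q => ampFun a b (fFun q) * (ampLog a b (fFun q) * (z q / 2))) _ p :=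
    hg.congr_of_eventuallyEq (Filter.Eventually.of_forall fun q => by simp only [mul_one_div])
  rw [hdiv, divergence_add (hθ.differentiableAt.fun_smul (hσd.fun_smul hr))
    (hg'.differentiableAt.fun_smul (hσd.fun_smul differentiableAt_fun_id)),
    divergence_smul hθ.differentiableAt (hσd.fun_smul hr),
    divergence_volDensity_smul_self hn hε hp hg'.differentiableAt, hθ.fderiv, hg'.fderiv]
  have h1 : fderiv ℝ fFun p (raiseCov ε p (fderiv ℝ z p)) = fderiv ℝ z p p / 2 := by
    rw [raiseCov_comm, raiseCov_fderiv_fFun (rad_pos hp), map_smul, smul_eq_mul]; ring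
  simp only [_root_.add_apply, _root_.smul_apply, map_smul, smul_eq_mul, h1, fderiv_fFun_self]
  field_simp
  ring

/-! ### Covectors in polar coordinates and the pointwise estimate -/

/-- `L(∂_τ)`. -/
def covTau (p : Spacetime m n) (L : Spacetime m n →L[ℝ] ℝ) : ℝ :=
  L (mkPoint ((tau p)⁻¹ • timePart p) 0)

/-- `L(∂_r)`. -/
def covRad (p : Spacetime m n) (L : Spacetime m n →L[ℝ] ℝ) : ℝ :=
  L (mkPoint 0 ((rad p)⁻¹ • spacePart p))

/-- The square of the angular part of the Euclidean gradient in the `t`-directions. -/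
def temporalSq (p : Spacetime m n) (L : Spacetime m n →L[ℝ] ℝ) : ℝ :=
  ⟪timePart (sharp L), timePart (sharp L)⟫ - covTau p L ^ 2

lemma covTau_eq (L : Spacetime m n →L[ℝ] ℝ) :
    covTau p L = (tau p)⁻¹ * ⟪timePart p, timePart (sharp L)⟫ := by
  rw [covTau, ← inner_sharp' L, inner_eq_parts, timePart_mkPoint, spacePart_mkPoint,
    inner_zero_left, add_zero, inner_smul_left]
  simp

lemma covRad_eq (L : Spacetime m n →L[ℝ] ℝ) :
    covRad p L = (rad p)⁻¹ * ⟪spacePart p, spacePart (sharp L)⟫ := by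
  rw [covRad, ← inner_sharp' L, inner_eq_parts, timePart_mkPoint, spacePart_mkPoint,
    inner_zero_left, zero_add, inner_smul_left]
  simp

lemma tau_mul_covTau (L : Spacetime m n →L[ℝ] ℝ) :
    tau p * covTau p L = ⟪timePart p, timePart (sharp L)⟫ := by
  rw [covTau_eq]
  rcases eq_or_ne (tau p) 0 with h | h
  · have : timePart p = 0 := norm_eq_zero.1 h
    rw [h, this]; simp
  · field_simp

lemma rad_mul_covRad (hr : 0 < rad p) (L : Spacetime m n →L[ℝ] ℝ) :
    rad p * covRad p L = ⟪spacePart p, spacePart (sharp L)⟫ := by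
  rw [covRad_eq]; field_simp

lemma apply_self_eq (hr : 0 < rad p) (L : Spacetime m n →L[ℝ] ℝ) :
    L p = tau p * covTau p L + rad p * covRad p L := by
  rw [tau_mul_covTau, rad_mul_covRad hr, ← inner_sharp' L, inner_eq_parts]

lemma angularSq_nonneg (hr : 0 < rad p) (L : Spacetime m n →L[ℝ] ℝ) : 0 ≤ angularSq ε p L := by
  refine mul_nonneg (by positivity) (sub_nonneg.2 ?_)
  rw [div_le_iff₀ (by positivity), real_inner_self_eq_norm_sq]
  have h := abs_real_inner_le_norm (spacePart p) (spacePart (sharp L))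
  calc _ = |⟪spacePart p, spacePart (sharp L)⟫| ^ 2 := (sq_abs _).symm
    _ ≤ (‖spacePart p‖ * ‖spacePart (sharp L)‖) ^ 2 := by gcongr
    _ = _ := by rw [rad]; ring

lemma temporalSq_nonneg (L : Spacetime m n →L[ℝ] ℝ) : 0 ≤ temporalSq p L := by
  rw [temporalSq, covTau_eq, real_inner_self_eq_norm_sq]
  have h := abs_real_inner_le_norm (timePart p) (timePart (sharp L))
  rcases eq_or_ne (tau p) 0 with h0 | h0
  · rw [h0]; simp
  · have ht : 0 < tau p := lt_of_le_of_ne (tau_nonneg p) h0.symm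
    rw [sub_nonneg]
    calc ((tau p)⁻¹ * ⟪timePart p, timePart (sharp L)⟫) ^ 2
        = (tau p)⁻¹ ^ 2 * |⟪timePart p, timePart (sharp L)⟫| ^ 2 := by rw [sq_abs]; ring
      _ ≤ (tau p)⁻¹ ^ 2 * (tau p * ‖timePart (sharp L)‖) ^ 2 := by gcongr; exact h
      _ = _ := by field_simp

lemma sharp_fderiv_fFun (p : Spacetime m n) : sharp (fderiv ℝ fFun p) =
      mkPoint (-(1 / 2 : ℝ) • timePart p) ((1 / 2 : ℝ) • spacePart p) := by
  refine ext_inner_right ℝ fun Y => ?_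
  rw [inner_sharp, fderiv_fFun, inner_eq_parts, timePart_mkPoint, spacePart_mkPoint,
    inner_smul_left, inner_smul_left]
  simp
  ring

lemma timePart_sharp_comb (c c' : ℝ) (L : Spacetime m n →L[ℝ] ℝ) :
    timePart (sharp (c • L + c' • fderiv ℝ fFun p)) =
      c • timePart (sharp L) + (-(c' / 2)) • timePart p := by
  rw [sharp_add, sharp_smul, sharp_smul, sharp_fderiv_fFun, timePart_add, timePart_smul,
    timePart_smul, timePart_mkPoint, smul_smul]
  congr 2; ring

lemma spacePart_sharp_comb (c c' : ℝ) (L : Spacetime m n →L[ℝ] ℝ) :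
    spacePart (sharp (c • L + c' • fderiv ℝ fFun p)) =
      c • spacePart (sharp L) + (c' / 2) • spacePart p := by
  rw [sharp_add, sharp_smul, sharp_smul, sharp_fderiv_fFun, spacePart_add, spacePart_smul,
    spacePart_smul, spacePart_mkPoint, smul_smul]
  congr 2; ring

/-- Radial functions do not contribute to the angular derivatives. -/
lemma angularSq_comb (hr : 0 < rad p) (c c' : ℝ) (L : Spacetime m n →L[ℝ] ℝ) :
    angularSq ε p (c • L + c' • fderiv ℝ fFun p) = c ^ 2 * angularSq ε p L := by
  have hx : ⟪spacePart p, spacePart p⟫ = rad p ^ 2 := real_inner_self_eq_norm_sq _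
  simp only [angularSq, spacePart_sharp_comb, inner_add_left, inner_add_right, inner_smul_left,
    inner_smul_right, hx, conj_trivial, real_inner_comm (spacePart p) (spacePart (sharp L))]
  field_simp
  ring

lemma temporalSq_comb (c c' : ℝ) (L : Spacetime m n →L[ℝ] ℝ) :
    temporalSq p (c • L + c' • fderiv ℝ fFun p) = c ^ 2 * temporalSq p L := by
  have hx : ⟪timePart p, timePart p⟫ = tau p ^ 2 := real_inner_self_eq_norm_sq _
  simp only [temporalSq, covTau_eq, timePart_sharp_comb, inner_add_left, inner_add_right,
    inner_smul_left, inner_smul_right, hx, conj_trivial,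
    real_inner_comm (timePart p) (timePart (sharp L))]
  rcases eq_or_ne (tau p) 0 with h | h
  · have : timePart p = 0 := norm_eq_zero.1 h
    rw [h, this]; simp; ring
  · field_simp
    ring

lemma covRad_comb (hr : 0 < rad p) (c c' : ℝ) (L : Spacetime m n →L[ℝ] ℝ) :
    covRad p (c • L + c' • fderiv ℝ fFun p) = c * covRad p L + c' * rad p / 2 := by
  have hx : ⟪spacePart p, spacePart p⟫ = rad p ^ 2 := real_inner_self_eq_norm_sq _
  rw [covRad_eq, spacePart_sharp_comb, inner_add_right, inner_smul_right, inner_smul_right, hx,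
    covRad_eq]
  field_simp

lemma covTau_comb (c c' : ℝ) (L : Spacetime m n →L[ℝ] ℝ) :
    covTau p (c • L + c' • fderiv ℝ fFun p) = c * covTau p L - c' * tau p / 2 := by
  have hx : ⟪timePart p, timePart p⟫ = tau p ^ 2 := real_inner_self_eq_norm_sq _
  rw [covTau_eq, timePart_sharp_comb, inner_add_right, inner_smul_right, inner_smul_right, hx,
    covTau_eq]
  rcases eq_or_ne (tau p) 0 with h | h
  · rw [h]; simp
  · field_simp
    ring

lemma raiseCov_self_polar (hr : 0 < rad p) (L : Spacetime m n →L[ℝ] ℝ) :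
    L (raiseCov ε p L) = covRad p L ^ 2 - covTau p L ^ 2 + angularSq ε p L - temporalSq p L := by
  rw [raiseCov_self, temporalSq, covRad_eq]
  field_simp
  ring

lemma spatialAngularSq_eq (hr : 0 < rad p) (z : Spacetime m n → ℝ) :
    spatialAngularSq ε z p = angularSq ε p (fderiv ℝ z p) := by
  have h1 : ∑ j : Fin n, partialD (Sum.inr j) z p ^ 2 =
      ⟪spacePart (sharp (fderiv ℝ z p)), spacePart (sharp (fderiv ℝ z p))⟫ := by
    rw [PiLp.inner_apply]
    refine Finset.sum_congr rfl fun j _ => ?_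
    simp [spacePart, sharp_apply, partialD, sq]
  have h2 : derivRad z p = covRad p (fderiv ℝ z p) := rfl
  rw [spatialAngularSq, angularSq, h1, h2, covRad_eq, warpRatio]
  field_simp

lemma temporalAngularSq_eq (z : Spacetime m n → ℝ) :
    temporalAngularSq z p = -temporalSq p (fderiv ℝ z p) := by
  have h1 : ∑ j : Fin m, partialD (Sum.inl j) z p ^ 2 =
      ⟪timePart (sharp (fderiv ℝ z p)), timePart (sharp (fderiv ℝ z p))⟫ := by
    rw [PiLp.inner_apply]
    refine Finset.sum_congr rfl fun j _ => ?_
    simp [timePart, sharp_apply, partialD, sq]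
  rw [temporalAngularSq, temporalSq, h1]
  rfl

/-- The zeroth order part `w` of the multiplier, chosen so that in `divergence_current` the
coefficient of `|∇ψ|²` is `-ε f / ρ̄`. -/
def multW (ε : ℝ) (p : Spacetime m n) : ℝ :=
  ((m : ℝ) + n - 2) / 4 + ((n : ℝ) - 2) / 2 * ε * (fFun p / warpedRadius ε p)

lemma warpedRadius_pos (hε : 0 < ε) (hp : p ∈ exteriorCone m n) : 0 < warpedRadius ε p := by
  have h1 := rad_pos hp
  have h2 : 0 < fFun p := hp
  unfold warpedRadius; positivity

lemma contDiffAt_multW {k : WithTop ℕ∞} (hk : k ≤ ∞) (hε : 0 < ε) (hp : p ∈ exteriorCone m n) :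
    ContDiffAt ℝ k (multW ε : Spacetime m n → ℝ) p := by
  have h1 : ContDiffAt ℝ k (fFun : Spacetime m n → ℝ) p := (contDiff_fFun.of_le hk).contDiffAt
  have h2 : ContDiffAt ℝ k (warpedRadius ε : Spacetime m n → ℝ) p :=
    (contDiffAt_rad (rad_pos hp)).add (contDiffAt_const.mul h1)
  exact contDiffAt_const.add (contDiffAt_const.mul (h1.div h2 (warpedRadius_pos hε hp).ne'))

lemma dRad_raiseCov (hr : 0 < rad p) (L : Spacetime m n →L[ℝ] ℝ) :
    dRad p (raiseCov ε p L) = covRad p L := by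
  rw [dRad, raiseCov, raise, spacePart_mkPoint, inner_add_right, inner_smul_right,
    inner_smul_right, real_inner_self_eq_norm_sq, covRad_eq, show ‖spacePart p‖ = rad p from rfl]
  field_simp
  ring

lemma fderiv_multW_raiseCov (hε : 0 < ε) (hp : p ∈ exteriorCone m n)
    (L : Spacetime m n →L[ℝ] ℝ) :
    fderiv ℝ (multW ε) p (raiseCov ε p L) =
      ((n : ℝ) - 2) * ε * (nullV p * (nullV p * (covTau p L + covRad p L))
        - nullU p * (nullU p * (covTau p L - covRad p L))) / (4 * warpedRadius ε p ^ 2) := by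
  have hr := rad_pos hp
  have hρ := warpedRadius_pos hε hp
  have hrd := (hasFDerivAt_rad hr).differentiableAt
  have hfd := differentiableAt_fFun p
  have hρd := hrd.hasFDerivAt.fun_add (hfd.hasFDerivAt.const_mul (2 * ε))
  have hinv := (hasDerivAt_inv hρ.ne').comp_hasFDerivAt p hρd
  have hmain := ((hfd.hasFDerivAt.fun_mul hinv).const_mul (((n : ℝ) - 2) / 2 * ε)).const_add
    (((m : ℝ) + n - 2) / 4)
  have hmul : fderiv ℝ (multW ε) p = _ := (HasFDerivAt.congr_of_eventuallyEq hmain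
    (Filter.Eventually.of_forall fun q => by
      simp only [multW, Function.comp, div_eq_mul_inv])).fderiv
  have h1 : fderiv ℝ fFun p (raiseCov ε p L) = L p / 2 := by
    rw [raiseCov_comm, raiseCov_fderiv_fFun hr, map_smul, smul_eq_mul]; ring
  rw [hmul]
  simp only [_root_.smul_apply, _root_.add_apply, smul_eq_mul, h1, fderiv_rad hr,
    dRad_raiseCov hr, apply_self_eq hr, Function.comp]
  have hρ' : rad p + 2 * ε * fFun p = warpedRadius ε p := rfl
  field_simp
  simp only [← hρ', fFun, nullU, nullV]
  ring

/-- The current of the multiplier for `ψ = ζ^{1/2} z`, in terms of the value `y` and the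
differential `L` of `z` at `p`. -/
def carlemanCurrent (ε a b : ℝ) (p : Spacetime m n) (y : ℝ) (L : Spacetime m n →L[ℝ] ℝ) :
    Spacetime m n :=
  volDensity ε p • current ε (multW ε p) (ampPot a b (fFun p)) p (ampFun a b (fFun p) * y)
    (conjCov a b p y L)

/-- The pointwise Carleman estimate: `carleman_algebra` applied to the null components of `dψ`, where
`ψ = ζ^{1/2} z`, after the terms with `u ∂_u z` and `v ∂_v z` are expressed through `ψ`. -/
lemma pointwise_carleman (hm : 1 ≤ m) (hn : 1 ≤ n) (hp : p ∈ exteriorCone m n) (hε : 0 < ε)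
    (hb : 0 < b) (had : ((m : ℝ) + n) ^ 2 ≤ a) (hεb : ε ≤ b / 100)
    (hbs : b * √(fFun p) ≤ 1 / 100) {z : Spacetime m n → ℝ} (hz : ContDiffAt ℝ 2 z p) :
    ε / 8 * firstOrderTerm ε a b z p + b * a ^ 2 / 4 * zerothOrderTerm a b z p ≤
      1 / (2 * a) * waveTerm ε a b z p + (volDensity ε p)⁻¹ *
        divergence (fun q => carlemanCurrent ε a b q (z q) (fderiv ℝ z q)) p := by
  have hf : 0 < fFun p := hp
  have hr := rad_pos hp
  have hs := Real.sqrt_pos.2 hf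
  have hzd : DifferentiableAt ℝ z p := hz.differentiableAt (by norm_num)
  have hev : (fun q => carlemanCurrent ε a b q (z q) (fderiv ℝ z q)) =ᶠ[nhds p]
      fun q => volDensity ε q • current ε (multW ε q) (ampPot a b (fFun q)) q (conj a b z q)
        (fderiv ℝ (conj a b z) q) := by
    filter_upwards [isOpen_exteriorCone.mem_nhds hp,
      (hz.eventually (by decide)).mono fun q hq => hq.differentiableAt (by norm_num)] with q hq hzq
    rw [(hasFDerivAt_conj hq hzq).fderiv]
    rfl
  have hdiv : divergence (fun q => carlemanCurrent ε a b q (z q) (fderiv ℝ z q)) p = divergence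
      (fun q => volDensity ε q • current ε (multW ε q) (ampPot a b (fFun q)) q (conj a b z q)
        (fderiv ℝ (conj a b z) q)) p := by
    refine Finset.sum_congr rfl fun i _ => partialD_congr ?_ i
    filter_upwards [hev] with q hq
    rw [hq]
  have hA := hasFDerivAt_comp_fFun (m := m) (n := n) (p := p) (hasDerivAt_ampPot (a := a) (b := b) hf)
  rw [hdiv, divergence_current hn hε hp (contDiffAt_conj (by decide) hp hz)
    ((contDiffAt_multW (k := 1) (by simp) hε hp).differentiableAt (by norm_num))
    hA.differentiableAt, hA.fderiv, box_conj hn hε hp hz, (hasFDerivAt_conj hp hzd).fderiv,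
    fderiv_multW_raiseCov hε hp]
  set L := fderiv ℝ z p with hL
  set θ := ampFun a b (fFun p) with hθ
  set φ := ampLog a b (fFun p) with hφ
  set M := conjCov a b p (z p) L with hM
  have hθ0 : θ ≠ 0 := (ampFun_pos _).ne'
  have key := carleman_algebra (a := a) (b := b) (ε := ε) (f := fFun p) (s := √(fFun p))
    (r := rad p) (ρ := warpedRadius ε p) (u := nullU p) (v := nullV p) (w := multW ε p)
    (d := (m : ℝ) + n) (n := n) (U := nullU p * (covTau p M - covRad p M))
    (V := nullV p * (covTau p M + covRad p M)) (y := θ * z p)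
    (L := θ * box (warpedMetric ε) z p) (Ax := angularSq ε p M) (At := temporalSq p M)
    (N := M (raiseCov ε p M)) (D := fderiv ℝ (multW ε) p (raiseCov ε p M))
    hf hs (Real.sq_sqrt hf.le) (nullU_neg hp) (nullV_pos hp) rfl
    (by simp only [nullU, nullV]; ring) rfl hε hb (by exact_mod_cast hn)
    (by have : (1 : ℝ) ≤ m := by exact_mod_cast hm
        linarith) had hεb hbs rfl
    (by rw [raiseCov_self_polar hr]; simp only [fFun]; ring)
    (angularSq_nonneg hr _) (temporalSq_nonneg _) (fderiv_multW_raiseCov hε hp M)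
  rw [fderiv_multW_raiseCov hε hp] at key
  have hMp : M p = nullU p * (covTau p M - covRad p M) + nullV p * (covTau p M + covRad p M) := by
    rw [apply_self_eq hr]; simp only [nullU, nullV]; ring
  have hMp' : M p = θ * L p + θ * φ * z p * (2 * fFun p) := by
    rw [hM, conjCov]
    simp only [_root_.add_apply, _root_.smul_apply, smul_eq_mul, fderiv_fFun_self]
    rfl
  have hΦ : fFun p * φ = a * (1 + b * √(fFun p)) := by
    rw [hφ, ampLog]
    have := Real.sq_sqrt hf.le
    field_simp
    linear_combination (-(a * b)) * this
  have hff : fFun p = -(nullU p * nullV p) := rfl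
  have hτ : tau p = nullU p + nullV p := by simp only [nullU, nullV]; ring
  have hrad : rad p = nullV p - nullU p := by simp only [nullU, nullV]; ring
  have hU : nullU p * (covTau p M - covRad p M) - a * (1 + b * √(fFun p)) * (θ * z p) =
      θ * (nullU p * derivU z p) := by
    rw [hM, conjCov, covTau_comb, covRad_comb hr, ← hΦ,
      show derivU z p = covTau p L - covRad p L from rfl, ← hθ, ← hφ, hff, hτ, hrad]
    ring
  have hV : nullV p * (covTau p M + covRad p M) - a * (1 + b * √(fFun p)) * (θ * z p) =
      θ * (nullV p * derivV z p) := by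
    rw [hM, conjCov, covTau_comb, covRad_comb hr, ← hΦ,
      show derivV z p = covTau p L + covRad p L from rfl, ← hθ, ← hφ, hff, hτ, hrad]
    ring
  have hAx : angularSq ε p M = θ ^ 2 * angularSq ε p L := angularSq_comb hr _ _ _
  have hAt : temporalSq p M = θ ^ 2 * temporalSq p L := temporalSq_comb _ _ _
  have hζ : weight a b p = θ ^ 2 := (ampFun_sq hp).symm
  have e1 : firstOrderTerm ε a b z p = (warpedRadius ε p)⁻¹ *
      ((nullU p * (covTau p M - covRad p M) - a * (1 + b * √(fFun p)) * (θ * z p)) ^ 2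
      + (nullV p * (covTau p M + covRad p M) - a * (1 + b * √(fFun p)) * (θ * z p)) ^ 2
      + fFun p * angularSq ε p M + fFun p * temporalSq p M) := by
    rw [hU, hV, hAx, hAt, firstOrderTerm, hζ, spatialAngularSq_eq hr, temporalAngularSq_eq]
    ring
  have e2 : zerothOrderTerm a b z p = (θ * z p) ^ 2 / √(fFun p) := by
    rw [zerothOrderTerm, hζ, Real.rpow_neg hf.le, ← Real.sqrt_eq_rpow]
    ring
  have e3 : 1 / (2 * a) * waveTerm ε a b z p =
      fFun p * (θ * box (warpedMetric ε) z p) ^ 2 / (2 * a) := by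
    rw [waveTerm, hζ]; ring
  rw [e1, e2, e3]
  refine key.trans (le_of_eq ?_)
  have hconj : conj a b z p = θ * z p := rfl
  have hLp : θ * L p = M p - φ * (θ * z p) * (2 * fFun p) := by rw [hMp']; ring
  have e4 : θ * (box (warpedMetric ε) z p + φ * L p + z p * (φ *
          ((m + n + 2 * ((n : ℝ) - 1) * ε * (fFun p / warpedRadius ε p)) / 2)
        + fFun p * φ ^ 2 + fFun p * (-a / fFun p ^ 2 - a * b / (2 * fFun p * √(fFun p))))) =
      θ * box (warpedMetric ε) z p + φ * (M p - φ * (θ * z p) * (2 * fFun p))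
      + θ * z p * (φ *
          ((m + n + 2 * ((n : ℝ) - 1) * ε * (fFun p / warpedRadius ε p)) / 2)
        + fFun p * φ ^ 2 + fFun p * (-a / fFun p ^ 2 - a * b / (2 * fFun p * √(fFun p)))) := by
    rw [← hLp]; ring
  rw [e4, hconj]
  simp only [_root_.smul_apply, smul_eq_mul, fderiv_fFun_self, ← hMp]
  have hφ' : φ = a / fFun p + a * b / √(fFun p) := rfl
  have hw : multW ε p = ((m : ℝ) + n - 2) / 4
    + ((n : ℝ) - 2) / 2 * ε * (fFun p / warpedRadius ε p) := rfl
  rw [hφ', hw, ampPot]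
  generalize M p = P
  generalize θ * z p = y
  generalize M (raiseCov ε p M) = N
  generalize angularSq ε p M = Ax
  generalize θ * box (warpedMetric ε) z p = B
  obtain ⟨s, hs', hfs⟩ : ∃ s, 0 < s ∧ fFun p = s ^ 2 := ⟨√(fFun p), hs, (Real.sq_sqrt hf.le).symm⟩
  have hρ := warpedRadius_pos hε hp
  generalize warpedRadius ε p = ρ at hρ ⊢
  rw [hfs, Real.sqrt_sq hs'.le]
  field_simp
  ring

end Conjugation

/-! ### The image of a domain under the conformal map -/

section WarpedDomain

variable {m n : ℕ} {ε : ℝ} {p : Spacetime m n} {U A : Set (Spacetime m n)}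

/-- The image `Φ̄(A ∩ 𝔇)`, written as a preimage under the inverse `warpMap (-ε)` of `Φ̄`. -/
def warpedSet (ε : ℝ) (A : Set (Spacetime m n)) : Set (Spacetime m n) :=
  exteriorCone m n ∩ warpMap (-ε) ⁻¹' A

lemma contDiffAt_warpMap_neg (hε : 0 < ε) (hp : p ∈ exteriorCone m n) :
    ContDiffAt ℝ ∞ (warpMap (-ε)) p :=
  contDiffAt_warpMap (exteriorCone_subset_warpDomain_neg hε hp)

lemma continuousOn_warpMap_neg (hε : 0 < ε) :
    ContinuousOn (warpMap (-ε)) (exteriorCone m n) := fun _ hp =>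
  (contDiffAt_warpMap_neg hε hp).continuousAt.continuousWithinAt

lemma isOpen_warpedSet (hε : 0 < ε) (hU : IsOpen U) : IsOpen (warpedSet ε U) :=
  (continuousOn_warpMap_neg hε).isOpen_inter_preimage isOpen_exteriorCone hU

/-- The conformal map is a homeomorphism onto the exterior of the null cone, so it commutes with the
closure relative to the exterior. -/
lemma warpedSet_closure (hε : 0 < ε) (U : Set (Spacetime m n)) :
    warpedSet ε (closure U) = exteriorCone m n ∩ closure (warpedSet ε U) := by
  ext p
  refine ⟨fun hp => ⟨hp.1, ?_⟩, fun hp => ⟨hp.1, ?_⟩⟩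
  · have h1 := warpMap_neg_mem hε hp.1
    have h2 : warpMap (-ε) p ∈ closure (warpDomain ε m n ∩ U) :=
      (isOpen_warpDomain ε).inter_closure ⟨h1, hp.2⟩
    have h3 := (contDiffAt_warpMap h1).continuousAt.continuousWithinAt.mem_closure_image h2
    rw [warpMap_warpMap_neg hε hp.1] at h3
    refine closure_mono ?_ h3
    rintro _ ⟨q, hq, rfl⟩
    refine ⟨(warpMap_mem_warpDomain hq.1).1, ?_⟩
    rw [Set.mem_preimage, warpMap_neg_warpMap hq.1]
    exact hq.2
  · exact ((contDiffAt_warpMap_neg hε hp.1).continuousAt.continuousWithinAt.mem_closure hp.2)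
      fun q hq => hq.2

lemma warpedSet_frontier (hε : 0 < ε) (hU : IsOpen U) :
    warpedSet ε (frontier U) = exteriorCone m n ∩ frontier (warpedSet ε U) := by
  rw [hU.frontier_eq, (isOpen_warpedSet hε hU).frontier_eq]
  have h := warpedSet_closure hε U
  ext p
  constructor
  · rintro ⟨h1, h2, h3⟩
    have : p ∈ warpedSet ε (closure U) := ⟨h1, h2⟩
    rw [h] at this
    exact ⟨h1, this.2, fun h4 => h3 h4.2⟩
  · rintro ⟨h1, h2, h3⟩
    have : p ∈ warpedSet ε (closure U) := by rw [h]; exact ⟨h1, h2⟩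
    exact ⟨h1, this.2, fun h4 => h3 ⟨h1, h4⟩⟩

/-- The derivatives of `Φ̄` and of its inverse are inverse to each other. -/
lemma fderiv_warpMap_comp (hε : 0 < ε) (hp : p ∈ exteriorCone m n) (Y : Spacetime m n) :
    fderiv ℝ (warpMap (-ε)) p (fderiv ℝ (warpMap ε) (warpMap (-ε) p) Y) = Y := by
  have h1 := warpMap_neg_mem hε hp
  have hd1 : HasFDerivAt (warpMap ε) (fderiv ℝ (warpMap ε) (warpMap (-ε) p)) (warpMap (-ε) p) :=
    ((contDiffAt_warpMap h1).differentiableAt (by simp)).hasFDerivAt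
  have hd2 : HasFDerivAt (warpMap (-ε)) (fderiv ℝ (warpMap (-ε)) p)
      (warpMap ε (warpMap (-ε) p)) := by
    rw [warpMap_warpMap_neg hε hp]
    exact ((contDiffAt_warpMap_neg hε hp).differentiableAt (by simp)).hasFDerivAt
  have h2 := hd2.comp (warpMap (-ε) p) hd1
  have h3 : HasFDerivAt (fun q : Spacetime m n => q) (ContinuousLinearMap.id ℝ _)
      (warpMap (-ε) p) := hasFDerivAt_id _
  have h4 : (warpMap (-ε) ∘ warpMap ε) =ᶠ[nhds (warpMap (-ε) p)] fun q : Spacetime m n => q := by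
    filter_upwards [(isOpen_warpDomain ε).mem_nhds h1] with q hq
    exact warpMap_neg_warpMap hq
  have h5 := h2.unique (h3.congr_of_eventuallyEq h4)
  exact congrArg (fun L => L Y) h5

/-- Pulling back by the inverse of the conformal map preserves local defining functions. -/
lemma IsLocalDefiningFunction.warped (hε : 0 < ε) {k : WithTop ℕ∞} (hk1 : 1 ≤ k) (hk : k ≤ ∞)
    {W : Set (Spacetime m n)}
    {φ : Spacetime m n → ℝ} (h : IsLocalDefiningFunction k U W φ) :
    IsLocalDefiningFunction k (warpedSet ε U) (warpedSet ε W) (φ ∘ warpMap (-ε)) := by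
  refine ⟨isOpen_warpedSet hε h.isOpen, ?_, ?_, ?_⟩
  · exact h.contDiffOn.comp (fun q hq => ((contDiffAt_warpMap_neg hε hq.1).of_le
      hk).contDiffWithinAt) fun q hq => hq.2
  · intro q hq h0
    refine h.fderiv_ne_zero _ hq.2 (ContinuousLinearMap.ext fun Y => ?_)
    have hd : HasFDerivAt (φ ∘ warpMap (-ε)) _ q :=
      (h.differentiableAt hk1 hq.2).hasFDerivAt.comp q
        ((contDiffAt_warpMap_neg hε hq.1).differentiableAt (by simp)).hasFDerivAt
    rw [hd.fderiv] at h0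
    have := congrArg (fun L => L (fderiv ℝ (warpMap ε) (warpMap (-ε) q) Y)) h0
    simpa [fderiv_warpMap_comp hε hq.1] using this
  · ext q
    have := congrArg (fun s => warpMap (-ε) q ∈ s) h.inter_eq
    simp only [Set.mem_inter_iff, Set.mem_ofPred_eq, eq_iff_iff] at this
    constructor
    · rintro ⟨h1, h2⟩
      exact ⟨h2, (this.1 ⟨h1.2, h2.2⟩).2⟩
    · rintro ⟨h1, h2⟩
      exact ⟨⟨h1.1, (this.2 ⟨h1.2, h2⟩).1⟩, h1⟩

/-- `Φ̄` is conformal: it pulls the warped metric back to a multiple of the flat one. -/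
lemma flatMetric_fderiv_warpMap_neg (hε : 0 < ε) (hp : p ∈ exteriorCone m n)
    (q X Y : Spacetime m n) :
    flatMetric q (fderiv ℝ (warpMap (-ε)) p X) (fderiv ℝ (warpMap (-ε)) p Y) =
      (warpFactor (-ε) p ^ 2)⁻¹ * warpedMetric ε p X Y := by
  have hr := rad_pos hp
  have hp' := exteriorCone_subset_warpDomain_neg hε hp
  have hE := warpFactor_pos hp'
  have h0 : warpMap (-ε) =ᶠ[nhds p] fun q => mkPointCLM m n
      ((warpFactor (-ε) q)⁻¹ • timeCLM m n q,
        ((warpFactor (-ε) q)⁻¹ * warpRatio ε q) • spaceCLM m n q) := by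
    filter_upwards [(isOpen_warpDomain (-ε)).mem_nhds hp'] with q hq
    rw [warpMap_eq hq, warpRatio, warpedRadius]
    simp only [mul_neg, neg_mul, sub_neg_eq_add]
    rfl
  have hrd := hasFDerivAt_rad hr
  have hfd := (differentiableAt_fFun p).hasFDerivAt
  have hEd : HasFDerivAt (warpFactor (-ε) : Spacetime m n → ℝ)
      (ε • fderiv ℝ rad p + ε ^ 2 • fderiv ℝ fFun p) p := by
    have h1 := ((hrd.differentiableAt.hasFDerivAt.const_mul ε).const_add 1).fun_add
      (hfd.const_mul (ε ^ 2))
    refine h1.congr_of_eventuallyEq (Filter.Eventually.of_forall fun q => ?_)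
    simp only [warpFactor]; ring
  have hsd : HasFDerivAt (warpRatio ε : Spacetime m n → ℝ)
      ((2 * ε / rad p) • fderiv ℝ fFun p - (2 * ε * fFun p / rad p ^ 2) • fderiv ℝ rad p) p := by
    have h1 := ((hfd.const_mul (2 * ε)).fun_mul
      ((hasDerivAt_inv hr.ne').comp_hasFDerivAt p hrd.differentiableAt.hasFDerivAt)).const_add 1
    have h2 : HasFDerivAt (warpRatio ε : Spacetime m n → ℝ) _ p := h1.congr_of_eventuallyEq (by
      filter_upwards [continuous_rad.continuousAt.eventually (lt_mem_nhds hr)] with q hq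
      rw [warpRatio_eq hq, div_eq_mul_inv]; rfl)
    refine h2.congr_fderiv ?_
    ext Y
    simp only [_root_.add_apply, _root_.sub_apply, _root_.smul_apply, smul_eq_mul, Function.comp]
    field_simp
    ring
  have hEi := (hasDerivAt_inv hE.ne').comp_hasFDerivAt p hEd
  have hd := (mkPointCLM m n).hasFDerivAt.comp p
    ((hEi.fun_smul (timeCLM m n).hasFDerivAt).prodMk
      ((hEi.fun_mul hsd).fun_smul (spaceCLM m n).hasFDerivAt))
  have hΨ : HasFDerivAt (warpMap (-ε) : Spacetime m n → Spacetime m n) _ p :=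
    hd.congr_of_eventuallyEq h0
  set E := warpFactor (-ε) p with hEdef
  set s := warpRatio ε p with hsdef
  have hform : ∀ X, fderiv ℝ (warpMap (-ε)) p X = mkPoint
      (E⁻¹ • timePart X + (-(E ^ 2)⁻¹ * (ε * dRad p X + ε ^ 2 * fderiv ℝ fFun p X)) • timePart p)
      ((E⁻¹ * s) • spacePart X + (E⁻¹ * (2 * ε / rad p * fderiv ℝ fFun p X
        - 2 * ε * fFun p / rad p ^ 2 * dRad p X)
        + s * (-(E ^ 2)⁻¹ * (ε * dRad p X + ε ^ 2 * fderiv ℝ fFun p X))) • spacePart p) := by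
    intro X
    rw [hΨ.fderiv, ← fderiv_rad hr]
    rfl
  have hs : s = 1 + 2 * ε * fFun p / rad p := warpRatio_eq hr
  have hEe : E = 1 + ε * rad p + ε ^ 2 * fFun p := by
    rw [hEdef, warpFactor]; ring
  have hf : fFun p = (rad p ^ 2 - tau p ^ 2) / 4 := fFun_eq p
  have ht : ⟪timePart p, timePart p⟫ = tau p ^ 2 := real_inner_self_eq_norm_sq _
  have hx : ⟪spacePart p, spacePart p⟫ = rad p ^ 2 := real_inner_self_eq_norm_sq _
  rw [flatMetric, hform, hform, warpedMetric_eq hr, ← hsdef]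
  simp only [timePart_mkPoint, spacePart_mkPoint, inner_add_left, inner_add_right,
    inner_smul_left, inner_smul_right, conj_trivial, ht, hx, fderiv_fFun, dRad,
    real_inner_comm (timePart p) (timePart X), real_inner_comm (spacePart p) (spacePart X)]
  generalize ⟪timePart X, timePart Y⟫ = a1
  generalize ⟪spacePart X, spacePart Y⟫ = a2
  generalize ⟪timePart p, timePart X⟫ = T
  generalize ⟪timePart p, timePart Y⟫ = T'
  generalize ⟪spacePart p, spacePart X⟫ = Z
  generalize ⟪spacePart p, spacePart Y⟫ = Z'
  clear_value s E
  generalize rad p = r at *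
  generalize tau p = t at *
  generalize fFun p = f at *
  subst hs
  have hE' := hE.ne'
  have hr' := hr.ne'
  -- clear denominators; the remaining identity is polynomial once `E` and `f` are substituted
  field_simp
  rw [hEe, hf]
  ring

/-- The image of the domain stays within twice the radius, since the conformal factor is at least
`1/2`; and `√f ≤ r / 2`. -/
lemma rad_lt_of_mem_warpedSet {R : ℝ} (hε : 0 < ε) (hR : ε * R ≤ 1 / 2)
    (hA : A ∩ exteriorCone m n ⊆ {p | rad p < R}) (hp : p ∈ warpedSet ε A) :
    rad p < 2 * R ∧ √(fFun p) ≤ R := by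
  have h1 := warpMap_neg_mem hε hp.1
  have hr' : rad (warpMap (-ε) p) < R := hA ⟨hp.2, h1.1⟩
  have hf : 0 < fFun (warpMap (-ε) p) := h1.1
  have hr0 := rad_nonneg (warpMap (-ε) p)
  have h2 : rad p = (warpFactor ε (warpMap (-ε) p))⁻¹ *
      (rad (warpMap (-ε) p) - 2 * ε * fFun (warpMap (-ε) p)) := by
    rw [← rad_warpMap h1, warpMap_warpMap_neg hε hp.1]
  have hE : 1 / 2 ≤ warpFactor ε (warpMap (-ε) p) := by
    have h3 : ε * rad (warpMap (-ε) p) ≤ ε * R := mul_le_mul_of_nonneg_left hr'.le hε.le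
    have h4 : 0 ≤ ε ^ 2 * fFun (warpMap (-ε) p) := by positivity
    rw [warpFactor]; linarith
  have hlt : rad p < 2 * R := by
    rw [h2, inv_mul_lt_iff₀ (by linarith)]
    have h5 : 0 ≤ 2 * ε * fFun (warpMap (-ε) p) := by positivity
    have h6 : R ≤ warpFactor ε (warpMap (-ε) p) * (2 * R) := by nlinarith
    linarith
  refine ⟨hlt, Real.sqrt_le_iff.2 ⟨by linarith, ?_⟩⟩
  have := rad_nonneg p
  rw [fFun_eq]
  nlinarith [sq_nonneg (tau p)]

end WarpedDomain

/-! ### Derivatives at the boundary -/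

section BoundaryDerivatives

variable {m n : ℕ} {V W O : Set (Spacetime m n)} {φ z : Spacetime m n → ℝ} {q : Spacetime m n}

/-- The closure of a domain with `C¹` boundary has unique derivatives: its tangent cone at a
boundary point contains an open half space. -/
lemma IsLocalDefiningFunction.uniqueDiffWithinAt (h : IsLocalDefiningFunction 1 V W φ)
    (hV : IsOpen V) {S : Set (Spacetime m n)} (hS : V ⊆ S) (hq : q ∈ W)
    (hqV : q ∈ frontier V) : UniqueDiffWithinAt ℝ S q := by
  have h0 := (h.mem_frontier_iff hV hq).1 hqV
  refine ⟨?_, closure_mono hS (frontier_subset_closure hqV)⟩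
  have hcone : ∀ Y, fderiv ℝ φ q Y < 0 → Y ∈ tangentConeAt ℝ S q := by
    intro Y hY
    refine mem_tangentConeAt_of_add_smul_mem (l := nhdsWithin (0 : ℝ) (Set.Ioi 0)) (c := id)
      (Filter.tendsto_id.mono_left (nhdsWithin_mono _ fun x hx => ne_of_gt hx)) ?_
    filter_upwards [eventually_neg_of_fderiv_neg (h.differentiableAt le_rfl hq) h0.le hY,
      (tendsto_add_smul_nhdsGT q Y).eventually (h.isOpen.mem_nhds hq)] with s h1 h2
    exact hS ((h.mem_iff h2).2 h1)
  obtain ⟨e, he⟩ := exists_fderiv_neg (h.fderiv_ne_zero q hq)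
  have htop : Submodule.span ℝ (tangentConeAt ℝ S q) = ⊤ := by
    refine eq_top_iff.2 fun Y _ => ?_
    obtain ⟨c, hc⟩ : ∃ c : ℝ, fderiv ℝ φ q Y + c * fderiv ℝ φ q e < 0 :=
      ⟨(-fderiv ℝ φ q Y - 1) / fderiv ℝ φ q e, by rw [div_mul_cancel₀ _ he.ne]; linarith⟩
    have h1 : Y + c • e ∈ tangentConeAt ℝ S q := hcone _ (by simpa using hc)
    have h2 : Y = (Y + c • e) - c • e := by simp
    rw [h2]
    exact Submodule.sub_mem _ (Submodule.subset_span h1)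
      (Submodule.smul_mem _ _ (Submodule.subset_span (hcone e he)))
  rw [htop]
  exact dense_univ

/-- If `z` vanishes on the boundary its derivative annihilates the tangent vectors of the boundary. -/
lemma IsLocalDefiningFunction.hasFDerivWithinAt_tangent (h : IsLocalDefiningFunction 1 V W φ)
    (hV : IsOpen V) {S : Set (Spacetime m n)} {L : Spacetime m n →L[ℝ] ℝ} (hq : q ∈ W)
    (hqV : q ∈ frontier V) (hS : frontier V ∩ W ⊆ S) (hz : ∀ y ∈ frontier V ∩ W, z y = 0)
    (hL : HasFDerivWithinAt z L S q) {Y : Spacetime m n} (hY : fderiv ℝ φ q Y = 0) : L Y = 0 := by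
  have h0 := (h.mem_frontier_iff hV hq).1 hqV
  have hd := h.differentiableAt le_rfl hq
  obtain ⟨e', he'⟩ := exists_fderiv_neg (h.fderiv_ne_zero q hq)
  set e := -e' with he
  have hepos : 0 < fderiv ℝ φ q e := by rw [he, map_neg]; linarith
  -- curves on both sides of the boundary with tangents close to `Y` enclose boundary points
  have key : ∀ δ : ℝ, 0 < δ → |L Y| ≤ δ * (|L e| + (‖Y‖ + δ * ‖e‖)) := by
    intro δ hδ
    have hlo := (hL.isLittleO.def hδ)
    rw [Filter.eventually_iff, Metric.mem_nhdsWithin_iff] at hlo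
    obtain ⟨ρ1, hρ1, hlo⟩ := hlo
    obtain ⟨ρ2, hρ2, hW⟩ := Metric.isOpen_iff.1 h.isOpen q hq
    have e1 := eventually_neg_of_fderiv_neg (Y := Y - δ • e) hd h0.le (by
      rw [map_sub, map_smul, hY, smul_eq_mul]; nlinarith)
    have e2 := eventually_neg_of_fderiv_neg (φ := fun y => -φ y) (Y := Y + δ • e) (q := q) hd.neg
      (by simp [h0]) (by
        have : fderiv ℝ (fun y => -φ y) q = -fderiv ℝ φ q := hd.hasFDerivAt.neg.fderiv
        rw [this, _root_.neg_apply, map_add, map_smul, hY, smul_eq_mul]; nlinarith)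
    have hC : 0 ≤ ‖Y‖ + δ * ‖e‖ := by positivity
    have e3 : ∀ᶠ t in nhdsWithin (0 : ℝ) (Set.Ioi 0), t * (‖Y‖ + δ * ‖e‖) < min ρ1 ρ2 := by
      have : Filter.Tendsto (fun t : ℝ => t * (‖Y‖ + δ * ‖e‖)) (nhdsWithin 0 (Set.Ioi 0))
          (nhds (0 * (‖Y‖ + δ * ‖e‖))) :=
        ((continuous_id.mul continuous_const).tendsto 0).mono_left nhdsWithin_le_nhds
      rw [zero_mul] at this
      exact this.eventually (gt_mem_nhds (lt_min hρ1 hρ2))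
    obtain ⟨t, ⟨⟨ht1, ht2⟩, ht3⟩, ht0⟩ := ((e1.and e2).and e3 |>.and self_mem_nhdsWithin).exists
    have ht : 0 < t := ht0
    have hnorm : ∀ s ∈ Set.Icc (-δ) δ, ‖t • (Y + s • e)‖ ≤ t * (‖Y‖ + δ * ‖e‖) := by
      intro s hs
      rw [norm_smul, Real.norm_of_nonneg ht.le]
      refine mul_le_mul_of_nonneg_left ((norm_add_le _ _).trans ?_) ht.le
      rw [norm_smul]
      exact add_le_add_right (mul_le_mul_of_nonneg_right (abs_le.2 hs) (norm_nonneg _)) _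
    have hmemW : ∀ s ∈ Set.Icc (-δ) δ, q + t • (Y + s • e) ∈ W := by
      intro s hs
      refine hW ?_
      rw [Metric.mem_ball, dist_self_add_left]
      exact (hnorm s hs).trans_lt (ht3.trans_le (min_le_right _ _))
    have hcont : ContinuousOn (fun s : ℝ => φ (q + t • (Y + s • e))) (Set.Icc (-δ) δ) :=
      h.contDiffOn.continuousOn.comp (by fun_prop) hmemW
    have hivt := intermediate_value_Icc (by linarith) hcont
    obtain ⟨s, hs, hs0⟩ : (0 : ℝ) ∈ (fun s : ℝ => φ (q + t • (Y + s • e))) '' Set.Icc (-δ) δ := by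
      refine hivt ⟨?_, ?_⟩
      · have : Y + (-δ) • e = Y - δ • e := by rw [neg_smul, sub_eq_add_neg]
        simpa only [this] using ht1.le
      · have : -φ (q + t • (Y + δ • e)) < 0 := ht2
        change 0 ≤ φ (q + t • (Y + δ • e))
        linarith
    have hfr : q + t • (Y + s • e) ∈ frontier V ∩ W :=
      ⟨(h.mem_frontier_iff hV (hmemW s hs)).2 hs0, hmemW s hs⟩
    have hlo' := hlo ⟨by
      rw [Metric.mem_ball, dist_self_add_left]
      exact (hnorm s hs).trans_lt (ht3.trans_le (min_le_left _ _)), hS hfr⟩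
    rw [Set.mem_ofPred_eq, hz _ hfr, hz q ⟨hqV, hq⟩, add_sub_cancel_left, sub_self, zero_sub,
      norm_neg, map_smul, norm_smul, Real.norm_of_nonneg ht.le] at hlo'
    have h5 : t * ‖L (Y + s • e)‖ ≤ t * (δ * (‖Y‖ + δ * ‖e‖)) := by
      calc _ ≤ δ * ‖t • (Y + s • e)‖ := hlo'
        _ ≤ δ * (t * (‖Y‖ + δ * ‖e‖)) := mul_le_mul_of_nonneg_left (hnorm s hs) hδ.le
        _ = _ := by ring
    have h6 := le_of_mul_le_mul_left h5 ht
    have h7 : L Y = L (Y + s • e) - s * L e := by simp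
    have h8 : |s * L e| ≤ δ * |L e| := by
      rw [abs_mul]; exact mul_le_mul_of_nonneg_right (abs_le.2 hs) (abs_nonneg _)
    rw [h7]
    calc _ ≤ |L (Y + s • e)| + |s * L e| := abs_sub _ _
      _ ≤ δ * (‖Y‖ + δ * ‖e‖) + δ * |L e| := add_le_add h6 h8
      _ = _ := by ring
  have hlim : Filter.Tendsto (fun δ : ℝ => δ * (|L e| + (‖Y‖ + δ * ‖e‖)))
      (nhdsWithin 0 (Set.Ioi 0)) (nhds 0) := by
    have : Continuous (fun δ : ℝ => δ * (|L e| + (‖Y‖ + δ * ‖e‖))) := by fun_prop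
    simpa using (this.tendsto 0).mono_left (nhdsWithin_le_nhds (s := Set.Ioi (0 : ℝ)))
  have := ge_of_tendsto hlim (by
    filter_upwards [self_mem_nhdsWithin] with δ hδ using key δ hδ)
  exact abs_eq_zero.1 (le_antisymm this (abs_nonneg _))

/-- A linear form that vanishes on the kernel of `L` is a multiple of `L`. -/
lemma exists_eq_smul_of_ker_le {L M : Spacetime m n →L[ℝ] ℝ} (hL : L ≠ 0)
    (h : ∀ Y, L Y = 0 → M Y = 0) : ∃ k : ℝ, M = k • L := by
  obtain ⟨e, he⟩ : ∃ e, L e ≠ 0 := by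
    by_contra! hcon
    exact hL (ContinuousLinearMap.ext hcon)
  refine ⟨M e / L e, ContinuousLinearMap.ext fun Y => ?_⟩
  have := h (Y - (L Y / L e) • e) (by simp [he])
  rw [map_sub, map_smul, smul_eq_mul, sub_eq_zero] at this
  rw [this, _root_.smul_apply, smul_eq_mul]
  ring

lemma continuousOn_outerConormal (hV : IsOpen V)
    (hloc : ∀ q ∈ frontier V ∩ O, ∃ W φ, q ∈ W ∧ IsLocalDefiningFunction 1 V W φ) :
    ContinuousOn (outerConormal V) (frontier V ∩ O) := by
  intro q hq
  obtain ⟨W, φ, hqW, h⟩ := hloc q hq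
  have hcd : ContinuousOn (fderiv ℝ φ) W := h.contDiffOn.continuousOn_fderiv_of_isOpen h.isOpen le_rfl
  have hc : ContinuousAt (fun y => ‖fderiv ℝ φ y‖⁻¹ • fderiv ℝ φ y) q := by
    have h1 := hcd.continuousAt (h.isOpen.mem_nhds hqW)
    exact (h1.norm.inv₀ (norm_ne_zero_iff.2 (h.fderiv_ne_zero q hqW))).smul h1
  refine hc.continuousWithinAt.congr_of_eventuallyEq ?_
    (h.outerConormal_eq hqW ((h.mem_frontier_iff hV hqW).1 hq.1))
  filter_upwards [self_mem_nhdsWithin, mem_nhdsWithin_of_mem_nhds (h.isOpen.mem_nhds hqW)]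
    with y hy hyW
  exact h.outerConormal_eq hyW ((h.mem_frontier_iff hV hyW).1 hy.1)

lemma IsLocalDefiningFunction.fderiv_eq_norm_smul (h : IsLocalDefiningFunction 1 V W φ)
    (hq : q ∈ W) (h0 : φ q = 0) :
    fderiv ℝ φ q = ‖fderiv ℝ φ q‖ • outerConormal V q := by
  rw [h.outerConormal_eq hq h0, smul_smul,
    mul_inv_cancel₀ (norm_ne_zero_iff.2 (h.fderiv_ne_zero q hq)), one_smul]

lemma IsLocalDefiningFunction.norm_outerConormal (h : IsLocalDefiningFunction 1 V W φ)
    (hq : q ∈ W) (h0 : φ q = 0) : ‖outerConormal V q‖ = 1 := by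
  rw [h.outerConormal_eq hq h0, norm_smul, norm_inv, norm_norm,
    inv_mul_cancel₀ (norm_ne_zero_iff.2 (h.fderiv_ne_zero q hq))]

end BoundaryDerivatives

/-! ### Unit normals and the induced volume of the boundary -/

section UnitNormal

variable {m n : ℕ} {ε : ℝ} {V W : Set (Spacetime m n)} {φ z : Spacetime m n → ℝ}
  {q : Spacetime m n}

lemma eq_of_warpedMetric_eq (hε : 0 < ε) (hq : q ∈ exteriorCone m n) {X Y : Spacetime m n}
    (h : ∀ Z, warpedMetric ε q X Z = warpedMetric ε q Y Z) : X = Y := by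
  refine ext_inner_left ℝ fun Z => ?_
  have hs := (warpRatio_pos hε hq).ne'
  rw [← warpedMetric_raise (rad_pos hq) hs Z X, ← warpedMetric_raise (rad_pos hq) hs Z Y,
    warpedMetric_comm, h, warpedMetric_comm]

lemma warpedMetric_raiseCov (hε : 0 < ε) (hq : q ∈ exteriorCone m n)
    (L : Spacetime m n →L[ℝ] ℝ) (Y : Spacetime m n) :
    warpedMetric ε q (raiseCov ε q L) Y = L Y := by
  rw [raiseCov, warpedMetric_raise (rad_pos hq) (warpRatio_pos hε hq).ne', inner_sharp]

lemma warpedMetric_smul_left (c : ℝ) (hq : q ∈ exteriorCone m n) (X Y : Spacetime m n) :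
    warpedMetric ε q (c • X) Y = c * warpedMetric ε q X Y := by
  rw [warpedMetric_eq (rad_pos hq), warpedMetric_eq (rad_pos hq)]
  simp only [timePart_smul, spacePart_smul, inner_smul_left, inner_smul_right, conj_trivial]
  ring

lemma warpedMetric_add_left (hq : q ∈ exteriorCone m n) (X X' Y : Spacetime m n) :
    warpedMetric ε q (X + X') Y = warpedMetric ε q X Y + warpedMetric ε q X' Y := by
  rw [warpedMetric_eq (rad_pos hq), warpedMetric_eq (rad_pos hq), warpedMetric_eq (rad_pos hq)]
  simp only [timePart_add, spacePart_add, inner_add_left, inner_add_right]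
  ring

/-- The outer unit normal is the normalised `ḡ`-gradient of a defining function. -/
lemma outerUnitNormal_eq (hε : 0 < ε) (hV : IsOpen V) (hq : q ∈ exteriorCone m n)
    (h : IsLocalDefiningFunction 1 V W φ) (hqW : q ∈ W) (hqV : q ∈ frontier V)
    (hpos : 0 < outerConormal V q (raiseCov ε q (outerConormal V q))) :
    outerUnitNormal (warpedMetric ε) V q =
      (√(outerConormal V q (raiseCov ε q (outerConormal V q))))⁻¹
        • raiseCov ε q (outerConormal V q) := by
  set ν := outerConormal V q with hν
  set κ := ν (raiseCov ε q ν) with hκ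
  have hs := Real.sqrt_pos.2 hpos
  have hex : ∃ X, IsOuterUnitNormal (warpedMetric ε) V q X := by
    have h0 := (h.mem_frontier_iff hV hqW).1 hqV
    have hn := norm_pos_iff.2 (h.fderiv_ne_zero q hqW)
    refine ⟨(√κ)⁻¹ • raiseCov ε q ν, W, φ, hqW, h0, h,
      ⟨(√κ)⁻¹ * ‖fderiv ℝ φ q‖⁻¹, fun Y => ?_⟩, ?_, ?_⟩
    · rw [warpedMetric_smul_left _ hq, warpedMetric_raiseCov hε hq,
        h.fderiv_eq_norm_smul hqW h0, ← hν, _root_.smul_apply, smul_eq_mul, norm_smul,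
        hν, h.norm_outerConormal hqW h0, norm_norm, mul_one]
      field_simp
    · rw [warpedMetric_smul_left _ hq, warpedMetric_raiseCov hε hq, map_smul, smul_eq_mul, ← hκ]
      have : (√κ)⁻¹ * ((√κ)⁻¹ * κ) = 1 := by
        nth_rewrite 3 [← Real.sq_sqrt hpos.le]
        field_simp
      rw [this, abs_one]
    · rw [h.fderiv_eq_norm_smul hqW h0, ← hν, _root_.smul_apply, map_smul, smul_eq_mul,
        smul_eq_mul, ← hκ]
      positivity
  rw [outerUnitNormal, dif_pos hex]
  -- any outer unit normal is a positive multiple of the gradient, and the length fixes the multiple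
  obtain ⟨W', φ', hqW', h0', h', ⟨c, hc⟩, h1, h2⟩ := hex.choose_spec
  set X := hex.choose
  have hX : X = (c * ‖fderiv ℝ φ' q‖) • raiseCov ε q ν := by
    refine eq_of_warpedMetric_eq hε hq fun Z => ?_
    rw [hc, warpedMetric_smul_left _ hq, warpedMetric_raiseCov hε hq,
      h'.fderiv_eq_norm_smul hqW' h0', ← hν, _root_.smul_apply, smul_eq_mul, norm_smul, hν,
      h'.norm_outerConormal hqW' h0', norm_norm, mul_one]
    ring
  set d := c * ‖fderiv ℝ φ' q‖
  have hn' := norm_pos_iff.2 (h'.fderiv_ne_zero q hqW')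
  have hd : 0 < d := by
    rw [hX, h'.fderiv_eq_norm_smul hqW' h0', ← hν, _root_.smul_apply, map_smul, smul_eq_mul,
      smul_eq_mul, ← hκ] at h2
    exact pos_of_mul_pos_left (pos_of_mul_pos_right h2 hn'.le) hpos.le
  rw [hX]
  congr 1
  rw [hX, warpedMetric_smul_left _ hq, warpedMetric_raiseCov hε hq, map_smul, smul_eq_mul, ← hκ,
    abs_of_pos (by positivity), ← Real.sq_sqrt hpos.le] at h1
  have h3 : (d * √κ) ^ 2 = 1 := by rw [← h1]; ring
  have h4 : d * √κ = 1 := by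
    exact (pow_eq_one_iff_of_nonneg (mul_pos hd hs).le two_ne_zero).1 h3
  exact eq_inv_of_mul_eq_one_left h4

/-- The Gram determinant of a symmetric bilinear form on a hyperplane with unit normal `e` is the
full determinant times `⟨e, r⟩`, where `r` represents `⟨e, ·⟩` in the form. -/
lemma det_gram_orthogonal {k : ℕ} {G : Spacetime m n → Spacetime m n → ℝ}
    (hadd : ∀ X X' Y, G (X + X') Y = G X Y + G X' Y) (hsmul : ∀ (c : ℝ) X Y, G (c • X) Y = c * G X Y)
    (hcomm : ∀ X Y, G X Y = G Y X) {e r : Spacetime m n} (he : ‖e‖ = 1)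
    (hr : ∀ Y, G r Y = ⟪e, Y⟫) {T : Submodule ℝ (Spacetime m n)} (hT : T = (ℝ ∙ e)ᗮ)
    (b : OrthonormalBasis (Fin k) ℝ T) :
    (Matrix.of fun i j => G (b i) (b j)).det =
      (Matrix.of fun i j => G (coordVec i) (coordVec j)).det * ⟪e, r⟫ := by
  have hsum : ∀ {ι : Type} (s : Finset ι) (c : ι → ℝ) (X : ι → Spacetime m n) Y,
      G (∑ i ∈ s, c i • X i) Y = ∑ i ∈ s, c i * G (X i) Y := by
    intro ι s c X Y
    classical
    induction s using Finset.induction_on with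
    | empty =>
      have := hsmul 0 0 Y
      simpa using this
    | insert i s hi ih => rw [Finset.sum_insert hi, Finset.sum_insert hi, hadd, hsmul, ih]
  have hee : ⟪e, e⟫ = (1 : ℝ) := by rw [real_inner_self_eq_norm_sq, he, one_pow]
  have hbe : ∀ i, ⟪e, (b i : Spacetime m n)⟫ = 0 := fun i => by
    have : (b i : Spacetime m n) ∈ (ℝ ∙ e)ᗮ := hT ▸ (b i).2
    exact Submodule.mem_orthogonal_singleton_iff_inner_right.1 this
  have hbb : ∀ i j, ⟪(b i : Spacetime m n), (b j : Spacetime m n)⟫ = if i = j then (1 : ℝ) else 0 := by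
    intro i j
    have := orthonormal_iff_ite.1 b.orthonormal i j
    simpa using this
  have hexp : ∀ Y : Spacetime m n, ∑ i, ⟪(b i : Spacetime m n), Y⟫ • (b i : Spacetime m n)
      + ⟪e, Y⟫ • e = Y := by
    intro Y
    have hmem : Y - ⟪e, Y⟫ • e ∈ T := by
      rw [hT, Submodule.mem_orthogonal_singleton_iff_inner_right, inner_sub_right,
        inner_smul_right, hee, mul_one, sub_self]
    have h1 := congrArg (Subtype.val) (b.sum_repr' ⟨_, hmem⟩)
    simp only [AddSubmonoidClass.coe_finsetSum, Submodule.coe_smul, Submodule.coe_inner,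
      inner_sub_right, inner_smul_right, real_inner_comm (e) (b _ : Spacetime m n), hbe, mul_zero,
      sub_zero] at h1
    rw [h1]; simp
  -- complete `b` to an orthonormal basis of the whole space by `e`
  set F : Fin k ⊕ Unit → Spacetime m n := Sum.elim (fun i => (b i : Spacetime m n)) fun _ => e with hF
  set P : Matrix (Fin k ⊕ Unit) (Fin m ⊕ Fin n) ℝ := Matrix.of fun i j => F i j with hP
  have hFF : ∀ i j, ⟪F i, F j⟫ = if i = j then (1 : ℝ) else 0 := by
    rintro (i | i) (j | j)
    · simp [hF, hbb]
    · simp [hF, real_inner_comm e, hbe]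
    · simp [hF, hbe]
    · simpa [hF] using Or.inl he
  have hPP : P * P.transpose = 1 := by
    ext i j
    rw [Matrix.mul_apply, Matrix.one_apply, ← hFF i j, PiLp.inner_apply]
    refine Finset.sum_congr rfl fun l _ => ?_
    simp [hP, mul_comm]
  have hPP' : P.transpose * P = 1 := by
    ext i j
    have h1 := congrArg (fun X : Spacetime m n => X j) (hexp (coordVec i))
    have h2 : ∀ X : Spacetime m n, ⟪X, coordVec i⟫ = X i := fun X => by
      rw [coordVec, EuclideanSpace.inner_single_right]; simp
    rw [Matrix.mul_apply, Matrix.one_apply]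
    simp only [h2] at h1
    have h3 : (coordVec i : Spacetime m n) j = if i = j then 1 else 0 := by
      simp [coordVec, eq_comm]
    rw [← h3, ← h1]
    simp [hP, hF, Fintype.sum_sum_type]
  have hMat : P * (Matrix.of fun i j => G (coordVec i) (coordVec j)) * P.transpose =
      Matrix.of fun i j => G (F i) (F j) := by
    ext i j
    have h1 : ∀ X Y : Spacetime m n, G X Y =
        ∑ l, (∑ l', X l' * G (coordVec l') (coordVec l)) * Y l := by
      intro X Y
      conv_lhs => rw [← sum_smul_coordVec Y, hcomm, hsum]
      refine Finset.sum_congr rfl fun l _ => ?_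
      rw [hcomm]
      conv_lhs => rw [← sum_smul_coordVec X, hsum]
      ring
    rw [Matrix.of_apply, h1]
    simp only [Matrix.mul_apply, Matrix.transpose_apply, hP, Matrix.of_apply]
  -- the last column of `C` represents `r`, which makes the product with the Gram matrix block triangular
  set C : Matrix (Fin k ⊕ Unit) (Fin k ⊕ Unit) ℝ := Matrix.fromBlocks 1
    (Matrix.of fun i _ => ⟪F (Sum.inl i), r⟫) 0 (Matrix.of fun _ _ => ⟪e, r⟫) with hC
  have hprod : (Matrix.of fun i j => G (F i) (F j)) * C =
      Matrix.fromBlocks (Matrix.of fun i j => G (b i) (b j)) 0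
        (Matrix.of fun _ j => G e (b j)) 1 := by
    have hcol : ∀ i, ∑ j : Fin k, G (F i) (b j) * ⟪(b j : Spacetime m n), r⟫ + G (F i) e * ⟪e, r⟫
        = ⟪e, F i⟫ := by
      intro i
      rw [← hr (F i)]
      conv_rhs => rw [← hexp r, hadd, hsum, hsmul]
      simp only [hcomm (F i), mul_comm]
    ext i j
    rw [Matrix.mul_apply, Fintype.sum_sum_type]
    rcases j with j | j
    · rcases i with i | i <;> simp [hC, hF, Matrix.one_apply]
    · have := hcol i
      rcases i with i | i
      · simp only [hF, Sum.elim_inl, hbe] at this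
        simpa [hC, hF] using this
      · simp only [hF, Sum.elim_inr, hee] at this
        simpa [hC, hF] using this
  have hdet := congrArg Matrix.det hprod
  rw [Matrix.det_mul, ← hMat, Matrix.det_conj_of_mul_eq_one hPP hPP', hC,
    Matrix.det_fromBlocks_zero₂₁, Matrix.det_fromBlocks_zero₁₂, Matrix.det_one, Matrix.det_one,
    one_mul, mul_one,
    Matrix.det_unique (Matrix.of fun _ _ : Unit => ⟪e, r⟫)] at hdet
  exact hdet.symm

/-- The area density of the boundary for `ḡ` is the volume density times the `ḡ`-length of the
Euclidean unit conormal. -/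
lemma boundaryDensity_eq (hn : 1 ≤ n) (hε : 0 < ε) (hV : IsOpen V) (hq : q ∈ exteriorCone m n)
    (h : IsLocalDefiningFunction 1 V W φ) (hqW : q ∈ W) (hqV : q ∈ frontier V)
    (hpos : 0 < outerConormal V q (raiseCov ε q (outerConormal V q))) :
    boundaryDensity (warpedMetric ε) V q =
      volDensity ε q * √(outerConormal V q (raiseCov ε q (outerConormal V q))) := by
  set ν := outerConormal V q with hν
  set κ := ν (raiseCov ε q ν) with hκ
  have hs := Real.sqrt_pos.2 hpos
  have h0 := (h.mem_frontier_iff hV hqW).1 hqV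
  have hN := outerUnitNormal_eq hε hV hq h hqW hqV hpos
  rw [← hν, ← hκ] at hN
  have hT : boundaryTangent (warpedMetric ε) V q = (ℝ ∙ sharp ν)ᗮ := by
    have h1 : (WithLp.toLp 2 fun i => warpedMetric ε q (outerUnitNormal (warpedMetric ε) V q)
        (coordVec i) : Spacetime m n) = (√κ)⁻¹ • sharp ν := by
      ext i
      rw [hN, PiLp.smul_apply, smul_eq_mul, sharp_apply]
      change warpedMetric ε q _ _ = _
      rw [warpedMetric_smul_left _ hq, warpedMetric_raiseCov hε hq]
    rw [boundaryTangent, h1]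
    congr 1
    exact Submodule.span_singleton_smul_eq (IsUnit.mk0 _ (inv_pos.2 hs).ne') _
  rw [boundaryDensity, det_gram_orthogonal (G := warpedMetric ε q) (e := sharp ν)
    (r := raiseCov ε q ν) (warpedMetric_add_left hq) (fun c X Y => warpedMetric_smul_left c hq X Y)
    (fun X Y => warpedMetric_comm X Y) (by rw [norm_sharp, hν, h.norm_outerConormal hqW h0])
    (fun Y => by rw [warpedMetric_raiseCov hε hq, inner_sharp]) hT, abs_mul, inner_sharp, ← hκ,
    Real.sqrt_mul (abs_nonneg _), abs_of_pos hpos]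
  congr 1
  exact sqrt_abs_det_metricMatrix hn hε hq

end UnitNormal

/-! ### Finite area of the boundary -/

section FiniteArea

variable {m n : ℕ} {ε : ℝ} {F : Type*} [NormedAddCommGroup F] [NormedSpace ℝ F]

/-- `h` is bounded and Lipschitz on `s`. -/
def BddLipschitzOn (s : Set (Spacetime m n)) (h : Spacetime m n → F) : Prop :=
  ∃ C : ℝ, 0 ≤ C ∧ (∀ p ∈ s, ‖h p‖ ≤ C) ∧ ∀ p ∈ s, ∀ q ∈ s, ‖h p - h q‖ ≤ C * ‖p - q‖

variable {s : Set (Spacetime m n)}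

lemma BddLipschitzOn.of_bounds {h : Spacetime m n → F} {C C' : ℝ} (hb : ∀ p ∈ s, ‖h p‖ ≤ C)
    (hl : ∀ p ∈ s, ∀ q ∈ s, ‖h p - h q‖ ≤ C' * ‖p - q‖) : BddLipschitzOn s h :=
  ⟨max 0 (max C C'), le_max_left _ _,
    fun p hp => (hb p hp).trans ((le_max_left _ _).trans (le_max_right _ _)),
    fun p hp q hq => (hl p hp q hq).trans (mul_le_mul_of_nonneg_right
      ((le_max_right _ _).trans (le_max_right _ _)) (norm_nonneg _))⟩

lemma BddLipschitzOn.const (c : F) : BddLipschitzOn s fun _ => c :=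
  BddLipschitzOn.of_bounds (C := ‖c‖) (C' := 0) (fun _ _ => le_rfl) (by simp)

lemma BddLipschitzOn.sub {h k : Spacetime m n → F} (hh : BddLipschitzOn s h)
    (hk : BddLipschitzOn s k) : BddLipschitzOn s fun p => h p - k p := by
  obtain ⟨C, -, h1, h2⟩ := hh
  obtain ⟨D, -, k1, k2⟩ := hk
  refine BddLipschitzOn.of_bounds (C := C + D) (C' := C + D)
    (fun p hp => (norm_sub_le _ _).trans (add_le_add (h1 p hp) (k1 p hp))) fun p hp q hq => ?_
  rw [sub_sub_sub_comm, add_mul]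
  exact (norm_sub_le _ _).trans (add_le_add (h2 p hp q hq) (k2 p hp q hq))

lemma BddLipschitzOn.smul {h : Spacetime m n → ℝ} {k : Spacetime m n → F}
    (hh : BddLipschitzOn s h) (hk : BddLipschitzOn s k) :
    BddLipschitzOn s fun p => h p • k p := by
  obtain ⟨C, hC, h1, h2⟩ := hh
  obtain ⟨D, hD, k1, k2⟩ := hk
  refine BddLipschitzOn.of_bounds (C := C * D) (C' := C * D + C * D) (fun p hp => ?_)
    fun p hp q hq => ?_
  · rw [norm_smul]; exact mul_le_mul (h1 p hp) (k1 p hp) (norm_nonneg _) hC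
  · have : h p • k p - h q • k q = (h p - h q) • k p + h q • (k p - k q) := by
      rw [sub_smul, smul_sub]; abel
    rw [this]
    refine (norm_add_le _ _).trans ?_
    rw [norm_smul, norm_smul, add_mul]
    refine add_le_add ?_ ?_
    · calc _ ≤ (C * ‖p - q‖) * D :=
          mul_le_mul (h2 p hp q hq) (k1 p hp) (norm_nonneg _) (by positivity)
        _ = _ := by ring
    · calc _ ≤ C * (D * ‖p - q‖) := mul_le_mul (h1 q hq) (k2 p hp q hq) (norm_nonneg _) hC
        _ = _ := by ring

lemma BddLipschitzOn.clm (L : Spacetime m n →L[ℝ] F) {R : ℝ} (hs : ∀ p ∈ s, ‖p‖ ≤ R) :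
    BddLipschitzOn s L := by
  refine BddLipschitzOn.of_bounds (C := ‖L‖ * R) (C' := ‖L‖) (fun p hp => ?_) fun p hp q hq => ?_
  · exact (L.le_opNorm p).trans (mul_le_mul_of_nonneg_left (hs p hp) (norm_nonneg _))
  · rw [← map_sub]; exact L.le_opNorm _

lemma BddLipschitzOn.norm {h : Spacetime m n → F} (hh : BddLipschitzOn s h) :
    BddLipschitzOn s fun p => ‖h p‖ := by
  obtain ⟨C, -, h1, h2⟩ := hh
  refine BddLipschitzOn.of_bounds (C := C) (C' := C) (fun p hp => by rw [norm_norm]; exact h1 p hp)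
    fun p hp q hq => ?_
  exact (abs_norm_sub_norm_le _ _).trans (h2 p hp q hq)

lemma BddLipschitzOn.inv {h : Spacetime m n → ℝ} (hh : BddLipschitzOn s h) {c : ℝ} (hc : 0 < c)
    (hpos : ∀ p ∈ s, c ≤ h p) : BddLipschitzOn s fun p => (h p)⁻¹ := by
  obtain ⟨C, hC, h1, h2⟩ := hh
  refine BddLipschitzOn.of_bounds (C := c⁻¹) (C' := c⁻¹ * c⁻¹ * C) (fun p hp => ?_)
    fun p hp q hq => ?_
  · rw [norm_inv, Real.norm_of_nonneg (hc.le.trans (hpos p hp))]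
    exact inv_anti₀ hc (hpos p hp)
  · have hp0 := hc.trans_le (hpos p hp)
    have hq0 := hc.trans_le (hpos q hq)
    have : (h p)⁻¹ - (h q)⁻¹ = ((h p)⁻¹ * (h q)⁻¹) * (h q - h p) := by field_simp
    rw [this, norm_mul, mul_assoc]
    have h3 : ‖(h p)⁻¹ * (h q)⁻¹‖ ≤ c⁻¹ * c⁻¹ := by
      rw [Real.norm_of_nonneg (by positivity)]
      exact mul_le_mul (inv_anti₀ hc (hpos p hp)) (inv_anti₀ hc (hpos q hq)) (by positivity)
        (by positivity)
    have h4 : ‖h q - h p‖ ≤ C * ‖p - q‖ := by rw [norm_sub_rev]; exact h2 p hp q hq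
    calc _ ≤ (c⁻¹ * c⁻¹) * (C * ‖p - q‖) := mul_le_mul h3 h4 (norm_nonneg _) (by positivity)
      _ = _ := by ring

/-- The map to the unit vector has Lipschitz constant of order `1 / ‖y‖`. -/
lemma norm_unit_sub_unit_le {x y : EuclideanSpace ℝ (Fin n)} (hx : 0 < ‖x‖) (hy : 0 < ‖y‖) :
    ‖‖x‖⁻¹ • x - ‖y‖⁻¹ • y‖ ≤ ‖y‖⁻¹ * (2 * ‖x - y‖) := by
  have h1 : ‖x‖⁻¹ • x - ‖y‖⁻¹ • y = (‖x‖⁻¹ - ‖y‖⁻¹) • x + ‖y‖⁻¹ • (x - y) := by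
    rw [sub_smul, smul_sub]; abel
  rw [h1]
  refine (norm_add_le _ _).trans ?_
  rw [norm_smul, norm_smul, Real.norm_of_nonneg (inv_nonneg.2 hy.le)]
  have h2 : ‖‖x‖⁻¹ - ‖y‖⁻¹‖ * ‖x‖ ≤ ‖y‖⁻¹ * ‖x - y‖ := by
    have : ‖x‖⁻¹ - ‖y‖⁻¹ = (‖y‖ - ‖x‖) * (‖x‖⁻¹ * ‖y‖⁻¹) := by field_simp
    rw [this, norm_mul, Real.norm_of_nonneg (show 0 ≤ ‖x‖⁻¹ * ‖y‖⁻¹ by positivity), mul_assoc]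
    have e : ‖x‖⁻¹ * ‖y‖⁻¹ * ‖x‖ = ‖y‖⁻¹ := by field_simp
    rw [e, mul_comm]
    refine mul_le_mul_of_nonneg_left ?_ (by positivity)
    rw [norm_sub_rev x y]; exact abs_norm_sub_norm_le _ _
  linarith

/-- The conformal map is Lipschitz on bounded parts of the exterior of the null cone. The only term
that is not smooth at the vertex is `τ² x / r`, and `τ < r`. -/
lemma exists_lipschitzOnWith_warpMap {R : ℝ} (hε : 0 < ε) (hR : ε * R ≤ 1 / 2) :
    ∃ K, LipschitzOnWith K (warpMap ε) (exteriorCone m n ∩ {p | rad p < R}) := by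
  set s := exteriorCone m n ∩ {p : Spacetime m n | rad p < R} with hs
  have hbd : ∀ p ∈ s, ‖p‖ ≤ 2 * R := fun p hp => by
    have h1 := norm_le_parts p
    have h2 : tau p < rad p := tau_lt_rad hp.1
    have h3 : rad p < R := hp.2
    unfold tau rad at *
    linarith
  have ht : BddLipschitzOn s (timeCLM m n) := .clm _ hbd
  have hx : BddLipschitzOn s (spaceCLM m n) := .clm _ hbd
  have hτ : BddLipschitzOn s (tau : Spacetime m n → ℝ) := ht.norm
  have hr : BddLipschitzOn s (rad : Spacetime m n → ℝ) := hx.norm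
  have hτ2 : BddLipschitzOn s (fun p : Spacetime m n => tau p * tau p) := hτ.smul hτ
  have hf : BddLipschitzOn s (fun p : Spacetime m n => (1 / 4 : ℝ) • (rad p * rad p - tau p * tau p)) :=
    (BddLipschitzOn.const (1 / 4 : ℝ)).smul ((hr.smul hr).sub hτ2)
  have hE : BddLipschitzOn s (fun p : Spacetime m n => ((1 - ε • rad p)
      - (-ε ^ 2) • (1 / 4 : ℝ) • (rad p * rad p - tau p * tau p))⁻¹) := by
    refine (((BddLipschitzOn.const (1 : ℝ)).sub ((BddLipschitzOn.const ε).smul hr)).sub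
      ((BddLipschitzOn.const (-ε ^ 2)).smul hf)).inv (c := 1 / 4) (by norm_num) fun p hp => ?_
    obtain ⟨-, h1, h2⟩ := mem_warpDomain_of_rad_lt hε hR hp.1 hp.2
    have h3 : (1 - ε • rad p) - (-ε ^ 2) • (1 / 4 : ℝ) • (rad p * rad p - tau p * tau p)
        = (1 + ε * nullU p) * (1 - ε * nullV p) := by
      rw [← warpFactor_eq, warpFactor, fFun_eq]; simp only [smul_eq_mul]; ring
    rw [h3]; nlinarith
  -- the unit vector `x / r` has Lipschitz constant `O(1/r)`, compensated by `τ² ≤ r²`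
  have hunit : BddLipschitzOn s (fun p : Spacetime m n =>
      (tau p * tau p) • ((rad p)⁻¹ • spacePart p)) := by
    obtain ⟨C, hC, -, h2⟩ := hτ2
    refine BddLipschitzOn.of_bounds (C := R * R) (C' := C + R * 2) (fun p hp => ?_)
      fun p hp q hq => ?_
    · have h1 := rad_pos hp.1
      have h3 := tau_lt_rad hp.1
      have h4 : rad p < R := hp.2
      have h5 := tau_nonneg p
      rw [norm_smul, norm_smul, norm_inv, Real.norm_of_nonneg (by positivity),
        Real.norm_of_nonneg h1.le, show ‖spacePart p‖ = rad p from rfl, inv_mul_cancel₀ h1.ne']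
      nlinarith
    · have hp1 := rad_pos hp.1
      have hq1 := rad_pos hq.1
      have h3 := tau_lt_rad hq.1
      have h4 : rad q < R := hq.2
      have h5 := tau_nonneg q
      have h6 : (tau p * tau p) • ((rad p)⁻¹ • spacePart p)
          - (tau q * tau q) • ((rad q)⁻¹ • spacePart q) =
          (tau p * tau p - tau q * tau q) • ((rad p)⁻¹ • spacePart p)
          + (tau q * tau q) • ((rad p)⁻¹ • spacePart p - (rad q)⁻¹ • spacePart q) := by
        rw [sub_smul, smul_sub]; abel
      rw [h6, add_mul]
      refine (norm_add_le _ _).trans (add_le_add ?_ ?_)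
      · rw [norm_smul, norm_smul, norm_inv, Real.norm_of_nonneg hp1.le,
          show ‖spacePart p‖ = rad p from rfl, inv_mul_cancel₀ hp1.ne', mul_one]
        exact h2 p hp q hq
      · rw [norm_smul, Real.norm_of_nonneg (by positivity)]
        have h7 : ‖(rad p)⁻¹ • spacePart p - (rad q)⁻¹ • spacePart q‖
            ≤ (rad q)⁻¹ * (2 * ‖p - q‖) := by
          refine (norm_unit_sub_unit_le (x := spacePart p) (y := spacePart q) hp1 hq1).trans ?_
          refine mul_le_mul_of_nonneg_left ?_ (inv_nonneg.2 hq1.le)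
          have := norm_spacePart_le (p - q)
          rw [spacePart_sub] at this
          linarith
        have h8 : tau q * tau q * (rad q)⁻¹ ≤ R := by
          rw [← div_eq_mul_inv, div_le_iff₀ hq1]; nlinarith
        calc _ ≤ (tau q * tau q) * ((rad q)⁻¹ * (2 * ‖p - q‖)) :=
              mul_le_mul_of_nonneg_left h7 (by positivity)
          _ = (tau q * tau q * (rad q)⁻¹) * (2 * ‖p - q‖) := by ring
          _ ≤ R * (2 * ‖p - q‖) := mul_le_mul_of_nonneg_right h8 (by positivity)
          _ = _ := by ring
  have hX := hE.smul (hx.sub ((BddLipschitzOn.const (ε / 2)).smul ((hr.smul hx).sub hunit)))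
  have hT := hE.smul ht
  obtain ⟨C, hC, -, h1⟩ := hT
  obtain ⟨D, hD, -, h2⟩ := hX
  refine ⟨⟨C + D, by positivity⟩, LipschitzOnWith.of_dist_le_mul fun p hp q hq => ?_⟩
  have hform : ∀ p ∈ s, warpMap ε p = mkPoint (((1 - ε • rad p)
      - (-ε ^ 2) • (1 / 4 : ℝ) • (rad p * rad p - tau p * tau p))⁻¹ • timeCLM m n p)
      (((1 - ε • rad p) - (-ε ^ 2) • (1 / 4 : ℝ) • (rad p * rad p - tau p * tau p))⁻¹ •
        (spaceCLM m n p - (ε / 2) • (rad p • spaceCLM m n p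
          - (tau p * tau p) • ((rad p)⁻¹ • spacePart p)))) := by
    intro p hp
    have hr0 := (rad_pos hp.1).ne'
    have h3 : (1 - ε • rad p) - (-ε ^ 2) • (1 / 4 : ℝ) • (rad p * rad p - tau p * tau p)
        = warpFactor ε p := by
      rw [warpFactor, fFun_eq]; simp only [smul_eq_mul]; ring
    rw [warpMap_eq (mem_warpDomain_of_rad_lt hε hR hp.1 hp.2).1, h3]
    congr 1
    rw [mul_smul]
    congr 1
    have h4 : (rad p - 2 * ε * fFun p) / rad p =
        1 - ε / 2 * (rad p - tau p * tau p * (rad p)⁻¹) := by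
      rw [fFun_eq]; field_simp; ring
    rw [h4, sub_smul, one_smul, mul_smul, sub_smul, mul_smul]
    rfl
  rw [dist_eq_norm, dist_eq_norm, hform p hp, hform q hq]
  refine (norm_le_parts _).trans ?_
  rw [timePart_sub, spacePart_sub, timePart_mkPoint, timePart_mkPoint, spacePart_mkPoint,
    spacePart_mkPoint]
  change _ ≤ (C + D) * ‖p - q‖
  rw [add_mul]
  exact add_le_add (h1 p hp q hq) (h2 p hp q hq)

/-- A smooth boundary has finite area in compact sets. -/
lemma surfaceMeasure_frontier_inter_lt_top {U K : Set (Spacetime m n)}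
    (hU : IsOpen U) (hloc : ∀ q ∈ frontier U, ∃ W φ, q ∈ W ∧ IsLocalDefiningFunction 1 U W φ)
    (hK : IsCompact K) : surfaceMeasure m n (frontier U ∩ K) < ⊤ := by
  have hc : IsCompact (frontier U ∩ K) := hK.inter_left isClosed_frontier
  have h := hc.induction_on (p := fun s => surfaceMeasure m n (frontier U ∩ s) < ⊤) (by simp)
    (fun s t hst ht => (measure_mono (Set.inter_subset_inter_right _ hst)).trans_lt ht)
    (fun s t hs ht => by
      rw [Set.inter_union_distrib_left]
      exact (measure_union_le _ _).trans_lt (ENNReal.add_lt_top.2 ⟨hs, ht⟩))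
    (fun q hq => by
      obtain ⟨W, φ, hqW, h⟩ := hloc q hq.1
      obtain ⟨ρ, hρ, -, hfin, -⟩ := h.exists_local_divergence_le hU hqW
        ((h.mem_frontier_iff hU hqW).1 hq.1)
      exact ⟨_, mem_nhdsWithin_of_mem_nhds (Metric.ball_mem_nhds q hρ), hfin⟩)
  rwa [← Set.inter_assoc, Set.inter_self] at h

/-- The boundary of the image has finite area although it may be irregular at the null cone: it is
the Lipschitz image of a bounded part of the smooth boundary of `U`. -/
lemma surfaceMeasure_warpedSet_frontier_lt_top {U : Set (Spacetime m n)} {R : ℝ}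
    (hε : 0 < ε) (hR : ε * R ≤ 1 / 2) (hU : IsOpen U)
    (hUR : closure U ∩ exteriorCone m n ⊆ {p | rad p < R})
    (hloc : ∀ q ∈ frontier U, ∃ W φ, q ∈ W ∧ IsLocalDefiningFunction 1 U W φ) :
    surfaceMeasure m n (warpedSet ε (frontier U)) < ⊤ := by
  have hsub : frontier U ∩ exteriorCone m n ⊆ {p | rad p < R} :=
    (Set.inter_subset_inter_left _ frontier_subset_closure).trans hUR
  obtain ⟨K, hK⟩ := exists_lipschitzOnWith_warpMap (m := m) (n := n) hε hR
  rw [warpedSet, ← warpMap_image_eq hε hR hsub]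
  have h1 : LipschitzOnWith K (warpMap ε) (frontier U ∩ exteriorCone m n) :=
    hK.mono fun p hp => ⟨hp.2, hsub hp⟩
  refine (h1.euclideanHausdorffMeasure_image_le _).trans_lt ?_
  refine ENNReal.mul_lt_top (by simp) ((measure_mono ?_).trans_lt
    (surfaceMeasure_frontier_inter_lt_top hU hloc (isCompact_closedBall 0 (2 * R))))
  refine fun p hp => ⟨hp.1, ?_⟩
  have h2 := norm_le_parts p
  have h3 : tau p < rad p := tau_lt_rad hp.2
  have h4 : rad p < R := hsub hp
  rw [mem_closedBall_zero_iff]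
  unfold tau rad at *
  linarith

end FiniteArea

/-! ### Size of the Carleman current -/

section CurrentBound

variable {m n : ℕ} {ε : ℝ} {p : Spacetime m n}

lemma one_le_warpRatio (hε : 0 < ε) (hp : p ∈ exteriorCone m n) : 1 ≤ warpRatio ε p := by
  have h1 := rad_pos hp
  have h2 : 0 < fFun p := hp
  rw [warpRatio_eq h1]
  have : 0 ≤ 2 * ε * fFun p / rad p := by positivity
  linarith

lemma fFun_div_rad_le (hp : p ∈ exteriorCone m n) : fFun p / rad p ≤ rad p / 4 := by
  have h1 := rad_pos hp
  rw [div_le_div_iff₀ h1 (by norm_num), fFun_eq]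
  nlinarith [sq_nonneg (tau p)]

lemma norm_le_two_rad (hp : p ∈ exteriorCone m n) : ‖p‖ ≤ 2 * rad p := by
  have h2 := norm_le_parts p
  have h3 : tau p < rad p := tau_lt_rad hp
  unfold tau rad at *
  linarith

lemma norm_raise_le (hr : 0 < rad p) (hs : 1 ≤ warpRatio ε p) (W : Spacetime m n) :
    ‖raise ε p W‖ ≤ 2 * ‖W‖ := by
  set c := (warpRatio ε p ^ 2)⁻¹ with hc
  have hc0 : 0 ≤ c := by positivity
  have hc1 : c ≤ 1 := inv_le_one_of_one_le₀ (one_le_pow₀ hs)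
  have h1 : ‖timePart (raise ε p W)‖ ≤ ‖W‖ := by
    rw [raise, timePart_mkPoint, norm_neg]; exact norm_timePart_le W
  have h2 : ‖spacePart (raise ε p W)‖ ≤ ‖W‖ := by
    rw [raise, spacePart_mkPoint, ← hc]
    refine (norm_add_le _ _).trans ?_
    have e1 : ‖c • spacePart W‖ ≤ c * ‖W‖ := by
      rw [norm_smul, Real.norm_of_nonneg hc0]
      exact mul_le_mul_of_nonneg_left (norm_spacePart_le W) hc0
    have e2 : ‖((1 - c) / rad p ^ 2 * ⟪spacePart p, spacePart W⟫) • spacePart p‖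
        ≤ (1 - c) * ‖W‖ := by
      have h3 : |⟪spacePart p, spacePart W⟫| ≤ rad p * ‖W‖ :=
        (abs_real_inner_le_norm _ _).trans
          (mul_le_mul_of_nonneg_left (norm_spacePart_le W) (norm_nonneg _))
      have h4 : 0 ≤ (1 - c) / rad p ^ 2 := div_nonneg (by linarith) (by positivity)
      rw [norm_smul, norm_mul, Real.norm_of_nonneg h4, Real.norm_eq_abs]
      calc _ ≤ (1 - c) / rad p ^ 2 * (rad p * ‖W‖) * rad p :=
            mul_le_mul_of_nonneg_right (mul_le_mul_of_nonneg_left h3 h4) hr.le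
        _ = _ := by field_simp
    linarith
  linarith [norm_le_parts (raise ε p W)]

lemma norm_raiseCov_le (hε : 0 < ε) (hp : p ∈ exteriorCone m n) (L : Spacetime m n →L[ℝ] ℝ) :
    ‖raiseCov ε p L‖ ≤ 2 * ‖L‖ := by
  rw [← norm_sharp L]
  exact norm_raise_le (rad_pos hp) (one_le_warpRatio hε hp) _

lemma norm_fderiv_fFun_le (p : Spacetime m n) : ‖fderiv ℝ fFun p‖ ≤ ‖p‖ := by
  refine ContinuousLinearMap.opNorm_le_bound _ (norm_nonneg _) fun X => ?_
  rw [fderiv_fFun, Real.norm_eq_abs, abs_div, abs_two, div_le_iff₀ two_pos]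
  have h1 := (abs_real_inner_le_norm (spacePart p) (spacePart X)).trans
    (mul_le_mul (norm_spacePart_le p) (norm_spacePart_le X) (norm_nonneg _) (norm_nonneg _))
  have h2 := (abs_real_inner_le_norm (timePart p) (timePart X)).trans
    (mul_le_mul (norm_timePart_le p) (norm_timePart_le X) (norm_nonneg _) (norm_nonneg _))
  have := abs_sub (⟪spacePart p, spacePart X⟫ : ℝ) ⟪timePart p, timePart X⟫
  linarith

/-- The part of the exterior of the null cone in which the estimate takes place. -/
def boundedExterior (R : ℝ) (m n : ℕ) : Set (Spacetime m n) :=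
  {p | p ∈ exteriorCone m n ∧ rad p ≤ 2 * R ∧ √(fFun p) ≤ R}

lemma norm_le_of_mem_boundedExterior {R : ℝ} (hp : p ∈ boundedExterior R m n) : ‖p‖ ≤ 4 * R := by
  have := norm_le_two_rad hp.1
  linarith [hp.2.1]

lemma warpRatio_le_two {R : ℝ} (hε : 0 < ε) (hR : ε * R ≤ 1 / 2) (hp : p ∈ boundedExterior R m n) :
    warpRatio ε p ≤ 2 := by
  have h1 := fFun_div_rad_le hp.1
  have h2 := hp.2.1
  rw [warpRatio_eq (rad_pos hp.1), mul_div_assoc]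
  nlinarith

lemma volDensity_le {R : ℝ} (hε : 0 < ε) (hR : ε * R ≤ 1 / 2) (hp : p ∈ boundedExterior R m n) :
    volDensity ε p ≤ 2 ^ (n - 1) :=
  pow_le_pow_left₀ (warpRatio_pos hε hp.1).le (warpRatio_le_two hε hR hp) _

lemma fFun_le_sq {R : ℝ} (hp : p ∈ boundedExterior R m n) : fFun p ≤ R ^ 2 := by
  have h1 : 0 < fFun p := hp.1
  rw [← Real.sq_sqrt h1.le]
  exact pow_le_pow_left₀ (Real.sqrt_nonneg _) hp.2.2 2

/-- The weight vanishes to fourth order on the null cone, because `2 a ≥ 4`. -/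
lemma exists_weight_le {a b R : ℝ} (ha : 2 ≤ a) (hb : 0 < b) :
    ∃ C : ℝ, 0 ≤ C ∧ ∀ p ∈ boundedExterior R m n, weight a b p ≤ C * fFun p ^ 4 := by
  refine ⟨(R ^ 2) ^ (2 * a - 4) * Real.exp (4 * a * b * R), by positivity, fun p hp => ?_⟩
  have h1 : 0 < fFun p := hp.1
  have h2 : fFun p ^ (2 * a) = fFun p ^ (2 * a - 4) * fFun p ^ 4 := by
    rw [← Real.rpow_natCast, ← Real.rpow_add h1]; congr 1; norm_num
  rw [weight, h2, ← Real.sqrt_eq_rpow]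
  have h3 : fFun p ^ (2 * a - 4) ≤ (R ^ 2) ^ (2 * a - 4) :=
    Real.rpow_le_rpow h1.le (fFun_le_sq hp) (by linarith)
  have h4 : Real.exp (4 * a * b * √(fFun p)) ≤ Real.exp (4 * a * b * R) :=
    Real.exp_le_exp.2 (mul_le_mul_of_nonneg_left hp.2.2 (by positivity))
  calc _ ≤ (R ^ 2) ^ (2 * a - 4) * fFun p ^ 4 * Real.exp (4 * a * b * R) := by gcongr
    _ = _ := by ring

lemma abs_multW_le {R : ℝ} (hε : 0 < ε) (hp : p ∈ boundedExterior R m n) :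
    |multW ε p| ≤ ((m : ℝ) + n + 2) + ((n : ℝ) + 2) * ε * R := by
  have h1 : 0 < fFun p := hp.1
  have hr := rad_pos hp.1
  have hρ := warpedRadius_pos hε hp.1
  have h2 : fFun p / warpedRadius ε p ≤ R := by
    have : fFun p / warpedRadius ε p ≤ fFun p / rad p := by
      refine div_le_div_of_nonneg_left h1.le hr ?_
      unfold warpedRadius
      nlinarith [mul_pos hε h1]
    have h3 := fFun_div_rad_le hp.1
    have h4 := hp.2.1
    linarith
  have h3 : 0 ≤ fFun p / warpedRadius ε p := by positivity
  rw [multW]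
  have hm : (0 : ℝ) ≤ m := Nat.cast_nonneg m
  have hn : (0 : ℝ) ≤ n := Nat.cast_nonneg n
  refine (abs_add_le _ _).trans (add_le_add ?_ ?_)
  · rw [abs_le]; constructor <;> linarith
  · rw [abs_mul, abs_mul, abs_of_nonneg h3, abs_of_pos hε]
    have h5 : |((n : ℝ) - 2) / 2| ≤ (n : ℝ) + 2 := by rw [abs_le]; constructor <;> linarith
    gcongr

/-- The powers of `f` in the weight compensate the poles of the current on the null cone. -/
lemma exists_norm_carlemanCurrent_le {a b R M : ℝ} (hε : 0 < ε) (hR : ε * R ≤ 1 / 2) (ha : 2 ≤ a)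
    (hb : 0 < b) (hM : 0 ≤ M) (hR0 : 0 ≤ R) :
    ∃ C : ℝ, 0 ≤ C ∧ ∀ p ∈ boundedExterior R m n, ∀ (y : ℝ) (L : Spacetime m n →L[ℝ] ℝ),
      |y| ≤ M → ‖L‖ ≤ M → ‖carlemanCurrent ε a b p y L‖ ≤ C * fFun p ^ 2 := by
  obtain ⟨C0, hC0, hw⟩ := exists_weight_le (m := m) (n := n) (R := R) ha hb
  set c1 := R ^ 2 * M + (a + a * b * R) * M * (4 * R) with hc1
  set c2 := ((m : ℝ) + n + 2) + ((n : ℝ) + 2) * ε * R with hc2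
  set c3 := a ^ 2 + (2 * a ^ 2 * b + a * b) * R + a ^ 2 * b ^ 2 * R ^ 2 with hc3
  have hc10 : 0 ≤ c1 := by positivity
  have hc20 : 0 ≤ c2 := by positivity
  have hc30 : 0 ≤ c3 := by positivity
  set c4 := (c1 * (4 * R) + 2 * c2 * (R ^ 2 * M)) * (2 * c1) +
    (c3 * R ^ 2 * M ^ 2 + c1 * (2 * c1)) / 2 * (4 * R) with hc4
  have hc40 : 0 ≤ c4 := by positivity
  refine ⟨2 ^ (n - 1) * (C0 * c4), by positivity, fun p hp y L hy hL => ?_⟩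
  have hf : 0 < fFun p := hp.1
  set f := fFun p with hfdef
  have hsq : 0 < √f := Real.sqrt_pos.2 hf
  have hfR : f ≤ R ^ 2 := fFun_le_sq hp
  have hsR : √f ≤ R := hp.2.2
  have hpR := norm_le_of_mem_boundedExterior hp
  set θ := ampFun a b f with hθ
  have hθ0 : 0 < θ := ampFun_pos f
  set K := conjCov a b p y L with hK
  -- `f` times the conjugated covector
  have hφ : f * ampLog a b f ≤ a + a * b * R := by
    have : f * ampLog a b f = a + a * b * √f := by
      calc _ = a * (f / f) + a * b * (f / √f) := by rw [ampLog]; ring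
        _ = _ := by rw [div_self hf.ne', Real.div_sqrt, mul_one]
    rw [this]; gcongr
  have hφ0 : 0 ≤ ampLog a b f := by unfold ampLog; positivity
  have hKn : f * ‖K‖ ≤ θ * c1 := by
    have e1 : ‖K‖ ≤ θ * ‖L‖ + θ * ampLog a b f * |y| * ‖fderiv ℝ fFun p‖ := by
      rw [hK, conjCov]
      refine (norm_add_le _ _).trans_eq ?_
      rw [norm_smul, norm_smul, norm_mul, norm_mul, Real.norm_of_nonneg hθ0.le,
        Real.norm_of_nonneg hφ0, Real.norm_eq_abs]
    have e2 := (norm_fderiv_fFun_le p).trans hpR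
    calc f * ‖K‖ ≤ f * (θ * ‖L‖ + θ * ampLog a b f * |y| * ‖fderiv ℝ fFun p‖) := by gcongr
      _ = θ * (f * ‖L‖ + (f * ampLog a b f) * |y| * ‖fderiv ℝ fFun p‖) := by ring
      _ ≤ θ * c1 := by rw [hc1]; gcongr
  -- the potential has a simple pole in `f`
  have hA : |f * ampPot a b f| ≤ c3 := by
    have : f * ampPot a b f = a ^ 2 + (2 * a ^ 2 * b - a * b / 2) * √f + a ^ 2 * b ^ 2 * f := by
      calc _ = a ^ 2 * (f / f) + (2 * a ^ 2 * b - a * b / 2) * (f / √f) + a ^ 2 * b ^ 2 * f := by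
            rw [ampPot]; ring
        _ = _ := by rw [div_self hf.ne', Real.div_sqrt, mul_one]
    rw [this, hc3]
    refine (abs_add_le _ _).trans (add_le_add ((abs_add_le _ _).trans (add_le_add ?_ ?_)) ?_)
    · rw [abs_of_nonneg (by positivity)]
    · rw [abs_mul, abs_of_pos hsq]
      have : |2 * a ^ 2 * b - a * b / 2| ≤ 2 * a ^ 2 * b + a * b := by
        have : 0 < a * b := by positivity
        have : 0 < a ^ 2 * b := by positivity
        rw [abs_le]; constructor <;> linarith
      gcongr
    · rw [abs_of_nonneg (by positivity)]; gcongr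
  have hraise := norm_raiseCov_le hε hp.1 K
  have hW := abs_multW_le hε hp
  have hcur : f ^ 2 * ‖current ε (multW ε p) (ampPot a b f) p (θ * y) K‖ ≤ θ ^ 2 * c4 := by
    have e1 : ‖current ε (multW ε p) (ampPot a b f) p (θ * y) K‖ ≤
        (‖K‖ * ‖p‖ + 2 * |multW ε p| * (θ * |y|)) * (2 * ‖K‖) +
        (|ampPot a b f| * (θ * |y|) ^ 2 + ‖K‖ * (2 * ‖K‖)) / 2 * ‖p‖ := by
      rw [current]
      refine (norm_add_le _ _).trans (add_le_add ?_ ?_)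
      · rw [norm_smul]
        refine mul_le_mul ((norm_add_le _ _).trans (add_le_add (K.le_opNorm p) (le_of_eq ?_)))
          hraise (norm_nonneg _) (by positivity)
        simp only [norm_mul, Real.norm_eq_abs, abs_two, abs_of_pos hθ0]
      · rw [norm_smul, norm_div, Real.norm_two]
        gcongr
        refine (norm_sub_le _ _).trans (add_le_add (le_of_eq ?_) ?_)
        · simp only [norm_mul, norm_pow, Real.norm_eq_abs, abs_of_pos hθ0]
        · exact (K.le_opNorm _).trans (mul_le_mul_of_nonneg_left hraise (norm_nonneg _))
    calc _ ≤ f ^ 2 * ((‖K‖ * ‖p‖ + 2 * |multW ε p| * (θ * |y|)) * (2 * ‖K‖) +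
        (|ampPot a b f| * (θ * |y|) ^ 2 + ‖K‖ * (2 * ‖K‖)) / 2 * ‖p‖) := by gcongr
      _ = ((f * ‖K‖) * ‖p‖ + 2 * |multW ε p| * (θ * (f * |y|))) * (2 * (f * ‖K‖)) +
        ((f * |ampPot a b f|) * f * (θ * |y|) ^ 2 + (f * ‖K‖) * (2 * (f * ‖K‖))) / 2 * ‖p‖ := by
        ring
      _ ≤ ((θ * c1) * (4 * R) + 2 * c2 * (θ * (R ^ 2 * M))) * (2 * (θ * c1)) +
        (c3 * R ^ 2 * (θ * M) ^ 2 + (θ * c1) * (2 * (θ * c1))) / 2 * (4 * R) := by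
        rw [abs_mul, abs_of_pos hf] at hA
        gcongr
      _ = θ ^ 2 * c4 := by rw [hc4]; ring
  have hθw : θ ^ 2 ≤ C0 * f ^ 4 := by rw [hθ, ampFun_sq hp.1]; exact hw p hp
  have hcur2 : ‖current ε (multW ε p) (ampPot a b f) p (θ * y) K‖ ≤ C0 * c4 * f ^ 2 := by
    refine le_of_mul_le_mul_left (hcur.trans ?_) (show 0 < f ^ 2 by positivity)
    calc _ ≤ C0 * f ^ 4 * c4 := by gcongr
      _ = _ := by ring
  have hv0 := (volDensity_pos hε hp.1).le
  rw [carlemanCurrent, norm_smul, Real.norm_of_nonneg hv0]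
  calc _ ≤ 2 ^ (n - 1) * (C0 * c4 * f ^ 2) :=
        mul_le_mul (volDensity_le hε hR hp) hcur2 (norm_nonneg _) (by positivity)
    _ = _ := by ring

end CurrentBound

/-! ### The flux through the boundary -/

section Flux

variable {m n : ℕ} {ε a b : ℝ} {V W S : Set (Spacetime m n)} {φ z : Spacetime m n → ℝ}
  {q : Spacetime m n}

/-- Where `z = 0` the flux of the Carleman current is the boundary integrand of the estimate. -/
lemma flux_carlemanCurrent (hn : 1 ≤ n) (hε : 0 < ε) (hV : IsOpen V) (hq : q ∈ exteriorCone m n)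
    (h : IsLocalDefiningFunction 1 V W φ) (hqW : q ∈ W) (hqV : q ∈ frontier V)
    (hpos : 0 < outerConormal V q (raiseCov ε q (outerConormal V q))) {k : ℝ}
    (hk : fderivWithin ℝ z S q = k • outerConormal V q) (hz : z q = 0) :
    outerConormal V q (carlemanCurrent ε a b q (z q) (fderivWithin ℝ z S q)) =
      boundaryDensity (warpedMetric ε) V q * boundaryTerm ε a b V S z q := by
  have hN := outerUnitNormal_eq hε hV hq h hqW hqV hpos
  rw [boundaryDensity_eq hn hε hV hq h hqW hqV hpos, boundaryTerm, hN, hk, hz, ← ampFun_sq hq]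
  set ν := outerConormal V q with hν
  set κ := ν (raiseCov ε q ν) with hκ
  have hs := Real.sqrt_pos.2 hpos
  have hss : √κ * √κ = κ := Real.mul_self_sqrt hpos.le
  have h1 : fderiv ℝ fFun q (raiseCov ε q ν) = ν q / 2 := by
    rw [raiseCov_comm, raiseCov_fderiv_fFun (rad_pos hq), map_smul, smul_eq_mul]; ring
  have h2 : conjCov a b q 0 (k • ν) = (ampFun a b (fFun q) * k) • ν := by
    rw [conjCov, mul_zero, zero_smul, add_zero, smul_smul]
  rw [carlemanCurrent, h2, current, raiseCov_smul]
  simp only [map_smul, map_add, _root_.smul_apply, smul_eq_mul, ← hκ, h1, mul_zero, add_zero]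
  generalize √κ = t at hs hss ⊢
  rw [← hss]
  field_simp
  ring

end Flux

/-! ### Domains and functions for the estimate in warped coordinates -/

section Admissible

variable {m n : ℕ} {ε a b R M : ℝ} {V : Set (Spacetime m n)} {z : Spacetime m n → ℝ}
  {p q : Spacetime m n}

/-- A domain in the exterior of the null cone whose boundary there is `C¹`, timelike for `ḡ` and of
finite area, and which is bounded in terms of `R`. -/
structure AdmissibleDomain (ε R : ℝ) (V : Set (Spacetime m n)) : Prop where
  isOpen : IsOpen V
  subset : V ⊆ exteriorCone m n
  exists_defining : ∀ q ∈ frontier V ∩ exteriorCone m n,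
    ∃ W φ, q ∈ W ∧ IsLocalDefiningFunction 1 V W φ
  conormal_pos : ∀ q ∈ frontier V ∩ exteriorCone m n,
    0 < outerConormal V q (raiseCov ε q (outerConormal V q))
  closure_subset : closure V ∩ exteriorCone m n ⊆ boundedExterior R m n
  area_lt_top : surfaceMeasure m n (frontier V ∩ exteriorCone m n) < ⊤

/-- A function on `V` of the regularity that the estimate asks for, with bound `M` for its values
and first derivatives, and with Dirichlet boundary values. -/
structure AdmissibleFunction (M : ℝ) (V : Set (Spacetime m n)) (z : Spacetime m n → ℝ) : Prop where
  contDiffOn_two : ContDiffOn ℝ 2 z V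
  contDiffOn_one : ContDiffOn ℝ 1 z (closure V ∩ exteriorCone m n)
  bound : ∀ p ∈ V, |z p| ≤ M ∧ ‖fderiv ℝ z p‖ ≤ M
  eq_zero : ∀ q ∈ frontier V ∩ exteriorCone m n, z q = 0

/-- The differential of `z` in the relative closure of `V`. -/
abbrev closureFDeriv (V : Set (Spacetime m n)) (z : Spacetime m n → ℝ) (p : Spacetime m n) :
    Spacetime m n →L[ℝ] ℝ :=
  fderivWithin ℝ z (closure V ∩ exteriorCone m n) p

lemma AdmissibleDomain.subset_closure (hV : AdmissibleDomain ε R V) :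
    V ⊆ closure V ∩ exteriorCone m n :=
  fun _ hp => ⟨_root_.subset_closure hp, hV.subset hp⟩

lemma AdmissibleDomain.uniqueDiffOn (hV : AdmissibleDomain ε R V) :
    UniqueDiffOn ℝ (closure V ∩ exteriorCone m n) := by
  intro q hq
  by_cases hqV : q ∈ V
  · exact (hV.isOpen.uniqueDiffWithinAt hqV).mono hV.subset_closure
  · have hf : q ∈ frontier V := by rw [hV.isOpen.frontier_eq]; exact ⟨hq.1, hqV⟩
    obtain ⟨W, φ, hqW, h⟩ := hV.exists_defining q ⟨hf, hq.2⟩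
    exact h.uniqueDiffWithinAt hV.isOpen hV.subset_closure hqW hf

lemma AdmissibleDomain.mem_boundedExterior (hV : AdmissibleDomain ε R V) (hp : p ∈ V) :
    p ∈ boundedExterior R m n :=
  hV.closure_subset (hV.subset_closure hp)

lemma frontier_inter_exteriorCone_subset (V : Set (Spacetime m n)) :
    frontier V ∩ exteriorCone m n ⊆ closure V ∩ exteriorCone m n :=
  Set.inter_subset_inter_left _ frontier_subset_closure

lemma measurableSet_frontier_inter_exteriorCone (V : Set (Spacetime m n)) :
    MeasurableSet (frontier V ∩ exteriorCone m n) :=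
  isClosed_frontier.measurableSet.inter isOpen_exteriorCone.measurableSet

lemma AdmissibleDomain.closureFDeriv_eq (hV : AdmissibleDomain ε R V) (hp : p ∈ V) :
    closureFDeriv V z p = fderiv ℝ z p :=
  fderivWithin_of_mem_nhds (Filter.mem_of_superset (hV.isOpen.mem_nhds hp) hV.subset_closure)

lemma AdmissibleFunction.continuousOn_closureFDeriv (hz : AdmissibleFunction M V z)
    (hV : AdmissibleDomain ε R V) :
    ContinuousOn (closureFDeriv V z) (closure V ∩ exteriorCone m n) :=
  hz.contDiffOn_one.continuousOn_fderivWithin hV.uniqueDiffOn le_rfl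

lemma AdmissibleFunction.contDiffAt (hz : AdmissibleFunction M V z)
    (hV : AdmissibleDomain ε R V) (hp : p ∈ V) : ContDiffAt ℝ 2 z p :=
  hz.contDiffOn_two.contDiffAt (hV.isOpen.mem_nhds hp)

/-- The bounds for `z` and its differential hold up to the boundary, by continuity. -/
lemma AdmissibleFunction.closure_bound (hz : AdmissibleFunction M V z)
    (hV : AdmissibleDomain ε R V) (hp : p ∈ closure V ∩ exteriorCone m n) :
    |z p| ≤ M ∧ ‖closureFDeriv V z p‖ ≤ M := by
  have h1 := (hz.contDiffOn_one.continuousOn p hp).mono hV.subset_closure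
  have h2 := (hz.continuousOn_closureFDeriv hV p hp).mono hV.subset_closure
  refine ⟨ContinuousWithinAt.closure_le hp.1 h1.norm continuousWithinAt_const
    fun y hy => (hz.bound y hy).1,
    ContinuousWithinAt.closure_le hp.1 h2.norm continuousWithinAt_const fun y hy => ?_⟩
  rw [hV.closureFDeriv_eq hy]
  exact (hz.bound y hy).2

/-- The Dirichlet condition makes the differential of `z` at the boundary conormal. -/
lemma AdmissibleFunction.exists_closureFDeriv_eq (hz : AdmissibleFunction M V z)
    (hV : AdmissibleDomain ε R V) (hq : q ∈ frontier V ∩ exteriorCone m n) :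
    ∃ k : ℝ, closureFDeriv V z q = k • outerConormal V q := by
  obtain ⟨W, φ, hqW, h⟩ := hV.exists_defining q hq
  have h' := h.inter_isOpen isOpen_exteriorCone
  have hqW' : q ∈ W ∩ exteriorCone m n := ⟨hqW, hq.2⟩
  have h0 := (h.mem_frontier_iff hV.isOpen hqW).1 hq.1
  refine exists_eq_smul_of_ker_le (norm_ne_zero_iff.1 (by
    rw [h.norm_outerConormal hqW h0]; exact one_ne_zero)) fun Y hY => ?_
  have hd := ((hz.contDiffOn_one.differentiableOn (by norm_num)) q
    (frontier_inter_exteriorCone_subset V hq)).hasFDerivWithinAt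
  refine h'.hasFDerivWithinAt_tangent hV.isOpen hqW' hq.1
    (fun y hy => frontier_inter_exteriorCone_subset V ⟨hy.1, hy.2.2⟩)
    (fun y hy => hz.eq_zero y ⟨hy.1, hy.2.2⟩) hd ?_
  rw [h.fderiv_eq_norm_smul hqW h0, _root_.smul_apply, hY, smul_zero]

/-- The Carleman current depends smoothly on all its arguments. -/
lemma contDiffAt_carlemanCurrent {k : WithTop ℕ∞} (hk : k ≤ ∞) (hε : 0 < ε)
    {Q : Spacetime m n × ℝ × (Spacetime m n →L[ℝ] ℝ)} (hp : Q.1 ∈ exteriorCone m n) :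
    ContDiffAt ℝ k (fun Q : Spacetime m n × ℝ × (Spacetime m n →L[ℝ] ℝ) =>
      carlemanCurrent ε a b Q.1 Q.2.1 Q.2.2) Q := by
  have hf : 0 < fFun Q.1 := hp
  have e1 : ContDiffAt ℝ k (fun Q : Spacetime m n × ℝ × (Spacetime m n →L[ℝ] ℝ) => Q.1) Q :=
    contDiffAt_fst
  have e2 : ContDiffAt ℝ k (fun Q : Spacetime m n × ℝ × (Spacetime m n →L[ℝ] ℝ) => Q.2.1) Q :=
    contDiffAt_fst.comp Q contDiffAt_snd
  have e3 : ContDiffAt ℝ k (fun Q : Spacetime m n × ℝ × (Spacetime m n →L[ℝ] ℝ) => Q.2.2) Q :=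
    contDiffAt_snd.comp Q contDiffAt_snd
  have ef : ContDiffAt ℝ k (fun Q : Spacetime m n × ℝ × (Spacetime m n →L[ℝ] ℝ) => fFun Q.1) Q :=
    (contDiff_fFun.of_le hk).contDiffAt.comp Q e1
  have edf : ContDiffAt ℝ k (fun Q : Spacetime m n × ℝ × (Spacetime m n →L[ℝ] ℝ) =>
      fderiv ℝ (fFun : Spacetime m n → ℝ) Q.1) Q := by
    have : ContDiff ℝ k (fderiv ℝ (fFun : Spacetime m n → ℝ)) :=
      (contDiff_fFun.fderiv_right (m := ∞) (by simp)).of_le hk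
    exact this.contDiffAt.comp Q e1
  have eσ : ContDiffAt ℝ k (fun Q : Spacetime m n × ℝ × (Spacetime m n →L[ℝ] ℝ) =>
      volDensity ε Q.1) Q :=
    ((contDiffAt_warpRatio hk (rad_pos hp)).comp Q e1).pow _
  have ew : ContDiffAt ℝ k (fun Q : Spacetime m n × ℝ × (Spacetime m n →L[ℝ] ℝ) =>
      multW ε Q.1) Q := (contDiffAt_multW hk hε hp).comp Q e1
  have eθ : ContDiffAt ℝ k (fun Q : Spacetime m n × ℝ × (Spacetime m n →L[ℝ] ℝ) =>
      ampFun a b (fFun Q.1)) Q :=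
    ContDiffAt.comp (g := ampFun a b) Q (contDiffAt_ampFun hf) ef
  have eφ : ContDiffAt ℝ k (fun Q : Spacetime m n × ℝ × (Spacetime m n →L[ℝ] ℝ) =>
      ampLog a b (fFun Q.1)) Q :=
    ContDiffAt.comp (g := ampLog a b) Q (contDiffAt_ampLog hf) ef
  have eA : ContDiffAt ℝ k (fun Q : Spacetime m n × ℝ × (Spacetime m n →L[ℝ] ℝ) =>
      ampPot a b (fFun Q.1)) Q :=
    ContDiffAt.comp (g := ampPot a b) Q (contDiffAt_ampPot hf) ef
  have eK : ContDiffAt ℝ k (fun Q : Spacetime m n × ℝ × (Spacetime m n →L[ℝ] ℝ) =>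
      conjCov a b Q.1 Q.2.1 Q.2.2) Q :=
    (eθ.smul e3).add (((eθ.mul eφ).mul e2).smul edf)
  have eH : ContDiffAt ℝ k (fun Q : Spacetime m n × ℝ × (Spacetime m n →L[ℝ] ℝ) =>
      raiseCov ε Q.1 (conjCov a b Q.1 Q.2.1 Q.2.2)) Q := by
    refine contDiffAt_euclidean.2 fun i => ?_
    simp only [raiseCov_apply]
    exact ContDiffAt.sum fun j _ =>
      ((contDiffAt_cometricMatrix hk hε hp i j).comp Q e1).mul (eK.clm_apply contDiffAt_const)
  unfold carlemanCurrent current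
  exact eσ.smul ((((eK.clm_apply e1).add ((contDiffAt_const.mul ew).mul (eθ.mul e2))).smul eH).add
    ((((eA.mul ((eθ.mul e2).pow 2)).sub (eK.clm_apply eH)).div_const 2).smul e1))

/-- The Carleman current of `z`, up to the boundary. -/
def currentField (ε a b : ℝ) (V : Set (Spacetime m n)) (z : Spacetime m n → ℝ)
    (p : Spacetime m n) : Spacetime m n :=
  carlemanCurrent ε a b p (z p) (closureFDeriv V z p)

lemma AdmissibleFunction.continuousOn_currentField (hz : AdmissibleFunction M V z) (hε : 0 < ε)
    (hV : AdmissibleDomain ε R V) :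
    ContinuousOn (currentField ε a b V z) (closure V ∩ exteriorCone m n) := by
  intro p hp
  have h1 : ContinuousWithinAt (fun p => (p, z p, closureFDeriv V z p))
      (closure V ∩ exteriorCone m n) p :=
    continuousWithinAt_id.prodMk ((hz.contDiffOn_one.continuousOn p hp).prodMk
      (hz.continuousOn_closureFDeriv hV p hp))
  have h2 := (contDiffAt_carlemanCurrent (a := a) (b := b) (k := 1) (by simp) hε
    (Q := (p, z p, closureFDeriv V z p)) hp.2).continuousAt
  have h3 : currentField ε a b V z =
      (fun Q : Spacetime m n × ℝ × (Spacetime m n →L[ℝ] ℝ) => carlemanCurrent ε a b Q.1 Q.2.1 Q.2.2)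
        ∘ fun p => (p, z p, closureFDeriv V z p) := rfl
  rw [h3]
  exact ContinuousAt.comp_continuousWithinAt (f := fun p => (p, z p, closureFDeriv V z p)) h2 h1

lemma AdmissibleDomain.currentField_eventuallyEq (hV : AdmissibleDomain ε R V) (hp : p ∈ V) :
    currentField ε a b V z =ᶠ[nhds p] fun q => carlemanCurrent ε a b q (z q) (fderiv ℝ z q) := by
  filter_upwards [hV.isOpen.mem_nhds hp] with q hq
  rw [currentField, hV.closureFDeriv_eq hq]

lemma AdmissibleFunction.contDiffAt_currentField (hz : AdmissibleFunction M V z) (hε : 0 < ε)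
    (hV : AdmissibleDomain ε R V) (hp : p ∈ V) :
    ContDiffAt ℝ 1 (currentField ε a b V z) p := by
  refine ContDiffAt.congr_of_eventuallyEq ?_ (hV.currentField_eventuallyEq hp)
  have h2 := hz.contDiffAt hV hp
  have h1 : ContDiffAt ℝ 1 (fun p => (p, z p, fderiv ℝ z p)) p :=
    contDiffAt_id.prodMk ((h2.of_le one_le_two).prodMk (h2.fderiv_right (by norm_num)))
  exact ContDiffAt.comp (f := fun p => (p, z p, fderiv ℝ z p))
    (g := fun Q : Spacetime m n × ℝ × (Spacetime m n →L[ℝ] ℝ) =>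
      carlemanCurrent ε a b Q.1 Q.2.1 Q.2.2) p
    (contDiffAt_carlemanCurrent (k := 1) (by simp) hε (hV.subset hp)) h1

lemma AdmissibleFunction.exists_norm_currentField_le (hz : AdmissibleFunction M V z) (hε : 0 < ε)
    (hR : ε * R ≤ 1 / 2) (ha : 2 ≤ a) (hb : 0 < b) (hM : 0 ≤ M) (hR0 : 0 ≤ R)
    (hV : AdmissibleDomain ε R V) :
    ∃ C : ℝ, 0 ≤ C ∧ ∀ p ∈ closure V ∩ exteriorCone m n,
      ‖currentField ε a b V z p‖ ≤ C * fFun p ^ 2 := by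
  obtain ⟨C, hC, h⟩ := exists_norm_carlemanCurrent_le (m := m) (n := n) (a := a) hε hR ha hb hM hR0
  refine ⟨C, hC, fun p hp => h p (hV.closure_subset hp) _ _ ?_ ?_⟩
  · exact (hz.closure_bound hV hp).1
  · exact (hz.closure_bound hV hp).2

/-! ### The boundary integral -/

/-- The flux density of the Carleman current through the boundary. -/
def boundaryFlux (ε a b : ℝ) (V : Set (Spacetime m n)) (z : Spacetime m n → ℝ)
    (q : Spacetime m n) : ℝ :=
  outerConormal V q (currentField ε a b V z q)

lemma AdmissibleFunction.boundaryFlux_eq (hz : AdmissibleFunction M V z) (hn : 1 ≤ n) (hε : 0 < ε)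
    (hV : AdmissibleDomain ε R V) (hq : q ∈ frontier V ∩ exteriorCone m n) :
    boundaryFlux ε a b V z q = boundaryDensity (warpedMetric ε) V q *
      boundaryTerm ε a b V (closure V ∩ exteriorCone m n) z q := by
  obtain ⟨W, φ, hqW, h⟩ := hV.exists_defining q hq
  obtain ⟨k, hk⟩ := hz.exists_closureFDeriv_eq hV hq
  exact flux_carlemanCurrent hn hε hV.isOpen hq.2 h hqW hq.1 (hV.conormal_pos q hq) hk
    (hz.eq_zero q hq)

lemma AdmissibleDomain.continuousOn_outerConormal (hV : AdmissibleDomain ε R V) :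
    ContinuousOn (outerConormal V) (frontier V ∩ exteriorCone m n) :=
  WarpedCarleman.continuousOn_outerConormal hV.isOpen hV.exists_defining

lemma AdmissibleFunction.integrableOn_boundaryFlux (hz : AdmissibleFunction M V z) (hε : 0 < ε)
    (hR : ε * R ≤ 1 / 2) (ha : 2 ≤ a) (hb : 0 < b) (hM : 0 ≤ M) (hR0 : 0 ≤ R)
    (hV : AdmissibleDomain ε R V) :
    IntegrableOn (boundaryFlux ε a b V z) (frontier V ∩ exteriorCone m n) (surfaceMeasure m n) := by
  obtain ⟨C, hC, h⟩ := hz.exists_norm_currentField_le (a := a) hε hR ha hb hM hR0 hV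
  have hB := measurableSet_frontier_inter_exteriorCone V
  have hcont : ContinuousOn (boundaryFlux ε a b V z) (frontier V ∩ exteriorCone m n) :=
    hV.continuousOn_outerConormal.clm_apply
      ((hz.continuousOn_currentField hε hV).mono (frontier_inter_exteriorCone_subset V))
  have : IsFiniteMeasure ((surfaceMeasure m n).restrict (frontier V ∩ exteriorCone m n)) :=
    ⟨by rw [Measure.restrict_apply_univ]; exact hV.area_lt_top⟩
  refine Integrable.of_bound (hcont.aestronglyMeasurable hB) (C * (R ^ 2) ^ 2) ?_
  refine (ae_restrict_iff' hB).2 (Filter.Eventually.of_forall fun q hq => ?_)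
  have hq' := frontier_inter_exteriorCone_subset V hq
  have h1 : ‖outerConormal V q‖ ≤ 1 := norm_outerConormal_le V q
  have h2 := fFun_le_sq (hV.closure_subset hq')
  have h3 : 0 < fFun q := hq.2
  calc ‖boundaryFlux ε a b V z q‖ ≤ ‖outerConormal V q‖ * ‖currentField ε a b V z q‖ :=
        ContinuousLinearMap.le_opNorm _ _
    _ ≤ 1 * (C * fFun q ^ 2) := mul_le_mul h1 (h q hq') (norm_nonneg _) zero_le_one
    _ ≤ C * (R ^ 2) ^ 2 := by rw [one_mul]; gcongr

lemma AdmissibleDomain.aemeasurable_boundaryDensity (hn : 1 ≤ n) (hε : 0 < ε)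
    (hV : AdmissibleDomain ε R V) :
    AEMeasurable (fun q => ENNReal.ofReal (boundaryDensity (warpedMetric ε) V q))
      ((surfaceMeasure m n).restrict (frontier V ∩ exteriorCone m n)) := by
  have hB := measurableSet_frontier_inter_exteriorCone V
  have hν := hV.continuousOn_outerConormal
  have hH : ContinuousOn (fun q => raiseCov ε q (outerConormal V q))
      (frontier V ∩ exteriorCone m n) := by
    have : (fun q => raiseCov ε q (outerConormal V q)) = fun q => WithLp.toLp 2 fun i =>
        ∑ k, cometricMatrix ε q i k * outerConormal V q (coordVec k) := by
      funext q; ext i; exact raiseCov_apply _ i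
    rw [this]
    refine (PiLp.continuous_toLp 2 _).comp_continuousOn (continuousOn_pi.2 fun i => ?_)
    refine continuousOn_finsetSum _ fun k _ => ContinuousOn.mul (fun q hq => ?_)
      (hν.clm_apply continuousOn_const)
    exact (contDiffAt_cometricMatrix (k := 0) (by simp) hε hq.2 i k).continuousAt.continuousWithinAt
  have hσ : ContinuousOn (volDensity ε) (frontier V ∩ exteriorCone m n) := fun q hq =>
    ((contDiffAt_warpRatio (k := 0) (by simp) (rad_pos hq.2)).pow _).continuousAt.continuousWithinAt
  have hcont : ContinuousOn (boundaryDensity (warpedMetric ε) V)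
      (frontier V ∩ exteriorCone m n) := by
    refine (hσ.mul (hν.clm_apply hH).sqrt).congr fun q hq => ?_
    obtain ⟨W, φ, hqW, h⟩ := hV.exists_defining q hq
    exact boundaryDensity_eq hn hε hV.isOpen hq.2 h hqW hq.1 (hV.conormal_pos q hq)
  exact (hcont.aestronglyMeasurable hB).aemeasurable.ennreal_ofReal

lemma AdmissibleFunction.boundaryTerm_smul_ae_eq (hz : AdmissibleFunction M V z) (hn : 1 ≤ n)
    (hε : 0 < ε) (hV : AdmissibleDomain ε R V) :
    (fun q => (ENNReal.ofReal (boundaryDensity (warpedMetric ε) V q)).toReal •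
      boundaryTerm ε a b V (closure V ∩ exteriorCone m n) z q)
      =ᵐ[(surfaceMeasure m n).restrict (frontier V ∩ exteriorCone m n)]
        boundaryFlux ε a b V z := by
  refine (ae_restrict_iff' (measurableSet_frontier_inter_exteriorCone V)).2
    (Filter.Eventually.of_forall fun q hq => ?_)
  dsimp only
  rw [ENNReal.toReal_ofReal (show 0 ≤ boundaryDensity (warpedMetric ε) V q from Real.sqrt_nonneg _),
    smul_eq_mul, ← hz.boundaryFlux_eq hn hε hV hq]

/-- The boundary integrand of the estimate is integrable. -/
lemma AdmissibleFunction.integrable_boundaryTerm (hz : AdmissibleFunction M V z) (hn : 1 ≤ n)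
    (hε : 0 < ε) (hR : ε * R ≤ 1 / 2) (ha : 2 ≤ a) (hb : 0 < b) (hM : 0 ≤ M) (hR0 : 0 ≤ R)
    (hV : AdmissibleDomain ε R V) :
    Integrable (boundaryTerm ε a b V (closure V ∩ exteriorCone m n) z)
      (boundaryMeasure (warpedMetric ε) V (frontier V ∩ exteriorCone m n)) := by
  rw [boundaryMeasure, integrable_withDensity_iff_integrable_smul₀'
    (hV.aemeasurable_boundaryDensity hn hε) (Filter.Eventually.of_forall fun _ => by simp)]
  exact (hz.integrableOn_boundaryFlux hε hR ha hb hM hR0 hV).congr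
    (hz.boundaryTerm_smul_ae_eq hn hε hV).symm

lemma AdmissibleFunction.integral_boundaryTerm (hz : AdmissibleFunction M V z) (hn : 1 ≤ n)
    (hε : 0 < ε) (hV : AdmissibleDomain ε R V) :
    ∫ q, boundaryTerm ε a b V (closure V ∩ exteriorCone m n) z q
      ∂(boundaryMeasure (warpedMetric ε) V (frontier V ∩ exteriorCone m n)) =
    ∫ q in frontier V ∩ exteriorCone m n, boundaryFlux ε a b V z q ∂(surfaceMeasure m n) := by
  rw [boundaryMeasure, integral_withDensity_eq_integral_toReal_smul₀
    (hV.aemeasurable_boundaryDensity hn hε) (Filter.Eventually.of_forall fun _ => by simp)]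
  exact integral_congr_ae (hz.boundaryTerm_smul_ae_eq hn hε hV)

end Admissible

/-! ### The volume integrals -/

section Volume

variable {m n : ℕ} {ε a b R M : ℝ} {V : Set (Spacetime m n)} {z g : Spacetime m n → ℝ}
  {p : Spacetime m n}

lemma continuousOn_volDensity (hV : V ⊆ exteriorCone m n) :
    ContinuousOn (volDensity ε) V := fun q hq =>
  ((contDiffAt_warpRatio (k := 0) (by simp) (rad_pos (hV hq))).pow _).continuousAt.continuousWithinAt

/-- In the exterior of the null cone the density of the volume measure is `volDensity`. -/
lemma volumeMeasure_restrict (hn : 1 ≤ n) (hε : 0 < ε) (hVm : MeasurableSet V)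
    (hV : V ⊆ exteriorCone m n) : (volumeMeasure (warpedMetric ε)).restrict V =
      (volume.restrict V).withDensity fun p => ENNReal.ofReal (volDensity ε p) := by
  rw [volumeMeasure, restrict_withDensity hVm]
  refine withDensity_congr_ae ((ae_restrict_iff' hVm).2 (Filter.Eventually.of_forall fun p hp => ?_))
  dsimp only
  rw [sqrt_abs_det_metricMatrix hn hε (hV hp)]

lemma aemeasurable_volDensity (hVm : MeasurableSet V) (hV : V ⊆ exteriorCone m n) :
    AEMeasurable (fun p => ENNReal.ofReal (volDensity ε p)) (volume.restrict V) :=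
  ((continuousOn_volDensity hV).aestronglyMeasurable hVm).aemeasurable.ennreal_ofReal

lemma volDensity_smul_ae_eq (hε : 0 < ε) (hVm : MeasurableSet V) (hV : V ⊆ exteriorCone m n)
    (g : Spacetime m n → ℝ) :
    (fun p => (ENNReal.ofReal (volDensity ε p)).toReal • g p) =ᵐ[volume.restrict V]
      fun p => volDensity ε p * g p := by
  refine (ae_restrict_iff' hVm).2 (Filter.Eventually.of_forall fun p hp => ?_)
  dsimp only
  rw [ENNReal.toReal_ofReal (volDensity_pos hε (hV hp)).le, smul_eq_mul]

lemma integrableOn_volumeMeasure_iff (hn : 1 ≤ n) (hε : 0 < ε) (hVm : MeasurableSet V)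
    (hV : V ⊆ exteriorCone m n) : IntegrableOn g V (volumeMeasure (warpedMetric ε)) ↔
      IntegrableOn (fun p => volDensity ε p * g p) V := by
  rw [IntegrableOn, volumeMeasure_restrict hn hε hVm hV,
    integrable_withDensity_iff_integrable_smul₀' (aemeasurable_volDensity hVm hV)
      (Filter.Eventually.of_forall fun _ => by simp)]
  exact integrable_congr (volDensity_smul_ae_eq hε hVm hV g)

lemma setIntegral_volumeMeasure (hn : 1 ≤ n) (hε : 0 < ε) (hVm : MeasurableSet V)
    (hV : V ⊆ exteriorCone m n) (g : Spacetime m n → ℝ) :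
    ∫ p in V, g p ∂(volumeMeasure (warpedMetric ε)) = ∫ p in V, volDensity ε p * g p := by
  rw [volumeMeasure_restrict hn hε hVm hV,
    integral_withDensity_eq_integral_toReal_smul₀ (aemeasurable_volDensity hVm hV)
      (Filter.Eventually.of_forall fun _ => by simp)]
  exact integral_congr_ae (volDensity_smul_ae_eq hε hVm hV g)

lemma measurable_sharp_fderiv (z : Spacetime m n → ℝ) :
    Measurable fun p => sharp (fderiv ℝ z p) :=
  (InnerProductSpace.toDual ℝ (Spacetime m n)).symm.continuous.measurable.comp
    (measurable_fderiv ℝ z)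

lemma measurable_derivTau (z : Spacetime m n → ℝ) : Measurable (derivTau z) := by
  have : derivTau z = fun p => (tau p)⁻¹ * ⟪timeCLM m n p, timeCLM m n (sharp (fderiv ℝ z p))⟫ :=
    funext fun p => covTau_eq (fderiv ℝ z p)
  rw [this]
  exact continuous_tau.measurable.inv.mul ((timeCLM m n).continuous.measurable.inner
    ((timeCLM m n).continuous.measurable.comp (measurable_sharp_fderiv z)))

lemma measurable_derivRad (z : Spacetime m n → ℝ) : Measurable (derivRad z) := by
  have : derivRad z = fun p => (rad p)⁻¹ * ⟪spaceCLM m n p, spaceCLM m n (sharp (fderiv ℝ z p))⟫ :=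
    funext fun p => covRad_eq (fderiv ℝ z p)
  rw [this]
  exact continuous_rad.measurable.inv.mul ((spaceCLM m n).continuous.measurable.inner
    ((spaceCLM m n).continuous.measurable.comp (measurable_sharp_fderiv z)))

lemma measurable_fFun : Measurable (fFun : Spacetime m n → ℝ) :=
  contDiff_fFun.continuous.measurable

lemma measurable_weight : Measurable (weight a b : Spacetime m n → ℝ) := by
  have h := measurable_fFun (m := m) (n := n)
  unfold weight
  exact (h.pow_const _).mul ((h.pow_const _).const_mul _).exp

lemma measurable_firstOrderTerm (z : Spacetime m n → ℝ) : Measurable (firstOrderTerm ε a b z) := by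
  have hf := measurable_fFun (m := m) (n := n)
  have hr : Measurable (rad : Spacetime m n → ℝ) := continuous_rad.measurable
  have ht : Measurable (tau : Spacetime m n → ℝ) := continuous_tau.measurable
  have hw := measurable_weight (m := m) (n := n) (a := a) (b := b)
  have hT := measurable_derivTau z
  have hX := measurable_derivRad z
  have hD : ∀ i, Measurable (partialD i z) := fun i =>
    measurable_fderiv_apply_const ℝ z (coordVec i)
  have hρ : Measurable (warpedRadius ε : Spacetime m n → ℝ) := by
    unfold warpedRadius; fun_prop
  unfold firstOrderTerm spatialAngularSq temporalAngularSq derivU derivV nullU nullV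
  refine (hw.mul hρ.inv).mul ?_
  have h1 : Measurable fun p => ∑ j : Fin n, partialD (Sum.inr j) z p ^ 2 :=
    Finset.measurable_sum _ fun j _ => (hD _).pow_const 2
  have h2 : Measurable fun p => ∑ j : Fin m, partialD (Sum.inl j) z p ^ 2 :=
    Finset.measurable_sum _ fun j _ => (hD _).pow_const 2
  fun_prop

lemma abs_covTau_le (L : Spacetime m n →L[ℝ] ℝ) : |covTau p L| ≤ ‖L‖ := by
  have h1 : ‖(mkPoint ((tau p)⁻¹ • timePart p) 0 : Spacetime m n)‖ ≤ 1 := by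
    refine (norm_le_parts _).trans ?_
    rw [timePart_mkPoint, spacePart_mkPoint, norm_zero, add_zero, norm_smul, norm_inv,
      Real.norm_of_nonneg (tau_nonneg p)]
    exact inv_mul_le_one
  calc |covTau p L| ≤ ‖L‖ * ‖(mkPoint ((tau p)⁻¹ • timePart p) 0 : Spacetime m n)‖ :=
        L.le_opNorm _
    _ ≤ ‖L‖ := mul_le_of_le_one_right (norm_nonneg _) h1

lemma abs_covRad_le (L : Spacetime m n →L[ℝ] ℝ) : |covRad p L| ≤ ‖L‖ := by
  have h1 : ‖(mkPoint 0 ((rad p)⁻¹ • spacePart p) : Spacetime m n)‖ ≤ 1 := by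
    refine (norm_le_parts _).trans ?_
    rw [timePart_mkPoint, spacePart_mkPoint, norm_zero, zero_add, norm_smul, norm_inv,
      Real.norm_of_nonneg (rad_nonneg p)]
    exact inv_mul_le_one
  calc |covRad p L| ≤ ‖L‖ * ‖(mkPoint 0 ((rad p)⁻¹ • spacePart p) : Spacetime m n)‖ :=
        L.le_opNorm _
    _ ≤ ‖L‖ := mul_le_of_le_one_right (norm_nonneg _) h1

lemma angularSq_le (hε : 0 < ε) (hp : p ∈ exteriorCone m n) (L : Spacetime m n →L[ℝ] ℝ) :
    angularSq ε p L ≤ ‖L‖ ^ 2 := by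
  have hs := one_le_warpRatio hε hp
  have h1 : ⟪spacePart (sharp L), spacePart (sharp L)⟫ ≤ ‖L‖ ^ 2 := by
    rw [real_inner_self_eq_norm_sq, ← norm_sharp L]
    exact pow_le_pow_left₀ (norm_nonneg _) (norm_spacePart_le _) 2
  have h2 : 0 ≤ ⟪spacePart p, spacePart (sharp L)⟫ ^ 2 / rad p ^ 2 := by positivity
  have h3 : (warpRatio ε p ^ 2)⁻¹ ≤ 1 := inv_le_one_of_one_le₀ (one_le_pow₀ hs)
  have h4 : 0 ≤ (warpRatio ε p ^ 2)⁻¹ := by positivity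
  calc angularSq ε p L ≤ (warpRatio ε p ^ 2)⁻¹ * ‖L‖ ^ 2 :=
        mul_le_mul_of_nonneg_left (by linarith) h4
    _ ≤ ‖L‖ ^ 2 := mul_le_of_le_one_left (by positivity) h3

lemma temporalSq_le (L : Spacetime m n →L[ℝ] ℝ) : temporalSq p L ≤ ‖L‖ ^ 2 := by
  have h1 : ⟪timePart (sharp L), timePart (sharp L)⟫ ≤ ‖L‖ ^ 2 := by
    rw [real_inner_self_eq_norm_sq, ← norm_sharp L]
    exact pow_le_pow_left₀ (norm_nonneg _) (norm_timePart_le _) 2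
  have := sq_nonneg (covTau p L)
  rw [temporalSq]
  linarith

lemma weight_nonneg (hp : p ∈ exteriorCone m n) : 0 ≤ weight a b p := by
  rw [← ampFun_sq hp]; positivity

/-- The powers of `f` in the weight compensate the factor `1 / ρ̄`. -/
lemma exists_abs_firstOrderTerm_le (hε : 0 < ε) (ha : 2 ≤ a) (hb : 0 < b) (hR0 : 0 ≤ R) :
    ∃ C : ℝ, ∀ p ∈ boundedExterior R m n, ‖fderiv ℝ z p‖ ≤ M →
      |firstOrderTerm ε a b z p| ≤ C := by
  obtain ⟨C0, hC0, hw⟩ := exists_weight_le (m := m) (n := n) (R := R) ha hb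
  refine ⟨C0 * (R ^ 2) ^ 3 * R * ((2 * R * (2 * M)) ^ 2 + (2 * R * (2 * M)) ^ 2
    + R ^ 2 * M ^ 2 + R ^ 2 * M ^ 2), fun p hp hL => ?_⟩
  set L := fderiv ℝ z p with hLdef
  have hf : 0 < fFun p := hp.1
  have hr := rad_pos hp.1
  have hρ := warpedRadius_pos hε hp.1
  have h1 : fFun p * (warpedRadius ε p)⁻¹ ≤ R := by
    have h2 : fFun p * (warpedRadius ε p)⁻¹ ≤ fFun p / rad p := by
      rw [← div_eq_mul_inv]
      refine div_le_div_of_nonneg_left hf.le hr ?_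
      unfold warpedRadius
      nlinarith [mul_pos hε hf]
    linarith [fFun_div_rad_le hp.1, hp.2.1]
  have hfR := fFun_le_sq hp
  have h2 : weight a b p * (warpedRadius ε p)⁻¹ ≤ C0 * (R ^ 2) ^ 3 * R := by
    calc _ ≤ C0 * fFun p ^ 4 * (warpedRadius ε p)⁻¹ := by gcongr; exact hw p hp
      _ = C0 * fFun p ^ 3 * (fFun p * (warpedRadius ε p)⁻¹) := by ring
      _ ≤ _ := by gcongr
  have h2' : 0 ≤ weight a b p * (warpedRadius ε p)⁻¹ :=
    mul_nonneg (weight_nonneg hp.1) (inv_nonneg.2 hρ.le)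
  have hT : |derivTau z p| ≤ M := (abs_covTau_le L).trans hL
  have hX : |derivRad z p| ≤ M := (abs_covRad_le L).trans hL
  have htr := tau_lt_rad hp.1
  have ht0 := tau_nonneg p
  have hp2 := hp.2.1
  have hu : (nullU p * derivU z p) ^ 2 ≤ (2 * R * (2 * M)) ^ 2 := by
    refine sq_le_sq' ?_ ?_ <;> refine (abs_le.1 (?_ : |_| ≤ 2 * R * (2 * M))).elim fun _ _ => ‹_›
    all_goals
      rw [abs_mul]
      refine mul_le_mul ?_ ?_ (abs_nonneg _) (by positivity)
      · rw [nullU, abs_le]; constructor <;> linarith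
      · rw [derivU]; exact (abs_sub _ _).trans (by linarith)
  have hv : (nullV p * derivV z p) ^ 2 ≤ (2 * R * (2 * M)) ^ 2 := by
    refine sq_le_sq' ?_ ?_ <;> refine (abs_le.1 (?_ : |_| ≤ 2 * R * (2 * M))).elim fun _ _ => ‹_›
    all_goals
      rw [abs_mul]
      refine mul_le_mul ?_ ?_ (abs_nonneg _) (by positivity)
      · rw [nullV, abs_le]; constructor <;> linarith
      · rw [derivV]; exact (abs_add_le _ _).trans (by linarith)
  have hMsq : ‖L‖ ^ 2 ≤ M ^ 2 := pow_le_pow_left₀ (norm_nonneg _) hL 2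
  have hA0 := angularSq_nonneg (ε := ε) hr L
  have hB0 := temporalSq_nonneg (p := p) L
  have hA : fFun p * angularSq ε p L ≤ R ^ 2 * M ^ 2 :=
    mul_le_mul hfR ((angularSq_le hε hp.1 L).trans hMsq) hA0 (by positivity)
  have hB : fFun p * temporalSq p L ≤ R ^ 2 * M ^ 2 :=
    mul_le_mul hfR ((temporalSq_le L).trans hMsq) hB0 (by positivity)
  have hA0' := mul_nonneg hf.le hA0
  have hB0' := mul_nonneg hf.le hB0
  rw [firstOrderTerm, spatialAngularSq_eq hr, temporalAngularSq_eq, ← hLdef, mul_neg, sub_neg_eq_add,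
    abs_of_nonneg (by positivity)]
  exact mul_le_mul h2 (by linarith) (by positivity) (by positivity)

/-- The powers of `f` in the weight compensate the factor `f^{-1/2}`. -/
lemma exists_abs_zerothOrderTerm_le (ha : 2 ≤ a) (hb : 0 < b) (hR0 : 0 ≤ R) :
    ∃ C : ℝ, ∀ p ∈ boundedExterior R m n, |z p| ≤ M → |zerothOrderTerm a b z p| ≤ C := by
  obtain ⟨C0, hC0, hw⟩ := exists_weight_le (m := m) (n := n) (R := R) ha hb
  refine ⟨C0 * (R ^ 2) ^ 3 * R * M ^ 2, fun p hp hz => ?_⟩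
  have hf : 0 < fFun p := hp.1
  have hfR := fFun_le_sq hp
  have h1 : fFun p ^ (-(1 / 2) : ℝ) = (√(fFun p))⁻¹ := by
    rw [Real.rpow_neg hf.le, ← Real.sqrt_eq_rpow]
  have hs := Real.sqrt_pos.2 hf
  have h2 : fFun p * (√(fFun p))⁻¹ ≤ R := by
    rw [← div_eq_mul_inv, Real.div_sqrt]; exact hp.2.2
  have hzz : z p ^ 2 ≤ M ^ 2 := by
    rw [← sq_abs]; exact pow_le_pow_left₀ (abs_nonneg _) hz 2
  have hw0 := weight_nonneg (a := a) (b := b) hp.1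
  rw [zerothOrderTerm, h1, abs_of_nonneg (by positivity)]
  calc _ ≤ C0 * fFun p ^ 4 * (√(fFun p))⁻¹ * z p ^ 2 := by gcongr; exact hw p hp
    _ = C0 * fFun p ^ 3 * (fFun p * (√(fFun p))⁻¹) * z p ^ 2 := by ring
    _ ≤ _ := by gcongr

lemma AdmissibleDomain.volume_lt_top (hV : AdmissibleDomain ε R V) : volume V < ⊤ := by
  refine (measure_mono fun p hp => ?_).trans_lt
    (measure_closedBall_lt_top (x := (0 : Spacetime m n)) (r := 4 * R))
  rw [mem_closedBall_zero_iff]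
  exact norm_le_of_mem_boundedExterior (hV.mem_boundedExterior hp)

lemma AdmissibleDomain.integrableOn_of_bound (hV : AdmissibleDomain ε R V) {C : ℝ}
    (hg : AEStronglyMeasurable g (volume.restrict V)) (hC : ∀ p ∈ V, |g p| ≤ C) :
    IntegrableOn g V := by
  have : IsFiniteMeasure ((volume : Measure (Spacetime m n)).restrict V) :=
    ⟨by rw [Measure.restrict_apply_univ]; exact hV.volume_lt_top⟩
  exact Integrable.of_bound hg C ((ae_restrict_iff' hV.isOpen.measurableSet).2
    (Filter.Eventually.of_forall hC))

lemma AdmissibleDomain.integrableOn_volDensity_mul (hV : AdmissibleDomain ε R V) (hε : 0 < ε)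
    (hR : ε * R ≤ 1 / 2) {C : ℝ}
    (hg : AEStronglyMeasurable g (volume.restrict V)) (hC : ∀ p ∈ V, |g p| ≤ C) :
    IntegrableOn (fun p => volDensity ε p * g p) V := by
  refine hV.integrableOn_of_bound (C := 2 ^ (n - 1) * C)
    (((continuousOn_volDensity hV.subset).aestronglyMeasurable hV.isOpen.measurableSet).mul hg)
    fun p hp => ?_
  have h0 := (volDensity_pos hε (hV.subset hp)).le
  rw [abs_mul, abs_of_nonneg h0]
  exact mul_le_mul (volDensity_le hε hR (hV.mem_boundedExterior hp)) (hC p hp) (abs_nonneg _)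
    (by positivity)

lemma AdmissibleFunction.integrableOn_firstOrderTerm (hz : AdmissibleFunction M V z)
    (hV : AdmissibleDomain ε R V) (hε : 0 < ε) (hR : ε * R ≤ 1 / 2) (ha : 2 ≤ a) (hb : 0 < b)
    (hR0 : 0 ≤ R) :
    IntegrableOn (fun p => volDensity ε p * firstOrderTerm ε a b z p) V := by
  obtain ⟨C, hC⟩ := exists_abs_firstOrderTerm_le (m := m) (n := n) (z := z) (M := M) hε ha hb hR0
  exact hV.integrableOn_volDensity_mul hε hR (measurable_firstOrderTerm z).aestronglyMeasurable
    fun p hp => hC p (hV.mem_boundedExterior hp) (hz.bound p hp).2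

lemma AdmissibleFunction.integrableOn_zerothOrderTerm (hz : AdmissibleFunction M V z)
    (hV : AdmissibleDomain ε R V) (hε : 0 < ε) (hR : ε * R ≤ 1 / 2) (ha : 2 ≤ a) (hb : 0 < b)
    (hR0 : 0 ≤ R) :
    IntegrableOn (fun p => volDensity ε p * zerothOrderTerm a b z p) V := by
  obtain ⟨C, hC⟩ := exists_abs_zerothOrderTerm_le (m := m) (n := n) (z := z) (M := M) ha hb hR0
  refine hV.integrableOn_volDensity_mul hε hR ?_
    fun p hp => hC p (hV.mem_boundedExterior hp) (hz.bound p hp).1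
  have h1 : AEStronglyMeasurable z (volume.restrict V) :=
    hz.contDiffOn_two.continuousOn.aestronglyMeasurable hV.isOpen.measurableSet
  exact (measurable_weight.mul (measurable_fFun.pow_const _)).aestronglyMeasurable.mul (h1.pow 2)

lemma continuousOn_divergence (hV : IsOpen V) {X : Spacetime m n → Spacetime m n}
    (hX : ContDiffOn ℝ 1 X V) : ContinuousOn (divergence X) V := by
  unfold divergence partialD
  refine continuousOn_finsetSum _ fun i _ => ContinuousOn.clm_apply ?_ continuousOn_const
  exact (contDiffOn_euclidean.1 hX i).continuousOn_fderiv_of_isOpen hV le_rfl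

lemma AdmissibleFunction.aestronglyMeasurable_waveTerm (hz : AdmissibleFunction M V z)
    (hV : AdmissibleDomain ε R V) (hn : 1 ≤ n) (hε : 0 < ε) :
    AEStronglyMeasurable (waveTerm ε a b z) (volume.restrict V) := by
  have hX : ContDiffOn ℝ 1 (fun q => volDensity ε q • raiseCov ε q (fderiv ℝ z q)) V := by
    refine fun p hp => ContDiffAt.contDiffWithinAt ?_
    have hd : ContDiffAt ℝ 1 (fderiv ℝ z) p :=
      (hz.contDiffAt hV hp).fderiv_right (by norm_num)
    refine ContDiffAt.smul ((contDiffAt_warpRatio (by simp) (rad_pos (hV.subset hp))).pow _)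
      (contDiffAt_euclidean.2 fun i => ?_)
    simp only [raiseCov_apply]
    exact ContDiffAt.sum fun k _ =>
      (contDiffAt_cometricMatrix (by simp) hε (hV.subset hp) i k).mul
        (hd.clm_apply contDiffAt_const)
  have hbox : ContinuousOn (box (warpedMetric ε) z) V := by
    refine (((continuousOn_volDensity hV.subset).inv₀ fun p hp =>
      (volDensity_pos hε (hV.subset hp)).ne').mul (continuousOn_divergence hV.isOpen hX)).congr
        fun p hp => ?_
    exact box_warpedMetric hn hε (hV.subset hp) (hz.contDiffAt hV hp)
  exact (measurable_weight.mul measurable_fFun).aestronglyMeasurable.mul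
    ((hbox.aestronglyMeasurable hV.isOpen.measurableSet).pow 2)

lemma AdmissibleFunction.lintegral_waveTerm (hz : AdmissibleFunction M V z)
    (hV : AdmissibleDomain ε R V) (hn : 1 ≤ n) (hε : 0 < ε) :
    ∫⁻ p in V, ENNReal.ofReal (waveTerm ε a b z p) ∂(volumeMeasure (warpedMetric ε)) =
      ∫⁻ p in V, ENNReal.ofReal (volDensity ε p * waveTerm ε a b z p) := by
  have hVm := hV.isOpen.measurableSet
  rw [volumeMeasure_restrict hn hε hVm hV.subset, lintegral_withDensity_eq_lintegral_mul₀
    (aemeasurable_volDensity hVm hV.subset)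
    (hz.aestronglyMeasurable_waveTerm hV hn hε).aemeasurable.ennreal_ofReal]
  refine lintegral_congr_ae ((ae_restrict_iff' hVm).2 (Filter.Eventually.of_forall fun p hp => ?_))
  dsimp only
  rw [Pi.mul_apply, ENNReal.ofReal_mul (volDensity_pos hε (hV.subset hp)).le]

lemma waveTerm_nonneg (hp : p ∈ exteriorCone m n) : 0 ≤ waveTerm ε a b z p := by
  have hf : 0 < fFun p := hp
  have := weight_nonneg (a := a) (b := b) hp
  unfold waveTerm; positivity

end Volume

/-! ### Cutoff near the null cone and the integrated estimate -/

section Cutoff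

variable {m n : ℕ} {ε a b R M : ℝ} {V : Set (Spacetime m n)} {z : Spacetime m n → ℝ}
  {p q : Spacetime m n}

lemma deriv_smoothTransition_of_one_lt {x : ℝ} (hx : 1 < x) : deriv Real.smoothTransition x = 0 := by
  have : Real.smoothTransition =ᶠ[nhds x] fun _ => (1 : ℝ) := by
    filter_upwards [lt_mem_nhds hx] with y hy using Real.smoothTransition.one_of_one_le hy.le
  rw [this.deriv_eq, deriv_const]

lemma deriv_smoothTransition_of_neg {x : ℝ} (hx : x < 0) : deriv Real.smoothTransition x = 0 := by
  have : Real.smoothTransition =ᶠ[nhds x] fun _ => (0 : ℝ) := by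
    filter_upwards [gt_mem_nhds hx] with y hy using Real.smoothTransition.zero_of_nonpos hy.le
  rw [this.deriv_eq, deriv_const]

lemma exists_abs_deriv_smoothTransition_le :
    ∃ C : ℝ, 0 ≤ C ∧ ∀ x, |deriv Real.smoothTransition x| ≤ C := by
  have hc : Continuous (deriv Real.smoothTransition) :=
    (Real.smoothTransition.contDiff (n := 1)).continuous_deriv le_rfl
  obtain ⟨C, hC⟩ := (isCompact_Icc (a := (0 : ℝ)) (b := 1)).exists_bound_of_continuousOn
    hc.continuousOn
  refine ⟨max C 0, le_max_right _ _, fun x => ?_⟩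
  rcases lt_or_ge x 0 with h | h
  · rw [deriv_smoothTransition_of_neg h, abs_zero]; exact le_max_right _ _
  rcases lt_or_ge 1 x with h' | h'
  · rw [deriv_smoothTransition_of_one_lt h', abs_zero]; exact le_max_right _ _
  · exact (hC x ⟨h, h'⟩).trans (le_max_left _ _)

/-- A cutoff that vanishes for `f ≤ δ` and equals `1` for `f ≥ 2 δ`. -/
def coneCutoff (δ : ℝ) (p : Spacetime m n) : ℝ := Real.smoothTransition (fFun p / δ - 1)

lemma coneCutoff_nonneg (δ : ℝ) (p : Spacetime m n) : 0 ≤ coneCutoff δ p :=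
  Real.smoothTransition.nonneg _

lemma coneCutoff_le_one (δ : ℝ) (p : Spacetime m n) : coneCutoff δ p ≤ 1 :=
  Real.smoothTransition.le_one _

lemma coneCutoff_eq_zero {δ : ℝ} (hδ : 0 < δ) (h : fFun p ≤ δ) : coneCutoff δ p = 0 :=
  Real.smoothTransition.zero_of_nonpos (by
    have := (div_le_one hδ).2 h
    linarith)

lemma coneCutoff_eq_one {δ : ℝ} (hδ : 0 < δ) (h : 2 * δ ≤ fFun p) : coneCutoff δ p = 1 :=
  Real.smoothTransition.one_of_one_le (by
    have := (le_div_iff₀ hδ).2 h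
    linarith)

lemma contDiff_coneCutoff (δ : ℝ) : ContDiff ℝ ∞ (coneCutoff δ : Spacetime m n → ℝ) :=
  Real.smoothTransition.contDiff.comp ((contDiff_fFun.div_const δ).sub contDiff_const)

/-- The derivative of the cutoff is of size `1 / δ`, but only where `f ≤ 2 δ`. -/
lemma exists_abs_fderiv_coneCutoff_le : ∃ C : ℝ, 0 ≤ C ∧ ∀ δ : ℝ, 0 < δ →
    ∀ p ∈ exteriorCone m n, ∀ Y : Spacetime m n,
      fFun p ^ 2 * |fderiv ℝ (coneCutoff δ) p Y| ≤ C * δ * (‖p‖ * ‖Y‖) := by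
  obtain ⟨C, hC, h⟩ := exists_abs_deriv_smoothTransition_le
  refine ⟨4 * C, by positivity, fun δ hδ p hp Y => ?_⟩
  have hf : 0 < fFun p := hp
  have h1 : HasFDerivAt (coneCutoff δ) (deriv Real.smoothTransition (fFun p / δ - 1) •
      (δ⁻¹ • fderiv ℝ fFun p)) p := by
    have e1 : HasFDerivAt (fun p : Spacetime m n => fFun p / δ - 1) (δ⁻¹ • fderiv ℝ fFun p) p := by
      simp only [div_eq_inv_mul]
      exact ((differentiableAt_fFun p).hasFDerivAt.const_mul δ⁻¹).sub_const 1
    have e2 : HasDerivAt Real.smoothTransition (deriv Real.smoothTransition (fFun p / δ - 1))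
        (fFun p / δ - 1) :=
      ((Real.smoothTransition.contDiff (n := 1)).differentiable (by norm_num) _).hasDerivAt
    exact e2.comp_hasFDerivAt p e1
  have h2 : |fderiv ℝ fFun p Y| ≤ ‖p‖ * ‖Y‖ :=
    (ContinuousLinearMap.le_opNorm _ _).trans
      (mul_le_mul_of_nonneg_right (norm_fderiv_fFun_le p) (norm_nonneg _))
  rw [h1.fderiv, _root_.smul_apply, _root_.smul_apply, smul_eq_mul, smul_eq_mul, abs_mul, abs_mul,
    abs_of_pos (inv_pos.2 hδ)]
  rcases lt_or_ge (2 * δ) (fFun p) with h3 | h3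
  · rw [deriv_smoothTransition_of_one_lt (by have := (lt_div_iff₀ hδ).2 h3; linarith), abs_zero,
      zero_mul, mul_zero]
    positivity
  · calc _ ≤ (2 * δ) ^ 2 * (C * (δ⁻¹ * (‖p‖ * ‖Y‖))) := by gcongr; exact h _
      _ = _ := by field_simp; ring

lemma tendsto_coneCutoff (hp : p ∈ exteriorCone m n) :
    Filter.Tendsto (fun k : ℕ => coneCutoff (1 / ((k : ℝ) + 1)) p) Filter.atTop (nhds 1) := by
  have hf : 0 < fFun p := hp
  have h1 := tendsto_one_div_add_atTop_nhds_zero_nat (𝕜 := ℝ)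
  refine tendsto_const_nhds.congr' ?_
  filter_upwards [h1.eventually (gt_mem_nhds (half_pos hf))] with k hk
  exact (coneCutoff_eq_one (by positivity) (by linarith)).symm

lemma tendsto_integral_coneCutoff_mul {μ : Measure (Spacetime m n)} {A : Set (Spacetime m n)}
    (hA : MeasurableSet A) (hAD : A ⊆ exteriorCone m n) {g : Spacetime m n → ℝ}
    (hg : IntegrableOn g A μ) :
    Filter.Tendsto (fun k : ℕ => ∫ p in A, coneCutoff (1 / ((k : ℝ) + 1)) p * g p ∂μ) Filter.atTop
      (nhds (∫ p in A, g p ∂μ)) := by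
  refine tendsto_integral_of_dominated_convergence (fun p => ‖g p‖) (fun k => ?_) hg.norm
    (fun k => Filter.Eventually.of_forall fun p => ?_) ?_
  · exact (contDiff_coneCutoff _).continuous.aestronglyMeasurable.mul hg.aestronglyMeasurable
  · rw [norm_mul, Real.norm_of_nonneg (coneCutoff_nonneg _ p)]
    exact mul_le_of_le_one_left (norm_nonneg _) (coneCutoff_le_one _ p)
  · refine (ae_restrict_iff' hA).2 (Filter.Eventually.of_forall fun p hp => ?_)
    simpa using (tendsto_coneCutoff (hAD hp)).mul_const (g p)

lemma integrableOn_coneCutoff_mul {μ : Measure (Spacetime m n)} {A : Set (Spacetime m n)}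
    {g : Spacetime m n → ℝ} (hg : IntegrableOn g A μ) (δ : ℝ) :
    IntegrableOn (fun p => coneCutoff δ p * g p) A μ :=
  Integrable.mono hg ((contDiff_coneCutoff _).continuous.aestronglyMeasurable.mul
    hg.aestronglyMeasurable) (Filter.Eventually.of_forall fun p => by
      rw [norm_mul, Real.norm_of_nonneg (coneCutoff_nonneg _ p)]
      exact mul_le_of_le_one_left (norm_nonneg _) (coneCutoff_le_one _ p))

lemma isCompact_le_fFun_inter_closedBall (δ ρ : ℝ) :
    IsCompact ({p : Spacetime m n | δ ≤ fFun p} ∩ Metric.closedBall 0 ρ) :=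
  (isCompact_closedBall 0 ρ).inter_left (isClosed_le continuous_const contDiff_fFun.continuous)

/-- The divergence inequality for the Carleman current. The current is not compactly supported in
the exterior of the null cone, but it is `O(f²)`, so that a cutoff of scale `δ` costs `O(δ)`. -/
lemma AdmissibleFunction.setIntegral_le_boundaryFlux (hz : AdmissibleFunction M V z)
    (hV : AdmissibleDomain ε R V) (hε : 0 < ε) (hR : ε * R ≤ 1 / 2) (ha : 2 ≤ a) (hb : 0 < b)
    (hM : 0 ≤ M) (hR0 : 0 ≤ R) {g : Spacetime m n → ℝ} (hg : IntegrableOn g V)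
    (hdiv : ∀ p ∈ V, g p ≤ divergence (currentField ε a b V z) p) :
    ∫ p in V, g p ≤
      ∫ q in frontier V ∩ exteriorCone m n, boundaryFlux ε a b V z q ∂(surfaceMeasure m n) := by
  obtain ⟨C1, hC1, hJ⟩ := hz.exists_norm_currentField_le (a := a) hε hR ha hb hM hR0 hV
  obtain ⟨C2, hC2, hχ⟩ := exists_abs_fderiv_coneCutoff_le (m := m) (n := n)
  set C := C2 * (4 * R) * C1 with hC
  have hfin := hV.volume_lt_top
  -- the divergence of the truncated current is at least `χ g - C δ`
  have key : ∀ δ : ℝ, 0 < δ → ∫ p in V, coneCutoff δ p * g p ≤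
      C * δ * (volume V).toReal +
      ∫ q in frontier V ∩ exteriorCone m n, coneCutoff δ q * boundaryFlux ε a b V z q
        ∂(surfaceMeasure m n) := by
    intro δ hδ
    have hint := integrableOn_coneCutoff_mul hg δ
    have hconst : IntegrableOn (fun _ : Spacetime m n => C * δ) V :=
      integrableOn_const hfin.ne
    have h := setIntegral_le_flux (ℓ := fun p => coneCutoff δ p * g p - C * δ)
      (X := fun p => coneCutoff δ p • currentField ε a b V z p)
      (K := {p | δ ≤ fFun p} ∩ Metric.closedBall 0 (4 * R))
      hV.isOpen isOpen_exteriorCone hV.subset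
      hV.exists_defining (isCompact_le_fFun_inter_closedBall δ (4 * R))
      (fun p hp => hδ.trans_le hp.1)
      (fun p hp => (((contDiff_coneCutoff δ).of_le (by simp)).contDiffAt.smul
        (hz.contDiffAt_currentField hε hV hp)).contDiffWithinAt)
      ((contDiff_coneCutoff δ).continuous.continuousOn.smul (hz.continuousOn_currentField hε hV))
      (fun p hp hpK => by
        have h1 : fFun p < δ := by
          by_contra! hcon
          refine hpK ⟨hcon, ?_⟩
          rw [mem_closedBall_zero_iff]
          exact norm_le_of_mem_boundedExterior (hV.closure_subset hp)
        rw [coneCutoff_eq_zero hδ h1.le, zero_smul])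
      (hint.sub hconst)
      (fun p hp => by
        have hf : 0 < fFun p := hV.subset hp
        rw [divergence_smul ((contDiff_coneCutoff δ).differentiable (by simp) p)
          ((hz.contDiffAt_currentField hε hV hp).differentiableAt (by norm_num))]
        have h1 := mul_le_mul_of_nonneg_left (hdiv p hp) (coneCutoff_nonneg δ p)
        have h2 : |fderiv ℝ (coneCutoff δ) p (currentField ε a b V z p)| ≤ C * δ := by
          refine le_of_mul_le_mul_left ?_ (pow_pos hf 2)
          calc _ ≤ C2 * δ * (‖p‖ * ‖currentField ε a b V z p‖) := hχ δ hδ p (hV.subset hp) _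
            _ ≤ C2 * δ * ((4 * R) * (C1 * fFun p ^ 2)) := by
              gcongr
              · exact norm_le_of_mem_boundedExterior (hV.mem_boundedExterior hp)
              · exact hJ p (hV.subset_closure hp)
            _ = _ := by rw [hC]; ring
        have h3 := (abs_le.1 h2).1
        linarith)
    rw [integral_sub hint hconst, setIntegral_const, smul_eq_mul] at h
    have h4 : ∀ q, outerConormal V q (coneCutoff δ q • currentField ε a b V z q) =
        coneCutoff δ q * boundaryFlux ε a b V z q := fun q => by
      rw [map_smul, smul_eq_mul, boundaryFlux]
    simp only [h4] at h
    rw [Measure.real] at h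
    linarith
  have hlim1 := tendsto_integral_coneCutoff_mul hV.isOpen.measurableSet hV.subset hg
  have hlim2 := tendsto_integral_coneCutoff_mul (measurableSet_frontier_inter_exteriorCone V)
    Set.inter_subset_right (hz.integrableOn_boundaryFlux (a := a) hε hR ha hb hM hR0 hV)
  have hlim3 : Filter.Tendsto (fun k : ℕ => C * (1 / ((k : ℝ) + 1)) * (volume V).toReal)
      Filter.atTop (nhds 0) := by
    simpa using (tendsto_one_div_add_atTop_nhds_zero_nat.const_mul C).mul_const (volume V).toReal
  have hlim4 := hlim3.add hlim2
  rw [zero_add] at hlim4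
  exact le_of_tendsto_of_tendsto' hlim1 hlim4 fun k => key _ (by positivity)

/-- The Carleman estimate on an admissible domain. -/
theorem AdmissibleFunction.carleman_estimate (hz : AdmissibleFunction M V z)
    (hV : AdmissibleDomain ε R V) (hm : 1 ≤ m) (hn : 1 ≤ n) (hε : 0 < ε) (hR : ε * R ≤ 1 / 2)
    (had : ((m : ℝ) + n) ^ 2 ≤ a) (hb : 0 < b) (hεb : ε ≤ b / 100) (hbR : b * R ≤ 1 / 100)
    (hM : 0 ≤ M) (hR0 : 0 ≤ R) :
    ((ε / 8 * (∫ p in V, firstOrderTerm ε a b z p ∂(volumeMeasure (warpedMetric ε)))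
      + b * a ^ 2 / 4 * (∫ p in V, zerothOrderTerm a b z p ∂(volumeMeasure (warpedMetric ε))) : ℝ)
        : EReal)
      ≤ ((ENNReal.ofReal (1 / (2 * a)) * ∫⁻ p in V, ENNReal.ofReal (waveTerm ε a b z p)
          ∂(volumeMeasure (warpedMetric ε)) : ENNReal) : EReal)
        + ((∫ q, boundaryTerm ε a b V (closure V ∩ exteriorCone m n) z q
            ∂(boundaryMeasure (warpedMetric ε) V (frontier V ∩ exteriorCone m n)) : ℝ) : EReal) := by
  have ha : 2 ≤ a := by
    have h1 : (1 : ℝ) ≤ m := by exact_mod_cast hm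
    have h2 : (1 : ℝ) ≤ n := by exact_mod_cast hn
    nlinarith
  have hVm := hV.isOpen.measurableSet
  have hc : (0 : ℝ) < 1 / (2 * a) := by positivity
  rw [hz.lintegral_waveTerm hV hn hε, hz.integral_boundaryTerm hn hε hV,
    setIntegral_volumeMeasure hn hε hVm hV.subset, setIntegral_volumeMeasure hn hε hVm hV.subset]
  set w := fun p => volDensity ε p * waveTerm ε a b z p with hw
  have hw0 : ∀ᵐ p ∂(volume.restrict V), 0 ≤ w p :=
    (ae_restrict_iff' hVm).2 (Filter.Eventually.of_forall fun p hp =>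
      mul_nonneg (volDensity_pos hε (hV.subset hp)).le (waveTerm_nonneg (hV.subset hp)))
  have hwm : AEStronglyMeasurable w (volume.restrict V) :=
    ((continuousOn_volDensity hV.subset).aestronglyMeasurable hVm).mul
      (hz.aestronglyMeasurable_waveTerm hV hn hε)
  -- if the integral of the wave term diverges there is nothing to prove
  by_cases htop : ∫⁻ p in V, ENNReal.ofReal (w p) = ⊤
  · rw [htop, ENNReal.mul_top (by simpa using hc), EReal.coe_ennreal_top, EReal.top_add_coe]
    exact le_top
  have hwi : IntegrableOn w V :=
    ⟨hwm, (hasFiniteIntegral_iff_ofReal hw0).2 (lt_top_iff_ne_top.2 htop)⟩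
  have hF := hz.integrableOn_firstOrderTerm hV hε hR ha hb hR0
  have hZ := hz.integrableOn_zerothOrderTerm hV hε hR ha hb hR0
  have hFc : IntegrableOn (fun p => ε / 8 * (volDensity ε p * firstOrderTerm ε a b z p)) V :=
    hF.const_mul _
  have hZc : IntegrableOn (fun p => b * a ^ 2 / 4 * (volDensity ε p * zerothOrderTerm a b z p)) V :=
    hZ.const_mul _
  have hwc : IntegrableOn (fun p => 1 / (2 * a) * w p) V := hwi.const_mul _
  have hFZ : IntegrableOn (fun p => ε / 8 * (volDensity ε p * firstOrderTerm ε a b z p)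
      + b * a ^ 2 / 4 * (volDensity ε p * zerothOrderTerm a b z p)) V := hFc.add hZc
  have hmain := hz.setIntegral_le_boundaryFlux (a := a) (b := b) hV hε hR ha hb hM hR0
    (g := fun p => ε / 8 * (volDensity ε p * firstOrderTerm ε a b z p)
      + b * a ^ 2 / 4 * (volDensity ε p * zerothOrderTerm a b z p) - 1 / (2 * a) * w p)
    (hFZ.sub hwc) (fun p hp => by
      have hpE := hV.mem_boundedExterior hp
      have hσ := volDensity_pos hε hpE.1
      have hbs : b * √(fFun p) ≤ 1 / 100 :=
        (mul_le_mul_of_nonneg_left hpE.2.2 hb.le).trans hbR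
      have h1 := pointwise_carleman hm hn hpE.1 hε hb had hεb hbs (hz.contDiffAt hV hp)
      have h2 : divergence (currentField ε a b V z) p =
          divergence (fun q => carlemanCurrent ε a b q (z q) (fderiv ℝ z q)) p :=
        Finset.sum_congr rfl fun i _ => partialD_congr
          ((hV.currentField_eventuallyEq hp).fun_comp fun Y => Y i) i
      rw [h2]
      have h3 := mul_le_mul_of_nonneg_left h1 hσ.le
      rw [mul_add (volDensity ε p) (1 / (2 * a) * _), mul_inv_cancel_left₀ hσ.ne'] at h3
      rw [hw]
      linarith)
  rw [integral_sub hFZ hwc, integral_add hFc hZc, integral_const_mul, integral_const_mul,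
    integral_const_mul] at hmain
  rw [← ofReal_integral_eq_lintegral_ofReal hwi hw0, ← ENNReal.ofReal_mul hc.le,
    EReal.coe_ennreal_ofReal, max_eq_left (mul_nonneg hc.le (integral_nonneg_of_ae hw0)),
    ← EReal.coe_add, EReal.coe_le_coe_iff]
  linarith

end Cutoff

/-! ### From the flat to the warped domain -/

section Transfer

variable {m n : ℕ} {ε R : ℝ} {U : Set (Spacetime m n)} {z : Spacetime m n → ℝ}
  {q : Spacetime m n}

/-- Conformal maps preserve the timelike character of the boundary. -/
lemma outerConormal_raiseCov_pos (hε : 0 < ε) (hU : IsOpen U)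
    (hs : HasSmoothBoundary U) (ht : HasTimelikeBoundary flatMetric U)
    (hq : q ∈ warpedSet ε (frontier U)) :
    0 < outerConormal (warpedSet ε U) q (raiseCov ε q (outerConormal (warpedSet ε U) q)) := by
  obtain ⟨W, φ, hqW, h⟩ := hs _ hq.2
  have h1 := h.of_le (k' := 1) (by simp)
  have hw := h1.warped hε le_rfl (by simp)
  have hqW' : q ∈ warpedSet ε W := ⟨hq.1, hqW⟩
  have hfr : q ∈ frontier (warpedSet ε U) := by
    rw [warpedSet_frontier hε hU] at hq; exact hq.2
  have h0 := (hw.mem_frontier_iff (isOpen_warpedSet hε hU) hqW').1 hfr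
  have hE := warpFactor_pos (exteriorCone_subset_warpDomain_neg hε hq.1)
  set ν := outerConormal (warpedSet ε U) q with hν
  set X := raiseCov ε q ν with hX
  set A := fderiv ℝ (warpMap (-ε)) q with hA
  have hν0 : ν ≠ 0 := norm_ne_zero_iff.1 (by
    rw [hν, hw.norm_outerConormal hqW' h0]; exact one_ne_zero)
  have hdν : fderiv ℝ (φ ∘ warpMap (-ε)) q = ‖fderiv ℝ (φ ∘ warpMap (-ε)) q‖ • ν :=
    hw.fderiv_eq_norm_smul hqW' h0
  have hn := norm_pos_iff.2 (hw.fderiv_ne_zero q hqW')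
  have hchain : fderiv ℝ (φ ∘ warpMap (-ε)) q = (fderiv ℝ φ (warpMap (-ε) q)).comp A :=
    fderiv_comp q (h1.differentiableAt le_rfl hqW)
      ((contDiffAt_warpMap_neg hε hq.1).differentiableAt (by simp))
  have hconf : ∀ Y, flatMetric (warpMap (-ε) q) (A X) (A Y) =
      (warpFactor (-ε) q ^ 2)⁻¹ * ν Y := fun Y => by
    rw [hA, flatMetric_fderiv_warpMap_neg hε hq.1, hX, warpedMetric_raiseCov hε hq.1]
  have hAX : A X ≠ 0 := by
    intro hcon
    refine hν0 (ContinuousLinearMap.ext fun Y => ?_)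
    have h2 := hconf Y
    rw [hcon] at h2
    have h3 : flatMetric (warpMap (-ε) q) 0 (A Y) = 0 := by
      have e1 : timePart (0 : Spacetime m n) = 0 := rfl
      have e2 : spacePart (0 : Spacetime m n) = 0 := rfl
      rw [flatMetric, e1, e2, inner_zero_left, inner_zero_left, neg_zero, add_zero]
    rw [h3] at h2
    exact (mul_eq_zero.1 h2.symm).resolve_left (by positivity)
  -- the flat normal at the corresponding boundary point is the image of the warped normal
  have hpos := ht _ hq.2 W φ hqW h1 (A X) hAX
    ⟨(warpFactor (-ε) q ^ 2)⁻¹ * ‖fderiv ℝ (φ ∘ warpMap (-ε)) q‖⁻¹, fun Y => ?_⟩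
  · rw [hconf X] at hpos
    exact pos_of_mul_pos_right hpos (by positivity)
  · have hsurj : A (fderiv ℝ (warpMap ε) (warpMap (-ε) q) Y) = Y :=
      fderiv_warpMap_comp hε hq.1 Y
    have h4 : fderiv ℝ φ (warpMap (-ε) q) Y = ‖fderiv ℝ (φ ∘ warpMap (-ε)) q‖ *
        ν (fderiv ℝ (warpMap ε) (warpMap (-ε) q) Y) := by
      rw [← smul_eq_mul, ← _root_.smul_apply, ← hdν, hchain, ContinuousLinearMap.comp_apply, hsurj]
    rw [← hsurj, hconf, hsurj, h4]
    field_simp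

/-- The image of the domain of the estimate is admissible. -/
lemma admissibleDomain_warpedSet (hε : 0 < ε) (hR : ε * R ≤ 1 / 2) (hU : IsOpen U)
    (hUR : closure U ∩ exteriorCone m n ⊆ {p | rad p < R})
    (hs : HasSmoothBoundary U) (ht : HasTimelikeBoundary flatMetric U) :
    AdmissibleDomain ε R (warpedSet ε U) := by
  have hfr : frontier (warpedSet ε U) ∩ exteriorCone m n = warpedSet ε (frontier U) := by
    rw [warpedSet_frontier hε hU, Set.inter_comm]
  have hloc : ∀ q ∈ frontier U, ∃ W φ, q ∈ W ∧ IsLocalDefiningFunction 1 U W φ := fun q hq => by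
    obtain ⟨W, φ, hqW, h⟩ := hs q hq
    exact ⟨W, φ, hqW, h.of_le (by simp)⟩
  refine ⟨isOpen_warpedSet hε hU, fun p hp => hp.1, ?_, ?_, ?_, ?_⟩
  · rw [hfr]
    intro q hq
    obtain ⟨W, φ, hqW, h⟩ := hloc _ hq.2
    exact ⟨warpedSet ε W, φ ∘ warpMap (-ε), ⟨hq.1, hqW⟩, h.warped hε le_rfl (by simp)⟩
  · rw [hfr]
    exact fun q hq => outerConormal_raiseCov_pos hε hU hs ht hq
  · rw [Set.inter_comm, ← warpedSet_closure hε U]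
    intro p hp
    obtain ⟨h1, h2⟩ := rad_lt_of_mem_warpedSet hε hR hUR hp
    exact ⟨hp.1, h1.le, h2⟩
  · rw [hfr]
    exact surfaceMeasure_warpedSet_frontier_lt_top hε hR hU hUR hloc

end Transfer

end WarpedCarleman

end

theorem mainTheorem5 :
    ∃ c₀ : ℝ, 0 < c₀ ∧ ∀ m n : ℕ, 1 ≤ m → 1 ≤ n → ∃ c : ℝ, 0 < c ∧
      ∀ (U : Set (Spacetime m n)) (R : ℝ), IsOpen U → 0 < R →
        closure U ∩ exteriorCone m n ⊆ {p | rad p < R} →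
        HasSmoothBoundary U → HasTimelikeBoundary flatMetric U →
      ∀ ε a b : ℝ, 0 < ε → 0 < a → 0 < b →
        ((m : ℝ) + n) ^ 2 ≤ a → ε ≤ c * b → b ≤ c₀ * R⁻¹ →
      ∀ z : Spacetime m n → ℝ,
        ContDiffOn ℝ 2 z (warpMap ε '' (U ∩ exteriorCone m n)) →
        ContDiffOn ℝ 1 z (warpMap ε '' (closure U ∩ exteriorCone m n)) →
        (∃ M : ℝ, ∀ p ∈ warpMap ε '' (U ∩ exteriorCone m n), |z p| ≤ M ∧ ‖fderiv ℝ z p‖ ≤ M) →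
        (∀ p ∈ warpMap ε '' (frontier U ∩ exteriorCone m n), z p = 0) →
        IntegrableOn (firstOrderTerm ε a b z) (warpMap ε '' (U ∩ exteriorCone m n))
          (volumeMeasure (warpedMetric ε)) ∧
        IntegrableOn (zerothOrderTerm a b z) (warpMap ε '' (U ∩ exteriorCone m n))
          (volumeMeasure (warpedMetric ε)) ∧
        Integrable
          (boundaryTerm ε a b (warpMap ε '' (U ∩ exteriorCone m n))
            (warpMap ε '' (closure U ∩ exteriorCone m n)) z)
          (boundaryMeasure (warpedMetric ε) (warpMap ε '' (U ∩ exteriorCone m n))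
            (warpMap ε '' (frontier U ∩ exteriorCone m n))) ∧
        ((ε / 8 * (∫ p in warpMap ε '' (U ∩ exteriorCone m n),
              firstOrderTerm ε a b z p ∂(volumeMeasure (warpedMetric ε)))
            + b * a ^ 2 / 4 * (∫ p in warpMap ε '' (U ∩ exteriorCone m n),
              zerothOrderTerm a b z p ∂(volumeMeasure (warpedMetric ε))) : ℝ) : EReal)
          ≤ ((ENNReal.ofReal (1 / (2 * a)) * ∫⁻ p in warpMap ε '' (U ∩ exteriorCone m n),
              ENNReal.ofReal (waveTerm ε a b z p) ∂(volumeMeasure (warpedMetric ε)) : ENNReal)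
                : EReal)
            + ((∫ q, boundaryTerm ε a b (warpMap ε '' (U ∩ exteriorCone m n))
                  (warpMap ε '' (closure U ∩ exteriorCone m n)) z q
                ∂(boundaryMeasure (warpedMetric ε) (warpMap ε '' (U ∩ exteriorCone m n))
                  (warpMap ε '' (frontier U ∩ exteriorCone m n))) : ℝ) : EReal) := by
  -- `b R ≤ 1/100` and `ε ≤ b/100` also give `ε R ≤ 1/2`, so that the domain lies where `Φ̄` is defined
  refine ⟨1 / 100, by norm_num, fun m n hm hn => ⟨1 / 100, by norm_num, ?_⟩⟩
  intro U R hU hR0 hUR hs ht ε a b hε _ hb had hεb hbR z hz2 hz1 ⟨M, hM⟩ hz0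
  have hbR' : b * R ≤ 1 / 100 := by
    calc b * R ≤ 1 / 100 * R⁻¹ * R := mul_le_mul_of_nonneg_right hbR hR0.le
      _ = 1 / 100 := by field_simp
  have hεR : ε * R ≤ 1 / 2 := by
    have := mul_le_mul_of_nonneg_right hεb hR0.le
    linarith
  have ha : 2 ≤ a := by
    have h1 : (1 : ℝ) ≤ m := by exact_mod_cast hm
    have h2 : (1 : ℝ) ≤ n := by exact_mod_cast hn
    nlinarith
  have himg : ∀ A ⊆ closure U, warpMap ε '' (A ∩ exteriorCone m n) = warpedSet ε A := fun A hA =>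
    warpMap_image_eq hε hεR ((Set.inter_subset_inter_left _ hA).trans hUR)
  have hcl : warpedSet ε (closure U) = closure (warpedSet ε U) ∩ exteriorCone m n := by
    rw [warpedSet_closure hε U, Set.inter_comm]
  have hfr : warpedSet ε (frontier U) = frontier (warpedSet ε U) ∩ exteriorCone m n := by
    rw [warpedSet_frontier hε hU, Set.inter_comm]
  rw [himg U subset_closure] at hz2 hM ⊢
  rw [himg _ subset_rfl, hcl] at hz1 ⊢
  rw [himg _ frontier_subset_closure, hfr] at hz0 ⊢
  have hV := admissibleDomain_warpedSet hε hεR hU hUR hs ht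
  have hz : AdmissibleFunction |M| (warpedSet ε U) z :=
    ⟨hz2, hz1, fun p hp => ⟨(hM p hp).1.trans (le_abs_self M), (hM p hp).2.trans (le_abs_self M)⟩,
      hz0⟩
  have hVm := hV.isOpen.measurableSet
  refine ⟨(integrableOn_volumeMeasure_iff hn hε hVm hV.subset).2
      (hz.integrableOn_firstOrderTerm hV hε hεR ha hb hR0.le),
    (integrableOn_volumeMeasure_iff hn hε hVm hV.subset).2
      (hz.integrableOn_zerothOrderTerm hV hε hεR ha hb hR0.le),
    hz.integrable_boundaryTerm hn hε hεR ha hb (abs_nonneg M) hR0.le hV,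
    hz.carleman_estimate hV hm hn hε hεR had hb (by linarith) hbR' (abs_nonneg M) hR0.le⟩
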